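/- **Setting.** $\mathbf R^{2,2}$ is $\mathbf R^4$ with the scalar product $s(u,v)=u_1v_1+u_2v_2-u_3v_3-u_4v_4$, identified with real $2\times2$ matrices, $\mathbf R^{2,2}=S\otimes S'$, by $(u,v,x,y)\mapsto\frac1{\sqrt2}\begin{pmatrix}u+x&y-v\\y+v&u-x\end{pmatrix}$; $\epsilon_{AB}\alpha^A\beta^B=\alpha^0\beta^1-\alpha^1\beta^0$, $\alpha_B=\alpha^A\epsilon_{AB}$, and a spin frame satisfies $\epsilon_{AB}o^A\iota^B=1$. Let $\Phi$ be a traceless endomorphism of $\mathbf R^{2,2}$, self-adjoint for $s$; let $\Phi_{ABA'B'}$ be the spinor form of $\Phi_{ab}$ (Ricci spinor), $P_\Phi=\Phi_{ABA'B'}\xi^A\xi^B\zeta^{A'}\zeta^{B'}$ its Ricci polynomial, written $P_\Phi(X,Y,U,V)$ when $\xi=Xo+Y\iota$, $\zeta=Uo'+V\iota'$, and $\Omega\subset\mathbf{CP}^1\times\mathbf{CP}^1$ the zero locus of $P_\Phi$ (Ricci locus), $\omega$ its real part. The point $([\mu],[\eta])$ is identified with the null direction $\langle\mu^A\eta^{A'}\rangle$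 in $\mathbf C^4$. In the affine chart $([\mu+y\nu],[\eta+v\theta])$ around $Q=([\mu],[\eta])$ let $F(t)$ be the restriction of $P_\Phi$ to the line $(y,v)=(\sigma t,\tau t)$. $Q\in\Omega$ is singular if $F=O(t^2)$ for all lines, and $n$-fold if $F=O(t^n)$ for all lines but not $F=O(t^{n+1})$ for all; then lines with $F=O(t^{n+1})$ are tangents. A node is a double point with two distinct tangents; a cusp a double point with coincident tangents; a tacnode a cusp whose tangent has $F=O(t^4)$. A real node has real tangents or complex tangents (and then is an isolated point of $\omega$); a complex node is a node off $\mathbf{RP}^1\times\mathbf{RP}^1$. The Ricci spinor type lists the bidegrees of the irreducible factors over $\mathbf C$ of $P_\Phi$, with multiplicities: $(r,s)$ is a real factor, $(r,s)\overline{(r,s)}$ a pair of complex conjugate factors; distinct factors listed are not proportional, and the zero loci of the distinct factors are the components of $\Omega$. A $\Psi$-ON basis $\{U,V,X,Y\}$ is pseudo-orthonormal with squares $1,1,-1,-1$; a Witt basis $\{E_1,\dots,E_4\}$ has $s(E_1,E_3)=s(E_2,E_4)=1$ and all other products $0$; these correspond by $E_{1,3}=(U\pm X)/\sqrt2$, $E_{2,4}=(V\pm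 Y)/\sqrt2$. The O-type $\mathbf O^\pm_\pm$ of a basis is the component of $\mathbf O(2,2)$ that carries the standard basis to it (upper sign: determinant of the positive definite block, lower sign: of the negative definite block). "SO" means $\mathbf O^+_+$ or $\mathbf O^-_-$, "ASO" means $\mathbf O^-_+$ or $\mathbf O^+_-$. Coordinates of points below: $\langle w\rangle$ is the point of the null vector $w$; $\langle w,w'\rangle$ is the line of $\mathbf{CP}^1\times\mathbf{CP}^1$ formed by the points of a totally null plane. **General facts.** (a) $\Phi_{ABA'B'}=\Phi_{(AB)(A'B')}$. (b) Each Witt basis has exactly one O-type, and it has O-type $\mathbf O^+_+,\mathbf O^-_-,\mathbf O^-_+,\mathbf O^+_-$ iff for some real spin frames it is, respectively, $(oo',\iota o',\iota\iota',-o\iota')$, $(\iota\iota',o\iota',oo',-\iota o')$, $(oo',o\iota',\iota\iota',-\iota o')$, $(\iota\iota',\iota o',oo',-o\iota')$. (c) The points of $\mathbf{CP}^1\times\mathbf{CP}^1$ correspond to the null directions of $\mathbf C^4$, and a point is a singular point of $\Omega$ iff its null direction consists of eigenvectors of $\Phi$. **Types.** Suppose $\Phi$ has the stated matrix (before imposing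 tracelessness) with respect to some basis of the stated kind, of any O-type. Then the stated trace condition holds; for all spin frames representing the basis as in (b), $\Phi_{ABA'B'}$ and $P_\Phi(X,Y,U,V)$ are the stated expressions in case $\mathbf O^+_+$, and are obtained from them for $\mathbf O^-_-$ by $o\leftrightarrow\iota,\ o'\leftrightarrow\iota'$ (in $P_\Phi$: $Y\leftrightarrow-X,\ V\leftrightarrow-U$), for $\mathbf O^-_+$ by $o\leftrightarrow o',\ \iota\leftrightarrow\iota'$ ($Y\leftrightarrow V,\ X\leftrightarrow U$), for $\mathbf O^+_-$ by $o\leftrightarrow\iota',\ \iota\leftrightarrow o'$ ($Y\leftrightarrow-U,\ X\leftrightarrow-V$); and the type and the singular points of $\Omega$ are as stated. Everywhere $\varepsilon,\omega\in\{1,-1\}$, and $[o\iota]$ stands for $o_A\iota_B+\iota_Ao_B$, $[oo]$ for $o_Ao_B$, $[\iota\iota]$ for $\iota_A\iota_B$, and likewise with primes. When spinor types are given for SO, those for ASO arise by exchanging the two entries of each bidegree. * **I.** Witt, $\begin{pmatrix}\lambda&1&0&0\\0&\lambda&0&\varepsilon\\0&0&\lambda&0\\0&0&1&\lambda\end{pmatrix}$;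 $\lambda=0$. $\Phi=\varepsilon[\iota\iota][o'o']-[oo][o'\iota']$, $P=\varepsilon X^2V^2+2UVY^2$. Type $(2,1)(0,1)$ (SO), $(1,0)(1,2)$ (ASO). The only singular point is the real point $\langle E_1\rangle$, a tacnode, the only intersection of the two components; the linear component is $\langle E_1,E_2\rangle$, tangent there to the other one. * **II.** Witt, $\begin{pmatrix}a&b&1&0\\-b&a&0&-1\\0&0&a&-b\\0&0&b&a\end{pmatrix}$, $b\ne0$; $a=0$. $\Phi=([oo]-[\iota\iota])[o'o']-b([oo]+[\iota\iota])[o'\iota']$, $P=[X^2(2bU-V)+Y^2(2bU+V)]V$. Type $(2,1)(0,1)$ (SO), $(1,0)(1,2)$ (ASO). Singular points: the complex nodes $\langle E_1\pm iE_2\rangle$, which are the intersections of the two components, whose tangents there are the tangents of the nodes; the linear component $\langle E_1,E_2\rangle$ is a common tangent. * **IIIa.** $\Psi$-ON, $\begin{pmatrix}\lambda&0&0&0\\0&\mu&h&0\\0&-h&\mu&h\\0&0&h&\mu\end{pmatrix}$, $h=1/\sqrt2$; $\lambda+3\mu=0$. $\Phi=-\mu(2[oo][o'o']+2[\iota\iota][\iota'\iota']+[o\iota][o'\iota'])-h([o\iota][o'o']-[\iota\iota][o'\iota'])$,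 $P=-2\mu(YV+XU)^2-\sqrt2X(XU-YV)V$. The only singular point is the real point $\langle V+Y\rangle$. If $\lambda\ne\mu$: type $(2,2)$, a cusp that is not a tacnode. If $\lambda=\mu$ ($=0$): type $(1,0)(1,1)(0,1)$, a triple point, through which all three components pass, any two of them meeting only there. * **IIIb.** $\Psi$-ON, $\begin{pmatrix}\lambda&h&0&0\\h&\lambda&-h&0\\0&h&\lambda&0\\0&0&0&\mu\end{pmatrix}$; $3\lambda+\mu=0$. $\Phi=\lambda(2[\iota\iota][o'o']+2[oo][\iota'\iota']+[o\iota][o'\iota'])+h([o\iota][o'o']-[oo][o'\iota'])$, $P=2\lambda(XV+UY)^2+\sqrt2Y(YU-XV)V$. As IIIa, with the point $\langle U+X\rangle$. * **IV.** Witt, $\begin{pmatrix}\frac{\lambda+\nu}2&0&\frac{\lambda-\nu}2&0\\0&\mu&0&\varepsilon\\\frac{\lambda-\nu}2&0&\frac{\lambda+\nu}2&0\\0&0&0&\mu\end{pmatrix}$; $\lambda+\nu=-2\mu$. $\Phi=\frac{\lambda-\nu}2([oo][o'o']+[\iota\iota][\iota'\iota'])+\frac{\lambda+\nu}2[o\iota][o'\iota']+\varepsilon[\iota\iota][o'o']$,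 $P=\frac{\lambda-\nu}2(Y^2V^2+X^2U^2)+2(\lambda+\nu)XYUV+\varepsilon X^2V^2$. * $\lambda,\mu,\nu$ distinct: type $(2,2)$; the only singular point is the real node $\langle E_2\rangle$; $D=(3\lambda+\nu)(\lambda+3\nu)\ne0$, and its tangents are real if $D>0$, complex if $D<0$. * $\mu=\nu\ne\lambda$: $\lambda+3\nu=0$; type $(1,1)(1,1)$ if $\varepsilon\nu>0$, $(1,1)\overline{(1,1)}$ if $\varepsilon\nu<0$. $\lambda=\mu\ne\nu$: $3\lambda+\nu=0$; type $(1,1)\overline{(1,1)}$ if $\varepsilon\lambda>0$, $(1,1)(1,1)$ if $\varepsilon\lambda<0$. In both cases the only singular point is the real point $\langle E_2\rangle$, a tacnode and the only intersection of the two components. * $\lambda=\nu\ne\mu$: $\lambda+\mu=0$; type $(1,0)(1,1)(0,1)$; singular points $\langle E_1\rangle,\langle E_2\rangle,\langle E_3\rangle$, real nodes with real tangents, which are tangents of components; the linear components are $\langle E_1,E_2\rangle$ and $\langle E_2,E_3\rangle$ (the $(0,1)$ and $(1,0)$ factors in case SO), which meet in $\langle E_2\rangle$ and meet the third component in $\langle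 E_1\rangle$ and in $\langle E_3\rangle$, respectively. * $\lambda=\mu=\nu$ ($=0$): type $(1,0)^2(0,1)^2$; $\Omega$, all of it singular, is the pair of double lines $\langle E_1,E_2\rangle$, $\langle E_2,E_3\rangle$, meeting in $\langle E_2\rangle$. * **V.** $\Psi$-ON, $\begin{pmatrix}\lambda&0&0&0\\0&a&b&0\\0&-b&a&0\\0&0&0&\nu\end{pmatrix}$, $b\neq0$; $\lambda+\nu=-2a$. $\Phi=\frac{3\lambda+\nu}4([oo][o'o']+[\iota\iota][\iota'\iota'])-\frac{\lambda+3\nu}4([\iota\iota][o'o']+[oo][\iota'\iota'])+\frac{\lambda-\nu}4[o\iota][o'\iota']-\frac b2\{[o\iota]([o'o']+[\iota'\iota'])-([oo]+[\iota\iota])[o'\iota']\}$, $P=\frac{3\lambda+\nu}4(YV+XU)^2-\frac{\lambda+3\nu}4(XV+YU)^2+b[XY(V^2+U^2)-(X^2+Y^2)UV]$. If $\lambda\ne\nu$: type $(2,2)$, no singular points. If $\lambda=\nu$ ($=-a$): type $(1,1)(1,1)$; singular points $\langle U\pm Y\rangle$, real nodes with real tangents, which are the intersections of the two components. * **VI.**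 Witt, $\begin{pmatrix}\lambda&0&\varepsilon&0\\0&a&0&-b\\0&0&\lambda&0\\0&b&0&a\end{pmatrix}$, $b\ne0$; $\lambda+a=0$. $\Phi=\varepsilon[oo][o'o']-b([\iota\iota][o'o']-[oo][\iota'\iota'])+\lambda[o\iota][o'\iota']$, $P=\varepsilon Y^2V^2-b(X^2V^2-Y^2U^2)+4\lambda XYUV$. Type $(2,2)$; the only singular point is $\langle E_1\rangle$, a real node with real tangents. * **VII.** Witt, $\begin{pmatrix}\lambda&0&\varepsilon&0\\0&\mu&0&\omega\\0&0&\lambda&0\\0&0&0&\mu\end{pmatrix}$; $\lambda+\mu=0$. $\Phi=(\varepsilon[oo]+\omega[\iota\iota])[o'o']+\lambda[o\iota][o'\iota']$, $P=[(\varepsilon Y^2+\omega X^2)V+4\lambda UXY]V$. * $\lambda\ne\mu$ (both $\ne0$): type $(2,1)(0,1)$ (SO), $(1,0)(1,2)$ (ASO); singular points $\langle E_1\rangle,\langle E_2\rangle$, real nodes with real tangents, the intersections of the two components; the linear component $\langle E_1,E_2\rangle$ is a common tangent. * $\lambda=\mu$ ($=0$): type $(1,0)(1,0)(0,1)^2$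 if $\varepsilon=-\omega$, $(1,0)\overline{(1,0)}(0,1)^2$ if $\varepsilon=\omega$ (SO); $(1,0)^2(0,1)(0,1)$, resp. $(1,0)^2(0,1)\overline{(0,1)}$ (ASO). The singular set is the double component $\langle E_1,E_2\rangle$. The other two components are $\langle E_1\pm E_2,E_3\mp E_4\rangle$ if $\varepsilon=-\omega$ and $\langle E_1\pm iE_2,E_3\pm iE_4\rangle$ if $\varepsilon=\omega$; the only intersections of distinct components are those with the double line, at $\langle E_1\pm E_2\rangle$, resp. $\langle E_1\pm iE_2\rangle$. These are threefold points, the double line being a tangent; all other points of the double line are tacnodes in the above sense. * **VIII.** $\Psi$-ON, $\begin{pmatrix}a&0&b&0\\0&c&0&d\\-b&0&a&0\\0&-d&0&c\end{pmatrix}$, $b,d\ne0$; $a+c=0$. $\Phi=a[o\iota][o'\iota']-b([oo][o'o']-[\iota\iota][\iota'\iota'])-d([\iota\iota][o'o']-[oo][\iota'\iota'])$, $P=4aUVXY+b(X^2U^2-Y^2V^2)+d(Y^2U^2-X^2V^2)$. Unless $a=c$ and $b=\pm d$: type $(2,2)$, no singular points. If $a=c$ ($=0$) and $b=d$: type $(1,0)\overline{(1,0)}(0,1)(0,1)$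 (SO), $(1,0)(1,0)(0,1)\overline{(0,1)}$ (ASO); the singular points are the complex nodes $\langle N_1\rangle,\langle N_2\rangle$ and their conjugates, $N_1=(U-Y)+i(X+V)$, $N_2=(U+Y)+i(X-V)$, which are the intersections of the four linear components; the components through a node are its tangents. * **IX.** $\Psi$-ON, $\mathrm{diag}(\lambda,\mu,\nu,\sigma)$; $\lambda+\mu+\nu+\sigma=0$. $\Phi=\frac{\lambda-\nu}2([oo][o'o']+[\iota\iota][\iota'\iota'])+\frac{\mu-\sigma}2([\iota\iota][o'o']+[oo][\iota'\iota'])+\frac{\lambda+\nu}2[o\iota][o'\iota']$, $P=\frac{\lambda-\nu}2(Y^2V^2+X^2U^2)+\frac{\mu-\sigma}2(X^2V^2+Y^2U^2)+2(\lambda+\nu)UVXY$. Write $B_1,\dots,B_4$ for the basis, $d_1,\dots,d_4$ for the eigenvalues, $\{i,j,k,l\}=\{1,2,3,4\}$. * No two equal: type $(2,2)$, no singular points. * Exactly $d_i=d_j$; let $D=(3d_k+d_l)(d_k+3d_l)$, which is $\neq0$. If $s(B_i,B_i)=s(B_j,B_j)$: the singular points are the complex nodes $\langle B_i\pm iB_j\rangle$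 (with $i=\sqrt{-1}$ as coefficient); type $(1,1)\overline{(1,1)}$ if $D>0$, $(1,1)(1,1)$ if $D<0$. If $s(B_i,B_i)=-s(B_j,B_j)$: the singular points are the real nodes $\langle B_i\pm B_j\rangle$; type $(1,1)(1,1)$ and real tangents if $D>0$, type $(1,1)\overline{(1,1)}$ and complex tangents if $D<0$. In all cases they are the intersections of the two components. * $d_i=d_j\ne d_k=d_l$. If $s(B_i,B_i)=s(B_j,B_j)$: type $(1,0)\overline{(1,0)}(0,1)\overline{(0,1)}$, the singular points are four complex nodes $\langle B_i\pm\sqrt{-1}B_j\rangle,\langle B_k\pm\sqrt{-1}B_l\rangle$. Otherwise: type $(1,0)(1,0)(0,1)(0,1)$, four real nodes $\langle B_i\pm B_j\rangle$, $\langle B_k\pm B_l\rangle$ with real tangents. The nodes are the intersections of the four linear components, which provide their tangents. * Exactly $d_i=d_j=d_k$: type $(1,1)^2$; $\Omega$, all of it singular, is a double curve, formed by the null directions of $\langle B_i,B_j,B_k\rangle_{\mathbf C}$. * All equal: $\lambda=\mu=\nu=\sigma=0$, $\Phi=0$, $\Phi_{ABA'B'}=0$, $P_\Phi=0$, $\Omega=\mathbf{CP}^1\times\mathbf{CP}^1$.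 -/

import Mathlib

noncomputable section

namespace NeutralRicci

/-! ### The inner product space of signature (2,2), spinors and the soldering -/

/-- The scalar product `s_{2,2}` of signature `(2,2)` on real vectors, and its complex bilinear extension. -/
def s22 {K : Type*} [CommRing K] (u v : Fin 4 → K) : K :=
  u 0 * v 0 + u 1 * v 1 - u 2 * v 2 - u 3 * v 3

/-- Complexification of a real tuple. -/
def cvec {n : ℕ} (v : Fin n → ℝ) : Fin n → ℂ := fun i => (v i : ℂ)

/-- The complex linear extension of a real endomorphism. -/
def complexify (Φ : (Fin 4 → ℝ) →ₗ[ℝ] (Fin 4 → ℝ)) : (Fin 4 → ℂ) →ₗ[ℂ] (Fin 4 → ℂ) :=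
  Matrix.toLin' ((LinearMap.toMatrix' Φ).map (algebraMap ℝ ℂ))

/-- The soldering `(u,v,x,y) ↦ (1/√2) (u+x, y-v; y+v, u-x)`, rows being indexed by unprimed spinor indices and
columns by primed ones. -/
def solder {K : Type*} [RCLike K] (w : Fin 4 → K) : Matrix (Fin 2) (Fin 2) K :=
  (((√2 : ℝ) : K))⁻¹ • !![w 0 + w 2, w 3 - w 1; w 3 + w 1, w 0 - w 2]

/-- The vector `α^A α^{A'}`: the vector whose soldered form is the rank one matrix with entries `α A * α' A'`. -/
def dyad {K : Type*} [RCLike K] (α α' : Fin 2 → K) : Fin 4 → K :=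
  (((√2 : ℝ) : K))⁻¹ • ![α 0 * α' 0 + α 1 * α' 1, α 1 * α' 0 - α 0 * α' 1,
    α 0 * α' 0 - α 1 * α' 1, α 1 * α' 0 + α 0 * α' 1]

/-- The symplectic form `ε_{AB} α^A β^B`. -/
def eps {K : Type*} [CommRing K] (α β : Fin 2 → K) : K := α 0 * β 1 - α 1 * β 0

/-- Lowering of an index, `α_B = α^A ε_{AB}`. -/
def low (α : Fin 2 → ℝ) : Fin 2 → ℝ := ![-α 1, α 0]

lemma sqrt_two_inv_sq {K : Type*} [RCLike K] :
    (((√2 : ℝ) : K))⁻¹ * (((√2 : ℝ) : K))⁻¹ = 2⁻¹ := by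
  rw [← mul_inv, ← RCLike.ofReal_mul, Real.mul_self_sqrt (by norm_num), RCLike.ofReal_ofNat]

lemma solder_dyad {K : Type*} [RCLike K] (α α' : Fin 2 → K) :
    solder (dyad α α') = Matrix.vecMulVec α α' := by
  have h := sqrt_two_inv_sq (K := K)
  ext i j
  fin_cases i <;> fin_cases j <;> simp [solder, dyad, Matrix.vecMulVec_apply]
  · linear_combination (2 * α 0 * α' 0) * h
  · linear_combination (2 * α 0 * α' 1) * h
  · linear_combination (2 * α 1 * α' 0) * h
  · linear_combination (2 * α 1 * α' 1) * h

lemma s22_dyad {K : Type*} [RCLike K] (α α' β β' : Fin 2 → K) :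
    s22 (dyad α α') (dyad β β') = eps α β * eps α' β' := by
  have h := sqrt_two_inv_sq (K := K)
  simp only [s22, dyad, eps, Pi.smul_apply, smul_eq_mul, Matrix.cons_val]
  linear_combination (2 * (α 0 * β 1 - α 1 * β 0) * (α' 0 * β' 1 - α' 1 * β' 0)) * h

/-! ### The Ricci spinor and the Ricci polynomial -/

/-- The components `Φ_{ABA'B'}` of the spinor form of the covariant tensor `Φ_{ab}`, `Φ_{ab} u^a v^b = s(u, Φ v)`. -/
def ricciSpinor (Φ : (Fin 4 → ℝ) →ₗ[ℝ] (Fin 4 → ℝ)) (A B A' B' : Fin 2) : ℝ :=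
  s22 (dyad (Pi.single A 1) (Pi.single A' 1)) (Φ (dyad (Pi.single B 1) (Pi.single B' 1)))

/-- The Ricci polynomial `P(X,Y,U,V) = Φ_{ABA'B'} ξ^A ξ^B ζ^{A'} ζ^{B'}` with `ξ = X o + Y ι`, `ζ = U o' + V ι'`;
the indeterminates `X, Y, U, V` are those with the numbers `0, 1, 2, 3`. -/
def ricciPolyIn (Φ : (Fin 4 → ℝ) →ₗ[ℝ] (Fin 4 → ℝ)) (o ι o' ι' : Fin 2 → ℝ) : MvPolynomial (Fin 4) ℝ :=
  ∑ A, ∑ B, ∑ A', ∑ B', MvPolynomial.C (ricciSpinor Φ A B A' B') *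
    (MvPolynomial.C (o A) * MvPolynomial.X 0 + MvPolynomial.C (ι A) * MvPolynomial.X 1) *
    (MvPolynomial.C (o B) * MvPolynomial.X 0 + MvPolynomial.C (ι B) * MvPolynomial.X 1) *
    (MvPolynomial.C (o' A') * MvPolynomial.X 2 + MvPolynomial.C (ι' A') * MvPolynomial.X 3) *
    (MvPolynomial.C (o' B') * MvPolynomial.X 2 + MvPolynomial.C (ι' B') * MvPolynomial.X 3)

/-- The Ricci polynomial in the components of `ξ` and `ζ` with respect to the standard spin frames. -/
def ricciPoly (Φ : (Fin 4 → ℝ) →ₗ[ℝ] (Fin 4 → ℝ)) : MvPolynomial (Fin 4) ℝ :=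
  ricciPolyIn Φ ![1, 0] ![0, 1] ![1, 0] ![0, 1]

/-- The Ricci polynomial, with its coefficients regarded as complex numbers. -/
def ricciPolyC (Φ : (Fin 4 → ℝ) →ₗ[ℝ] (Fin 4 → ℝ)) : MvPolynomial (Fin 4) ℂ :=
  MvPolynomial.map (algebraMap ℝ ℂ) (ricciPoly Φ)

/-! ### Bases and their O-types -/

/-- `Ψ`-orthonormal bases `{U, V, X, Y}`. -/
def IsPsiON (B : Fin 4 → Fin 4 → ℝ) : Prop :=
  ∀ i j, s22 (B i) (B j) = if i = j then ![1, 1, -1, -1] i else 0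

/-- Witt bases `{E₁, E₂, E₃, E₄}` (numbered from `0` here): the only nonzero products are those of the first and
third vectors, and of the second and fourth, which equal `1`. -/
def IsWitt (E : Fin 4 → Fin 4 → ℝ) : Prop :=
  ∀ i j, s22 (E i) (E j) = if i = j + 2 then 1 else 0

/-- The Witt basis associated with a `Ψ`-ON basis. -/
def toWitt (B : Fin 4 → Fin 4 → ℝ) : Fin 4 → Fin 4 → ℝ :=
  (√2)⁻¹ • ![B 0 + B 2, B 1 + B 3, B 0 - B 2, B 1 - B 3]

/-- The `Ψ`-ON basis associated with a Witt basis. -/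
def toPsiON (E : Fin 4 → Fin 4 → ℝ) : Fin 4 → Fin 4 → ℝ :=
  (√2)⁻¹ • ![E 0 + E 2, E 1 + E 3, E 0 - E 2, E 1 - E 3]

/-- `Φ` has matrix `M` with respect to the basis `B`. -/
def HasMatrix (Φ : (Fin 4 → ℝ) →ₗ[ℝ] (Fin 4 → ℝ)) (B : Fin 4 → Fin 4 → ℝ) (M : Matrix (Fin 4) (Fin 4) ℝ) : Prop :=
  ∀ j, Φ (B j) = ∑ i, M i j • B i

/-- The four components of `O(2,2)`: `pp`, `mm`, `mp`, `pm` stand for `O^+_+`, `O^-_-`, `O^-_+`, `O^+_-`. -/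
inductive OType
  | pp | mm | mp | pm

/-- The components in `SO(2,2)`; the other two form `ASO(2,2)`. -/
def OType.IsSO : OType → Prop
  | .pp => True
  | .mm => True
  | .mp => False
  | .pm => False

/-- The `Ψ`-ON basis `B` is the image of the standard basis under an element of the given component: the upper sign is
that of the determinant of the positive definite block, the lower one that of the negative definite block. -/
def HasOType (B : Fin 4 → Fin 4 → ℝ) (κ : OType) : Prop :=
  let t := B 0 0 * B 1 1 - B 0 1 * B 1 0
  let s := B 2 2 * B 3 3 - B 2 3 * B 3 2
  match κ with
  | .pp => 0 < t ∧ 0 < s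
  | .mm => t < 0 ∧ s < 0
  | .mp => t < 0 ∧ 0 < s
  | .pm => 0 < t ∧ s < 0

/-- The Witt basis of O-type `κ` built from spin frames `{o, ι}`, `{o', ι'}`. -/
def wittOf (κ : OType) (o ι o' ι' : Fin 2 → ℝ) : Fin 4 → Fin 4 → ℝ :=
  match κ with
  | .pp => ![dyad o o', dyad ι o', dyad ι ι', -dyad o ι']
  | .mm => ![dyad ι ι', dyad o ι', dyad o o', -dyad ι o']
  | .mp => ![dyad o o', dyad o ι', dyad ι ι', -dyad ι o']
  | .pm => ![dyad ι ι', dyad ι o', dyad o o', -dyad o ι']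

/-- `α_A α_B`. -/
def dbl (α : Fin 2 → ℝ) (A B : Fin 2) : ℝ := α A * α B

/-- `α_A β_B + β_A α_B`. -/
def mix (α β : Fin 2 → ℝ) (A B : Fin 2) : ℝ := α A * β B + β A * α B

/-- An expression for `Φ_{ABA'B'}` in terms of `o_A, ι_A, o_{A'}, ι_{A'}`. -/
abbrev SpinorForm := (o ι o' ι' : Fin 2 → ℝ) → (A B A' B' : Fin 2) → ℝ

/-- An expression for the Ricci polynomial in terms of `X, Y, U, V`. -/
abbrev PolyForm := (X Y U V : MvPolynomial (Fin 4) ℝ) → MvPolynomial (Fin 4) ℝ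

/-- The spinor form valid for bases of O-type `κ`, when `F` is the one valid for bases of O-type `O^+_+`: interchange
`o ↔ ι` and `o' ↔ ι'`, or `o ↔ o'` and `ι ↔ ι'`, or `o ↔ ι'` and `ι ↔ o'`. -/
def OType.spinor (κ : OType) (F : SpinorForm) : SpinorForm :=
  match κ with
  | .pp => F
  | .mm => fun o ι o' ι' A B A' B' => F ι o ι' o' A B A' B'
  | .mp => fun o ι o' ι' A B A' B' => F o' ι' o ι A' B' A B
  | .pm => fun o ι o' ι' A B A' B' => F ι' o' ι o A' B' A B

/-- The Ricci polynomial valid for bases of O-type `κ`, when `p` is the one valid for bases of O-type `O^+_+`: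
interchange `Y ↔ -X` and `V ↔ -U`, or `Y ↔ V` and `X ↔ U`, or `Y ↔ -U` and `X ↔ -V`. -/
def OType.poly (κ : OType) (p : PolyForm) : PolyForm :=
  match κ with
  | .pp => p
  | .mm => fun X Y U V => p (-Y) (-X) (-V) (-U)
  | .mp => fun X Y U V => p U V X Y
  | .pm => fun X Y U V => p (-V) (-U) (-Y) (-X)

/-- For all spin frames representing the Witt basis `E` of O-type `κ`, the Ricci spinor and the Ricci polynomial of `Φ`
are the ones obtained from the expressions `F`, `p`. -/
def HasSpinorForm (Φ : (Fin 4 → ℝ) →ₗ[ℝ] (Fin 4 → ℝ)) (κ : OType) (E : Fin 4 → Fin 4 → ℝ)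
    (F : SpinorForm) (p : PolyForm) : Prop :=
  ∀ o ι o' ι' : Fin 2 → ℝ, eps o ι = 1 → eps o' ι' = 1 → E = wittOf κ o ι o' ι' →
    (∀ A B A' B', ricciSpinor Φ A B A' B' = κ.spinor F (low o) (low ι) (low o') (low ι') A B A' B') ∧
    ricciPolyIn Φ o ι o' ι' =
      κ.poly p (MvPolynomial.X 0) (MvPolynomial.X 1) (MvPolynomial.X 2) (MvPolynomial.X 3)

/-! ### Ricci spinor types -/

/-- The building blocks of Ricci spinor types: a real factor `(r,s)`, the square `(r,s)²` of a real factor, and a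
complex conjugate pair of factors, `(r,s)` and its conjugate. -/
inductive Block
  | real (r s : ℕ)
  | sq (r s : ℕ)
  | conj (r s : ℕ)

/-- Interchange of the roles of unprimed and primed spinors. -/
def Block.swap : Block → Block
  | .real r s => .real s r
  | .sq r s => .sq s r
  | .conj r s => .conj s r

/-- The block itself for the O-types in `SO`, the swapped one for the O-types in `ASO`. -/
def OType.tw (κ : OType) (b : Block) : Block :=
  match κ with
  | .pp => b
  | .mm => b
  | .mp => b.swap
  | .pm => b.swap

/-- Complex conjugation of the coefficients. -/
def conjPoly (q : MvPolynomial (Fin 4) ℂ) : MvPolynomial (Fin 4) ℂ := MvPolynomial.map (starRingEnd ℂ) q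

/-- Homogeneity of degree `r` in `(X,Y)` and of degree `s` in `(U,V)`. -/
def IsBihomogeneous (q : MvPolynomial (Fin 4) ℂ) (r s : ℕ) : Prop :=
  MvPolynomial.IsWeightedHomogeneous (![1, 1, 0, 0] : Fin 4 → ℕ) q r ∧
    MvPolynomial.IsWeightedHomogeneous (![0, 0, 1, 1] : Fin 4 → ℕ) q s

/-- `q` is an irreducible polynomial as required by the block. -/
def Block.Admits : Block → MvPolynomial (Fin 4) ℂ → Prop
  | .real r s, q => Irreducible q ∧ IsBihomogeneous q r s ∧ conjPoly q = q
  | .sq r s, q => Irreducible q ∧ IsBihomogeneous q r s ∧ conjPoly q = q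
  | .conj r s, q => Irreducible q ∧ IsBihomogeneous q r s

/-- The contribution of a block to the product. -/
def Block.value : Block → MvPolynomial (Fin 4) ℂ → MvPolynomial (Fin 4) ℂ
  | .real _ _, q => q
  | .sq _ _, q => q ^ 2
  | .conj _ _, q => q * conjPoly q

/-- The irreducible polynomials that a block contributes, without multiplicity. -/
def Block.parts : Block → MvPolynomial (Fin 4) ℂ → List (MvPolynomial (Fin 4) ℂ)
  | .real _ _, q => [q]
  | .sq _ _, q => [q]
  | .conj _ _, q => [q, conjPoly q]

/-- The equations of the components of the zero locus. -/
def components (l : List (Block × MvPolynomial (Fin 4) ℂ)) : List (MvPolynomial (Fin 4) ℂ) :=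
  l.flatMap fun x => x.1.parts x.2

/-- `l` is the factorization of the Ricci polynomial of `Φ` into irreducible factors over the complex numbers, grouped
into blocks; different entries of `components l` are not proportional. The list of blocks of `l` is the Ricci spinor
type of `Φ`. -/
def IsSpinorFactorization (Φ : (Fin 4 → ℝ) →ₗ[ℝ] (Fin 4 → ℝ)) (l : List (Block × MvPolynomial (Fin 4) ℂ)) : Prop :=
  (∀ x ∈ l, x.1.Admits x.2) ∧
  (components l).Pairwise (fun p q => ¬ Associated p q) ∧
  ∃ c : ℝ, c ≠ 0 ∧ ricciPolyC Φ = MvPolynomial.C (c : ℂ) * (l.map fun x => x.1.value x.2).prod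

/-! ### The Ricci locus on `CP¹ × CP¹` and its singularities -/

/-- `CP¹ × CP¹`. -/
abbrev Pt := Projectivization ℂ (Fin 2 → ℂ) × Projectivization ℂ (Fin 2 → ℂ)

/-- The zero locus in `CP¹ × CP¹` of a (bihomogeneous) polynomial. -/
def zeros (q : MvPolynomial (Fin 4) ℂ) : Set Pt :=
  {Q | ∀ μ ∈ Q.1.submodule, ∀ η ∈ Q.2.submodule, MvPolynomial.eval ![μ 0, μ 1, η 0, η 1] q = 0}

/-- The points `([μ],[η])` for which the null vector `μ^A η^{A'}` lies in the subspace `W`. -/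
def pts (W : Submodule ℂ (Fin 4 → ℂ)) : Set Pt :=
  {Q | ∀ μ ∈ Q.1.submodule, ∀ η ∈ Q.2.submodule, dyad μ η ∈ W}

/-- The set of points whose null direction is spanned by `w`. -/
def pt (w : Fin 4 → ℂ) : Set Pt := pts (Submodule.span ℂ {w})

/-- The set of points whose null direction lies in the plane spanned by `w` and `w'`. -/
def linePts (w w' : Fin 4 → ℂ) : Set Pt := pts (Submodule.span ℂ {w, w'})

/-- Complex spin frames `{μ, ν}`, `{η, θ}` such that `Q = ([μ],[η])`. The points `([μ + y ν], [η + v θ])` form an affine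
chart around `Q`. -/
structure AdaptedFrame (Q : Pt) where
  μ : Fin 2 → ℂ
  ν : Fin 2 → ℂ
  η : Fin 2 → ℂ
  θ : Fin 2 → ℂ
  eps_μν : eps μ ν = 1
  eps_ηθ : eps η θ = 1
  span_μ : Q.1.submodule = Submodule.span ℂ {μ}
  span_η : Q.2.submodule = Submodule.span ℂ {η}

/-- The frame consists of real spinors. -/
def AdaptedFrame.IsReal {Q : Pt} (f : AdaptedFrame Q) : Prop :=
  ∃ μ ν η θ : Fin 2 → ℝ, f.μ = cvec μ ∧ f.ν = cvec ν ∧ f.η = cvec η ∧ f.θ = cvec θ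

/-- The coefficient of `t^n` in the restriction `F(t)` of `q` to the line `y = σ t`, `v = τ t` of the affine chart. -/
def lineCoeff (q : MvPolynomial (Fin 4) ℂ) {Q : Pt} (f : AdaptedFrame Q) (σ τ : ℂ) (n : ℕ) : ℂ :=
  (MvPolynomial.aeval
    ![Polynomial.C (f.μ 0) + Polynomial.C (σ * f.ν 0) * Polynomial.X,
      Polynomial.C (f.μ 1) + Polynomial.C (σ * f.ν 1) * Polynomial.X,
      Polynomial.C (f.η 0) + Polynomial.C (τ * f.θ 0) * Polynomial.X,
      Polynomial.C (f.η 1) + Polynomial.C (τ * f.θ 1) * Polynomial.X] q : Polynomial ℂ).coeff n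

/-- The set of singular points of the zero locus of `q`. -/
def singularSet (q : MvPolynomial (Fin 4) ℂ) : Set Pt :=
  {Q | ∀ (f : AdaptedFrame Q) (σ τ : ℂ), lineCoeff q f σ τ 0 = 0 ∧ lineCoeff q f σ τ 1 = 0}

/-- `Q` is an `n`-fold point of the zero locus of `q`: all lines through `Q` have contact of order at least `n`, and not
all of them have contact of higher order. Onefold points are the nonsingular points. -/
def IsFold (q : MvPolynomial (Fin 4) ℂ) (Q : Pt) (n : ℕ) : Prop :=
  ∀ f : AdaptedFrame Q, (∀ σ τ, ∀ k < n, lineCoeff q f σ τ k = 0) ∧ ∃ σ τ, lineCoeff q f σ τ n ≠ 0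

/-- Nodes: double points with two distinct tangents. -/
def IsNode (q : MvPolynomial (Fin 4) ℂ) (Q : Pt) : Prop :=
  IsFold q Q 2 ∧ ∀ f : AdaptedFrame Q, ∃ σ τ σ' τ', σ * τ' - τ * σ' ≠ 0 ∧
    lineCoeff q f σ τ 2 = 0 ∧ lineCoeff q f σ' τ' 2 = 0

/-- Cusps: double points whose two tangents coincide. -/
def IsCusp (q : MvPolynomial (Fin 4) ℂ) (Q : Pt) : Prop :=
  IsFold q Q 2 ∧ ∀ (f : AdaptedFrame Q) (σ τ σ' τ' : ℂ),
    lineCoeff q f σ τ 2 = 0 → lineCoeff q f σ' τ' 2 = 0 → σ * τ' - τ * σ' = 0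

/-- Tacnodes: cusps whose tangent has contact of order at least four. -/
def IsTacnode (q : MvPolynomial (Fin 4) ℂ) (Q : Pt) : Prop :=
  IsCusp q Q ∧ ∀ (f : AdaptedFrame Q) (σ τ : ℂ), lineCoeff q f σ τ 2 = 0 → lineCoeff q f σ τ 3 = 0

/-- The points of `RP¹ × RP¹`. -/
def IsRealPt (Q : Pt) : Prop := ∃ f : AdaptedFrame Q, f.IsReal

/-- Nodes off `RP¹ × RP¹`. -/
def IsComplexNode (q : MvPolynomial (Fin 4) ℂ) (Q : Pt) : Prop := IsNode q Q ∧ ¬ IsRealPt Q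

/-- Nodes on `RP¹ × RP¹` with two distinct real tangents. -/
def IsRealNodeRealTangents (q : MvPolynomial (Fin 4) ℂ) (Q : Pt) : Prop :=
  IsNode q Q ∧ IsRealPt Q ∧ ∀ f : AdaptedFrame Q, f.IsReal → ∃ σ τ σ' τ' : ℝ, σ * τ' - τ * σ' ≠ 0 ∧
    lineCoeff q f σ τ 2 = 0 ∧ lineCoeff q f σ' τ' 2 = 0

/-- Nodes on `RP¹ × RP¹` without real tangents, which are isolated points of the real zero locus. -/
def IsRealNodeComplexTangents (q : MvPolynomial (Fin 4) ℂ) (Q : Pt) : Prop :=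
  IsNode q Q ∧ IsRealPt Q ∧ ∀ f : AdaptedFrame Q, f.IsReal →
    (∀ σ τ : ℝ, lineCoeff q f σ τ 2 = 0 → σ = 0 ∧ τ = 0) ∧
    ∃ δ : ℝ, 0 < δ ∧ ∀ y v : ℝ, |y| < δ → |v| < δ →
      MvPolynomial.eval ![f.μ 0 + y * f.ν 0, f.μ 1 + y * f.ν 1, f.η 0 + v * f.θ 0, f.η 1 + v * f.θ 1] q = 0 →
      y = 0 ∧ v = 0

/-- The points at which two different components meet. -/
def crossings (l : List (Block × MvPolynomial (Fin 4) ℂ)) : Set Pt :=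
  {Q | ∃ p q, [p, q].Sublist (components l) ∧ Q ∈ zeros p ∧ Q ∈ zeros q}

/-- `Q` is a nonsingular point of the locus of `m`, and the tangent to it at `Q` is a tangent to the locus of `q` at its
`n`-fold point `Q`. -/
def IsTangentAt (m q : MvPolynomial (Fin 4) ℂ) (Q : Pt) (n : ℕ) : Prop :=
  IsFold m Q 1 ∧ IsFold q Q n ∧ ∀ (f : AdaptedFrame Q) (σ τ : ℂ), lineCoeff m f σ τ 1 = 0 → lineCoeff q f σ τ n = 0

/-- At the double point `Q` of the locus of `q`, the tangents are those of the components through `Q`. -/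
def TangentsFromComponents (q : MvPolynomial (Fin 4) ℂ) (l : List (Block × MvPolynomial (Fin 4) ℂ)) (Q : Pt) : Prop :=
  ∀ (f : AdaptedFrame Q) (σ τ : ℂ),
    lineCoeff q f σ τ 2 = 0 ↔ ∃ p ∈ components l, Q ∈ zeros p ∧ lineCoeff p f σ τ 1 = 0

end NeutralRicci

end

open NeutralRicci

/-!
A self-adjoint traceless endomorphism `Φ` of `R^{2,2}` is the same thing as a real polynomial of bidegree `(2, 2)` in
two spinors: `P_Φ(ξ, ζ) = s(w, Φ w)` for the null vector `w = ξ ζ`. Differentiating, the point `([μ], [η])` is singular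
on the zero locus of `P_Φ` if and only if `Φ (μ η)` is orthogonal to all vectors `ν η` and `μ θ`, which together span
the orthogonal complement of `μ η`; hence singular points are null eigenvectors (`mem_singularSet_iff`), and in each
normal form they are found by linear algebra.

A basis of either kind determines two real bases of spinors, up to an interchange of the primed and the unprimed
ones. `SpinCoord` records such a pair of bases together with the interchange. Zero loci, line restrictions,
factorizations and singularities are transported by `SpinCoord.push`, so that each type needs to be treated for one
O-type only: the Ricci polynomial becomes a fixed polynomial `q` in the coordinates `x, y, u, v`
(`SpinCoord.ricciPolyC_eq_push`), and a point is represented by coordinates `m`, `h` (`SpinCoord.Rep`).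

The singularities are read off from an expansion of `q` at the point. If `y` and `v` are the coordinates in an adapted
chart and `q = c₂₀ y² + c₁₁ y v + c₀₂ v² + c₂₁ y² v + c₁₂ y v² + c₂₂ y² v²` there (`SpinCoord.DoubleAt`), the point is
a node if the quadratic part is nondegenerate, at a real node the sign of its discriminant decides whether the tangents
are real, and for a degenerate quadratic part the cubic terms distinguish tacnodes from other cusps.

For the factorizations, a factor of a bihomogeneous polynomial is bihomogeneous. Two factors whose bidegrees add up to
`(2, 2)` have a common zero, which is a singular point of the product; so the Ricci polynomial is irreducible if it
has no null eigenvectors (`irreducible_of_singularSet_eq_empty`). In the remaining irreducible cases its discriminant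
with respect to `(x, y)` is not a square (`irreducible_of_discriminant`). Factors of bidegree `(2, 1)` are irreducible
because they do not vanish on a line of either ruling (`irreducible_of_bidegree_two_one`). Factors of bidegree `(1,
1)` arise from Ricci polynomials that are binary quadratic forms in two bilinear forms; such a form splits into two
real or two complex conjugate factors according to the sign of its discriminant (`pencil_real`, `pencil_conj`), and
the two bilinear forms vanish simultaneously at the intersections of the two factors. The cases with four linear
factors are covered by `four_lines`.
-/

namespace NeutralRicci

open MvPolynomial

/-! ### Bihomogeneous polynomials -/

lemma IsWeightedHomogeneous.eval_scale {w : Fin 4 → ℕ} {q : MvPolynomial (Fin 4) ℂ} {n : ℕ}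
    (h : IsWeightedHomogeneous w q n) (a : ℂ) (z : Fin 4 → ℂ) :
    eval (fun i => a ^ w i * z i) q = a ^ n * eval z q := by
  rw [eval_eq', eval_eq', Finset.mul_sum]
  refine Finset.sum_congr rfl fun d hd => ?_
  have hw := h (mem_support_iff.mp hd)
  rw [Finsupp.weight_eq_sum] at hw
  rw [← hw]
  simp only [mul_pow, Finset.prod_mul_distrib, ← pow_mul, smul_eq_mul, Finset.prod_pow_eq_pow_sum]
  simp only [mul_comm (w _)]
  ring

/-- Homogeneity can be tested on values: scaling by `2` separates the degrees. -/
lemma isWeightedHomogeneous_of_eval {w : Fin 4 → ℕ} {q : MvPolynomial (Fin 4) ℂ} {n : ℕ}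
    (h : ∀ z, eval (fun i => (2 : ℂ) ^ w i * z i) q = 2 ^ n * eval z q) :
    IsWeightedHomogeneous w q n := by
  let φ : MvPolynomial (Fin 4) ℂ →ₐ[ℂ] MvPolynomial (Fin 4) ℂ := aeval fun i => C ((2 : ℂ) ^ w i) * X i
  have hcoeff : ∀ p : MvPolynomial (Fin 4) ℂ, ∀ d,
      coeff d (φ p) = (2 : ℂ) ^ (Finsupp.weight w d) * coeff d p := by
    intro p
    induction p using MvPolynomial.induction_on' with
    | monomial e a =>
      intro d
      have : φ (monomial e a) = monomial e ((2 : ℂ) ^ (Finsupp.weight w e) * a) := by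
        simp only [monomial_eq (s := e)]
        rw [Finsupp.prod_fintype _ _ (by simp), Finsupp.weight_eq_sum]
        simp only [φ, map_mul, map_prod, map_pow, aeval_X, algHom_C, algebraMap_eq, mul_pow,
          Finset.prod_mul_distrib, ← pow_mul, smul_eq_mul, ← Finset.prod_pow_eq_pow_sum, mul_comm (w _)]
        ring
      rw [this, coeff_monomial, coeff_monomial]
      split_ifs with hed
      · rw [hed]
      · simp
    | add p₁ p₂ h₁ h₂ => intro d; simp only [map_add, coeff_add, h₁, h₂, mul_add]
  have hφ : φ q = C ((2 : ℂ) ^ n) * q := by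
    refine MvPolynomial.funext fun z => ?_
    rw [map_mul, eval_C, ← h z]
    simp only [φ, ← coe_aeval_eq_eval, RingHom.coe_coe]
    rw [← AlgHom.comp_apply, comp_aeval]
    simp
  intro d hd
  have h1 := hcoeff q d
  rw [hφ, coeff_C_mul] at h1
  have h2 := mul_right_cancel₀ hd h1
  exact (Nat.pow_right_injective le_rfl (by exact_mod_cast h2)).symm

lemma IsBihomogeneous.eval_scale {q : MvPolynomial (Fin 4) ℂ} {r s : ℕ} (h : IsBihomogeneous q r s)
    (a b x y u v : ℂ) :
    eval ![a * x, a * y, b * u, b * v] q = a ^ r * b ^ s * eval ![x, y, u, v] q := by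
  have h1 := IsWeightedHomogeneous.eval_scale h.1 a ![x, y, b * u, b * v]
  have h2 := IsWeightedHomogeneous.eval_scale h.2 b ![x, y, u, v]
  have e1 : (fun i => a ^ (![1, 1, 0, 0] : Fin 4 → ℕ) i * (![x, y, b * u, b * v] : Fin 4 → ℂ) i)
      = ![a * x, a * y, b * u, b * v] := by ext i; fin_cases i <;> simp
  have e2 : (fun i => b ^ (![0, 0, 1, 1] : Fin 4 → ℕ) i * (![x, y, u, v] : Fin 4 → ℂ) i)
      = ![x, y, b * u, b * v] := by ext i; fin_cases i <;> simp
  rw [e1] at h1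
  rw [e2] at h2
  rw [h1, h2, mul_assoc]

lemma isBihomogeneous_of_eval {q : MvPolynomial (Fin 4) ℂ} {r s : ℕ}
    (h : ∀ a b x y u v : ℂ, eval ![a * x, a * y, b * u, b * v] q = a ^ r * b ^ s * eval ![x, y, u, v] q) :
    IsBihomogeneous q r s := by
  constructor
  · refine isWeightedHomogeneous_of_eval fun z => ?_
    have e1 : (fun i => 2 ^ (![1, 1, 0, 0] : Fin 4 → ℕ) i * z i) = ![2 * z 0, 2 * z 1, 1 * z 2, 1 * z 3] := by
      ext i; fin_cases i <;> simp
    have e2 : z = ![z 0, z 1, z 2, z 3] := by ext i; fin_cases i <;> rfl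
    rw [e1, h, ← e2]; simp
  · refine isWeightedHomogeneous_of_eval fun z => ?_
    have e1 : (fun i => 2 ^ (![0, 0, 1, 1] : Fin 4 → ℕ) i * z i) = ![1 * z 0, 1 * z 1, 2 * z 2, 2 * z 3] := by
      ext i; fin_cases i <;> simp
    have e2 : z = ![z 0, z 1, z 2, z 3] := by ext i; fin_cases i <;> rfl
    rw [e1, h, ← e2]; simp

lemma IsBihomogeneous.exists_eval {q : MvPolynomial (Fin 4) ℂ} {r s : ℕ} (h : IsBihomogeneous q r s) :
    ∃ c : ℕ → ℕ → ℂ, ∀ x y u v, eval ![x, y, u, v] q =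
      ∑ i ∈ Finset.range (r + 1), ∑ j ∈ Finset.range (s + 1),
        c i j * (x ^ (r - i) * y ^ i) * (u ^ (s - j) * v ^ j) := by
  let δ : ℕ × ℕ → (Fin 4 →₀ ℕ) := fun ij => Finsupp.equivFunOnFinite.symm ![r - ij.1, ij.1, s - ij.2, ij.2]
  have hδ : Function.Injective δ := by
    intro a b hab
    have h1 := DFunLike.congr_fun hab 1
    have h3 := DFunLike.congr_fun hab 3
    simp [δ] at h1 h3
    exact Prod.ext h1 h3
  refine ⟨fun i j => coeff (δ (i, j)) q, fun x y u v => ?_⟩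
  rw [eval_eq', ← Finset.sum_product', Finset.sum_subset (s₂ := (Finset.range (r + 1) ×ˢ Finset.range (s + 1)).map ⟨δ, hδ⟩)]
  · rw [Finset.sum_map]
    refine Finset.sum_congr rfl fun ij _ => ?_
    simp [δ, Fin.prod_univ_four]
    ring
  · intro d hd
    have h1 := h.1 (mem_support_iff.mp hd)
    have h2 := h.2 (mem_support_iff.mp hd)
    simp [Finsupp.weight_eq_sum, Fin.sum_univ_four] at h1 h2
    simp only [Finset.mem_map, Finset.mem_product, Finset.mem_range, Function.Embedding.coeFn_mk, Prod.exists]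
    refine ⟨d 1, d 3, ⟨by omega, by omega⟩, ?_⟩
    ext i
    fin_cases i <;> simp [δ] <;> omega
  · intro d _ hd
    rw [notMem_support_iff.mp hd, zero_mul]

/-- Substituting `T X i` for the variables of weight one turns a homogeneous polynomial into a monomial in `T`,
and a factor of a monomial is a monomial. -/
lemma IsWeightedHomogeneous.of_mul {w : Fin 4 → ℕ} {f g : MvPolynomial (Fin 4) ℂ} {n : ℕ}
    (h : IsWeightedHomogeneous w (f * g) n) (h0 : f * g ≠ 0) :
    ∃ a b, a + b = n ∧ IsWeightedHomogeneous w f a ∧ IsWeightedHomogeneous w g b := by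
  let φ : MvPolynomial (Fin 4) ℂ →ₐ[ℂ] Polynomial (MvPolynomial (Fin 4) ℂ) :=
    aeval fun i => Polynomial.X ^ w i * Polynomial.C (X i)
  have hmon : ∀ p : MvPolynomial (Fin 4) ℂ, ∀ k, ∀ d, coeff d ((φ p).coeff k) =
      if Finsupp.weight w d = k then coeff d p else 0 := by
    intro p k
    induction p using MvPolynomial.induction_on' with
    | monomial e a =>
      intro d
      have : φ (monomial e a) = Polynomial.C (monomial e a) * Polynomial.X ^ (Finsupp.weight w e) := by
        simp only [monomial_eq (s := e)]
        rw [Finsupp.prod_fintype _ _ (by simp), Finsupp.weight_eq_sum]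
        simp only [φ, map_mul, map_prod, map_pow, aeval_X, algHom_C, mul_pow, Finset.prod_mul_distrib,
          ← pow_mul, smul_eq_mul, ← Finset.prod_pow_eq_pow_sum, mul_comm (w _)]
        rw [show algebraMap ℂ (Polynomial (MvPolynomial (Fin 4) ℂ)) a = Polynomial.C (C a) from rfl]
        ring
      rw [this, Polynomial.coeff_C_mul_X_pow]
      by_cases hed : e = d
      · subst hed
        by_cases hk : k = Finsupp.weight w e
        · simp [hk]
        · simp [hk, Ne.symm hk]
      · split_ifs <;> simp [coeff_monomial, hed]
    | add p₁ p₂ h₁ h₂ => intro d; simp only [map_add, Polynomial.coeff_add, coeff_add, h₁, h₂]; split_ifs <;> simp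
  have hinj : ∀ p, p ≠ 0 → φ p ≠ 0 := by
    intro p hp hz
    obtain ⟨d, hd⟩ := MvPolynomial.ne_zero_iff.mp hp
    have := hmon p (Finsupp.weight w d) d
    rw [hz] at this
    simp at this
    exact hd this.symm
  have hφ : φ (f * g) = Polynomial.monomial n (f * g) := by
    refine Polynomial.ext fun k => MvPolynomial.ext _ _ fun d => ?_
    rw [hmon, Polynomial.coeff_monomial]
    by_cases hd : coeff d (f * g) = 0
    · split_ifs <;> simp [hd]
    · rw [h hd]
      split_ifs <;> simp_all
  have hf := left_ne_zero_of_mul h0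
  have hg := right_ne_zero_of_mul h0
  have hdeg : (φ f).natDegree + (φ g).natDegree = n := by
    rw [← Polynomial.natDegree_mul (hinj f hf) (hinj g hg), ← map_mul, hφ,
      Polynomial.natDegree_monomial_eq _ h0]
  have htr : (φ f).natTrailingDegree + (φ g).natTrailingDegree = n := by
    rw [← Polynomial.natTrailingDegree_mul (hinj f hf) (hinj g hg), ← map_mul, hφ,
      Polynomial.natTrailingDegree_monomial h0]
  have l1 := Polynomial.natTrailingDegree_le_natDegree (φ f)
  have l2 := Polynomial.natTrailingDegree_le_natDegree (φ g)
  have key : ∀ p, (φ p).natTrailingDegree = (φ p).natDegree → IsWeightedHomogeneous w p (φ p).natDegree := by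
    intro p hp d hd
    by_contra hne
    have h1 := hmon p (Finsupp.weight w d) d
    rw [if_pos rfl] at h1
    rcases lt_or_gt_of_ne hne with hlt | hgt
    · rw [Polynomial.coeff_eq_zero_of_lt_natTrailingDegree (hp ▸ hlt)] at h1
      exact hd (by simpa using h1.symm)
    · rw [Polynomial.coeff_eq_zero_of_natDegree_lt hgt] at h1
      exact hd (by simpa using h1.symm)
  exact ⟨_, _, hdeg, key f (by omega), key g (by omega)⟩

lemma IsBihomogeneous.of_mul {f g : MvPolynomial (Fin 4) ℂ} {r s : ℕ}
    (h : IsBihomogeneous (f * g) r s) (h0 : f * g ≠ 0) :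
    ∃ a b c d, a + c = r ∧ b + d = s ∧ IsBihomogeneous f a b ∧ IsBihomogeneous g c d := by
  obtain ⟨a, c, hac, hf, hg⟩ := IsWeightedHomogeneous.of_mul h.1 h0
  obtain ⟨b, d, hbd, hf', hg'⟩ := IsWeightedHomogeneous.of_mul h.2 h0
  exact ⟨a, b, c, d, hac, hbd, ⟨hf, hf'⟩, ⟨hg, hg'⟩⟩

lemma eval_surj (z : Fin 4 → ℂ) : z = ![z 0, z 1, z 2, z 3] := by ext i; fin_cases i <;> rfl

lemma funext_eval {p q : MvPolynomial (Fin 4) ℂ}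
    (h : ∀ x y u v, eval ![x, y, u, v] p = eval ![x, y, u, v] q) : p = q :=
  MvPolynomial.funext fun z => by rw [eval_surj z]; exact h _ _ _ _

/-! ### Irreducibility of bihomogeneous polynomials -/

lemma exists_zero_binary {n : ℕ} (hn : 0 < n) (c : ℕ → ℂ) :
    ∃ x y : ℂ, (x ≠ 0 ∨ y ≠ 0) ∧ ∑ i ∈ Finset.range (n + 1), c i * (x ^ (n - i) * y ^ i) = 0 := by
  by_cases h0 : c 0 = 0
  · refine ⟨1, 0, by simp, Finset.sum_eq_zero fun i _ => ?_⟩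
    rcases Nat.eq_zero_or_pos i with rfl | hi
    · simp [h0]
    · simp [hi.ne']
  · let p : Polynomial ℂ := ∑ i ∈ Finset.range (n + 1), Polynomial.C (c i) * Polynomial.X ^ (n - i)
    have hp : p.coeff n = c 0 := by
      simp only [p, Polynomial.finsetSum_coeff, Polynomial.coeff_C_mul_X_pow]
      rw [Finset.sum_eq_single 0]
      · simp
      · intro i hi hi0
        rw [if_neg]
        simp at hi
        omega
      · simp
    have hdeg : p.degree ≠ 0 := by
      intro hd
      have := Polynomial.coeff_eq_zero_of_degree_lt (p := p) (n := n) (by rw [hd]; exact_mod_cast hn)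
      exact h0 (hp ▸ this)
    obtain ⟨x, hx⟩ := IsAlgClosed.exists_root p hdeg
    refine ⟨x, 1, by simp, ?_⟩
    simpa [p, Polynomial.IsRoot, Polynomial.eval_finsetSum] using hx

lemma IsBihomogeneous.exists_zero_left {q : MvPolynomial (Fin 4) ℂ} {r s : ℕ} (h : IsBihomogeneous q r s)
    (hr : 0 < r) (u v : ℂ) : ∃ x y : ℂ, (x ≠ 0 ∨ y ≠ 0) ∧ eval ![x, y, u, v] q = 0 := by
  obtain ⟨c, hc⟩ := h.exists_eval
  obtain ⟨x, y, hxy, h0⟩ := exists_zero_binary hr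
    (fun i => ∑ j ∈ Finset.range (s + 1), c i j * (u ^ (s - j) * v ^ j))
  refine ⟨x, y, hxy, ?_⟩
  rw [hc, ← h0]
  refine Finset.sum_congr rfl fun i _ => ?_
  rw [Finset.sum_mul]
  exact Finset.sum_congr rfl fun j _ => by ring

lemma IsBihomogeneous.exists_zero_right {q : MvPolynomial (Fin 4) ℂ} {r s : ℕ} (h : IsBihomogeneous q r s)
    (hs : 0 < s) (x y : ℂ) : ∃ u v : ℂ, (u ≠ 0 ∨ v ≠ 0) ∧ eval ![x, y, u, v] q = 0 := by
  obtain ⟨c, hc⟩ := h.exists_eval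
  obtain ⟨u, v, huv, h0⟩ := exists_zero_binary hs
    (fun j => ∑ i ∈ Finset.range (r + 1), c i j * (x ^ (r - i) * y ^ i))
  refine ⟨u, v, huv, ?_⟩
  rw [hc, ← h0, Finset.sum_comm]
  refine Finset.sum_congr rfl fun i _ => ?_
  rw [Finset.sum_mul]

lemma IsBihomogeneous.eval_left_const {q : MvPolynomial (Fin 4) ℂ} {r : ℕ} (h : IsBihomogeneous q r 0)
    (x y u v u' v' : ℂ) : eval ![x, y, u, v] q = eval ![x, y, u', v'] q := by
  have h1 := h.eval_scale 1 0 x y u v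
  have h2 := h.eval_scale 1 0 x y u' v'
  simp at h1 h2
  rw [← h1, ← h2]

lemma IsBihomogeneous.eval_right_const {q : MvPolynomial (Fin 4) ℂ} {s : ℕ} (h : IsBihomogeneous q 0 s)
    (x y u v x' y' : ℂ) : eval ![x, y, u, v] q = eval ![x', y', u, v] q := by
  have h1 := h.eval_scale 0 1 x y u v
  have h2 := h.eval_scale 0 1 x' y' u v
  simp at h1 h2
  rw [← h1, ← h2]

lemma IsBihomogeneous.isUnit {q : MvPolynomial (Fin 4) ℂ} (h : IsBihomogeneous q 0 0) (h0 : q ≠ 0) : IsUnit q := by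
  have : q = C (eval ![0, 0, 0, 0] q) := by
    refine funext_eval fun x y u v => ?_
    rw [eval_C, h.eval_left_const x y u v 0 0, h.eval_right_const x y 0 0 0 0]
  rw [this] at h0 ⊢
  exact (isUnit_iff_ne_zero.mpr (fun hz => h0 (by rw [hz, C_0]))).map C

/-- It suffices to exclude factorizations into bihomogeneous polynomials of nonzero bidegree. -/
lemma irreducible_of_factors {q : MvPolynomial (Fin 4) ℂ} {r s : ℕ} (hq : IsBihomogeneous q r s) (h0 : q ≠ 0)
    (hrs : r ≠ 0 ∨ s ≠ 0)
    (H : ∀ f g a b c d, q = f * g → a + c = r → b + d = s → IsBihomogeneous f a b → IsBihomogeneous g c d →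
      (a ≠ 0 ∨ b ≠ 0) → (c ≠ 0 ∨ d ≠ 0) → False) : Irreducible q := by
  constructor
  · intro hu
    obtain ⟨g, hg⟩ := hu.exists_right_inv
    rcases hrs with hr | hs
    · obtain ⟨x, y, -, hz⟩ := hq.exists_zero_left (Nat.pos_of_ne_zero hr) 0 0
      have := congrArg (eval ![x, y, 0, 0]) hg
      simp [hz] at this
    · obtain ⟨u, v, -, hz⟩ := hq.exists_zero_right (Nat.pos_of_ne_zero hs) 0 0
      have := congrArg (eval ![0, 0, u, v]) hg
      simp [hz] at this
  · intro f g hfg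
    obtain ⟨a, b, c, d, hac, hbd, hf, hg⟩ := (hfg ▸ hq).of_mul (hfg ▸ h0)
    have hf0 : f ≠ 0 := left_ne_zero_of_mul (hfg ▸ h0)
    have hg0 : g ≠ 0 := right_ne_zero_of_mul (hfg ▸ h0)
    by_cases h1 : a ≠ 0 ∨ b ≠ 0
    · by_cases h2 : c ≠ 0 ∨ d ≠ 0
      · exact (H f g a b c d hfg hac hbd hf hg h1 h2).elim
      · push Not at h2
        obtain ⟨rfl, rfl⟩ := h2
        exact Or.inr (hg.isUnit hg0)
    · push Not at h1
      obtain ⟨rfl, rfl⟩ := h1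
      exact Or.inl (hf.isUnit hf0)

lemma irreducible_linear_left {q : MvPolynomial (Fin 4) ℂ} (hq : IsBihomogeneous q 1 0) (h0 : q ≠ 0) :
    Irreducible q :=
  irreducible_of_factors hq h0 (by simp) fun f g a b c d _ _ _ _ _ _ _ => by omega

lemma irreducible_linear_right {q : MvPolynomial (Fin 4) ℂ} (hq : IsBihomogeneous q 0 1) (h0 : q ≠ 0) :
    Irreducible q :=
  irreducible_of_factors hq h0 (by simp) fun f g a b c d _ _ _ _ _ _ _ => by omega

/-- A polynomial without factors that depend only on `X, Y` or only on `U, V` is irreducible as soon as it is not a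
product of factors that depend on both. -/
lemma irreducible_of_mixed {q : MvPolynomial (Fin 4) ℂ} {r s : ℕ} (hq : IsBihomogeneous q r s)
    (hr : r ≠ 0) (h1 : ∀ x y, (x ≠ 0 ∨ y ≠ 0) → ∃ u v, eval ![x, y, u, v] q ≠ 0)
    (h2 : ∀ u v, (u ≠ 0 ∨ v ≠ 0) → ∃ x y, eval ![x, y, u, v] q ≠ 0)
    (H : ∀ f g a b c d, q = f * g → a + c = r → b + d = s → IsBihomogeneous f a b → IsBihomogeneous g c d →
      0 < a → 0 < b → 0 < c → 0 < d → False) : Irreducible q := by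
  have h0 : q ≠ 0 := by
    rintro rfl
    obtain ⟨u, v, h⟩ := h1 1 0 (by simp)
    simp at h
  have k1 : ∀ f g : MvPolynomial (Fin 4) ℂ, ∀ a, q = f * g → IsBihomogeneous f a 0 → a ≠ 0 → False := by
    intro f g a hfg hf ha
    obtain ⟨x, y, hxy, hz⟩ := hf.exists_zero_left (Nat.pos_of_ne_zero ha) 0 0
    obtain ⟨u, v, huv⟩ := h1 x y hxy
    rw [hfg, map_mul, hf.eval_left_const x y u v 0 0, hz, zero_mul] at huv
    exact huv rfl
  have k2 : ∀ f g : MvPolynomial (Fin 4) ℂ, ∀ b, q = f * g → IsBihomogeneous f 0 b → b ≠ 0 → False := by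
    intro f g b hfg hf hb
    obtain ⟨u, v, huv, hz⟩ := hf.exists_zero_right (Nat.pos_of_ne_zero hb) 0 0
    obtain ⟨x, y, hxy⟩ := h2 u v huv
    rw [hfg, map_mul, hf.eval_right_const x y u v 0 0, hz, zero_mul] at hxy
    exact hxy rfl
  refine irreducible_of_factors hq h0 (Or.inl hr) fun f g a b c d hfg hac hbd hf hg hab hcd => ?_
  rcases Nat.eq_zero_or_pos a with rfl | ha
  · exact k2 f g b hfg hf (by simpa using hab)
  rcases Nat.eq_zero_or_pos b with rfl | hb
  · exact k1 f g a hfg hf ha.ne'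
  rcases Nat.eq_zero_or_pos c with rfl | hc
  · exact k2 g f d (by rw [hfg, mul_comm]) hg (by simpa using hcd)
  rcases Nat.eq_zero_or_pos d with rfl | hd
  · exact k1 g f c (by rw [hfg, mul_comm]) hg hc.ne'
  exact H f g a b c d hfg hac hbd hf hg ha hb hc hd

lemma irreducible_of_bidegree_two_one {q : MvPolynomial (Fin 4) ℂ} (hq : IsBihomogeneous q 2 1)
    (h1 : ∀ x y, (x ≠ 0 ∨ y ≠ 0) → ∃ u v, eval ![x, y, u, v] q ≠ 0)
    (h2 : ∀ u v, (u ≠ 0 ∨ v ≠ 0) → ∃ x y, eval ![x, y, u, v] q ≠ 0) : Irreducible q :=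
  irreducible_of_mixed hq (by simp) h1 h2 fun f g a b c d _ _ _ _ _ _ _ _ _ => by omega

lemma irreducible_bilinear {q : MvPolynomial (Fin 4) ℂ} {a b c d : ℂ}
    (hq : ∀ x y u v, eval ![x, y, u, v] q = a * (x * u) + b * (x * v) + c * (y * u) + d * (y * v))
    (hdet : a * d - b * c ≠ 0) : Irreducible q := by
  have hb : IsBihomogeneous q 1 1 := isBihomogeneous_of_eval fun a b x y u v => by simp only [hq]; ring
  refine irreducible_of_mixed hb (by simp) (fun x y hxy => ?_) (fun u v huv => ?_)
    fun f g a b c d _ _ _ _ _ _ _ _ _ => by omega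
  · by_contra! hz
    have e1 := hz 1 0
    have e2 := hz 0 1
    rw [hq] at e1 e2
    have hx : (a * d - b * c) * x = 0 := by linear_combination d * e1 - c * e2
    have hy : (a * d - b * c) * y = 0 := by linear_combination a * e2 - b * e1
    simp [hdet] at hx hy
    simp [hx, hy] at hxy
  · by_contra! hz
    have e1 := hz 1 0
    have e2 := hz 0 1
    rw [hq] at e1 e2
    have hx : (a * d - b * c) * u = 0 := by linear_combination d * e1 - b * e2
    have hy : (a * d - b * c) * v = 0 := by linear_combination a * e2 - c * e1
    simp [hdet] at hx hy
    simp [hx, hy] at huv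

lemma IsBihomogeneous.eval_one_one {q : MvPolynomial (Fin 4) ℂ} (h : IsBihomogeneous q 1 1) :
    ∃ a b c d : ℂ, ∀ x y u v, eval ![x, y, u, v] q = a * (x * u) + b * (x * v) + c * (y * u) + d * (y * v) := by
  obtain ⟨c, hc⟩ := h.exists_eval
  refine ⟨c 0 0, c 0 1, c 1 0, c 1 1, fun x y u v => ?_⟩
  rw [hc]
  simp [Finset.sum_range_succ]
  ring

/-- A polynomial of bidegree `(2,2)` which is a product of two polynomials of bidegree `(1,1)` is a quadratic form in
`X, Y` whose discriminant is a square. -/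
lemma irreducible_of_discriminant {q : MvPolynomial (Fin 4) ℂ} (A B D : ℂ → ℂ → ℂ) (hq : IsBihomogeneous q 2 2)
    (hev : ∀ x y u v, eval ![x, y, u, v] q = A u v * x ^ 2 + B u v * (x * y) + D u v * y ^ 2)
    (h1 : ∀ x y, (x ≠ 0 ∨ y ≠ 0) → ∃ u v, eval ![x, y, u, v] q ≠ 0)
    (h2 : ∀ u v, (u ≠ 0 ∨ v ≠ 0) → ∃ x y, eval ![x, y, u, v] q ≠ 0)
    (h3 : ∀ r s t : ℂ, ¬ ∀ u v, B u v ^ 2 - 4 * A u v * D u v = (r * u ^ 2 + s * (u * v) + t * v ^ 2) ^ 2) :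
    Irreducible q := by
  refine irreducible_of_mixed hq (by simp) h1 h2 fun f g a b c d hfg hac hbd hf hg ha hb hc hd => ?_
  obtain ⟨rfl, rfl, rfl, rfl⟩ : a = 1 ∧ b = 1 ∧ c = 1 ∧ d = 1 := by omega
  obtain ⟨a, b, c, d, hf⟩ := hf.eval_one_one
  obtain ⟨a', b', c', d', hg⟩ := hg.eval_one_one
  refine h3 (a * c' - a' * c) (a * d' + b * c' - a' * d - b' * c) (b * d' - b' * d) fun u v => ?_
  have key : ∀ x y, A u v * x ^ 2 + B u v * (x * y) + D u v * y ^ 2 =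
      (a * (x * u) + b * (x * v) + c * (y * u) + d * (y * v)) *
      (a' * (x * u) + b' * (x * v) + c' * (y * u) + d' * (y * v)) := by
    intro x y
    rw [← hev, hfg, map_mul, hf, hg]
  have hA : A u v = (a * u + b * v) * (a' * u + b' * v) := by linear_combination key 1 0
  have hD : D u v = (c * u + d * v) * (c' * u + d' * v) := by linear_combination key 0 1
  have hB : B u v = (a * u + b * v) * (c' * u + d' * v) + (c * u + d * v) * (a' * u + b' * v) := by
    linear_combination key 1 1 - hA - hD
  rw [hA, hB, hD]
  ring

lemma not_associated_of_eval {p q : MvPolynomial (Fin 4) ℂ} (z : Fin 4 → ℂ) (hp : eval z p = 0)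
    (hq : eval z q ≠ 0) : ¬ Associated p q := by
  rintro ⟨c, rfl⟩
  simp [hp] at hq

end NeutralRicci

namespace NeutralRicci

open MvPolynomial

/-! ### Linear algebra of the scalar product -/

section Bilinear

variable {K : Type*} [CommRing K]

lemma s22_comm (u v : Fin 4 → K) : s22 u v = s22 v u := by simp only [s22]; ring

lemma s22_add_left (u u' v : Fin 4 → K) : s22 (u + u') v = s22 u v + s22 u' v := by
  simp only [s22, Pi.add_apply]; ring

lemma s22_smul_left (a : K) (u v : Fin 4 → K) : s22 (a • u) v = a * s22 u v := by
  simp only [s22, Pi.smul_apply, smul_eq_mul]; ring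

lemma s22_neg_left (u v : Fin 4 → K) : s22 (-u) v = -s22 u v := by
  simp only [s22, Pi.neg_apply]; ring

lemma s22_add_right (u v v' : Fin 4 → K) : s22 u (v + v') = s22 u v + s22 u v' := by
  simp only [s22, Pi.add_apply]; ring

lemma s22_smul_right (a : K) (u v : Fin 4 → K) : s22 u (a • v) = a * s22 u v := by
  simp only [s22, Pi.smul_apply, smul_eq_mul]; ring

lemma s22_neg_right (u v : Fin 4 → K) : s22 u (-v) = -s22 u v := by
  simp only [s22, Pi.neg_apply]; ring

lemma s22_zero_right (u : Fin 4 → K) : s22 u 0 = 0 := by simp [s22]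

lemma s22_sum_right {n : ℕ} (u : Fin 4 → K) (f : Fin n → Fin 4 → K) :
    s22 u (∑ i, f i) = ∑ i, s22 u (f i) := by
  simp only [s22, Finset.sum_apply, Finset.mul_sum, ← Finset.sum_add_distrib, ← Finset.sum_sub_distrib]

end Bilinear

lemma s22_cvec (u v : Fin 4 → ℝ) : s22 (cvec u) (cvec v) = ((s22 u v : ℝ) : ℂ) := by
  simp [s22, cvec]

lemma cvec_add {n : ℕ} (u v : Fin n → ℝ) : cvec (u + v) = cvec u + cvec v := by ext; simp [cvec]

lemma cvec_sub {n : ℕ} (u v : Fin n → ℝ) : cvec (u - v) = cvec u - cvec v := by ext; simp [cvec]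

lemma cvec_neg {n : ℕ} (u : Fin n → ℝ) : cvec (-u) = -cvec u := by ext; simp [cvec]

lemma cvec_smul {n : ℕ} (a : ℝ) (u : Fin n → ℝ) : cvec (a • u) = (a : ℂ) • cvec u := by ext; simp [cvec]

lemma cvec_sum {n k : ℕ} (f : Fin k → Fin n → ℝ) : cvec (∑ i, f i) = ∑ i, cvec (f i) := by
  ext; simp [cvec]

lemma complexify_cvec (Φ : (Fin 4 → ℝ) →ₗ[ℝ] (Fin 4 → ℝ)) (v : Fin 4 → ℝ) :
    complexify Φ (cvec v) = cvec (Φ v) := by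
  ext i
  conv_rhs => rw [← LinearMap.toMatrix'_mulVec Φ v]
  simp [complexify, cvec, Matrix.mulVec, dotProduct]

lemma cvec_dyad (α α' : Fin 2 → ℝ) : cvec (dyad α α') = dyad (cvec α) (cvec α') := by
  ext i; fin_cases i <;> simp [cvec, dyad]

/-- A family with a dual family for `s` is a basis, whose coordinates are read off by the dual family. -/
lemma exists_basis_of_dual {K : Type*} [Field K] {E F : Fin 4 → Fin 4 → K} (h : ∀ i j, s22 (F i) (E j) = if i = j then 1 else 0) :
    ∃ b : Module.Basis (Fin 4) K (Fin 4 → K), ⇑b = E ∧ ∀ w, w = ∑ i, s22 (F i) w • E i := by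
  have hli : LinearIndependent K E := by
    rw [Fintype.linearIndependent_iff]
    intro g hg i
    have := congrArg (s22 (F i)) hg
    simpa [s22_sum_right, s22_smul_right, h, s22_zero_right] using this
  let b := basisOfLinearIndependentOfCardEqFinrank hli (by simp)
  have hb : ⇑b = E := coe_basisOfLinearIndependentOfCardEqFinrank _ _
  refine ⟨b, hb, fun w => ?_⟩
  have hw := b.sum_repr w
  rw [hb] at hw
  conv_rhs => rw [← hw]
  conv_lhs => rw [← hw]
  refine Finset.sum_congr rfl fun i _ => ?_
  simp [s22_sum_right, s22_smul_right, h]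

lemma trace_eq_of_hasMatrix {Φ : (Fin 4 → ℝ) →ₗ[ℝ] (Fin 4 → ℝ)} {E : Fin 4 → Fin 4 → ℝ}
    {M : Matrix (Fin 4) (Fin 4) ℝ} (b : Module.Basis (Fin 4) ℝ (Fin 4 → ℝ)) (hb : ⇑b = E)
    (hM : HasMatrix Φ E M) : LinearMap.trace ℝ (Fin 4 → ℝ) Φ = M 0 0 + M 1 1 + M 2 2 + M 3 3 := by
  have : LinearMap.toMatrix b b Φ = M := by
    ext i j
    rw [LinearMap.toMatrix_apply, hb, hM j, ← hb]
    simp [Finsupp.single_apply]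
  rw [LinearMap.trace_eq_matrix_trace ℝ b, this, Matrix.trace, Fin.sum_univ_four]
  rfl

/-- Passing from a `Ψ`-ON basis to its Witt basis, the matrix of an endomorphism is conjugated by the (involutory)
matrix of the change of basis. -/
noncomputable def psiToWitt (M : Matrix (Fin 4) (Fin 4) ℝ) : Matrix (Fin 4) (Fin 4) ℝ :=
  let S : Matrix (Fin 4) (Fin 4) ℝ := !![1, 0, 1, 0; 0, 1, 0, 1; 1, 0, -1, 0; 0, 1, 0, -1]
  Matrix.of fun i j => (1 / 2) * ∑ k, ∑ l, S i k * M k l * S l j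

lemma HasMatrix.toWitt {Φ : (Fin 4 → ℝ) →ₗ[ℝ] (Fin 4 → ℝ)} {B : Fin 4 → Fin 4 → ℝ}
    {M : Matrix (Fin 4) (Fin 4) ℝ} (hM : HasMatrix Φ B M) : HasMatrix Φ (toWitt B) (psiToWitt M) := by
  have h0 := hM 0
  have h1 := hM 1
  have h2 := hM 2
  have h3 := hM 3
  simp only [Fin.sum_univ_four] at h0 h1 h2 h3
  intro j
  fin_cases j <;> ext k <;>
    simp [NeutralRicci.toWitt, psiToWitt, h0, h1, h2, h3, Fin.sum_univ_four] <;> ring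

lemma IsPsiON.toWitt {B : Fin 4 → Fin 4 → ℝ} (hB : IsPsiON B) : IsWitt (toWitt B) := by
  have h2 := sqrt_two_inv_sq (K := ℝ)
  simp only [RCLike.ofReal_real_eq_id, id] at h2
  intro i j
  have key : ∀ u u' v v' : Fin 4 → ℝ, s22 ((√2)⁻¹ • (u + u')) ((√2)⁻¹ • (v + v')) =
      2⁻¹ * (s22 u v + s22 u v' + s22 u' v + s22 u' v') := by
    intro u u' v v'
    rw [s22_smul_left, s22_smul_right, ← mul_assoc, h2, s22_add_left, s22_add_right, s22_add_right]
    ring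
  have e0 : NeutralRicci.toWitt B 0 = (√2)⁻¹ • (B 0 + B 2) := rfl
  have e1 : NeutralRicci.toWitt B 1 = (√2)⁻¹ • (B 1 + B 3) := rfl
  have e2 : NeutralRicci.toWitt B 2 = (√2)⁻¹ • (B 0 + -B 2) := by rw [← sub_eq_add_neg]; rfl
  have e3 : NeutralRicci.toWitt B 3 = (√2)⁻¹ • (B 1 + -B 3) := by rw [← sub_eq_add_neg]; rfl
  fin_cases i <;> fin_cases j <;>
    simp only [Fin.zero_eta, Fin.mk_one, Fin.reduceFinMk, e0, e1, e2, e3, key] <;>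
    simp [s22_neg_left, s22_neg_right, hB _ _] <;> norm_num

lemma toPsiON_toWitt (B : Fin 4 → Fin 4 → ℝ) : toPsiON (toWitt B) = B := by
  have h2 := sqrt_two_inv_sq (K := ℝ)
  simp only [RCLike.ofReal_real_eq_id, id] at h2
  ext i k
  fin_cases i <;> simp [toPsiON, toWitt]
  · linear_combination (2 * B 0 k) * h2
  · linear_combination (2 * B 1 k) * h2
  · linear_combination (2 * B 2 k) * h2
  · linear_combination (2 * B 3 k) * h2

lemma IsWitt.dual {E : Fin 4 → Fin 4 → ℝ} (hE : IsWitt E) (i j : Fin 4) :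
    s22 (E (i + 2)) (E j) = if i = j then 1 else 0 := by
  rw [hE]
  exact if_congr (by simp) rfl rfl

/-! ### Symmetries of the Ricci spinor, its expression in spin frames -/

section RicciSpinor

variable {Φ : (Fin 4 → ℝ) →ₗ[ℝ] (Fin 4 → ℝ)}

lemma ricciSpinor_symm (hsa : ∀ u v, s22 (Φ u) v = s22 u (Φ v))
    (htr : LinearMap.trace ℝ (Fin 4 → ℝ) Φ = 0) (A B A' B' : Fin 2) :
    ricciSpinor Φ A B A' B' = ricciSpinor Φ B A A' B' ∧ ricciSpinor Φ A B A' B' = ricciSpinor Φ A B B' A' := by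
  let t : Fin 2 → Fin 2 → Fin 4 → ℝ := fun A A' => dyad (Pi.single A 1) (Pi.single A' 1)
  have hswap : ∀ A B A' B', ricciSpinor Φ A B A' B' = ricciSpinor Φ B A B' A' := by
    intro A B A' B'
    simp only [ricciSpinor]
    rw [← hsa, s22_comm]
  let E : Fin 4 → Fin 4 → ℝ := ![t 0 0, t 1 0, t 1 1, -t 0 1]
  have hE : IsWitt E := by
    intro i j
    fin_cases i <;> fin_cases j <;> simp [E, t, s22_neg_left, s22_neg_right, s22_dyad, eps]
  obtain ⟨b, hb, hw⟩ := exists_basis_of_dual hE.dual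
  have htr' := trace_eq_of_hasMatrix (M := fun i j => s22 (E (i + 2)) (Φ (E j))) b hb (fun j => hw _)
  have hz : ricciSpinor Φ 0 1 0 1 = ricciSpinor Φ 0 1 1 0 := by
    have e1 : ricciSpinor Φ 0 1 0 1 = s22 (t 0 0) (Φ (t 1 1)) := rfl
    have e2 : ricciSpinor Φ 0 1 1 0 = s22 (t 0 1) (Φ (t 1 0)) := rfl
    have e3 : ricciSpinor Φ 1 0 1 0 = s22 (t 1 1) (Φ (t 0 0)) := rfl
    have e4 : ricciSpinor Φ 1 0 0 1 = s22 (t 1 0) (Φ (t 0 1)) := rfl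
    have f1 := hswap 0 1 0 1
    have f2 := hswap 0 1 1 0
    rw [htr] at htr'
    simp [E, s22_neg_left, s22_neg_right] at htr'
    linarith
  have g1 := hswap 0 1 0 1
  have g2 := hswap 0 1 1 0
  have g3 := hswap 0 1 0 0
  have g4 := hswap 0 1 1 1
  have g5 := hswap 0 0 0 1
  have g6 := hswap 1 1 0 1
  fin_cases A <;> fin_cases B <;> fin_cases A' <;> fin_cases B' <;> constructor <;>
    simp only [Fin.zero_eta, Fin.mk_one] <;> linarith

lemma eval_ricciPolyC (x y u v : ℂ) : eval ![x, y, u, v] (ricciPolyC Φ) =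
    s22 (dyad ![x, y] ![u, v]) (complexify Φ (dyad ![x, y] ![u, v])) := by
  let t : Fin 2 → Fin 2 → Fin 4 → ℝ := fun A A' => dyad (Pi.single A 1) (Pi.single A' 1)
  have hd : dyad ![x, y] ![u, v] = (x * u) • cvec (t 0 0) + (x * v) • cvec (t 0 1) + (y * u) • cvec (t 1 0)
      + (y * v) • cvec (t 1 1) := by
    ext i; fin_cases i <;> simp [t, dyad, cvec] <;> ring
  have hr : ∀ A B A' B', ((ricciSpinor Φ A B A' B' : ℝ) : ℂ) = s22 (cvec (t A A')) (cvec (Φ (t B B'))) :=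
    fun A B A' B' => (s22_cvec _ _).symm
  rw [hd]
  simp only [map_add, map_smul, complexify_cvec, s22_add_left, s22_add_right, s22_smul_left, s22_smul_right, ← hr]
  simp [ricciPolyC, ricciPoly, ricciPolyIn, Fin.sum_univ_two]
  ring

lemma s22_single_dyad (α α' : Fin 2 → ℝ) (A A' : Fin 2) :
    s22 (dyad (Pi.single A 1) (Pi.single A' 1)) (dyad α α') = low α A * low α' A' := by
  rw [s22_dyad]
  fin_cases A <;> fin_cases A' <;> simp [eps, low]

/-- The spinors `a_A a'_{A'}`, `b_A a'_{A'}`, `b_A b'_{A'}`, `-a_A b'_{A'}` of a Witt basis of type `O^+_+`. -/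
def wittSpinor (a b a' b' : Fin 2 → ℝ) (i : Fin 4) (A A' : Fin 2) : ℝ :=
  (![a A * a' A', b A * a' A', b A * b' A', -(a A * b' A')] : Fin 4 → ℝ) i

/-- The contractions of the spinors `wittSpinor` with `(X o + Y ι)(U o' + V ι')`. -/
noncomputable def wittForm (X Y U V : MvPolynomial (Fin 4) ℝ) : Fin 4 → MvPolynomial (Fin 4) ℝ :=
  ![Y * V, -(X * V), X * U, Y * U]

lemma ricciSpinor_eq_sum {E : Fin 4 → Fin 4 → ℝ} {M : Matrix (Fin 4) (Fin 4) ℝ} (hE : IsWitt E)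
    (hM : HasMatrix Φ E M) (A B A' B' : Fin 2) : ricciSpinor Φ A B A' B' =
      ∑ i, ∑ j, M i j * s22 (dyad (Pi.single A 1) (Pi.single A' 1)) (E i) *
        s22 (dyad (Pi.single B 1) (Pi.single B' 1)) (E (j + 2)) := by
  obtain ⟨b, hb, hw⟩ := exists_basis_of_dual hE.dual
  rw [ricciSpinor]
  conv_lhs => rw [hw (dyad (Pi.single B 1) (Pi.single B' 1))]
  rw [map_sum, s22_sum_right, Finset.sum_comm]
  refine Finset.sum_congr rfl fun j _ => ?_
  rw [map_smul, s22_smul_right, hM j, s22_sum_right, Finset.mul_sum]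
  refine Finset.sum_congr rfl fun i _ => ?_
  rw [s22_smul_right, s22_comm (E (j + 2))]
  ring

lemma ricciPolyIn_eq_sum {M : Matrix (Fin 4) (Fin 4) ℝ} {S : Fin 4 → Fin 2 → Fin 2 → ℝ}
    (h : ∀ A B A' B', ricciSpinor Φ A B A' B' = ∑ i, ∑ j, M i j * S i A A' * S (j + 2) B B')
    (o ι o' ι' : Fin 2 → ℝ) {w : Fin 4 → MvPolynomial (Fin 4) ℝ}
    (hw : ∀ i, ∑ A, ∑ A', C (S i A A') * (C (o A) * X 0 + C (ι A) * X 1) * (C (o' A') * X 2 + C (ι' A') * X 3) = w i) :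
    ricciPolyIn Φ o ι o' ι' = ∑ i, ∑ j, C (M i j) * w i * w (j + 2) := by
  simp only [ricciPolyIn, h, ← hw, map_sum, map_mul, Finset.sum_mul, Fin.sum_univ_two]
  simp only [← Finset.sum_add_distrib]
  refine Finset.sum_congr rfl fun i _ => Finset.sum_congr rfl fun j _ => ?_
  ring

/-- The four O-types differ by an exchange of spinors, so that it suffices to verify the expressions for `O^+_+`, for
arbitrary spinors. -/
lemma hasSpinorForm_of_matrix {E : Fin 4 → Fin 4 → ℝ} {M : Matrix (Fin 4) (Fin 4) ℝ} {κ : OType}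
    {F : SpinorForm} {p : PolyForm} (hE : IsWitt E) (hM : HasMatrix Φ E M)
    (hF : ∀ a b a' b' A B A' B', ∑ i, ∑ j, M i j * wittSpinor a b a' b' i A A' *
      wittSpinor a b a' b' (j + 2) B B' = F a b a' b' A B A' B')
    (hp : ∀ X Y U V, ∑ i, ∑ j, C (M i j) * wittForm X Y U V i * wittForm X Y U V (j + 2) = p X Y U V) :
    HasSpinorForm Φ κ E F p := by
  intro o ι o' ι' h h' hEw
  have hC : (C (ι 1) * C (o 0) - C (o 1) * C (ι 0) : MvPolynomial (Fin 4) ℝ) = 1 := by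
    rw [← C_mul, ← C_mul, ← C_sub, ← C_1, ← h, eps, mul_comm]
  have hC' : (C (ι' 1) * C (o' 0) - C (o' 1) * C (ι' 0) : MvPolynomial (Fin 4) ℝ) = 1 := by
    rw [← C_mul, ← C_mul, ← C_sub, ← C_1, ← h', eps, mul_comm]
  have hCC : ((C (ι 1) * C (o 0) - C (o 1) * C (ι 0)) * (C (ι' 1) * C (o' 0) - C (o' 1) * C (ι' 0)) :
      MvPolynomial (Fin 4) ℝ) = 1 := by rw [hC, hC', one_mul]
  have hsum := ricciSpinor_eq_sum hE hM
  have hdn : ∀ (α α' : Fin 2 → ℝ) (A A' : Fin 2), s22 (dyad (Pi.single A 1) (Pi.single A' 1)) (-dyad α α') =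
      -(low α A * low α' A') := fun α α' A A' => by rw [s22_neg_right, s22_single_dyad]
  obtain ⟨S, hS⟩ : ∃ S : Fin 4 → Fin 2 → Fin 2 → ℝ, ∀ i A A',
      s22 (dyad (Pi.single A 1) (Pi.single A' 1)) (E i) = S i A A' := ⟨_, fun _ _ _ => rfl⟩
  simp only [hS] at hsum
  have hw := fun w hw => ricciPolyIn_eq_sum hsum o ι o' ι' (w := w) hw
  subst hEw
  cases κ
  · have hS' : S = wittSpinor (low o) (low ι) (low o') (low ι') := by
      ext i A A'
      rw [← hS]
      fin_cases i <;> simp [wittOf, wittSpinor, s22_single_dyad, hdn]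
    subst hS'
    refine ⟨fun A B A' B' => by rw [hsum, hF]; rfl, ?_⟩
    rw [hw (wittForm (X 0) (X 1) (X 2) (X 3)), hp]
    · rfl
    intro i
    fin_cases i <;> simp [wittSpinor, wittForm, low, Fin.sum_univ_two]
    · linear_combination (X 1 * X 3) * hCC
    · linear_combination -(X 0 * X 3) * hCC
    · linear_combination (X 0 * X 2) * hCC
    · linear_combination (X 1 * X 2) * hCC
  · have hS' : S = wittSpinor (low ι) (low o) (low ι') (low o') := by
      ext i A A'
      rw [← hS]
      fin_cases i <;> simp [wittOf, wittSpinor, s22_single_dyad, hdn]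
    subst hS'
    refine ⟨fun A B A' B' => by rw [hsum, hF]; rfl, ?_⟩
    rw [hw (wittForm (-X 1) (-X 0) (-X 3) (-X 2)), hp]
    · rfl
    intro i
    fin_cases i <;> simp [wittSpinor, wittForm, low, Fin.sum_univ_two]
    · linear_combination (X 0 * X 2) * hCC
    · linear_combination -(X 1 * X 2) * hCC
    · linear_combination (X 1 * X 3) * hCC
    · linear_combination (X 0 * X 3) * hCC
  · have hS' : S = fun i A A' => wittSpinor (low o') (low ι') (low o) (low ι) i A' A := by
      ext i A A'
      rw [← hS]
      fin_cases i <;> simp [wittOf, wittSpinor, s22_single_dyad, hdn, mul_comm]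
    subst hS'
    refine ⟨fun A B A' B' => by rw [hsum, hF]; rfl, ?_⟩
    rw [hw (wittForm (X 2) (X 3) (X 0) (X 1)), hp]
    · rfl
    intro i
    fin_cases i <;> simp [wittSpinor, wittForm, low, Fin.sum_univ_two]
    · linear_combination (X 1 * X 3) * hCC
    · linear_combination -(X 1 * X 2) * hCC
    · linear_combination (X 0 * X 2) * hCC
    · linear_combination (X 0 * X 3) * hCC
  · have hS' : S = fun i A A' => wittSpinor (low ι') (low o') (low ι) (low o) i A' A := by
      ext i A A'
      rw [← hS]
      fin_cases i <;> simp [wittOf, wittSpinor, s22_single_dyad, hdn, mul_comm]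
    subst hS'
    refine ⟨fun A B A' B' => by rw [hsum, hF]; rfl, ?_⟩
    rw [hw (wittForm (-X 3) (-X 2) (-X 1) (-X 0)), hp]
    · rfl
    intro i
    fin_cases i <;> simp [wittSpinor, wittForm, low, Fin.sum_univ_two]
    · linear_combination (X 0 * X 2) * hCC
    · linear_combination -(X 0 * X 3) * hCC
    · linear_combination (X 1 * X 3) * hCC
    · linear_combination (X 1 * X 2) * hCC

end RicciSpinor

end NeutralRicci

namespace NeutralRicci

open MvPolynomial

/-! ### Null vectors and spin frames -/

section Dyad

variable {K : Type*} [RCLike K]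

lemma dyad_smul_left (a : K) (α α' : Fin 2 → K) : dyad (a • α) α' = a • dyad α α' := by
  ext i; fin_cases i <;> simp [dyad] <;> ring

lemma dyad_smul_right (a : K) (α α' : Fin 2 → K) : dyad α (a • α') = a • dyad α α' := by
  ext i; fin_cases i <;> simp [dyad] <;> ring

lemma dyad_neg_left (α α' : Fin 2 → K) : dyad (-α) α' = -dyad α α' := by
  ext i; fin_cases i <;> simp [dyad] <;> ring

lemma dyad_neg_right (α α' : Fin 2 → K) : dyad α (-α') = -dyad α α' := by
  ext i; fin_cases i <;> simp [dyad] <;> ring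

lemma dyad_add_left (α β α' : Fin 2 → K) : dyad (α + β) α' = dyad α α' + dyad β α' := by
  ext i; fin_cases i <;> simp [dyad] <;> ring

lemma dyad_add_right (α α' β' : Fin 2 → K) : dyad α (α' + β') = dyad α α' + dyad α β' := by
  ext i; fin_cases i <;> simp [dyad] <;> ring

lemma eps_self (α : Fin 2 → K) : eps α α = 0 := by simp [eps]; ring

lemma eps_swap (α β : Fin 2 → K) : eps α β = -eps β α := by simp only [eps]; ring

lemma eps_smul_left (a : K) (α β : Fin 2 → K) : eps (a • α) β = a * eps α β := by simp [eps]; ring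

lemma eps_smul_right (a : K) (α β : Fin 2 → K) : eps α (a • β) = a * eps α β := by simp [eps]; ring

lemma eps_add_right (α β γ : Fin 2 → K) : eps α (β + γ) = eps α β + eps α γ := by simp [eps]; ring

lemma eps_add_left (α β γ : Fin 2 → K) : eps (α + β) γ = eps α γ + eps β γ := by simp [eps]; ring

lemma eps_neg_left (α β : Fin 2 → K) : eps (-α) β = -eps α β := by simp [eps]; ring

lemma eps_neg_right (α β : Fin 2 → K) : eps α (-β) = -eps α β := by simp [eps]; ring

lemma exists_eps_eq_one {α : Fin 2 → K} (h : α ≠ 0) : ∃ β, eps α β = 1 := by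
  by_cases h0 : α 0 = 0
  · have h1 : α 1 ≠ 0 := fun h1 => h (by ext i; fin_cases i <;> assumption)
    exact ⟨![-(α 1)⁻¹, 0], by simp [eps, h1]⟩
  · exact ⟨![0, (α 0)⁻¹], by simp [eps, h0]⟩

lemma ne_zero_of_eps {α β : Fin 2 → K} (h : eps α β ≠ 0) : α ≠ 0 := by
  rintro rfl; simp [eps] at h

/-- Expansion of a spinor in a basis. -/
lemma spinor_expand {α β : Fin 2 → K} (h : eps α β ≠ 0) (ξ : Fin 2 → K) :
    ξ = (eps ξ β / eps α β) • α + (eps α ξ / eps α β) • β := by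
  ext i
  have h' : α 0 * β 1 - α 1 * β 0 ≠ 0 := h
  fin_cases i <;>
    simp only [eps, Pi.add_apply, Pi.smul_apply, smul_eq_mul, Fin.zero_eta, Fin.mk_one] <;>
    rw [div_mul_eq_mul_div, div_mul_eq_mul_div, ← add_div, eq_div_iff h'] <;> ring

lemma mem_span_of_eps_eq_zero {α β : Fin 2 → K} (hα : α ≠ 0) (h : eps α β = 0) : ∃ c : K, β = c • α := by
  obtain ⟨γ, hγ⟩ := exists_eps_eq_one hα
  have := spinor_expand (hγ ▸ one_ne_zero) β
  rw [h, hγ] at this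
  exact ⟨eps β γ / 1, by simpa using this⟩

/-- The null vectors are the rank one spinors. -/
lemma exists_eq_dyad {w : Fin 4 → K} (hw : s22 w w = 0) : ∃ α α', w = dyad α α' := by
  have h2 := sqrt_two_inv_sq (K := K)
  set c : K := (((√2 : ℝ) : K))⁻¹
  have hdet : (w 0 + w 2) * (w 0 - w 2) = (w 3 - w 1) * (w 3 + w 1) := by
    simp only [s22] at hw
    linear_combination hw
  have mk : ∀ t, w 3 + w 1 = t * (w 0 + w 2) → w 0 - w 2 = t * (w 3 - w 1) → ∃ α α', w = dyad α α' := by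
    intro t h3 h4
    refine ⟨![1, t], ![c * (w 0 + w 2), c * (w 3 - w 1)], ?_⟩
    ext i
    fin_cases i <;> simp [dyad]
    · linear_combination (-(w 0 + w 2) - t * (w 3 - w 1)) * h2 + 1 / 2 * h4
    · linear_combination (-t * (w 0 + w 2) + (w 3 - w 1)) * h2 + 1 / 2 * h3
    · linear_combination (-(w 0 + w 2) + t * (w 3 - w 1)) * h2 - 1 / 2 * h4
    · linear_combination (-t * (w 0 + w 2) - (w 3 - w 1)) * h2 + 1 / 2 * h3
  by_cases h0 : w 0 + w 2 = 0
  · by_cases h1 : w 3 - w 1 = 0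
    · refine ⟨![0, 1], ![c * (w 3 + w 1), c * (w 0 - w 2)], ?_⟩
      ext i
      fin_cases i <;> simp [dyad]
      · linear_combination (-(w 0 - w 2)) * h2 + 1 / 2 * h0
      · linear_combination (-(w 3 + w 1)) * h2 - 1 / 2 * h1
      · linear_combination ((w 0 - w 2)) * h2 + 1 / 2 * h0
      · linear_combination (-(w 3 + w 1)) * h2 + 1 / 2 * h1
    · refine mk ((w 0 - w 2) / (w 3 - w 1)) ?_ ?_
      · rw [h0, zero_mul] at hdet
        rw [h0, mul_zero]
        exact (mul_eq_zero.mp hdet.symm).resolve_left h1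
      · field_simp
  · refine mk ((w 3 + w 1) / (w 0 + w 2)) ?_ ?_
    · field_simp
    · field_simp
      linear_combination hdet

lemma dyad_ne_zero {α α' : Fin 2 → K} (h : α ≠ 0) (h' : α' ≠ 0) : dyad α α' ≠ 0 := by
  obtain ⟨β, hβ⟩ := exists_eps_eq_one h
  obtain ⟨β', hβ'⟩ := exists_eps_eq_one h'
  intro h0
  have := s22_dyad α α' β β'
  simp [h0, hβ, hβ', s22] at this

lemma s22_dyad_self (α α' : Fin 2 → K) : s22 (dyad α α') (dyad α α') = 0 := by
  rw [s22_dyad, eps_self, zero_mul]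

lemma ne_zero_of_dyad {α α' : Fin 2 → K} (h : dyad α α' ≠ 0) : α ≠ 0 ∧ α' ≠ 0 := by
  constructor
  · rintro rfl; exact h (by ext i; fin_cases i <;> simp [dyad])
  · rintro rfl; exact h (by ext i; fin_cases i <;> simp [dyad])

/-- Expansion of a vector in the Witt basis of a pair of spin frames. -/
lemma dyad_expand {α β α' β' : Fin 2 → K} (h : eps α β = 1) (h' : eps α' β' = 1) (w : Fin 4 → K) :
    w = s22 (dyad β β') w • dyad α α' - s22 (dyad α β') w • dyad β α' + s22 (dyad α α') w • dyad β β'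
      - s22 (dyad β α') w • dyad α β' := by
  obtain ⟨-, -, hw⟩ := exists_basis_of_dual (E := ![dyad α α', dyad β α', dyad β β', dyad α β'])
    (F := ![dyad β β', -dyad α β', dyad α α', -dyad β α']) (by
      have k : eps β α = -1 := by rw [eps_swap, h]
      have k' : eps β' α' = -1 := by rw [eps_swap, h']
      intro i j
      fin_cases i <;> fin_cases j <;> simp [s22_neg_left, s22_dyad, eps_self, h, h', k, k'])
  conv_lhs => rw [hw w]
  simp [Fin.sum_univ_four, s22_neg_left]
  module

lemma dyad_mem_span_iff {α α' β β' : Fin 2 → K} (hα : α ≠ 0) (hα' : α' ≠ 0) :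
    dyad β β' ∈ Submodule.span K {dyad α α'} → (β ≠ 0 → β' ≠ 0 →
      (∃ c : K, c ≠ 0 ∧ β = c • α) ∧ ∃ c : K, c ≠ 0 ∧ β' = c • α') := by
  intro hm hβ hβ'
  obtain ⟨k, hk⟩ := Submodule.mem_span_singleton.mp hm
  constructor
  · obtain ⟨γ', hγ'⟩ := exists_eps_eq_one hβ'
    have e := s22_dyad β β' α γ'
    rw [← hk, s22_smul_left, s22_dyad, eps_self, zero_mul, mul_zero, hγ', mul_one] at e
    obtain ⟨c, rfl⟩ := mem_span_of_eps_eq_zero hα (β := β) (by rw [eps_swap, ← e, neg_zero])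
    exact ⟨c, fun hc => hβ (by rw [hc, zero_smul]), rfl⟩
  · obtain ⟨γ, hγ⟩ := exists_eps_eq_one hβ
    have e := s22_dyad β β' γ α'
    rw [← hk, s22_smul_left, s22_dyad, eps_self, mul_zero, mul_zero, hγ, one_mul] at e
    obtain ⟨c, rfl⟩ := mem_span_of_eps_eq_zero hα' (β := β') (by rw [eps_swap, ← e, neg_zero])
    exact ⟨c, fun hc => hβ' (by rw [hc, zero_smul]), rfl⟩

end Dyad

/-! ### Witt bases and O-types -/

lemma null_orthogonal {o ι o' ι' : Fin 2 → ℝ} (h : eps o ι = 1) (h' : eps o' ι' = 1) {w : Fin 4 → ℝ}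
    (hw : s22 w w = 0) (h0 : s22 (dyad o o') w = 0) (h2 : s22 (dyad ι ι') w = 0) :
    (∃ r : ℝ, w = r • dyad ι o') ∨ ∃ r : ℝ, w = r • dyad o ι' := by
  have he := dyad_expand h h' w
  rw [h0, h2] at he
  have k : eps ι o = -1 := by rw [eps_swap, h]
  have hz : s22 w w = 2 * (s22 (dyad o ι') w * s22 (dyad ι o') w) * -1 := by
    conv_lhs => rw [he]
    simp only [sub_eq_add_neg, s22_add_left, s22_add_right, s22_neg_left, s22_neg_right, s22_smul_left,
      s22_smul_right, s22_dyad, eps_self, h, h', k, eps_swap ι' o']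
    simp [s22]
    ring
  rw [hw] at hz
  have : s22 (dyad o ι') w = 0 ∨ s22 (dyad ι o') w = 0 := by
    rw [← mul_eq_zero]; linarith
  rcases this with h1 | h1
  · exact Or.inr ⟨-s22 (dyad ι o') w, by rw [h1] at he; simpa using he⟩
  · exact Or.inl ⟨-s22 (dyad o ι') w, by rw [h1] at he; simpa using he⟩

lemma IsWitt.exists_wittOf {E : Fin 4 → Fin 4 → ℝ} (hE : IsWitt E) :
    ∃ κ o ι o' ι', eps o ι = 1 ∧ eps o' ι' = 1 ∧ E = wittOf κ o ι o' ι' := by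
  have g : ∀ i j, s22 (E i) (E j) = if i = j + 2 then 1 else 0 := hE
  obtain ⟨o, o', h0⟩ := exists_eq_dyad (w := E 0) (by rw [g]; rfl)
  obtain ⟨β, β', h2⟩ := exists_eq_dyad (w := E 2) (by rw [g]; rfl)
  have h02 : eps o β * eps o' β' = 1 := by rw [← s22_dyad, ← h0, ← h2, g]; rfl
  have hk : eps o β ≠ 0 := left_ne_zero_of_mul_eq_one h02
  set ι := (eps o β)⁻¹ • β with hι
  set ι' := eps o β • β' with hι'
  have e : eps o ι = 1 := by rw [hι, eps_smul_right, inv_mul_cancel₀ hk]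
  have e' : eps o' ι' = 1 := by rw [hι', eps_smul_right, h02]
  have h2' : E 2 = dyad ι ι' := by
    rw [h2, hι, hι', dyad_smul_left, dyad_smul_right, smul_smul, inv_mul_cancel₀ hk, one_smul]
  clear_value ι ι'
  have k : eps ι o = -1 := by rw [eps_swap, e]
  have k' : eps ι' o' = -1 := by rw [eps_swap, e']
  have hEeq : E = ![E 0, E 1, E 2, E 3] := by ext i; fin_cases i <;> rfl
  have g13 : s22 (E 1) (E 3) = 1 := by rw [g]; rfl
  have c1 := null_orthogonal e e' (w := E 1) (by rw [g]; rfl) (by rw [← h0, g]; rfl) (by rw [← h2', g]; rfl)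
  have c3 := null_orthogonal e e' (w := E 3) (by rw [g]; rfl) (by rw [← h0, g]; rfl) (by rw [← h2', g]; rfl)
  -- the factor `r` is normalized to `±1` by rescaling the spin frames
  have scale : ∀ r : ℝ, r ≠ 0 → ∃ a : ℝ, a ≠ 0 ∧ (r = a * a ∨ r = -(a * a)) := by
    intro r hr
    refine ⟨√|r|, by simpa using hr, ?_⟩
    rw [Real.mul_self_sqrt (abs_nonneg r)]
    exact eq_or_eq_neg_of_abs_eq rfl
  have sm : ∀ (x y : ℝ) (γ γ' : Fin 2 → ℝ), dyad (x • γ) (y • γ') = (x * y) • dyad γ γ' := fun x y γ γ' => by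
    rw [dyad_smul_left, dyad_smul_right, smul_smul]
  rcases c1 with ⟨r, h1⟩ | ⟨r, h1⟩ <;> rcases c3 with ⟨r', h3⟩ | ⟨r', h3⟩ <;>
    rw [h1, h3, s22_smul_left, s22_smul_right, s22_dyad] at g13 <;> simp [eps_self, e, e', k, k'] at g13
  · have hr : r ≠ 0 := by rintro rfl; simp at g13
    obtain ⟨a, ha, har⟩ := scale r hr
    have hr' : r' = -r⁻¹ := by field_simp; linarith
    rcases har with rfl | rfl
    · refine ⟨.pp, a⁻¹ • o, a • ι, a • o', a⁻¹ • ι', ?_, ?_, ?_⟩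
      · simp [eps_smul_left, eps_smul_right, e, ha]
      · simp [eps_smul_left, eps_smul_right, e', ha]
      · rw [hEeq, h0, h1, h2', h3, hr']
        simp [wittOf, sm, ha]
    · refine ⟨.mm, -(a • ι), a⁻¹ • o, -(a⁻¹ • ι'), a • o', ?_, ?_, ?_⟩
      · simp [eps_smul_left, eps_smul_right, eps_neg_left, k, ha]
      · simp [eps_smul_left, eps_smul_right, eps_neg_left, k', ha]
      · rw [hEeq, h0, h1, h2', h3, hr']
        simp [wittOf, sm, ha, dyad_neg_left, dyad_neg_right]
  · have hr : r ≠ 0 := by rintro rfl; simp at g13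
    obtain ⟨a, ha, har⟩ := scale r hr
    have hr' : r' = -r⁻¹ := by field_simp; linarith
    rcases har with rfl | rfl
    · refine ⟨.mp, a • o, a⁻¹ • ι, a⁻¹ • o', a • ι', ?_, ?_, ?_⟩
      · simp [eps_smul_left, eps_smul_right, e, ha]
      · simp [eps_smul_left, eps_smul_right, e', ha]
      · rw [hEeq, h0, h1, h2', h3, hr']
        simp [wittOf, sm, ha]
    · refine ⟨.pm, -(a⁻¹ • ι), a • o, -(a • ι'), a⁻¹ • o', ?_, ?_, ?_⟩
      · simp [eps_smul_left, eps_smul_right, eps_neg_left, k, ha]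
      · simp [eps_smul_left, eps_smul_right, eps_neg_left, k', ha]
      · rw [hEeq, h0, h1, h2', h3, hr']
        simp [wittOf, sm, ha, dyad_neg_left, dyad_neg_right]

lemma hasOType_wittOf (κ : OType) {o ι o' ι' : Fin 2 → ℝ} (h : eps o ι = 1) (h' : eps o' ι' = 1) :
    HasOType (toPsiON (wittOf κ o ι o' ι')) κ := by
  have h2 := sqrt_two_inv_sq (K := ℝ)
  simp only [RCLike.ofReal_real_eq_id, id] at h2
  have h4 : (√2)⁻¹ ^ 4 = (1 / 4 : ℝ) := by
    rw [show (√2)⁻¹ ^ 4 = ((√2)⁻¹ * (√2)⁻¹) * ((√2)⁻¹ * (√2)⁻¹) by ring, h2]; norm_num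
  simp only [eps] at h h'
  -- both determinants are, up to sign, a quarter of the sum of the squared norms of the four spinors
  have hpos : 0 < 1 / 4 * (o 0 ^ 2 + o 1 ^ 2 + ι 0 ^ 2 + ι 1 ^ 2 + o' 0 ^ 2 + o' 1 ^ 2 + ι' 0 ^ 2 + ι' 1 ^ 2) := by
    have : o 0 ≠ 0 ∨ o 1 ≠ 0 := by
      by_contra! hc
      simp [hc.1, hc.2] at h
    rcases this with hc | hc <;> positivity
  generalize hN : 1 / 4 * (o 0 ^ 2 + o 1 ^ 2 + ι 0 ^ 2 + ι 1 ^ 2 + o' 0 ^ 2 + o' 1 ^ 2 + ι' 0 ^ 2 + ι' 1 ^ 2) = N at hpos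
  have hpos' : -N < 0 := by linarith
  cases κ <;> simp only [HasOType, toPsiON, wittOf] <;> constructor
  all_goals first | refine lt_of_lt_of_eq hpos ?_ | refine lt_of_eq_of_lt ?_ hpos'
  all_goals
    rw [← hN]
    simp [dyad]
    generalize (√2)⁻¹ = r at h4
    linear_combination (-(o 0 ^ 2 + o 1 ^ 2 + ι 0 ^ 2 + ι 1 ^ 2 + o' 0 ^ 2 + o' 1 ^ 2 + ι' 0 ^ 2 + ι' 1 ^ 2)) * h4
      - r ^ 4 * (o' 0 ^ 2 + o' 1 ^ 2 + ι' 0 ^ 2 + ι' 1 ^ 2) * h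
      - r ^ 4 * (o 0 ^ 2 + o 1 ^ 2 + ι 0 ^ 2 + ι 1 ^ 2) * h'

lemma HasOType.unique {B : Fin 4 → Fin 4 → ℝ} {κ κ' : OType} (h : HasOType B κ) (h' : HasOType B κ') : κ = κ' := by
  cases κ <;> cases κ' <;> simp only [HasOType] at h h' <;> first | rfl | (exfalso; linarith [h.1, h.2, h'.1, h'.2])

lemma IsWitt.existsUnique_oType {E : Fin 4 → Fin 4 → ℝ} (hE : IsWitt E) : ∃! κ, HasOType (toPsiON E) κ := by
  obtain ⟨κ, o, ι, o', ι', h, h', rfl⟩ := hE.exists_wittOf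
  exact ⟨κ, hasOType_wittOf κ h h', fun κ' hκ' => hκ'.unique (hasOType_wittOf κ h h')⟩

lemma IsWitt.hasOType_iff {E : Fin 4 → Fin 4 → ℝ} (hE : IsWitt E) (κ : OType) : HasOType (toPsiON E) κ ↔
    ∃ o ι o' ι', eps o ι = 1 ∧ eps o' ι' = 1 ∧ E = wittOf κ o ι o' ι' := by
  constructor
  · intro hκ
    obtain ⟨κ', o, ι, o', ι', h, h', rfl⟩ := hE.exists_wittOf
    obtain rfl := hκ.unique (hasOType_wittOf κ' h h')
    exact ⟨o, ι, o', ι', h, h', rfl⟩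
  · rintro ⟨o, ι, o', ι', h, h', rfl⟩
    exact hasOType_wittOf κ h h'

/-! ### Restriction to lines of a chart, singular points and null eigenvectors -/

lemma exists_adaptedFrame {Q : Pt} {μ η : Fin 2 → ℂ} (hμ : Q.1.submodule = Submodule.span ℂ {μ})
    (hη : Q.2.submodule = Submodule.span ℂ {η}) : ∃ f : AdaptedFrame Q, f.μ = μ ∧ f.η = η := by
  have h0 : ∀ (P : Projectivization ℂ (Fin 2 → ℂ)) (μ : Fin 2 → ℂ), P.submodule = Submodule.span ℂ {μ} → μ ≠ 0 := by
    rintro P _ h rfl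
    have := P.finrank_submodule
    rw [h, Submodule.span_zero_singleton, finrank_bot] at this
    exact zero_ne_one this
  obtain ⟨ν, hν⟩ := exists_eps_eq_one (h0 _ _ hμ)
  obtain ⟨θ, hθ⟩ := exists_eps_eq_one (h0 _ _ hη)
  exact ⟨⟨μ, ν, η, θ, hν, hθ, hμ, hη⟩, rfl, rfl⟩

/-- The restriction `F(t)` of `q` to a line of the affine chart. -/
noncomputable def lineVal (q : MvPolynomial (Fin 4) ℂ) {Q : Pt} (f : AdaptedFrame Q) (σ τ t : ℂ) : ℂ :=
  eval ![f.μ 0 + σ * t * f.ν 0, f.μ 1 + σ * t * f.ν 1, f.η 0 + τ * t * f.θ 0, f.η 1 + τ * t * f.θ 1] q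

lemma eval_linePoly (q : MvPolynomial (Fin 4) ℂ) {Q : Pt} (f : AdaptedFrame Q) (σ τ t : ℂ) :
    Polynomial.eval t (MvPolynomial.aeval
      ![Polynomial.C (f.μ 0) + Polynomial.C (σ * f.ν 0) * Polynomial.X,
        Polynomial.C (f.μ 1) + Polynomial.C (σ * f.ν 1) * Polynomial.X,
        Polynomial.C (f.η 0) + Polynomial.C (τ * f.θ 0) * Polynomial.X,
        Polynomial.C (f.η 1) + Polynomial.C (τ * f.θ 1) * Polynomial.X] q : Polynomial ℂ) = lineVal q f σ τ t := by
  rw [lineVal]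
  induction q using MvPolynomial.induction_on with
  | C c => simp
  | add p₁ p₂ h₁ h₂ => rw [map_add, map_add, Polynomial.eval_add, h₁, h₂]
  | mul_X p i hp =>
    rw [map_mul (MvPolynomial.aeval _), Polynomial.eval_mul, hp, map_mul (eval _), aeval_X, eval_X]
    congr 1
    fin_cases i <;> simp <;> ring

lemma lineCoeff_of_lineVal {q : MvPolynomial (Fin 4) ℂ} {Q : Pt} {f : AdaptedFrame Q} {σ τ : ℂ}
    (p : Polynomial ℂ) (h : ∀ t, lineVal q f σ τ t = p.eval t) (n : ℕ) : lineCoeff q f σ τ n = p.coeff n := by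
  rw [lineCoeff]
  congr 1
  exact Polynomial.funext fun t => by rw [← h, eval_linePoly]

lemma lineCoeff_of_quartic {q : MvPolynomial (Fin 4) ℂ} {Q : Pt} {f : AdaptedFrame Q} {σ τ : ℂ}
    (k₀ k₁ k₂ k₃ k₄ : ℂ)
    (h : ∀ t, lineVal q f σ τ t = k₀ + k₁ * t + k₂ * t ^ 2 + k₃ * t ^ 3 + k₄ * t ^ 4) :
    lineCoeff q f σ τ 0 = k₀ ∧ lineCoeff q f σ τ 1 = k₁ ∧ lineCoeff q f σ τ 2 = k₂ ∧ lineCoeff q f σ τ 3 = k₃ := by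
  have hp := lineCoeff_of_lineVal (q := q) (f := f) (σ := σ) (τ := τ)
    (Polynomial.C k₀ + Polynomial.C k₁ * Polynomial.X + Polynomial.C k₂ * Polynomial.X ^ 2 +
      Polynomial.C k₃ * Polynomial.X ^ 3 + Polynomial.C k₄ * Polynomial.X ^ 4) (fun t => by rw [h]; simp)
  refine ⟨?_, ?_, ?_, ?_⟩ <;> rw [hp] <;>
    simp [Polynomial.coeff_X, Polynomial.coeff_C]

lemma lineCoeff_zero (q : MvPolynomial (Fin 4) ℂ) {Q : Pt} (f : AdaptedFrame Q) (σ τ : ℂ) :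
    lineCoeff q f σ τ 0 = eval ![f.μ 0, f.μ 1, f.η 0, f.η 1] q := by
  rw [lineCoeff, Polynomial.coeff_zero_eq_eval_zero, eval_linePoly, lineVal]
  simp

lemma lineCoeff_mul (p q : MvPolynomial (Fin 4) ℂ) {Q : Pt} (f : AdaptedFrame Q) (σ τ : ℂ) (n : ℕ) :
    lineCoeff (p * q) f σ τ n =
      ∑ ij ∈ Finset.HasAntidiagonal.antidiagonal n, lineCoeff p f σ τ ij.1 * lineCoeff q f σ τ ij.2 := by
  simp only [lineCoeff, map_mul, Polynomial.coeff_mul]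

section Singular

variable {Φ : (Fin 4 → ℝ) →ₗ[ℝ] (Fin 4 → ℝ)}

lemma complexify_selfAdjoint (hsa : ∀ u v, s22 (Φ u) v = s22 u (Φ v)) (u v : Fin 4 → ℂ) :
    s22 (complexify Φ u) v = s22 u (complexify Φ v) := by
  have hdec : ∀ w : Fin 4 → ℂ, w = cvec (fun i => (w i).re) + Complex.I • cvec (fun i => (w i).im) := by
    intro w
    ext i
    simp [cvec, mul_comm Complex.I, Complex.re_add_im]
  rw [hdec u, hdec v]
  simp only [map_add, map_smul, complexify_cvec, s22_add_left, s22_add_right, s22_smul_left, s22_smul_right,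
    s22_cvec, hsa]

/-- The derivatives of `s(w, Φ w)` at a null vector `w` along the null cone vanish if and only if `Φ w` is orthogonal
to the tangent space `w^⊥` of the cone, that is, a multiple of `w`. -/
lemma mem_singularSet_iff (hsa : ∀ u v, s22 (Φ u) v = s22 u (Φ v)) {Q : Pt} {μ η : Fin 2 → ℂ}
    (hμ : Q.1.submodule = Submodule.span ℂ {μ}) (hη : Q.2.submodule = Submodule.span ℂ {η}) :
    Q ∈ singularSet (ricciPolyC Φ) ↔ ∃ χ : ℂ, complexify Φ (dyad μ η) = χ • dyad μ η := by
  have key : ∀ (f : AdaptedFrame Q) (σ τ : ℂ),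
      lineCoeff (ricciPolyC Φ) f σ τ 0 = s22 (dyad f.μ f.η) (complexify Φ (dyad f.μ f.η)) ∧
      lineCoeff (ricciPolyC Φ) f σ τ 1 = 2 * (σ * s22 (dyad f.ν f.η) (complexify Φ (dyad f.μ f.η)) +
        τ * s22 (dyad f.μ f.θ) (complexify Φ (dyad f.μ f.η))) := by
    intro f σ τ
    have hl : ∀ t, lineVal (ricciPolyC Φ) f σ τ t = s22 (dyad (f.μ + (σ * t) • f.ν) (f.η + (τ * t) • f.θ))
        (complexify Φ (dyad (f.μ + (σ * t) • f.ν) (f.η + (τ * t) • f.θ))) := by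
      intro t
      rw [lineVal, eval_ricciPolyC]
      congr 3 <;> ext i <;> fin_cases i <;> simp
    have sym := fun u v => (complexify_selfAdjoint hsa u v).symm.trans (s22_comm _ _)
    have hq := lineCoeff_of_quartic (q := ricciPolyC Φ) (f := f) (σ := σ) (τ := τ)
      (s22 (dyad f.μ f.η) (complexify Φ (dyad f.μ f.η)))
      (2 * (σ * s22 (dyad f.ν f.η) (complexify Φ (dyad f.μ f.η)) +
        τ * s22 (dyad f.μ f.θ) (complexify Φ (dyad f.μ f.η))))
      (2 * σ * τ * s22 (dyad f.ν f.θ) (complexify Φ (dyad f.μ f.η)) +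
        σ ^ 2 * s22 (dyad f.ν f.η) (complexify Φ (dyad f.ν f.η)) +
        2 * σ * τ * s22 (dyad f.ν f.η) (complexify Φ (dyad f.μ f.θ)) +
        τ ^ 2 * s22 (dyad f.μ f.θ) (complexify Φ (dyad f.μ f.θ)))
      (2 * σ * τ * (σ * s22 (dyad f.ν f.η) (complexify Φ (dyad f.ν f.θ)) +
        τ * s22 (dyad f.μ f.θ) (complexify Φ (dyad f.ν f.θ))))
      (σ ^ 2 * τ ^ 2 * s22 (dyad f.ν f.θ) (complexify Φ (dyad f.ν f.θ))) (by
        intro t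
        rw [hl]
        simp only [dyad_add_left, dyad_add_right, dyad_smul_left, dyad_smul_right, map_add, map_smul, s22_add_left,
          s22_add_right, s22_smul_left, s22_smul_right]
        linear_combination (σ * t) * sym (dyad f.μ f.η) (dyad f.ν f.η) +
          (τ * t) * sym (dyad f.μ f.η) (dyad f.μ f.θ) +
          (σ * t * (τ * t)) * sym (dyad f.μ f.η) (dyad f.ν f.θ) +
          (σ * t * (τ * t)) * sym (dyad f.μ f.θ) (dyad f.ν f.η) +
          (σ * t * (σ * t) * (τ * t)) * sym (dyad f.ν f.θ) (dyad f.ν f.η) +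
          (σ * t * (τ * t) * (τ * t)) * sym (dyad f.ν f.θ) (dyad f.μ f.θ))
    exact ⟨hq.1, hq.2.1⟩
  constructor
  · intro hQ
    obtain ⟨f, rfl, rfl⟩ := exists_adaptedFrame hμ hη
    have h0 := (hQ f 0 0).1
    have h1 := (hQ f 1 0).2
    have h2 := (hQ f 0 1).2
    rw [(key f 0 0).1] at h0
    rw [(key f 1 0).2] at h1
    rw [(key f 0 1).2] at h2
    simp at h1 h2
    refine ⟨s22 (dyad f.ν f.θ) (complexify Φ (dyad f.μ f.η)), ?_⟩
    conv_lhs => rw [dyad_expand f.eps_μν f.eps_ηθ (complexify Φ (dyad f.μ f.η)), h0, h1, h2]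
    simp
  · rintro ⟨χ, hχ⟩ f σ τ
    have hw : ∃ c : ℂ, dyad f.μ f.η = c • dyad μ η := by
      have m1 : f.μ ∈ Submodule.span ℂ {μ} := by rw [← hμ, f.span_μ]; exact Submodule.mem_span_singleton_self _
      have m2 : f.η ∈ Submodule.span ℂ {η} := by rw [← hη, f.span_η]; exact Submodule.mem_span_singleton_self _
      obtain ⟨a, ha⟩ := Submodule.mem_span_singleton.mp m1
      obtain ⟨b, hb⟩ := Submodule.mem_span_singleton.mp m2
      exact ⟨a * b, by rw [← ha, ← hb, dyad_smul_left, dyad_smul_right, smul_smul]⟩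
    have hχ' : complexify Φ (dyad f.μ f.η) = χ • dyad f.μ f.η := by
      obtain ⟨c, hc⟩ := hw
      rw [hc, map_smul, hχ, smul_comm]
    rw [(key f σ τ).1, (key f σ τ).2, hχ']
    simp only [s22_smul_right, s22_dyad, eps_self]
    simp

lemma mem_pts_iff {W : Submodule ℂ (Fin 4 → ℂ)} {Q : Pt} {μ η : Fin 2 → ℂ}
    (hμ : Q.1.submodule = Submodule.span ℂ {μ}) (hη : Q.2.submodule = Submodule.span ℂ {η}) :
    Q ∈ pts W ↔ dyad μ η ∈ W := by
  constructor
  · intro h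
    exact h μ (by rw [hμ]; exact Submodule.mem_span_singleton_self _) η
      (by rw [hη]; exact Submodule.mem_span_singleton_self _)
  · intro h μ' hμ' η' hη'
    rw [hμ] at hμ'
    rw [hη] at hη'
    obtain ⟨a, rfl⟩ := Submodule.mem_span_singleton.mp hμ'
    obtain ⟨b, rfl⟩ := Submodule.mem_span_singleton.mp hη'
    rw [dyad_smul_left, dyad_smul_right]
    exact W.smul_mem _ (W.smul_mem _ h)

lemma exists_point {μ η : Fin 2 → ℂ} (hμ : μ ≠ 0) (hη : η ≠ 0) :
    ∃ Q : Pt, Q.1.submodule = Submodule.span ℂ {μ} ∧ Q.2.submodule = Submodule.span ℂ {η} :=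
  ⟨(Projectivization.mk ℂ μ hμ, Projectivization.mk ℂ η hη), Projectivization.submodule_mk _ _,
    Projectivization.submodule_mk _ _⟩

lemma pt_dyad {Q : Pt} {μ η : Fin 2 → ℂ} (hμ0 : μ ≠ 0) (hη0 : η ≠ 0)
    (hμ : Q.1.submodule = Submodule.span ℂ {μ}) (hη : Q.2.submodule = Submodule.span ℂ {η}) :
    pt (dyad μ η) = {Q} := by
  ext Q'
  rw [Set.mem_singleton_iff, pt, mem_pts_iff (Projectivization.submodule_eq _) (Projectivization.submodule_eq _)]
  constructor
  · intro h
    obtain ⟨⟨a, ha, h1⟩, b, hb, h2⟩ :=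
      dyad_mem_span_iff hμ0 hη0 h (Projectivization.rep_nonzero _) (Projectivization.rep_nonzero _)
    refine Prod.ext (Projectivization.submodule_injective ?_) (Projectivization.submodule_injective ?_)
    · rw [hμ, Projectivization.submodule_eq, h1, Submodule.span_singleton_smul_eq (IsUnit.mk0 a ha)]
    · rw [hη, Projectivization.submodule_eq, h2, Submodule.span_singleton_smul_eq (IsUnit.mk0 b hb)]
  · rintro rfl
    rw [← mem_pts_iff (Projectivization.submodule_eq _) (Projectivization.submodule_eq _), mem_pts_iff hμ hη]
    exact Submodule.mem_span_singleton_self _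

lemma null_direction_point (hsa : ∀ u v, s22 (Φ u) v = s22 u (Φ v)) {w : Fin 4 → ℂ} (hw : w ≠ 0) (hn : s22 w w = 0) :
    ∃ Q, pt w = {Q} ∧ (Q ∈ singularSet (ricciPolyC Φ) ↔ ∃ χ : ℂ, complexify Φ w = χ • w) := by
  obtain ⟨μ, η, rfl⟩ := exists_eq_dyad hn
  obtain ⟨hμ0, hη0⟩ := ne_zero_of_dyad hw
  obtain ⟨Q, hμ, hη⟩ := exists_point hμ0 hη0
  exact ⟨Q, pt_dyad hμ0 hη0 hμ hη, mem_singularSet_iff hsa hμ hη⟩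

lemma point_null_direction (Q : Pt) : ∃ w : Fin 4 → ℂ, w ≠ 0 ∧ s22 w w = 0 ∧ pt w = {Q} :=
  ⟨dyad Q.1.rep Q.2.rep, dyad_ne_zero Q.1.rep_nonzero Q.2.rep_nonzero, s22_dyad_self _ _,
    pt_dyad Q.1.rep_nonzero Q.2.rep_nonzero Q.1.submodule_eq Q.2.submodule_eq⟩

end Singular

end NeutralRicci

namespace NeutralRicci

open MvPolynomial

/-! ### Spinor coordinates -/

lemma eps_cvec (α β : Fin 2 → ℝ) : eps (cvec α) (cvec β) = ((eps α β : ℝ) : ℂ) := by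
  simp [eps, cvec]

/-- A pair of real bases `{α, β}`, `{α', β'}` of spinor space. If `sw` is false, then `{α, β}` consists of unprimed
spinors and `{α', β'}` of primed ones; if `sw` is true, it is the other way round. -/
structure SpinCoord where
  α : Fin 2 → ℝ
  β : Fin 2 → ℝ
  α' : Fin 2 → ℝ
  β' : Fin 2 → ℝ
  ne : eps α β ≠ 0
  ne' : eps α' β' ≠ 0
  sw : Bool

namespace SpinCoord

variable (C : SpinCoord)

/-- The spinor `x α + y β`. -/
noncomputable def fst (m : Fin 2 → ℂ) : Fin 2 → ℂ := m 0 • cvec C.α + m 1 • cvec C.β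

/-- The spinor `u α' + v β'`. -/
noncomputable def snd (h : Fin 2 → ℂ) : Fin 2 → ℂ := h 0 • cvec C.α' + h 1 • cvec C.β'

/-- The unprimed spinor with coordinates `m`, `h`. -/
noncomputable def left (m h : Fin 2 → ℂ) : Fin 2 → ℂ := if C.sw then C.snd h else C.fst m

/-- The primed spinor with coordinates `m`, `h`. -/
noncomputable def right (m h : Fin 2 → ℂ) : Fin 2 → ℂ := if C.sw then C.fst m else C.snd h

/-- The four null vectors formed by the spinors of the two bases; a Witt basis up to a common factor. -/
noncomputable def E : Fin 4 → Fin 4 → ℝ :=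
  if C.sw then ![dyad C.α' C.α, dyad C.α' C.β, dyad C.β' C.β, -dyad C.β' C.α]
  else ![dyad C.α C.α', dyad C.β C.α', dyad C.β C.β', -dyad C.α C.β']

/-- The coefficients of the null vector `(x α + y β)(u α' + v β')` with respect to the basis `C.E`. -/
def nullCoeffs (m h : Fin 2 → ℂ) : Fin 4 → ℂ := ![m 0 * h 0, m 1 * h 0, m 1 * h 1, -(m 0 * h 1)]

/-- The polynomial in the standard spinor components which is given by `q` in the coordinates `x, y, u, v`. -/
noncomputable def push : MvPolynomial (Fin 4) ℂ →ₐ[ℂ] MvPolynomial (Fin 4) ℂ :=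
  let i : Fin 4 := if C.sw then 2 else 0
  let e : ℂ := (eps C.α C.β : ℝ)
  let e' : ℂ := (eps C.α' C.β' : ℝ)
  aeval ![MvPolynomial.C (C.β 1 / e) * X i - MvPolynomial.C (C.β 0 / e) * X (i + 1),
    MvPolynomial.C (C.α 0 / e) * X (i + 1) - MvPolynomial.C (C.α 1 / e) * X i,
    MvPolynomial.C (C.β' 1 / e') * X (i + 2) - MvPolynomial.C (C.β' 0 / e') * X (i + 3),
    MvPolynomial.C (C.α' 0 / e') * X (i + 3) - MvPolynomial.C (C.α' 1 / e') * X (i + 2)]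

/-- The inverse of `push`. -/
noncomputable def pull : MvPolynomial (Fin 4) ℂ →ₐ[ℂ] MvPolynomial (Fin 4) ℂ :=
  let l : Fin 2 → MvPolynomial (Fin 4) ℂ := fun j =>
    MvPolynomial.C (C.α j : ℂ) * X 0 + MvPolynomial.C (C.β j : ℂ) * X 1
  let r : Fin 2 → MvPolynomial (Fin 4) ℂ := fun j =>
    MvPolynomial.C (C.α' j : ℂ) * X 2 + MvPolynomial.C (C.β' j : ℂ) * X 3
  aeval (if C.sw then ![r 0, r 1, l 0, l 1] else ![l 0, l 1, r 0, r 1])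

variable {C}

lemma neC : ((eps C.α C.β : ℝ) : ℂ) ≠ 0 := by exact_mod_cast C.ne

lemma neC' : ((eps C.α' C.β' : ℝ) : ℂ) ≠ 0 := by exact_mod_cast C.ne'

lemma eval_aeval (g : Fin 4 → MvPolynomial (Fin 4) ℂ) (z : Fin 4 → ℂ) (q : MvPolynomial (Fin 4) ℂ) :
    eval z (aeval g q) = eval (fun i => eval z (g i)) q := by
  induction q using MvPolynomial.induction_on with
  | C c => simp
  | add p₁ p₂ h₁ h₂ => rw [map_add, map_add, map_add, h₁, h₂]
  | mul_X p i hp => rw [map_mul, map_mul, map_mul, hp, aeval_X, eval_X]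

/-- The values of `push q` at arbitrary spinors. -/
lemma eval_push_std (q : MvPolynomial (Fin 4) ℂ) (x y u v : ℂ) : eval ![x, y, u, v] (C.push q) =
    if C.sw then eval ![eps ![u, v] (cvec C.β) / (eps C.α C.β : ℝ), eps (cvec C.α) ![u, v] / (eps C.α C.β : ℝ),
      eps ![x, y] (cvec C.β') / (eps C.α' C.β' : ℝ), eps (cvec C.α') ![x, y] / (eps C.α' C.β' : ℝ)] q
    else eval ![eps ![x, y] (cvec C.β) / (eps C.α C.β : ℝ), eps (cvec C.α) ![x, y] / (eps C.α C.β : ℝ),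
      eps ![u, v] (cvec C.β') / (eps C.α' C.β' : ℝ), eps (cvec C.α') ![u, v] / (eps C.α' C.β' : ℝ)] q := by
  rw [push, eval_aeval]
  split_ifs with hs
  · congr 2
    ext i
    fin_cases i <;> simp [cvec, eps] <;> ring
  · congr 2
    ext i
    fin_cases i <;> simp [cvec, eps] <;> ring

lemma eval_push (q : MvPolynomial (Fin 4) ℂ) (m h : Fin 2 → ℂ) :
    eval ![C.left m h 0, C.left m h 1, C.right m h 0, C.right m h 1] (C.push q) =
      eval ![m 0, m 1, h 0, h 1] q := by
  have v2 : ∀ z : Fin 2 → ℂ, ![z 0, z 1] = z := fun z => by ext i; fin_cases i <;> rfl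
  rw [eval_push_std, v2, v2]
  have e1 : eps (C.fst m) (cvec C.β) / (eps C.α C.β : ℝ) = m 0 := by
    rw [fst, eps_add_left, eps_smul_left, eps_smul_left, eps_self, eps_cvec, div_eq_iff neC]; ring
  have e2 : eps (cvec C.α) (C.fst m) / (eps C.α C.β : ℝ) = m 1 := by
    rw [fst, eps_add_right, eps_smul_right, eps_smul_right, eps_self, eps_cvec, div_eq_iff neC]; ring
  have e3 : eps (C.snd h) (cvec C.β') / (eps C.α' C.β' : ℝ) = h 0 := by
    rw [snd, eps_add_left, eps_smul_left, eps_smul_left, eps_self, eps_cvec, div_eq_iff neC']; ring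
  have e4 : eps (cvec C.α') (C.snd h) / (eps C.α' C.β' : ℝ) = h 1 := by
    rw [snd, eps_add_right, eps_smul_right, eps_smul_right, eps_self, eps_cvec, div_eq_iff neC']; ring
  simp only [left, right]
  split_ifs with hs <;> rw [e1, e2, e3, e4]

lemma eval_pull (q : MvPolynomial (Fin 4) ℂ) (m h : Fin 2 → ℂ) :
    eval ![m 0, m 1, h 0, h 1] (C.pull q) =
      eval ![C.left m h 0, C.left m h 1, C.right m h 0, C.right m h 1] q := by
  rw [pull, eval_aeval]
  congr 2
  ext i
  simp only [left, right]
  split_ifs with hs <;> fin_cases i <;> simp [fst, snd, cvec, mul_comm]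

/-- Any pair of spinors has coordinates. -/
lemma exists_coords (μ η : Fin 2 → ℂ) : ∃ m h, C.left m h = μ ∧ C.right m h = η := by
  have k : eps (cvec C.α) (cvec C.β) ≠ 0 := by rw [eps_cvec]; exact neC
  have k' : eps (cvec C.α') (cvec C.β') ≠ 0 := by rw [eps_cvec]; exact neC'
  have e : ∀ ξ, ∃ m, C.fst m = ξ := fun ξ =>
    ⟨![eps ξ (cvec C.β) / eps (cvec C.α) (cvec C.β), eps (cvec C.α) ξ / eps (cvec C.α) (cvec C.β)],
      (spinor_expand k ξ).symm⟩
  have e' : ∀ ξ, ∃ m, C.snd m = ξ := fun ξ =>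
    ⟨![eps ξ (cvec C.β') / eps (cvec C.α') (cvec C.β'), eps (cvec C.α') ξ / eps (cvec C.α') (cvec C.β')],
      (spinor_expand k' ξ).symm⟩
  simp only [left, right]
  split_ifs
  · obtain ⟨m, hm⟩ := e η
    obtain ⟨h, hh⟩ := e' μ
    exact ⟨m, h, hh, hm⟩
  · obtain ⟨m, hm⟩ := e μ
    obtain ⟨h, hh⟩ := e' η
    exact ⟨m, h, hm, hh⟩

/-- Polynomials are determined by their values in the coordinates. -/
lemma eq_push_of_eval {P q : MvPolynomial (Fin 4) ℂ}
    (h : ∀ m h, eval ![C.left m h 0, C.left m h 1, C.right m h 0, C.right m h 1] P = eval ![m 0, m 1, h 0, h 1] q) :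
    P = C.push q := by
  refine funext_eval fun x y u v => ?_
  obtain ⟨m, k, h1, h2⟩ := exists_coords (C := C) ![x, y] ![u, v]
  have e1 := h m k
  have e2 := eval_push (C := C) q m k
  rw [h1, h2] at e1 e2
  simp only [Matrix.cons_val] at e1 e2
  rw [e1, e2]

lemma push_pull (q : MvPolynomial (Fin 4) ℂ) : C.push (C.pull q) = q :=
  (eq_push_of_eval fun m h => (eval_pull q m h).symm).symm

lemma pull_push (q : MvPolynomial (Fin 4) ℂ) : C.pull (C.push q) = q := by
  refine funext_eval fun x y u v => ?_
  have := eval_pull (C := C) (C.push q) ![x, y] ![u, v]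
  rw [eval_push] at this
  exact this

variable (C) in
/-- The change of coordinates as a multiplicative automorphism of the polynomial ring. -/
noncomputable def pushEquiv : MvPolynomial (Fin 4) ℂ ≃* MvPolynomial (Fin 4) ℂ where
  toFun := C.push
  invFun := C.pull
  left_inv := pull_push
  right_inv := push_pull
  map_mul' := map_mul C.push

lemma irreducible_push {q : MvPolynomial (Fin 4) ℂ} (h : Irreducible q) : Irreducible (C.push q) :=
  (MulEquiv.irreducible_iff C.pushEquiv).mpr h

lemma associated_of_push {p q : MvPolynomial (Fin 4) ℂ} (h : Associated (C.push p) (C.push q)) : Associated p q := by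
  have := h.map C.pull
  rwa [pull_push, pull_push] at this

lemma conjPoly_push (q : MvPolynomial (Fin 4) ℂ) : conjPoly (C.push q) = C.push (conjPoly q) := by
  induction q using MvPolynomial.induction_on with
  | C c => simp [conjPoly, algHom_C]
  | add p₁ p₂ h₁ h₂ =>
    simp only [conjPoly, map_add] at h₁ h₂ ⊢
    rw [h₁, h₂]
  | mul_X p i hp =>
    simp only [conjPoly, map_mul, map_X] at hp ⊢
    rw [hp]
    congr 1
    simp only [push, aeval_X]
    fin_cases i <;> simp

lemma isBihomogeneous_push {q : MvPolynomial (Fin 4) ℂ} {r s : ℕ} (h : IsBihomogeneous q r s) :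
    IsBihomogeneous (C.push q) (if C.sw then s else r) (if C.sw then r else s) := by
  refine isBihomogeneous_of_eval fun a b x y u v => ?_
  have e1 : ∀ (c x y : ℂ) (γ : Fin 2 → ℂ) (e : ℂ), eps ![c * x, c * y] γ / e = c * (eps ![x, y] γ / e) := by
    intro c x y γ e; simp [eps]; ring
  have e2 : ∀ (c x y : ℂ) (γ : Fin 2 → ℂ) (e : ℂ), eps γ ![c * x, c * y] / e = c * (eps γ ![x, y] / e) := by
    intro c x y γ e; simp [eps]; ring
  rw [eval_push_std, eval_push_std]
  split_ifs with hs
  · rw [e1, e1, e2, e2, h.eval_scale]; ring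
  · rw [e1, e1, e2, e2, h.eval_scale]

/-! ### Transfer of factorizations -/

variable (C) in
/-- The effect of the coordinates on bidegrees. -/
def tw (b : Block) : Block := if C.sw then b.swap else b

variable (C) in
/-- The factorization in standard spinor components given by a factorization in the coordinates. -/
noncomputable def pushList (l : List (Block × MvPolynomial (Fin 4) ℂ)) : List (Block × MvPolynomial (Fin 4) ℂ) :=
  l.map fun x => (C.tw x.1, C.push x.2)

end SpinCoord

/-- `l` is a factorization of `P` into irreducible polynomials over the complex numbers, grouped into blocks. -/
def IsBlockFactorization (P : MvPolynomial (Fin 4) ℂ) (l : List (Block × MvPolynomial (Fin 4) ℂ)) : Prop :=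
  (∀ x ∈ l, x.1.Admits x.2) ∧
  (components l).Pairwise (fun p q => ¬ Associated p q) ∧
  ∃ c : ℝ, c ≠ 0 ∧ P = MvPolynomial.C (c : ℂ) * (l.map fun x => x.1.value x.2).prod

namespace SpinCoord

variable {C : SpinCoord}

lemma admits_push {b : Block} {q : MvPolynomial (Fin 4) ℂ} (h : b.Admits q) : (C.tw b).Admits (C.push q) := by
  rw [tw]
  cases b <;> simp only [Block.Admits] at h
  · have := isBihomogeneous_push (C := C) h.2.1
    split_ifs with hs <;> simp [hs] at this <;>
      exact ⟨irreducible_push h.1, this, by rw [conjPoly_push, h.2.2]⟩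
  · have := isBihomogeneous_push (C := C) h.2.1
    split_ifs with hs <;> simp [hs] at this <;>
      exact ⟨irreducible_push h.1, this, by rw [conjPoly_push, h.2.2]⟩
  · have := isBihomogeneous_push (C := C) h.2
    split_ifs with hs <;> simp [hs] at this <;>
      exact ⟨irreducible_push h.1, this⟩

lemma value_push (b : Block) (q : MvPolynomial (Fin 4) ℂ) : (C.tw b).value (C.push q) = C.push (b.value q) := by
  rw [tw]
  cases b <;> split_ifs <;> simp [Block.value, Block.swap, conjPoly_push]

lemma parts_push (b : Block) (q : MvPolynomial (Fin 4) ℂ) : (C.tw b).parts (C.push q) = (b.parts q).map C.push := by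
  rw [tw]
  cases b <;> split_ifs <;> simp [Block.parts, Block.swap, conjPoly_push]

lemma components_pushList (l : List (Block × MvPolynomial (Fin 4) ℂ)) :
    components (C.pushList l) = (components l).map C.push := by
  simp only [components, pushList, List.flatMap_map, List.map_flatMap, parts_push]

lemma isSpinorFactorization {Φ : (Fin 4 → ℝ) →ₗ[ℝ] (Fin 4 → ℝ)} {P : MvPolynomial (Fin 4) ℂ}
    (hP : ricciPolyC Φ = C.push P) {l : List (Block × MvPolynomial (Fin 4) ℂ)} (h : IsBlockFactorization P l) :
    IsSpinorFactorization Φ (C.pushList l) := by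
  obtain ⟨h1, h2, c, hc, h3⟩ := h
  refine ⟨?_, ?_, c, hc, ?_⟩
  · intro x hx
    obtain ⟨y, hy, rfl⟩ := List.mem_map.mp hx
    exact admits_push (h1 y hy)
  · rw [components_pushList, List.pairwise_map]
    exact h2.imp fun hn ha => hn (associated_of_push ha)
  · rw [hP, h3, map_mul, algHom_C, algebraMap_eq, map_list_prod, pushList, List.map_map, List.map_map]
    congr 2
    simp [value_push]

/-! ### Coordinates of points -/

variable (C) in
/-- The point `Q` has the homogeneous coordinates `m = (x, y)`, `h = (u, v)`. -/
def Rep (Q : Pt) (m h : Fin 2 → ℂ) : Prop :=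
  m ≠ 0 ∧ h ≠ 0 ∧ Q.1.submodule = Submodule.span ℂ {C.left m h} ∧ Q.2.submodule = Submodule.span ℂ {C.right m h}

lemma eps_fst (m n : Fin 2 → ℂ) : eps (C.fst m) (C.fst n) = eps m n * (eps C.α C.β : ℝ) := by
  simp only [fst, eps_add_left, eps_add_right, eps_smul_left, eps_smul_right, eps_self, eps_cvec,
    eps_swap (cvec C.β) (cvec C.α)]
  simp only [eps]; ring

lemma eps_snd (m n : Fin 2 → ℂ) : eps (C.snd m) (C.snd n) = eps m n * (eps C.α' C.β' : ℝ) := by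
  simp only [snd, eps_add_left, eps_add_right, eps_smul_left, eps_smul_right, eps_self, eps_cvec,
    eps_swap (cvec C.β') (cvec C.α')]
  simp only [eps]; ring

lemma fst_ne_zero {m : Fin 2 → ℂ} (hm : m ≠ 0) : C.fst m ≠ 0 := by
  obtain ⟨n, hn⟩ := exists_eps_eq_one hm
  exact ne_zero_of_eps (β := C.fst n) (by rw [eps_fst, hn, one_mul]; exact neC)

lemma snd_ne_zero {m : Fin 2 → ℂ} (hm : m ≠ 0) : C.snd m ≠ 0 := by
  obtain ⟨n, hn⟩ := exists_eps_eq_one hm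
  exact ne_zero_of_eps (β := C.snd n) (by rw [eps_snd, hn, one_mul]; exact neC')

lemma fst_smul (a : ℂ) (m : Fin 2 → ℂ) : C.fst (a • m) = a • C.fst m := by
  simp [fst, mul_smul]

lemma snd_smul (a : ℂ) (m : Fin 2 → ℂ) : C.snd (a • m) = a • C.snd m := by
  simp [snd, mul_smul]

lemma fst_add (m n : Fin 2 → ℂ) : C.fst (m + n) = C.fst m + C.fst n := by
  simp only [fst, Pi.add_apply, add_smul]; abel

lemma snd_add (m n : Fin 2 → ℂ) : C.snd (m + n) = C.snd m + C.snd n := by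
  simp only [snd, Pi.add_apply, add_smul]; abel

lemma fst_zero : C.fst 0 = 0 := by simp [fst]

lemma snd_zero : C.snd 0 = 0 := by simp [snd]

variable (C) in
lemma exists_rep (Q : Pt) : ∃ m h, C.Rep Q m h := by
  obtain ⟨m, h, h1, h2⟩ := exists_coords (C := C) Q.1.rep Q.2.rep
  have n1 := Q.1.rep_nonzero
  have n2 := Q.2.rep_nonzero
  rw [← h1] at n1
  rw [← h2] at n2
  refine ⟨m, h, ?_, ?_, by rw [h1]; exact Q.1.submodule_eq, by rw [h2]; exact Q.2.submodule_eq⟩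
  · rintro rfl
    simp only [left, right, fst_zero] at n1 n2
    split_ifs at n1 n2 <;> simp at n1 n2
  · rintro rfl
    simp only [left, right, snd_zero] at n1 n2
    split_ifs at n1 n2 <;> simp at n1 n2

lemma Rep.smul {Q : Pt} {m h m' h' : Fin 2 → ℂ} (R : C.Rep Q m h) {a b : ℂ} (hm : m = a • m') (hh : h = b • h') :
    C.Rep Q m' h' := by
  obtain ⟨h1, h2, h3, h4⟩ := R
  have ha : a ≠ 0 := by rintro rfl; simp [hm] at h1
  have hb : b ≠ 0 := by rintro rfl; simp [hh] at h2
  refine ⟨by rintro rfl; simp [hm] at h1, by rintro rfl; simp [hh] at h2, ?_, ?_⟩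
  · rw [h3, hm, hh]
    simp only [left, fst_smul, snd_smul]
    split_ifs
    · exact Submodule.span_singleton_smul_eq (IsUnit.mk0 _ hb) _
    · exact Submodule.span_singleton_smul_eq (IsUnit.mk0 _ ha) _
  · rw [h4, hm, hh]
    simp only [right, fst_smul, snd_smul]
    split_ifs
    · exact Submodule.span_singleton_smul_eq (IsUnit.mk0 _ ha) _
    · exact Submodule.span_singleton_smul_eq (IsUnit.mk0 _ hb) _

/-- Normalization of the coordinates of a point. -/
lemma Rep.of_eps {Q : Pt} {m h m' h' : Fin 2 → ℂ} (R : C.Rep Q m h) (hm' : m' ≠ 0) (hh' : h' ≠ 0)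
    (e : m' 0 * m 1 = m' 1 * m 0) (e' : h' 0 * h 1 = h' 1 * h 0) : C.Rep Q m' h' := by
  obtain ⟨a, ha⟩ := mem_span_of_eps_eq_zero hm' (β := m) (by simp only [eps]; linear_combination e)
  obtain ⟨b, hb⟩ := mem_span_of_eps_eq_zero hh' (β := h) (by simp only [eps]; linear_combination e')
  exact R.smul ha hb

lemma Rep.ne_fst {Q : Pt} {m h : Fin 2 → ℂ} (R : C.Rep Q m h) : m 0 ≠ 0 ∨ m 1 ≠ 0 := by
  by_contra! hc
  exact R.1 (by ext i; fin_cases i <;> simp [hc.1, hc.2])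

lemma Rep.ne_snd {Q : Pt} {m h : Fin 2 → ℂ} (R : C.Rep Q m h) : h 0 ≠ 0 ∨ h 1 ≠ 0 := by
  by_contra! hc
  exact R.2.1 (by ext i; fin_cases i <;> simp [hc.1, hc.2])

lemma mem_zeros_iff {q : MvPolynomial (Fin 4) ℂ} {r s : ℕ} (hq : IsBihomogeneous q r s) {Q : Pt} {μ η : Fin 2 → ℂ}
    (hμ : Q.1.submodule = Submodule.span ℂ {μ}) (hη : Q.2.submodule = Submodule.span ℂ {η}) :
    Q ∈ zeros q ↔ eval ![μ 0, μ 1, η 0, η 1] q = 0 := by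
  constructor
  · intro h
    exact h μ (by rw [hμ]; exact Submodule.mem_span_singleton_self _) η
      (by rw [hη]; exact Submodule.mem_span_singleton_self _)
  · intro h μ' hμ' η' hη'
    rw [hμ] at hμ'
    rw [hη] at hη'
    obtain ⟨a, rfl⟩ := Submodule.mem_span_singleton.mp hμ'
    obtain ⟨b, rfl⟩ := Submodule.mem_span_singleton.mp hη'
    simp only [Pi.smul_apply, smul_eq_mul]
    rw [hq.eval_scale, h, mul_zero]

lemma Rep.mem_zeros {Q : Pt} {m h : Fin 2 → ℂ} (R : C.Rep Q m h) {q : MvPolynomial (Fin 4) ℂ} {r s : ℕ}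
    (hq : IsBihomogeneous q r s) : Q ∈ zeros (C.push q) ↔ eval ![m 0, m 1, h 0, h 1] q = 0 := by
  rw [mem_zeros_iff (isBihomogeneous_push hq) R.2.2.1 R.2.2.2, eval_push]

lemma dyad_left_right (m h : Fin 2 → ℂ) :
    dyad (C.left m h) (C.right m h) = ∑ i, nullCoeffs m h i • cvec (C.E i) := by
  rw [Fin.sum_univ_four]
  simp only [left, right, E]
  split_ifs <;>
  · simp only [fst, snd, nullCoeffs, dyad_add_left, dyad_add_right, dyad_smul_left, dyad_smul_right, Matrix.cons_val,
      cvec_dyad, cvec_neg]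
    module

variable (C) in
/-- The factor by which the scalar products of the vectors `C.E` differ from those of a Witt basis. -/
noncomputable def scale : ℝ := eps C.α C.β * eps C.α' C.β'

lemma scale_ne_zero : C.scale ≠ 0 := mul_ne_zero C.ne C.ne'

lemma s22_E (i j : Fin 4) : s22 (C.E i) (C.E j) = if i = j + 2 then C.scale else 0 := by
  simp only [E, scale]
  split_ifs with hs hij hij <;>
  · fin_cases i <;> fin_cases j <;> simp at hij <;>
      simp [s22_dyad, s22_neg_left, s22_neg_right, eps_self, eps_swap C.β C.α, eps_swap C.β' C.α', mul_comm]

/-- A basis of real vectors in which the null vectors of the points have known coordinates. -/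
structure CoordBasis (C : SpinCoord) (D : Fin 4 → Fin 4 → ℝ) (k : (Fin 2 → ℂ) → (Fin 2 → ℂ) → Fin 4 → ℂ) : Prop where
  li : LinearIndependent ℂ fun i => cvec (D i)
  eq : ∃ c : ℂ, c ≠ 0 ∧ ∀ m h, dyad (C.left m h) (C.right m h) = c • ∑ i, k m h i • cvec (D i)

lemma coordBasis_E : CoordBasis C C.E nullCoeffs := by
  refine ⟨?_, 1, one_ne_zero, fun m h => by rw [one_smul, dyad_left_right]⟩
  have hs : (C.scale : ℂ) ≠ 0 := by exact_mod_cast scale_ne_zero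
  have hd : ∀ i j, s22 ((C.scale : ℂ)⁻¹ • cvec (C.E (i + 2))) (cvec (C.E j)) = if i = j then 1 else 0 := by
    intro i j
    rw [s22_smul_left, s22_cvec, s22_E]
    by_cases hij : i = j
    · simp [hij, hs]
    · simp [hij]
  obtain ⟨b, hb, -⟩ := exists_basis_of_dual (E := fun j => cvec (C.E j)) hd
  rw [← hb]
  exact b.linearIndependent

/-- The coefficients of null vectors with respect to a `Ψ`-ON basis. -/
def nullCoeffsON (m h : Fin 2 → ℂ) : Fin 4 → ℂ :=
  ![m 0 * h 0 + m 1 * h 1, m 1 * h 0 - m 0 * h 1, m 0 * h 0 - m 1 * h 1, m 1 * h 0 + m 0 * h 1]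

lemma coordBasis_on {B : Fin 4 → Fin 4 → ℝ} (hB : C.E = toWitt B) : CoordBasis C B nullCoeffsON := by
  have h2 : ((√2 : ℝ) : ℂ)⁻¹ ≠ 0 := by simp
  have h2' := sqrt_two_inv_sq (K := ℂ)
  have hEB : ∀ i, cvec (C.E i) = ∑ j, (((√2 : ℝ) : ℂ)⁻¹ *
      (!![1, 0, 1, 0; 0, 1, 0, 1; 1, 0, -1, 0; 0, 1, 0, -1] : Matrix (Fin 4) (Fin 4) ℂ) i j) • cvec (B j) := by
    intro i
    ext k
    rw [hB]
    fin_cases i <;> simp [toWitt, cvec, Fin.sum_univ_four] <;> ring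
  have hdy : ∀ m h, dyad (C.left m h) (C.right m h) = ((√2 : ℝ) : ℂ)⁻¹ • ∑ i, nullCoeffsON m h i • cvec (B i) := by
    intro m h
    rw [dyad_left_right]
    simp only [hEB]
    simp [Fin.sum_univ_four, nullCoeffs, nullCoeffsON]
    module
  refine ⟨?_, _, h2, hdy⟩
  have hspan : ⊤ ≤ Submodule.span ℂ (Set.range fun i => cvec (B i)) := by
    intro w _
    have hE := (coordBasis_E (C := C)).li
    have hw : w ∈ Submodule.span ℂ (Set.range fun i => cvec (C.E i)) := by
      rw [hE.span_eq_top_of_card_eq_finrank (by simp)]; trivial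
    refine Submodule.span_le.mpr ?_ hw
    rintro _ ⟨i, rfl⟩
    simp only [hEB]
    exact Submodule.sum_mem _ fun j _ => Submodule.smul_mem _ _ (Submodule.subset_span ⟨j, rfl⟩)
  exact linearIndependent_of_top_le_span_of_card_eq_finrank hspan (by simp)

lemma CoordBasis.mem_linePts {D : Fin 4 → Fin 4 → ℝ} {k : (Fin 2 → ℂ) → (Fin 2 → ℂ) → Fin 4 → ℂ}
    (H : CoordBasis C D k) {Q : Pt} {m h : Fin 2 → ℂ} (R : C.Rep Q m h) (a a' : Fin 4 → ℂ) {w w' : Fin 4 → ℂ}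
    (hw : w = ∑ i, a i • cvec (D i)) (hw' : w' = ∑ i, a' i • cvec (D i)) :
    Q ∈ linePts w w' ↔ ∃ c c' : ℂ, ∀ i, k m h i = c * a i + c' * a' i := by
  obtain ⟨r, hr, he⟩ := H.eq
  rw [linePts, mem_pts_iff R.2.2.1 R.2.2.2, he, Submodule.smul_mem_iff _ hr, Submodule.mem_span_pair, hw, hw']
  refine exists_congr fun c => exists_congr fun c' => ?_
  rw [Finset.smul_sum, Finset.smul_sum, ← Finset.sum_add_distrib]
  simp only [smul_smul, ← add_smul]
  constructor
  · intro e i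
    have := Fintype.linearIndependent_iff.mp H.li (fun i => c * a i + c' * a' i - k m h i)
      (by simp only [sub_smul, Finset.sum_sub_distrib, e, sub_self]) i
    linear_combination -this
  · intro e
    exact Finset.sum_congr rfl fun i _ => by rw [e i]

lemma CoordBasis.mem_singularSet {D : Fin 4 → Fin 4 → ℝ} {k : (Fin 2 → ℂ) → (Fin 2 → ℂ) → Fin 4 → ℂ}
    (H : CoordBasis C D k) {Φ : (Fin 4 → ℝ) →ₗ[ℝ] (Fin 4 → ℝ)} (hsa : ∀ u v, s22 (Φ u) v = s22 u (Φ v))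
    {M : Matrix (Fin 4) (Fin 4) ℝ} (hM : HasMatrix Φ D M) {Q : Pt} {m h : Fin 2 → ℂ} (R : C.Rep Q m h) :
    Q ∈ singularSet (ricciPolyC Φ) ↔ ∃ χ : ℂ, ∀ i, ∑ j, (M i j : ℂ) * k m h j = χ * k m h i := by
  obtain ⟨r, hr, he⟩ := H.eq
  rw [mem_singularSet_iff hsa R.2.2.1 R.2.2.2, he]
  refine exists_congr fun χ => ?_
  have e1 : complexify Φ (r • ∑ i, k m h i • cvec (D i)) = r • ∑ i, (∑ j, (M i j : ℂ) * k m h j) • cvec (D i) := by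
    rw [map_smul, map_sum]
    simp only [map_smul, complexify_cvec, hM _, cvec_sum, cvec_smul, Finset.smul_sum, Finset.sum_smul, smul_smul]
    rw [Finset.sum_comm]
    refine Finset.sum_congr rfl fun i _ => Finset.sum_congr rfl fun j _ => ?_
    ring_nf
  rw [e1, smul_comm χ r, (smul_right_injective _ hr).eq_iff, Finset.smul_sum]
  simp only [smul_smul]
  constructor
  · intro e i
    have := Fintype.linearIndependent_iff.mp H.li (fun i => (∑ j, (M i j : ℂ) * k m h j) - χ * k m h i)
      (by simp only [sub_smul, Finset.sum_sub_distrib, e, sub_self]) i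
    linear_combination this
  · intro e
    exact Finset.sum_congr rfl fun i _ => by rw [e i]

/-- The Ricci polynomial in spinor coordinates. -/
lemma ricciPolyC_eq_push {Φ : (Fin 4 → ℝ) →ₗ[ℝ] (Fin 4 → ℝ)} {M : Matrix (Fin 4) (Fin 4) ℝ}
    (hM : HasMatrix Φ C.E M) {P : MvPolynomial (Fin 4) ℂ}
    (hP : ∀ m h, (C.scale : ℂ) * ∑ i, ∑ j, nullCoeffs m h (i + 2) * (M i j : ℂ) * nullCoeffs m h j =
      eval ![m 0, m 1, h 0, h 1] P) : ricciPolyC Φ = C.push P := by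
  refine eq_push_of_eval fun m h => ?_
  have v2 : ∀ z : Fin 2 → ℂ, ![z 0, z 1] = z := fun z => by ext i; fin_cases i <;> rfl
  rw [← hP, eval_ricciPolyC, v2, v2, dyad_left_right]
  have e : ∀ i j, s22 (cvec (C.E i)) (cvec (C.E j)) = if i = j + 2 then (C.scale : ℂ) else 0 := by
    intro i j
    rw [s22_cvec, s22_E]
    split_ifs <;> simp
  have e' : ∀ j, s22 (∑ i, nullCoeffs m h i • cvec (C.E i)) (cvec (C.E j)) = C.scale * nullCoeffs m h (j + 2) := by
    intro j
    rw [s22_comm, s22_sum_right]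
    simp only [s22_smul_right, e]
    fin_cases j <;> simp [Fin.sum_univ_four, mul_comm]
  simp only [map_sum, map_smul, complexify_cvec, hM _, cvec_sum, cvec_smul, s22_sum_right, s22_smul_right, e',
    Finset.mul_sum]
  rw [Finset.sum_comm]
  exact Finset.sum_congr rfl fun i _ => Finset.sum_congr rfl fun j _ => by ring

end SpinCoord

end NeutralRicci

namespace NeutralRicci

open MvPolynomial

namespace SpinCoord

variable {C : SpinCoord}

lemma exists_of_hasOType {E : Fin 4 → Fin 4 → ℝ} {κ : OType} (hE : IsWitt E) (hκ : HasOType (toPsiON E) κ) :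
    ∃ C : SpinCoord, C.E = E ∧ C.scale = 1 ∧ ∀ b, κ.tw b = C.tw b := by
  obtain ⟨o, ι, o', ι', h, h', rfl⟩ := (hE.hasOType_iff κ).mp hκ
  have k : eps ι o = -1 := by rw [eps_swap, h]
  have k' : eps ι' o' = -1 := by rw [eps_swap, h']
  cases κ
  · refine ⟨⟨o, ι, o', ι', by simp [h], by simp [h'], false⟩, ?_, ?_, ?_⟩ <;> simp [E, wittOf, scale, tw, h, h', OType.tw]
  · refine ⟨⟨ι, o, ι', o', by simp [k], by simp [k'], false⟩, ?_, ?_, ?_⟩ <;> simp [E, wittOf, scale, tw, k, k', OType.tw]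
  · refine ⟨⟨o', ι', o, ι, by simp [h'], by simp [h], true⟩, ?_, ?_, ?_⟩ <;> simp [E, wittOf, scale, tw, h, h', OType.tw]
  · refine ⟨⟨ι', o', ι, o, by simp [k'], by simp [k], true⟩, ?_, ?_, ?_⟩ <;> simp [E, wittOf, scale, tw, k, k', OType.tw]

/-! ### Lines through a point in spinor coordinates -/

lemma frame_expand {μ ν M N : Fin 2 → ℂ} (h : eps μ ν = 1) (e : eps M N ≠ 0)
    (hs : μ ∈ Submodule.span ℂ {M}) : ∃ a a' c : ℂ, a ≠ 0 ∧ a' ≠ 0 ∧ μ = a • M ∧ ν = c • M + a' • N ∧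
      ((∃ r, μ = cvec r) → (∃ r, ν = cvec r) → (∃ r, M = cvec r) → (∃ r, N = cvec r) →
        ∃ p p' r : ℝ, a = p ∧ a' = p' ∧ c = r) := by
  obtain ⟨a, rfl⟩ := Submodule.mem_span_singleton.mp hs
  have ha : a ≠ 0 := by rintro rfl; simp [eps] at h
  have hν := spinor_expand e ν
  have ha' : a * eps M ν = 1 := by rw [← eps_smul_left, h]
  refine ⟨a, _, _, ha, div_ne_zero (right_ne_zero_of_mul_eq_one ha') e, rfl, hν, ?_⟩
  rintro ⟨μ', hμ'⟩ ⟨ν', rfl⟩ ⟨M', rfl⟩ ⟨N', rfl⟩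
  have h3 : a = eps (cvec μ') (cvec N') / eps (cvec M') (cvec N') := by
    rw [← hμ', eps_smul_left, mul_div_cancel_right₀ _ e]
  refine ⟨eps μ' N' / eps M' N', eps M' ν' / eps M' N', eps ν' N' / eps M' N', ?_, ?_, ?_⟩
  · rw [h3]; simp only [eps_cvec]; push_cast; rfl
  · simp only [eps_cvec]; push_cast; rfl
  · simp only [eps_cvec]; push_cast; rfl

lemma fst_cvec (m : Fin 2 → ℝ) : ∃ r, C.fst (cvec m) = cvec r :=
  ⟨m 0 • C.α + m 1 • C.β, by rw [cvec_add, cvec_smul, cvec_smul]; rfl⟩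

lemma snd_cvec (m : Fin 2 → ℝ) : ∃ r, C.snd (cvec m) = cvec r :=
  ⟨m 0 • C.α' + m 1 • C.β', by rw [cvec_add, cvec_smul, cvec_smul]; rfl⟩

/-- A line of an affine chart around `Q`, in coordinates adapted to `Q`: the first homogeneous coordinates of its points
also vary, because two charts around `Q` differ by a projective transformation. -/
lemma exists_line {Q : Pt} {m h n t : Fin 2 → ℂ} (R : C.Rep Q m h) (hn : eps m n ≠ 0) (ht : eps h t ≠ 0)
    (f : AdaptedFrame Q) : ∃ a a' b b' c d : ℂ, a ≠ 0 ∧ a' ≠ 0 ∧ b ≠ 0 ∧ b' ≠ 0 ∧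
      (f.IsReal → (∃ r, m = cvec r) → (∃ r, n = cvec r) → (∃ r, h = cvec r) → (∃ r, t = cvec r) →
        ∃ p p' q q' r s : ℝ, a = p ∧ a' = p' ∧ b = q ∧ b' = q' ∧ c = r ∧ d = s) ∧
      ∀ q σ τ s, lineVal (C.push q) f (if C.sw then τ else σ) (if C.sw then σ else τ) s =
        eval ![(a + c * σ * s) * m 0 + a' * σ * s * n 0, (a + c * σ * s) * m 1 + a' * σ * s * n 1,
          (b + d * τ * s) * h 0 + b' * τ * s * t 0, (b + d * τ * s) * h 1 + b' * τ * s * t 1] q := by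
  have hn' : eps (C.fst m) (C.fst n) ≠ 0 := by rw [eps_fst]; exact mul_ne_zero hn neC
  have ht' : eps (C.snd h) (C.snd t) ≠ 0 := by rw [eps_snd]; exact mul_ne_zero ht neC'
  have m1 : f.μ ∈ Submodule.span ℂ {C.left m h} := by
    rw [← R.2.2.1, f.span_μ]; exact Submodule.mem_span_singleton_self _
  have m2 : f.η ∈ Submodule.span ℂ {C.right m h} := by
    rw [← R.2.2.2, f.span_η]; exact Submodule.mem_span_singleton_self _
  have val : ∀ q (m h : Fin 2 → ℂ) (z : Fin 4 → ℂ), z 0 = C.left m h 0 → z 1 = C.left m h 1 → z 2 = C.right m h 0 →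
      z 3 = C.right m h 1 → eval z (C.push q) = eval ![m 0, m 1, h 0, h 1] q := by
    intro q m h z h0 h1 h2 h3
    rw [← eval_push, eval_surj z, h0, h1, h2, h3]
  by_cases hs : C.sw = true
  · simp only [left, right, hs, if_true] at m1 m2
    obtain ⟨b, b', d, hb, hb', e1, e2, hr1⟩ := frame_expand f.eps_μν ht' m1
    obtain ⟨a, a', c, ha, ha', e3, e4, hr2⟩ := frame_expand f.eps_ηθ hn' m2
    refine ⟨a, a', b, b', c, d, ha, ha', hb, hb', ?_, fun q σ τ s => ?_⟩
    · rintro ⟨μ, ν, η, θ, r1, r2, r3, r4⟩ ⟨m, rfl⟩ ⟨n, rfl⟩ ⟨h, rfl⟩ ⟨t, rfl⟩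
      obtain ⟨q, q', s, g1, g2, g3⟩ := hr1 ⟨_, r1⟩ ⟨_, r2⟩ (snd_cvec h) (snd_cvec t)
      obtain ⟨p, p', r, g4, g5, g6⟩ := hr2 ⟨_, r3⟩ ⟨_, r4⟩ (fst_cvec m) (fst_cvec n)
      exact ⟨p, p', q, q', r, s, g4, g5, g1, g2, g6, g3⟩
    · rw [lineVal, val q ((a + c * σ * s) • m + (a' * σ * s) • n) ((b + d * τ * s) • h + (b' * τ * s) • t)]
      · rfl
      all_goals
        simp only [left, right, hs, if_true, fst_add, snd_add, fst_smul, snd_smul, e1, e2, e3, e4]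
        simp
        ring
  · simp only [left, right, hs] at m1 m2
    obtain ⟨a, a', c, ha, ha', e1, e2, hr1⟩ := frame_expand f.eps_μν hn' m1
    obtain ⟨b, b', d, hb, hb', e3, e4, hr2⟩ := frame_expand f.eps_ηθ ht' m2
    refine ⟨a, a', b, b', c, d, ha, ha', hb, hb', ?_, fun q σ τ s => ?_⟩
    · rintro ⟨μ, ν, η, θ, r1, r2, r3, r4⟩ ⟨m, rfl⟩ ⟨n, rfl⟩ ⟨h, rfl⟩ ⟨t, rfl⟩
      obtain ⟨p, p', r, g1, g2, g3⟩ := hr1 ⟨_, r1⟩ ⟨_, r2⟩ (fst_cvec m) (fst_cvec n)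
      obtain ⟨q, q', s, g4, g5, g6⟩ := hr2 ⟨_, r3⟩ ⟨_, r4⟩ (snd_cvec h) (snd_cvec t)
      exact ⟨p, p', q, q', r, s, g1, g2, g4, g5, g3, g6⟩
    · rw [lineVal, val q ((a + c * σ * s) • m + (a' * σ * s) • n) ((b + d * τ * s) • h + (b' * τ * s) • t)]
      · rfl
      all_goals
        simp only [left, right, hs, fst_add, snd_add, fst_smul, snd_smul, e1, e2, e3, e4]
        simp
        ring

/-- The expansion of a polynomial at a point `(m, h)` at which it vanishes to the second order. -/
def DoubleAt (q : MvPolynomial (Fin 4) ℂ) (m n h t : Fin 2 → ℂ) (c₂₀ c₁₁ c₀₂ c₂₁ c₁₂ c₂₂ : ℂ) : Prop :=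
  ∀ x y u v, eval ![x * m 0 + y * n 0, x * m 1 + y * n 1, u * h 0 + v * t 0, u * h 1 + v * t 1] q =
    c₂₀ * (y ^ 2 * u ^ 2) + c₁₁ * (x * y * u * v) + c₀₂ * (x ^ 2 * v ^ 2) + c₂₁ * (y ^ 2 * u * v) +
      c₁₂ * (x * y * v ^ 2) + c₂₂ * (y ^ 2 * v ^ 2)

section Local

variable {Q : Pt} {m h n t : Fin 2 → ℂ} {q : MvPolynomial (Fin 4) ℂ} {c₂₀ c₁₁ c₀₂ c₂₁ c₁₂ c₂₂ : ℂ}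

lemma exists_lineCoeff (R : C.Rep Q m h) (hn : eps m n ≠ 0) (ht : eps h t ≠ 0)
    (H : DoubleAt q m n h t c₂₀ c₁₁ c₀₂ c₂₁ c₁₂ c₂₂) (f : AdaptedFrame Q) :
    ∃ a a' b b' c d : ℂ, a ≠ 0 ∧ a' ≠ 0 ∧ b ≠ 0 ∧ b' ≠ 0 ∧
      (f.IsReal → (∃ r, m = cvec r) → (∃ r, n = cvec r) → (∃ r, h = cvec r) → (∃ r, t = cvec r) →
        ∃ p p' q q' r s : ℝ, a = p ∧ a' = p' ∧ b = q ∧ b' = q' ∧ c = r ∧ d = s) ∧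
      ∀ σ τ,
        lineCoeff (C.push q) f (if C.sw then τ else σ) (if C.sw then σ else τ) 0 = 0 ∧
        lineCoeff (C.push q) f (if C.sw then τ else σ) (if C.sw then σ else τ) 1 = 0 ∧
        lineCoeff (C.push q) f (if C.sw then τ else σ) (if C.sw then σ else τ) 2 =
          c₂₀ * (a' * b) ^ 2 * σ ^ 2 + c₁₁ * (a * a' * b * b') * (σ * τ) + c₀₂ * (a * b') ^ 2 * τ ^ 2 ∧
        lineCoeff (C.push q) f (if C.sw then τ else σ) (if C.sw then σ else τ) 3 =
          2 * c₂₀ * (a' * σ) ^ 2 * b * (d * τ) + c₁₁ * (a' * σ) * (b' * τ) * (c * σ * b + a * (d * τ)) +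
          2 * c₀₂ * a * (c * σ) * (b' * τ) ^ 2 + c₂₁ * (a' * σ) ^ 2 * b * (b' * τ) +
          c₁₂ * a * (a' * σ) * (b' * τ) ^ 2 := by
  obtain ⟨a, a', b, b', c, d, ha, ha', hb, hb', hr, hl⟩ := exists_line R hn ht f
  refine ⟨a, a', b, b', c, d, ha, ha', hb, hb', hr, fun σ τ => ?_⟩
  refine lineCoeff_of_quartic _ _ _ _
    (c₂₀ * (a' * σ) ^ 2 * (d * τ) ^ 2 + c₁₁ * (a' * σ) * (b' * τ) * (c * σ) * (d * τ) +
      c₀₂ * (c * σ) ^ 2 * (b' * τ) ^ 2 + c₂₁ * (a' * σ) ^ 2 * (d * τ) * (b' * τ) +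
      c₁₂ * (c * σ) * (a' * σ) * (b' * τ) ^ 2 + c₂₂ * (a' * σ) ^ 2 * (b' * τ) ^ 2) fun s => ?_
  rw [hl, H]
  ring

/-- Twofold points: both `F = O(t²)` and the quadratic terms. -/
lemma isFold_two (R : C.Rep Q m h) (hn : eps m n ≠ 0) (ht : eps h t ≠ 0)
    (H : DoubleAt q m n h t c₂₀ c₁₁ c₀₂ c₂₁ c₁₂ c₂₂) (hc : c₂₀ ≠ 0 ∨ c₁₁ ≠ 0 ∨ c₀₂ ≠ 0) :
    IsFold (C.push q) Q 2 := by
  intro f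
  obtain ⟨a, a', b, b', c, d, ha, ha', hb, hb', -, hl⟩ := exists_lineCoeff R hn ht H f
  constructor
  · intro σ τ k hk
    have := hl (if C.sw then τ else σ) (if C.sw then σ else τ)
    interval_cases k
    · cases hs : C.sw <;> simp [hs] at this <;> exact this.1
    · cases hs : C.sw <;> simp [hs] at this <;> exact this.2.1
  · have : ∃ σ τ : ℂ, c₂₀ * (a' * b) ^ 2 * σ ^ 2 + c₁₁ * (a * a' * b * b') * (σ * τ) +
        c₀₂ * (a * b') ^ 2 * τ ^ 2 ≠ 0 := by
      by_contra! hz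
      have h1 := hz 1 0
      have h2 := hz 0 1
      have h3 := hz 1 1
      have h1' : c₂₀ = 0 := by simpa [ha', hb] using h1
      have h2' : c₀₂ = 0 := by simpa [ha, hb'] using h2
      have h3' : c₁₁ = 0 := by simpa [h1', h2', ha, ha', hb, hb'] using h3
      simp [h1', h2', h3'] at hc
    obtain ⟨σ, τ, hστ⟩ := this
    rw [← (hl σ τ).2.2.1] at hστ
    exact ⟨_, _, hστ⟩

lemma exists_two_zeros {K : Type*} [Field K] [CharZero K] {A B D δ : K} (hδ : δ ^ 2 = B ^ 2 - 4 * A * D)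
    (h0 : δ ≠ 0) : ∃ σ τ σ' τ' : K, σ * τ' - τ * σ' ≠ 0 ∧ A * σ ^ 2 + B * (σ * τ) + D * τ ^ 2 = 0 ∧
      A * σ' ^ 2 + B * (σ' * τ') + D * τ' ^ 2 = 0 := by
  by_cases hA : A = 0
  · subst hA
    have hB : B ≠ 0 := by rintro rfl; simp [h0] at hδ
    exact ⟨1, 0, -D, B, by simpa using hB, by simp, by ring⟩
  · refine ⟨-B + δ, 2 * A, -B - δ, 2 * A, ?_, by linear_combination A * hδ, by linear_combination A * hδ⟩
    rw [show (-B + δ) * (2 * A) - 2 * A * (-B - δ) = 4 * A * δ by ring]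
    simp [hA, h0]

lemma isNode (R : C.Rep Q m h) (hn : eps m n ≠ 0) (ht : eps h t ≠ 0)
    (H : DoubleAt q m n h t c₂₀ c₁₁ c₀₂ c₂₁ c₁₂ c₂₂) (hd : c₁₁ ^ 2 - 4 * c₂₀ * c₀₂ ≠ 0) :
    IsNode (C.push q) Q := by
  refine ⟨isFold_two R hn ht H ?_, fun f => ?_⟩
  · by_contra! hc
    simp [hc] at hd
  obtain ⟨a, a', b, b', c, d, ha, ha', hb, hb', -, hl⟩ := exists_lineCoeff R hn ht H f
  obtain ⟨δ, hδ⟩ := IsAlgClosed.exists_pow_nat_eq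
    ((c₁₁ * (a * a' * b * b')) ^ 2 - 4 * (c₂₀ * (a' * b) ^ 2) * (c₀₂ * (a * b') ^ 2)) (n := 2) (by norm_num)
  have h0 : δ ≠ 0 := by
    rintro rfl
    have : (a * a' * b * b') ^ 2 * (c₁₁ ^ 2 - 4 * c₂₀ * c₀₂) = 0 := by linear_combination -hδ
    simp [ha, ha', hb, hb', hd] at this
  obtain ⟨σ, τ, σ', τ', hne, e1, e2⟩ := exists_two_zeros hδ h0
  rw [← (hl σ τ).2.2.1] at e1
  rw [← (hl σ' τ').2.2.1] at e2
  refine ⟨_, _, _, _, ?_, e1, e2⟩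
  split_ifs
  · intro hz; exact hne (by linear_combination -hz)
  · exact hne

/-- Double points at which the quadratic terms are a square `k (p y + p' v)²`. -/
lemma isCusp {k p p' : ℂ} (R : C.Rep Q m h) (hn : eps m n ≠ 0) (ht : eps h t ≠ 0)
    (H : DoubleAt q m n h t (k * p ^ 2) (2 * k * p * p') (k * p' ^ 2) c₂₁ c₁₂ c₂₂)
    (hk : k ≠ 0) (hp : p ≠ 0 ∨ p' ≠ 0) : IsCusp (C.push q) Q := by
  refine ⟨isFold_two R hn ht H ?_, fun f σ τ σ' τ' e1 e2 => ?_⟩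
  · rcases hp with hp | hp
    · exact Or.inl (by simp [hk, hp])
    · exact Or.inr (Or.inr (by simp [hk, hp]))
  obtain ⟨a, a', b, b', c, d, ha, ha', hb, hb', -, hl⟩ := exists_lineCoeff R hn ht H f
  have key : ∀ σ τ, lineCoeff (C.push q) f (if C.sw then τ else σ) (if C.sw then σ else τ) 2 = 0 →
      p * (a' * b) * σ + p' * (a * b') * τ = 0 := by
    intro σ τ e
    rw [(hl σ τ).2.2.1] at e
    have : k * (p * (a' * b) * σ + p' * (a * b') * τ) ^ 2 = 0 := by linear_combination e
    simpa [hk] using this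
  have fin : ∀ σ τ σ' τ', p * (a' * b) * σ + p' * (a * b') * τ = 0 → p * (a' * b) * σ' + p' * (a * b') * τ' = 0 →
      σ * τ' - τ * σ' = 0 := by
    intro σ τ σ' τ' e1 e2
    rcases hp with hp | hp
    · have : (p * (a' * b)) * (σ * τ' - τ * σ') = 0 := by linear_combination τ' * e1 - τ * e2
      simpa [hp, ha', hb] using this
    · have : (p' * (a * b')) * (σ * τ' - τ * σ') = 0 := by linear_combination σ * e2 - σ' * e1
      simpa [hp, ha, hb'] using this
  cases hs : C.sw <;> simp only [hs] at key
  · exact fin _ _ _ _ (key σ τ e1) (key σ' τ' e2)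
  · have := fin _ _ _ _ (key τ σ e1) (key τ' σ' e2)
    linear_combination -this

/-- On the tangent of a cusp, the cubic terms alone decide about contact of order four. -/
lemma tacnode_aux {k p p' : ℂ} (R : C.Rep Q m h) (hn : eps m n ≠ 0) (ht : eps h t ≠ 0)
    (H : DoubleAt q m n h t (k * p ^ 2) (2 * k * p * p') (k * p' ^ 2) c₂₁ c₁₂ c₂₂)
    (hk : k ≠ 0) (hp : p ≠ 0 ∨ p' ≠ 0) (f : AdaptedFrame Q) :
    (p * p' * (c₂₁ * p' - c₁₂ * p) = 0 → ∀ σ τ : ℂ, lineCoeff (C.push q) f σ τ 2 = 0 →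
      lineCoeff (C.push q) f σ τ 3 = 0) ∧
    (p * p' * (c₂₁ * p' - c₁₂ * p) ≠ 0 → ∃ σ τ : ℂ, lineCoeff (C.push q) f σ τ 2 = 0 ∧
      lineCoeff (C.push q) f σ τ 3 ≠ 0) := by
  obtain ⟨a, a', b, b', c, d, ha, ha', hb, hb', -, hl⟩ := exists_lineCoeff R hn ht H f
  have cub : ∀ σ τ, p * (a' * b) * σ + p' * (a * b') * τ = 0 →
      lineCoeff (C.push q) f (if C.sw then τ else σ) (if C.sw then σ else τ) 3 =
        (a' * σ) * (b' * τ) * (c₂₁ * (a' * σ) * b + c₁₂ * a * (b' * τ)) := by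
    intro σ τ e
    rw [(hl σ τ).2.2.2]
    linear_combination (2 * k * p * (a' * σ) * (d * τ) + 2 * k * p' * (c * σ) * (b' * τ)) * e
  constructor
  · intro hcub
    have key : ∀ σ τ, lineCoeff (C.push q) f (if C.sw then τ else σ) (if C.sw then σ else τ) 2 = 0 →
        lineCoeff (C.push q) f (if C.sw then τ else σ) (if C.sw then σ else τ) 3 = 0 := by
      intro σ τ e
      rw [(hl σ τ).2.2.1] at e
      have e' : k * (p * (a' * b) * σ + p' * (a * b') * τ) ^ 2 = 0 := by linear_combination e
      have e'' : p * (a' * b) * σ + p' * (a * b') * τ = 0 := by simpa [hk] using e'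
      rw [cub σ τ e'']
      -- the tangent direction is `(a' b σ, a b' τ) = w (p', -p)`
      obtain ⟨w, h1, h2⟩ : ∃ w, a' * b * σ = w * p' ∧ a * b' * τ = -w * p := by
        rcases hp with hp | hp
        · exact ⟨-(a * b' * τ) / p, by field_simp; linear_combination e'', by field_simp⟩
        · exact ⟨a' * b * σ / p', by field_simp, by field_simp; linear_combination e''⟩
      have h0 : (a * b) * ((a' * σ) * (b' * τ) * (c₂₁ * (a' * σ) * b + c₁₂ * a * (b' * τ))) = 0 := by
        linear_combination (a * b' * τ) * (c₂₁ * (a' * σ) * b + c₁₂ * a * (b' * τ)) * h1 +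
          w * p' * (c₂₁ * (a' * σ) * b + c₁₂ * a * (b' * τ)) * h2 - w ^ 2 * p' * p * c₂₁ * h1
          - w ^ 2 * p' * p * c₁₂ * h2 - w ^ 3 * hcub
      simpa [ha, hb] using h0
    intro σ τ
    cases hs : C.sw <;> simp only [hs] at key
    · exact key σ τ
    · exact key τ σ
  · intro hcub
    have e : p * (a' * b) * (p' * a * b') + p' * (a * b') * (-p * a' * b) = 0 := by ring
    refine ⟨if C.sw then (-p * a' * b) else (p' * a * b'), if C.sw then (p' * a * b') else (-p * a' * b), ?_, ?_⟩
    · rw [(hl (p' * a * b') (-p * a' * b)).2.2.1]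
      linear_combination (k * (p * (a' * b) * (p' * a * b') + p' * (a * b') * (-p * a' * b))) * e
    · rw [cub (p' * a * b') (-p * a' * b) e]
      have : a' * (p' * a * b') * (b' * (-p * a' * b)) *
          (c₂₁ * (a' * (p' * a * b')) * b + c₁₂ * a * (b' * (-p * a' * b))) =
          -(a ^ 2 * a' ^ 3 * b ^ 2 * b' ^ 3) * (p * p' * (c₂₁ * p' - c₁₂ * p)) := by ring
      rw [this]
      simp only [ne_eq, mul_eq_zero, not_or] at hcub ⊢
      simp [ha, ha', hb, hb', hcub]

lemma isTacnode {k p p' : ℂ} (R : C.Rep Q m h) (hn : eps m n ≠ 0) (ht : eps h t ≠ 0)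
    (H : DoubleAt q m n h t (k * p ^ 2) (2 * k * p * p') (k * p' ^ 2) c₂₁ c₁₂ c₂₂)
    (hk : k ≠ 0) (hp : p ≠ 0 ∨ p' ≠ 0) (hc : p * p' * (c₂₁ * p' - c₁₂ * p) = 0) : IsTacnode (C.push q) Q :=
  ⟨isCusp R hn ht H hk hp, fun f => (tacnode_aux R hn ht H hk hp f).1 hc⟩

lemma not_isTacnode {k p p' : ℂ} (R : C.Rep Q m h) (hn : eps m n ≠ 0) (ht : eps h t ≠ 0)
    (H : DoubleAt q m n h t (k * p ^ 2) (2 * k * p * p') (k * p' ^ 2) c₂₁ c₁₂ c₂₂)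
    (hk : k ≠ 0) (hp : p ≠ 0 ∨ p' ≠ 0) (hc : p * p' * (c₂₁ * p' - c₁₂ * p) ≠ 0) : ¬ IsTacnode (C.push q) Q := by
  intro hT
  obtain ⟨f, -, -⟩ := exists_adaptedFrame R.2.2.1 R.2.2.2
  obtain ⟨σ, τ, h2, h3⟩ := (tacnode_aux R hn ht H hk hp f).2 hc
  exact h3 (hT.2 f σ τ h2)

lemma isFold_three (R : C.Rep Q m h) (hn : eps m n ≠ 0) (ht : eps h t ≠ 0)
    (H : DoubleAt q m n h t 0 0 0 c₂₁ c₁₂ c₂₂) (hc : c₂₁ ≠ 0 ∨ c₁₂ ≠ 0) : IsFold (C.push q) Q 3 := by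
  intro f
  obtain ⟨a, a', b, b', c, d, ha, ha', hb, hb', -, hl⟩ := exists_lineCoeff R hn ht H f
  constructor
  · intro σ τ k hk
    have := hl (if C.sw then τ else σ) (if C.sw then σ else τ)
    interval_cases k
    · cases hs : C.sw <;> simp [hs] at this <;> exact this.1
    · cases hs : C.sw <;> simp [hs] at this <;> exact this.2.1
    · cases hs : C.sw <;> simp [hs] at this <;> exact this.2.2.1
  · have : ∃ σ τ : ℂ, c₂₁ * (a' * σ) ^ 2 * b * (b' * τ) + c₁₂ * a * (a' * σ) * (b' * τ) ^ 2 ≠ 0 := by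
      by_contra! hz
      have h1 := hz 1 1
      have h2 := hz (-1) 1
      have h1' : 2 * (c₂₁ * (a' ^ 2 * b * b')) = 0 := by linear_combination h1 + h2
      have h2' : 2 * (c₁₂ * (a * a' * b' ^ 2)) = 0 := by linear_combination h1 - h2
      simp [ha, ha', hb, hb'] at h1' h2'
      simp [h1', h2'] at hc
    obtain ⟨σ, τ, hστ⟩ := this
    have e := (hl σ τ).2.2.2
    refine ⟨if C.sw then τ else σ, if C.sw then σ else τ, ?_⟩
    rw [e]
    intro hz
    exact hστ (by linear_combination hz)

end Local

/-! ### Real points -/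

lemma isRealPt {Q : Pt} {m h : Fin 2 → ℝ} (R : C.Rep Q (cvec m) (cvec h)) : IsRealPt Q := by
  have ex : ∀ r : Fin 2 → ℝ, cvec r ≠ 0 → ∃ s : Fin 2 → ℝ, eps (cvec r) (cvec s) = 1 := by
    intro r hr
    obtain ⟨s, hs⟩ := exists_eps_eq_one (α := r) (by rintro rfl; exact hr (by ext; simp [cvec]))
    exact ⟨s, by rw [eps_cvec, hs]; simp⟩
  obtain ⟨r, hr⟩ := fst_cvec (C := C) m
  obtain ⟨r', hr'⟩ := snd_cvec (C := C) h
  have h1 := fst_ne_zero (C := C) R.1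
  have h2 := snd_ne_zero (C := C) R.2.1
  rw [hr] at h1
  rw [hr'] at h2
  obtain ⟨s, hs⟩ := ex r h1
  obtain ⟨s', hs'⟩ := ex r' h2
  have e1 := R.2.2.1
  have e2 := R.2.2.2
  simp only [left, right, hr, hr'] at e1 e2
  split_ifs at e1 e2
  · exact ⟨⟨_, _, _, _, hs', hs, e1, e2⟩, r', s', r, s, rfl, rfl, rfl, rfl⟩
  · exact ⟨⟨_, _, _, _, hs, hs', e1, e2⟩, r, s, r', s', rfl, rfl, rfl, rfl⟩

lemma not_isRealPt {Q : Pt} {m h : Fin 2 → ℂ} (R : C.Rep Q m h)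
    (hm : m 0 * (starRingEnd ℂ) (m 1) ≠ (starRingEnd ℂ) (m 0) * m 1) : ¬ IsRealPt Q := by
  rintro ⟨f, μ, ν, η, θ, e1, e2, e3, e4⟩
  obtain ⟨n, hn⟩ := exists_eps_eq_one R.1
  obtain ⟨t, ht⟩ := exists_eps_eq_one R.2.1
  -- a real spinor proportional to `C.fst m`
  have key : ∃ (r : Fin 2 → ℝ) (a : ℂ), a ≠ 0 ∧ a • C.fst m = cvec r := by
    have m1 : f.μ ∈ Submodule.span ℂ {C.left m h} := by
      rw [← R.2.2.1, f.span_μ]; exact Submodule.mem_span_singleton_self _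
    have m2 : f.η ∈ Submodule.span ℂ {C.right m h} := by
      rw [← R.2.2.2, f.span_η]; exact Submodule.mem_span_singleton_self _
    simp only [left, right] at m1 m2
    split_ifs at m1 m2
    · obtain ⟨a, ha⟩ := Submodule.mem_span_singleton.mp m2
      refine ⟨η, a, ?_, by rw [ha, e3]⟩
      rintro rfl
      have := f.eps_ηθ
      rw [← ha] at this
      simp [eps] at this
    · obtain ⟨a, ha⟩ := Submodule.mem_span_singleton.mp m1
      refine ⟨μ, a, ?_, by rw [ha, e1]⟩
      rintro rfl
      have := f.eps_μν
      rw [← ha] at this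
      simp [eps] at this
  obtain ⟨r, a, ha, hr⟩ := key
  have h0 : a * m 0 * (eps C.α C.β : ℝ) = (eps r C.β : ℝ) := by
    rw [← eps_cvec, ← eps_cvec, ← hr, eps_smul_left, fst, eps_add_left, eps_smul_left, eps_smul_left, eps_self]
    ring
  have h1 : a * m 1 * (eps C.α C.β : ℝ) = (eps C.α r : ℝ) := by
    rw [← eps_cvec, ← eps_cvec, ← hr, eps_smul_right, fst, eps_add_right, eps_smul_right, eps_smul_right, eps_self]
    ring
  have h0' := congrArg (starRingEnd ℂ) h0
  have h1' := congrArg (starRingEnd ℂ) h1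
  simp only [map_mul, Complex.conj_ofReal] at h0' h1'
  have hca : (starRingEnd ℂ) a ≠ 0 := by simpa using ha
  have hz : (a * (starRingEnd ℂ) a * ((eps C.α C.β : ℝ) : ℂ) ^ 2) *
      (m 0 * (starRingEnd ℂ) (m 1) - (starRingEnd ℂ) (m 0) * m 1) = 0 := by
    linear_combination ((starRingEnd ℂ) a * (starRingEnd ℂ) (m 1) * (eps C.α C.β : ℝ)) * h0 + ((eps r C.β : ℝ) : ℂ) * h1' -
      ((starRingEnd ℂ) a * (starRingEnd ℂ) (m 0) * (eps C.α C.β : ℝ)) * h1 - ((eps C.α r : ℝ) : ℂ) * h0'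
  have hne := neC (C := C)
  rw [mul_eq_zero] at hz
  rcases hz with hz | hz
  · simp [ha, C.ne] at hz
  · exact hm (sub_eq_zero.mp hz)

section RealLocal

variable {Q : Pt} {m h n t : Fin 2 → ℝ} {q : MvPolynomial (Fin 4) ℂ} {c₂₀ c₁₁ c₀₂ c₂₁ c₁₂ c₂₂ : ℝ}

lemma isRealNodeRealTangents (R : C.Rep Q (cvec m) (cvec h)) (hn : eps m n ≠ 0) (ht : eps h t ≠ 0)
    (H : DoubleAt q (cvec m) (cvec n) (cvec h) (cvec t) c₂₀ c₁₁ c₀₂ c₂₁ c₁₂ c₂₂)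
    (hd : 0 < c₁₁ ^ 2 - 4 * c₂₀ * c₀₂) : IsRealNodeRealTangents (C.push q) Q := by
  have hn' : eps (cvec m) (cvec n) ≠ 0 := by rw [eps_cvec]; exact_mod_cast hn
  have ht' : eps (cvec h) (cvec t) ≠ 0 := by rw [eps_cvec]; exact_mod_cast ht
  refine ⟨isNode R hn' ht' H (by exact_mod_cast hd.ne'), isRealPt R, fun f hf => ?_⟩
  obtain ⟨a, a', b, b', c, d, ha, ha', hb, hb', hr, hl⟩ := exists_lineCoeff R hn' ht' H f
  obtain ⟨p, p', s, s', _, _, rfl, rfl, rfl, rfl, -, -⟩ := hr hf ⟨_, rfl⟩ ⟨_, rfl⟩ ⟨_, rfl⟩ ⟨_, rfl⟩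
  have hpos : 0 < (c₁₁ * (p * p' * s * s')) ^ 2 - 4 * (c₂₀ * (p' * s) ^ 2) * (c₀₂ * (p * s') ^ 2) := by
    have : (c₁₁ * (p * p' * s * s')) ^ 2 - 4 * (c₂₀ * (p' * s) ^ 2) * (c₀₂ * (p * s') ^ 2) =
      (p * p' * s * s') ^ 2 * (c₁₁ ^ 2 - 4 * c₂₀ * c₀₂) := by ring
    rw [this]
    norm_cast at ha ha' hb hb'
    positivity
  obtain ⟨σ, τ, σ', τ', hne, e1, e2⟩ := exists_two_zeros (Real.sq_sqrt hpos.le) (Real.sqrt_pos.mpr hpos).ne'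
  have g1 := (hl σ τ).2.2.1
  have g2 := (hl σ' τ').2.2.1
  have e1' : (c₂₀ : ℂ) * (p' * s) ^ 2 * σ ^ 2 + c₁₁ * (p * p' * s * s') * (σ * τ) + c₀₂ * (p * s') ^ 2 * τ ^ 2 = 0 := by
    exact_mod_cast e1
  have e2' : (c₂₀ : ℂ) * (p' * s) ^ 2 * σ' ^ 2 + c₁₁ * (p * p' * s * s') * (σ' * τ') + c₀₂ * (p * s') ^ 2 * τ' ^ 2 = 0 := by
    exact_mod_cast e2
  rw [e1'] at g1
  rw [e2'] at g2
  cases hs : C.sw <;> simp only [hs] at g1 g2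
  · exact ⟨σ, τ, σ', τ', hne, g1, g2⟩
  · exact ⟨τ, σ, τ', σ', fun hz => hne (by linear_combination -hz), g1, g2⟩

/-- A real zero close to the point would make the definite quadratic terms smaller than the terms of order four. -/
lemma isolated_zero (hd : 0 < 4 * c₂₀ * c₀₂ - c₁₁ ^ 2) : ∃ ρ : ℝ, 0 < ρ ∧ ∀ x y u v : ℝ, |y| < ρ * |x| → |v| < ρ * |u| →
    c₂₀ * (y ^ 2 * u ^ 2) + c₁₁ * (x * y * u * v) + c₀₂ * (x ^ 2 * v ^ 2) + c₂₂ * (y ^ 2 * v ^ 2) = 0 →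
      y = 0 ∧ v = 0 := by
  set Δ := 4 * c₂₀ * c₀₂ - c₁₁ ^ 2 with hΔ
  set K := 4 * |c₂₀ * c₂₂| + 1 with hK
  have hKpos : 0 < K := by positivity
  refine ⟨√(Δ / K), Real.sqrt_pos.mpr (by positivity), fun x y u v hy hv h0 => ?_⟩
  have hx : x ≠ 0 := by rintro rfl; simp at hy; linarith [abs_nonneg y]
  have hu : u ≠ 0 := by rintro rfl; simp at hv; linarith [abs_nonneg v]
  have hy2 : y ^ 2 * K ≤ Δ * x ^ 2 := by
    have : y ^ 2 ≤ (√(Δ / K) * |x|) ^ 2 := by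
      rw [← sq_abs y]; exact pow_le_pow_left₀ (abs_nonneg y) hy.le 2
    rw [mul_pow, Real.sq_sqrt (by positivity), sq_abs, div_mul_eq_mul_div, le_div_iff₀ hKpos] at this
    exact this
  have hab : -(4 * c₂₀ * c₂₂) ≤ K - 1 := by
    have := neg_abs_le (c₂₀ * c₂₂)
    rw [hK]; linarith
  have hv2 : 0 ≤ v ^ 2 := sq_nonneg v
  have hyv : 0 ≤ y ^ 2 * v ^ 2 := by positivity
  have hkey : (2 * c₂₀ * (y * u) + c₁₁ * (x * v)) ^ 2 + Δ * (x ^ 2 * v ^ 2) = -(4 * c₂₀ * c₂₂) * (y ^ 2 * v ^ 2) := by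
    rw [hΔ]; linear_combination 4 * c₂₀ * h0
  have h1 : -(4 * c₂₀ * c₂₂) * (y ^ 2 * v ^ 2) ≤ (K - 1) * (y ^ 2 * v ^ 2) := mul_le_mul_of_nonneg_right hab hyv
  have h2 : K * (y ^ 2 * v ^ 2) ≤ Δ * (x ^ 2 * v ^ 2) := by
    have := mul_le_mul_of_nonneg_right hy2 hv2
    linarith
  have h3 : y ^ 2 * v ^ 2 ≤ 0 := by nlinarith [sq_nonneg (2 * c₂₀ * (y * u) + c₁₁ * (x * v))]
  have h4 : y ^ 2 * v ^ 2 = 0 := le_antisymm h3 hyv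
  rw [h4, mul_zero] at hkey
  have hx2 : 0 < x ^ 2 := by positivity
  have hc : c₂₀ ≠ 0 := by
    rintro hc
    rw [hc] at hΔ
    nlinarith [sq_nonneg c₁₁]
  have h5 : v = 0 := by
    have : Δ * (x ^ 2 * v ^ 2) = 0 := by
      have : 0 ≤ Δ * (x ^ 2 * v ^ 2) := by positivity
      nlinarith [sq_nonneg (2 * c₂₀ * (y * u) + c₁₁ * (x * v))]
    simpa [hd.ne', hx] using this
  refine ⟨?_, h5⟩
  rw [h5] at hkey
  simpa [hc, hu] using hkey

lemma isRealNodeComplexTangents (R : C.Rep Q (cvec m) (cvec h)) (hn : eps m n ≠ 0) (ht : eps h t ≠ 0)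
    (H : DoubleAt q (cvec m) (cvec n) (cvec h) (cvec t) c₂₀ c₁₁ c₀₂ 0 0 c₂₂)
    (hd : 0 < 4 * c₂₀ * c₀₂ - c₁₁ ^ 2) : IsRealNodeComplexTangents (C.push q) Q := by
  have hn' : eps (cvec m) (cvec n) ≠ 0 := by rw [eps_cvec]; exact_mod_cast hn
  have ht' : eps (cvec h) (cvec t) ≠ 0 := by rw [eps_cvec]; exact_mod_cast ht
  refine ⟨isNode R hn' ht' H ?_, isRealPt R, fun f hf => ⟨?_, ?_⟩⟩
  · have : (c₁₁ ^ 2 - 4 * c₂₀ * c₀₂ : ℝ) ≠ 0 := by linarith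
    exact_mod_cast this
  · obtain ⟨a, a', b, b', c, d, ha, ha', hb, hb', hr, hl⟩ := exists_lineCoeff R hn' ht' H f
    obtain ⟨p, p', s, s', _, _, rfl, rfl, rfl, rfl, -, -⟩ := hr hf ⟨_, rfl⟩ ⟨_, rfl⟩ ⟨_, rfl⟩ ⟨_, rfl⟩
    norm_cast at ha ha' hb hb'
    have key : ∀ σ τ : ℝ, lineCoeff (C.push q) f (if C.sw then (τ : ℂ) else σ) (if C.sw then (σ : ℂ) else τ) 2 = 0 →
        σ = 0 ∧ τ = 0 := by
      intro σ τ e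
      rw [(hl σ τ).2.2.1] at e
      have e' : c₂₀ * (p' * s * σ) ^ 2 + c₁₁ * ((p' * s * σ) * (p * s' * τ)) + c₀₂ * (p * s' * τ) ^ 2 = 0 := by
        have e2 : c₂₀ * (p' * s) ^ 2 * σ ^ 2 + c₁₁ * (p * p' * s * s') * (σ * τ) + c₀₂ * (p * s') ^ 2 * τ ^ 2 = 0 := by
          exact_mod_cast e
        linear_combination e2
      have hc : c₂₀ ≠ 0 := by rintro rfl; nlinarith [sq_nonneg c₁₁]
      have e3 : (2 * c₂₀ * (p' * s * σ) + c₁₁ * (p * s' * τ)) ^ 2 +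
          (4 * c₂₀ * c₀₂ - c₁₁ ^ 2) * (p * s' * τ) ^ 2 = 0 := by linear_combination 4 * c₂₀ * e'
      have e4 : (4 * c₂₀ * c₀₂ - c₁₁ ^ 2) * (p * s' * τ) ^ 2 = 0 := by
        have := mul_nonneg hd.le (sq_nonneg (p * s' * τ))
        nlinarith [sq_nonneg (2 * c₂₀ * (p' * s * σ) + c₁₁ * (p * s' * τ))]
      have e5 : τ = 0 := by simpa [hd.ne', ha, hb'] using e4
      rw [e5] at e3
      exact ⟨by simpa [hc, ha', hb] using e3, e5⟩
    intro σ τ e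
    cases hs : C.sw <;> simp only [hs] at key
    · exact key σ τ e
    · exact (key τ σ e).symm
  · obtain ⟨a, a', b, b', c, d, ha, ha', hb, hb', hr, hl⟩ := exists_line R hn' ht' f
    obtain ⟨p, p', s, s', r, w, rfl, rfl, rfl, rfl, rfl, rfl⟩ := hr hf ⟨_, rfl⟩ ⟨_, rfl⟩ ⟨_, rfl⟩ ⟨_, rfl⟩
    norm_cast at ha ha' hb hb'
    obtain ⟨ρ, hρ, hiso⟩ := isolated_zero (c₂₂ := c₂₂) hd
    -- in the given chart the point `(y, v)` has the coordinates `(p + r y, p' y)`, `(s + w v, s' v)`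
    have near : ∀ p p' r : ℝ, p ≠ 0 → p' ≠ 0 → ∃ δ, 0 < δ ∧ ∀ y : ℝ, |y| < δ → |p' * y| < ρ * |p + r * y| := by
      intro p p' r hp hp'
      have hD : 0 < |p'| + ρ * |r| := by positivity
      refine ⟨ρ * |p| / (|p'| + ρ * |r|), by positivity, fun y hy => ?_⟩
      rw [lt_div_iff₀ hD] at hy
      have h1 : |p| ≤ |p + r * y| + |r| * |y| := by
        have := abs_sub (p + r * y) (r * y)
        rwa [add_sub_cancel_right, abs_mul r y] at this
      rw [abs_mul]
      have := mul_le_mul_of_nonneg_left h1 hρ.le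
      linarith
    obtain ⟨δ₁, hδ₁, n1⟩ := near p p' r ha ha'
    obtain ⟨δ₂, hδ₂, n2⟩ := near s s' w hb hb'
    have key : ∀ y v : ℝ, |y| < δ₁ → |v| < δ₂ →
        lineVal (C.push q) f (if C.sw then (v : ℂ) else y) (if C.sw then (y : ℂ) else v) 1 = 0 → y = 0 ∧ v = 0 := by
      intro y v hy hv e
      rw [hl, H] at e
      have e' : c₂₀ * ((p' * y) ^ 2 * (s + w * v) ^ 2) + c₁₁ * ((p + r * y) * (p' * y) * (s + w * v) * (s' * v)) +
          c₀₂ * ((p + r * y) ^ 2 * (s' * v) ^ 2) + c₂₂ * ((p' * y) ^ 2 * (s' * v) ^ 2) = 0 := by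
        have e2 : ((c₂₀ * ((p' * y) ^ 2 * (s + w * v) ^ 2) +
            c₁₁ * ((p + r * y) * (p' * y) * (s + w * v) * (s' * v)) +
            c₀₂ * ((p + r * y) ^ 2 * (s' * v) ^ 2) + c₂₂ * ((p' * y) ^ 2 * (s' * v) ^ 2) : ℝ) : ℂ) = 0 := by
          push_cast
          linear_combination e
        exact_mod_cast e2
      obtain ⟨g1, g2⟩ := hiso _ _ _ _ (n1 y hy) (n2 v hv) e'
      exact ⟨by simpa [ha'] using g1, by simpa [hb'] using g2⟩
    refine ⟨min δ₁ δ₂, lt_min hδ₁ hδ₂, fun y v hy hv e => ?_⟩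
    have e' : lineVal (C.push q) f y v 1 = 0 := by
      rw [lineVal]
      simpa using e
    cases hs : C.sw <;> simp only [hs] at key
    · exact key y v (hy.trans_le (min_le_left _ _)) (hv.trans_le (min_le_right _ _)) e'
    · exact (key v y (hv.trans_le (min_le_left _ _)) (hy.trans_le (min_le_right _ _)) e').symm

end RealLocal

end SpinCoord

end NeutralRicci

namespace NeutralRicci

open MvPolynomial

/-! ### Components and their intersections -/

lemma isBihomogeneous_conjPoly {q : MvPolynomial (Fin 4) ℂ} {r s : ℕ} (h : IsBihomogeneous q r s) :
    IsBihomogeneous (conjPoly q) r s :=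
  ⟨fun _ hd => h.1 fun h0 => hd (by rw [conjPoly, coeff_map, h0, map_zero]),
    fun _ hd => h.2 fun h0 => hd (by rw [conjPoly, coeff_map, h0, map_zero])⟩

lemma Block.Admits.isBihomogeneous {b : Block} {q p : MvPolynomial (Fin 4) ℂ} (h : b.Admits q) (hp : p ∈ b.parts q) :
    ∃ r s, IsBihomogeneous p r s := by
  cases b with
  | real r s =>
    rw [List.mem_singleton.mp hp]
    exact ⟨r, s, h.2.1⟩
  | sq r s =>
    rw [List.mem_singleton.mp hp]
    exact ⟨r, s, h.2.1⟩
  | conj r s =>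
    rcases List.mem_pair.mp hp with rfl | rfl
    · exact ⟨r, s, h.2⟩
    · exact ⟨r, s, isBihomogeneous_conjPoly h.2⟩

lemma exists_pair_cons {α : Type*} (A : α → Prop) (a : α) (L : List α) :
    (∃ p q, [p, q].Sublist (a :: L) ∧ A p ∧ A q) ↔
      (A a ∧ ∃ q ∈ L, A q) ∨ ∃ p q, [p, q].Sublist L ∧ A p ∧ A q := by
  constructor
  · rintro ⟨p, q, hs, hp, hq⟩
    rcases List.sublist_cons_iff.mp hs with hs | ⟨r, hr, hs⟩
    · exact Or.inr ⟨p, q, hs, hp, hq⟩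
    · obtain ⟨rfl, rfl⟩ := List.cons.inj hr
      exact Or.inl ⟨hp, q, List.singleton_sublist.mp hs, hq⟩
  · rintro (⟨ha, q, hq, hA⟩ | ⟨p, q, hs, hp, hq⟩)
    · exact ⟨a, q, (List.singleton_sublist.mpr hq).cons_cons a, ha, hA⟩
    · exact ⟨p, q, hs.cons a, hp, hq⟩

lemma exists_pair_nil {α : Type*} (A : α → Prop) :
    (∃ p q, [p, q].Sublist ([] : List α) ∧ A p ∧ A q) ↔ False := by simp

/-- The linear form in `X, Y` that vanishes at `(s, t)`. -/
noncomputable def leftForm (s t : ℂ) : MvPolynomial (Fin 4) ℂ := C t * X 0 - C s * X 1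

/-- The linear form in `U, V` that vanishes at `(s, t)`. -/
noncomputable def rightForm (s t : ℂ) : MvPolynomial (Fin 4) ℂ := C t * X 2 - C s * X 3

lemma eval_leftForm (s t x y u v : ℂ) : eval ![x, y, u, v] (leftForm s t) = t * x - s * y := by simp [leftForm]

lemma eval_rightForm (s t x y u v : ℂ) : eval ![x, y, u, v] (rightForm s t) = t * u - s * v := by simp [rightForm]

lemma isBihomogeneous_leftForm (s t : ℂ) : IsBihomogeneous (leftForm s t) 1 0 :=
  isBihomogeneous_of_eval fun a b x y u v => by simp only [eval_leftForm]; ring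

lemma isBihomogeneous_rightForm (s t : ℂ) : IsBihomogeneous (rightForm s t) 0 1 :=
  isBihomogeneous_of_eval fun a b x y u v => by simp only [eval_rightForm]; ring

lemma conjPoly_leftForm (s t : ℂ) :
    conjPoly (leftForm s t) = leftForm ((starRingEnd ℂ) s) ((starRingEnd ℂ) t) := by
  simp [conjPoly, leftForm]

lemma conjPoly_rightForm (s t : ℂ) :
    conjPoly (rightForm s t) = rightForm ((starRingEnd ℂ) s) ((starRingEnd ℂ) t) := by
  simp [conjPoly, rightForm]

lemma irreducible_leftForm {s t : ℂ} (h : s ≠ 0 ∨ t ≠ 0) : Irreducible (leftForm s t) := by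
  refine irreducible_linear_left (isBihomogeneous_leftForm s t) fun h0 => ?_
  have h1 := eval_leftForm s t 1 0 0 0
  have h2 := eval_leftForm s t 0 1 0 0
  rw [h0] at h1 h2
  simp [eq_comm] at h1 h2
  simp [h1, h2] at h

lemma irreducible_rightForm {s t : ℂ} (h : s ≠ 0 ∨ t ≠ 0) : Irreducible (rightForm s t) := by
  refine irreducible_linear_right (isBihomogeneous_rightForm s t) fun h0 => ?_
  have h1 := eval_rightForm s t 0 0 1 0
  have h2 := eval_rightForm s t 0 0 0 1
  rw [h0] at h1 h2
  simp [eq_comm] at h1 h2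
  simp [h1, h2] at h

namespace SpinCoord

variable {C : SpinCoord} {Q : Pt} {m h : Fin 2 → ℂ}

lemma Rep.mem_crossings (R : C.Rep Q m h) {l : List (Block × MvPolynomial (Fin 4) ℂ)}
    (hl : ∀ x ∈ l, x.1.Admits x.2) : Q ∈ crossings (C.pushList l) ↔
      ∃ p q, [p, q].Sublist (components l) ∧ eval ![m 0, m 1, h 0, h 1] p = 0 ∧ eval ![m 0, m 1, h 0, h 1] q = 0 := by
  have hb : ∀ p ∈ components l, (Q ∈ zeros (C.push p) ↔ eval ![m 0, m 1, h 0, h 1] p = 0) := by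
    intro p hp
    obtain ⟨x, hx, hpx⟩ := List.mem_flatMap.mp hp
    obtain ⟨r, s, hrs⟩ := (hl x hx).isBihomogeneous hpx
    exact R.mem_zeros hrs
  rw [crossings, components_pushList]
  constructor
  · rintro ⟨p, q, hs, hp, hq⟩
    obtain ⟨L, hL, he⟩ := List.sublist_map_iff.mp hs
    obtain ⟨p, L, rfl, rfl, he'⟩ := List.map_eq_cons_iff.mp he.symm
    obtain ⟨q, L, rfl, rfl, he''⟩ := List.map_eq_cons_iff.mp he'
    obtain rfl := List.map_eq_nil_iff.mp he''
    exact ⟨p, q, hL, (hb p (hL.subset (by simp))).mp hp, (hb q (hL.subset (by simp))).mp hq⟩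
  · rintro ⟨p, q, hs, hp, hq⟩
    exact ⟨C.push p, C.push q, hs.map C.push, (hb p (hs.subset (by simp))).mpr hp,
      (hb q (hs.subset (by simp))).mpr hq⟩

/-- The tangents of a node at which exactly two components meet. -/
lemma Rep.tangentsFromComponents (R : C.Rep Q m h) {l : List (Block × MvPolynomial (Fin 4) ℂ)}
    (hl : ∀ x ∈ l, x.1.Admits x.2) {a b r : MvPolynomial (Fin 4) ℂ} (ha : a ∈ components l) (hb : b ∈ components l)
    {P : MvPolynomial (Fin 4) ℂ} (hP : P = a * b * r) {i j : ℕ} (hr : IsBihomogeneous r i j)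
    (ha0 : eval ![m 0, m 1, h 0, h 1] a = 0) (hb0 : eval ![m 0, m 1, h 0, h 1] b = 0)
    (hr0 : eval ![m 0, m 1, h 0, h 1] r ≠ 0)
    (honly : ∀ p ∈ components l, eval ![m 0, m 1, h 0, h 1] p = 0 → p = a ∨ p = b) :
    TangentsFromComponents (C.push P) (C.pushList l) Q := by
  have hbi : ∀ p ∈ components l, (Q ∈ zeros (C.push p) ↔ eval ![m 0, m 1, h 0, h 1] p = 0) := by
    intro p hp
    obtain ⟨x, hx, hpx⟩ := List.mem_flatMap.mp hp
    obtain ⟨r, s, hrs⟩ := (hl x hx).isBihomogeneous hpx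
    exact R.mem_zeros hrs
  intro f σ τ
  have zero : ∀ p, Q ∈ zeros p → lineCoeff p f σ τ 0 = 0 := by
    intro p hp
    rw [lineCoeff_zero]
    exact hp _ (by rw [f.span_μ]; exact Submodule.mem_span_singleton_self _) _
      (by rw [f.span_η]; exact Submodule.mem_span_singleton_self _)
  have za := zero _ ((hbi a ha).mpr ha0)
  have zb := zero _ ((hbi b hb).mpr hb0)
  have zr : lineCoeff (C.push r) f σ τ 0 ≠ 0 := by
    rw [lineCoeff_zero]
    intro hz
    exact hr0 ((R.mem_zeros hr).mp ((mem_zeros_iff (isBihomogeneous_push hr) f.span_μ f.span_η).mpr hz))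
  have e : lineCoeff (C.push P) f σ τ 2 =
      lineCoeff (C.push a) f σ τ 1 * lineCoeff (C.push b) f σ τ 1 * lineCoeff (C.push r) f σ τ 0 := by
    simp [hP, map_mul, lineCoeff_mul, Finset.Nat.antidiagonal_succ, za, zb]
  rw [e, mul_eq_zero, or_iff_left zr, mul_eq_zero, components_pushList]
  constructor
  · rintro (h1 | h1)
    · exact ⟨_, List.mem_map_of_mem ha, (hbi a ha).mpr ha0, h1⟩
    · exact ⟨_, List.mem_map_of_mem hb, (hbi b hb).mpr hb0, h1⟩
  · rintro ⟨p, hp, hQ, h1⟩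
    obtain ⟨p, hp', rfl⟩ := List.mem_map.mp hp
    rcases honly p hp' ((hbi p hp').mp hQ) with rfl | rfl
    · exact Or.inl h1
    · exact Or.inr h1

/-! ### Points and lines in spinor coordinates -/

lemma CoordBasis.mem_pt_iff_rep {D : Fin 4 → Fin 4 → ℝ} {k : (Fin 2 → ℂ) → (Fin 2 → ℂ) → Fin 4 → ℂ}
    (H : CoordBasis C D k) (hm : m ≠ 0) (hh : h ≠ 0) {w : Fin 4 → ℂ} {c : ℂ} (hc : c ≠ 0)
    (hw : c • w = ∑ i, k m h i • cvec (D i)) (Q : Pt) : Q ∈ pt w ↔ C.Rep Q m h := by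
  obtain ⟨r, hr, he⟩ := H.eq
  have hL : C.left m h ≠ 0 := by
    rw [left]; split_ifs
    · exact snd_ne_zero hh
    · exact fst_ne_zero hm
  have hR : C.right m h ≠ 0 := by
    rw [right]; split_ifs
    · exact fst_ne_zero hm
    · exact snd_ne_zero hh
  have hpt : pt w = pt (dyad (C.left m h) (C.right m h)) := by
    rw [he, ← hw, smul_smul, pt, pt, Submodule.span_singleton_smul_eq (IsUnit.mk0 _ (mul_ne_zero hr hc))]
  rw [hpt]
  constructor
  · intro hQ
    obtain ⟨Q₀, h1, h2⟩ := exists_point hL hR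
    rw [pt_dyad hL hR h1 h2, Set.mem_singleton_iff] at hQ
    subst hQ
    exact ⟨hm, hh, h1, h2⟩
  · intro R
    rw [pt_dyad hL hR R.2.2.1 R.2.2.2]
    rfl

lemma ne_zero_left {x y : ℂ} (hx : x ≠ 0) : (![x, y] : Fin 2 → ℂ) ≠ 0 := fun h => hx (congrFun h 0)

lemma ne_zero_right {x y : ℂ} (hy : y ≠ 0) : (![x, y] : Fin 2 → ℂ) ≠ 0 := fun h => hy (congrFun h 1)

lemma zeros_push {q : MvPolynomial (Fin 4) ℂ} {r s : ℕ} (hq : IsBihomogeneous q r s) {S : Set Pt}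
    (H : ∀ Q m h, C.Rep Q m h → (eval ![m 0, m 1, h 0, h 1] q = 0 ↔ Q ∈ S)) : zeros (C.push q) = S := by
  ext Q
  obtain ⟨m, h, R⟩ := exists_rep C Q
  rw [R.mem_zeros hq, H Q m h R]

lemma isBihomogeneous_fourth : IsBihomogeneous (X 3) 0 1 :=
  isBihomogeneous_of_eval fun a b x y u v => by simp

lemma zeros_fourth : zeros (C.push (X 3)) = linePts (cvec (C.E 0)) (cvec (C.E 1)) := by
  refine zeros_push isBihomogeneous_fourth fun Q m h R => ?_
  rw [coordBasis_E.mem_linePts R ![1, 0, 0, 0] ![0, 1, 0, 0] (by simp [Fin.sum_univ_four])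
    (by simp [Fin.sum_univ_four])]
  simp only [eval_X, Matrix.cons_val]
  constructor
  · intro hz
    exact ⟨m 0 * h 0, m 1 * h 0, fun i => by fin_cases i <;> simp [nullCoeffs, hz]⟩
  · rintro ⟨c, c', hk⟩
    have h2 := hk 2
    have h3 := hk 3
    simp [nullCoeffs] at h2 h3
    rcases R.ne_fst with hm | hm
    · simpa [hm] using h3
    · simpa [hm] using h2

lemma zeros_left {s t : ℂ} (hst : s ≠ 0 ∨ t ≠ 0) {w w' : Fin 4 → ℂ} {c : ℂ} (hc : c ≠ 0)
    (hw : w = s • cvec (C.E 0) + t • cvec (C.E 1)) (hw' : w' = (c * t) • cvec (C.E 2) - (c * s) • cvec (C.E 3)) :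
    zeros (C.push (leftForm s t)) = linePts w w' := by
  refine zeros_push (isBihomogeneous_leftForm s t) fun Q m h R => ?_
  rw [coordBasis_E.mem_linePts R ![s, t, 0, 0] ![0, 0, c * t, -(c * s)] (by simp [hw, Fin.sum_univ_four])
    (by simp [hw', Fin.sum_univ_four, sub_eq_add_neg])]
  rw [eval_leftForm]
  constructor
  · intro hz
    obtain ⟨e, e0, e1⟩ : ∃ e, m 0 = e * s ∧ m 1 = e * t := by
      rcases hst with hs | ht
      · exact ⟨m 0 / s, by field_simp, by field_simp; linear_combination -hz⟩
      · exact ⟨m 1 / t, by field_simp; linear_combination hz, by field_simp⟩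
    refine ⟨e * h 0, e * h 1 / c, fun i => ?_⟩
    fin_cases i <;> simp [nullCoeffs, e0, e1] <;> field_simp
  · rintro ⟨e, e', hk⟩
    have h0 := hk 0
    have h1 := hk 1
    have h2 := hk 2
    have h3 := hk 3
    simp [nullCoeffs] at h0 h1 h2 h3
    rcases R.ne_snd with hh | hh
    · have : (t * m 0 - s * m 1) * h 0 = 0 := by linear_combination t * h0 - s * h1
      simpa [hh] using this
    · have : (t * m 0 - s * m 1) * h 1 = 0 := by linear_combination t * h3 - s * h2
      simpa [hh] using this

/-! ### Points on a component `V = 0` -/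

lemma lineCoeff_fourth (R : C.Rep Q m ![1, 0]) (f : AdaptedFrame Q) : ∃ b : ℂ, b ≠ 0 ∧ ∀ σ τ,
    lineCoeff (C.push (X 3)) f (if C.sw then τ else σ) (if C.sw then σ else τ) 0 = 0 ∧
    lineCoeff (C.push (X 3)) f (if C.sw then τ else σ) (if C.sw then σ else τ) 1 = b * τ := by
  obtain ⟨n, hn⟩ := exists_eps_eq_one R.1
  obtain ⟨a, a', b, b', c, d, ha, ha', hb, hb', -, hl⟩ :=
    exists_line R (n := n) (t := ![0, 1]) (by simp [hn]) (by simp [eps]) f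
  refine ⟨b', hb', fun σ τ => ?_⟩
  obtain ⟨h0, h1, -⟩ := lineCoeff_of_quartic (q := C.push (X 3)) (f := f) 0 (b' * τ) 0 0 0
    fun s => by rw [hl (X 3) σ τ s]; simp
  exact ⟨h0, h1⟩

lemma isFold_fourth (R : C.Rep Q m ![1, 0]) : IsFold (C.push (X 3)) Q 1 := by
  intro f
  obtain ⟨b, hb, hl⟩ := lineCoeff_fourth R f
  constructor
  · intro σ τ k hk
    obtain rfl : k = 0 := by omega
    have := (hl (if C.sw then τ else σ) (if C.sw then σ else τ)).1
    cases hs : C.sw <;> simpa [hs] using this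
  · have := (hl 0 1).2
    exact ⟨_, _, by rw [this]; simpa using hb⟩

lemma isTangentAt_fourth (R : C.Rep Q m ![1, 0]) {q : MvPolynomial (Fin 4) ℂ} {k : ℕ} (hq : IsFold q Q k)
    (H : ∀ (f : AdaptedFrame Q) (σ : ℂ), lineCoeff q f (if C.sw then 0 else σ) (if C.sw then σ else 0) k = 0) :
    IsTangentAt (C.push (X 3)) q Q k := by
  refine ⟨isFold_fourth R, hq, fun f σ τ e => ?_⟩
  obtain ⟨b, hb, hl⟩ := lineCoeff_fourth R f
  cases hs : C.sw
  · have := (hl σ τ).2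
    simp only [hs, Bool.false_eq_true, if_false, e] at this
    have h0 : τ = 0 := by simpa [hb] using this.symm
    simpa [hs, h0] using H f σ
  · have := (hl τ σ).2
    simp only [hs, if_true, e] at this
    have h0 : σ = 0 := by simpa [hb] using this.symm
    simpa [hs, h0] using H f τ

lemma isTangentAt_fourth_two {n : Fin 2 → ℂ} {q : MvPolynomial (Fin 4) ℂ} {c₁₁ c₀₂ c₂₁ c₁₂ c₂₂ : ℂ}
    (R : C.Rep Q m ![1, 0]) (hn : eps m n ≠ 0)
    (H : DoubleAt q m n ![1, 0] ![0, 1] 0 c₁₁ c₀₂ c₂₁ c₁₂ c₂₂) (hc : c₁₁ ≠ 0 ∨ c₀₂ ≠ 0) :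
    IsTangentAt (C.push (X 3)) (C.push q) Q 2 := by
  have ht : eps (![1, 0] : Fin 2 → ℂ) ![0, 1] ≠ 0 := by simp [eps]
  refine isTangentAt_fourth R (isFold_two R hn ht H (Or.inr hc)) fun f σ => ?_
  obtain ⟨a, a', b, b', c, d, ha, ha', hb, hb', -, hl⟩ := exists_lineCoeff R hn ht H f
  rw [(hl σ 0).2.2.1]
  ring

lemma isTangentAt_fourth_three {n : Fin 2 → ℂ} {q : MvPolynomial (Fin 4) ℂ} {c₂₁ c₁₂ c₂₂ : ℂ}
    (R : C.Rep Q m ![1, 0]) (hn : eps m n ≠ 0)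
    (H : DoubleAt q m n ![1, 0] ![0, 1] 0 0 0 c₂₁ c₁₂ c₂₂) (hc : c₂₁ ≠ 0 ∨ c₁₂ ≠ 0) :
    IsTangentAt (C.push (X 3)) (C.push q) Q 3 := by
  have ht : eps (![1, 0] : Fin 2 → ℂ) ![0, 1] ≠ 0 := by simp [eps]
  refine isTangentAt_fourth R (isFold_three R hn ht H hc) fun f σ => ?_
  obtain ⟨a, a', b, b', c, d, ha, ha', hb, hb', -, hl⟩ := exists_lineCoeff R hn ht H f
  rw [(hl σ 0).2.2.2]
  ring

/-! ### Singular points -/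

lemma DoubleAt.mem_singularSet {q : MvPolynomial (Fin 4) ℂ} {n t : Fin 2 → ℂ} {c₂₀ c₁₁ c₀₂ c₂₁ c₁₂ c₂₂ : ℂ}
    (H : DoubleAt q m n h t c₂₀ c₁₁ c₀₂ c₂₁ c₁₂ c₂₂) (R : C.Rep Q m h) (hn : eps m n ≠ 0) (ht : eps h t ≠ 0) :
    Q ∈ singularSet (C.push q) := by
  intro f σ τ
  obtain ⟨a, a', b, b', c, d, -, -, -, -, -, hl⟩ := exists_lineCoeff R hn ht H f
  have := hl (if C.sw then τ else σ) (if C.sw then σ else τ)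
  cases hs : C.sw <;> simp [hs] at this <;> exact ⟨this.1, this.2.1⟩

end SpinCoord

/-- The product of two polynomials is singular at their common zeros. -/
lemma mem_singularSet_mul {p q : MvPolynomial (Fin 4) ℂ} {Q : Pt} (hp : Q ∈ zeros p) (hq : Q ∈ zeros q) :
    Q ∈ singularSet (p * q) := by
  intro f σ τ
  have zero : ∀ p, Q ∈ zeros p → lineCoeff p f σ τ 0 = 0 := by
    intro p hp
    rw [lineCoeff_zero]
    exact hp _ (by rw [f.span_μ]; exact Submodule.mem_span_singleton_self _) _
      (by rw [f.span_η]; exact Submodule.mem_span_singleton_self _)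
  simp [lineCoeff_mul, Finset.Nat.antidiagonal_succ, zero p hp, zero q hq]

/-- Two curves in `CP¹ × CP¹` whose bidegrees add up to `(2,2)` meet. -/
lemma exists_common_zero {f g : MvPolynomial (Fin 4) ℂ} {a b c d : ℕ} (hf : IsBihomogeneous f a b)
    (hg : IsBihomogeneous g c d) (hac : a + c = 2) (hbd : b + d = 2) (hf0 : a ≠ 0 ∨ b ≠ 0) (hg0 : c ≠ 0 ∨ d ≠ 0) :
    ∃ x y u v : ℂ, (x ≠ 0 ∨ y ≠ 0) ∧ (u ≠ 0 ∨ v ≠ 0) ∧ eval ![x, y, u, v] f = 0 ∧ eval ![x, y, u, v] g = 0 := by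
  have k1 : ∀ {f g : MvPolynomial (Fin 4) ℂ} {a c d : ℕ}, IsBihomogeneous f a 0 → IsBihomogeneous g c d → 0 < a → 0 < d →
      ∃ x y u v : ℂ, (x ≠ 0 ∨ y ≠ 0) ∧ (u ≠ 0 ∨ v ≠ 0) ∧ eval ![x, y, u, v] f = 0 ∧ eval ![x, y, u, v] g = 0 := by
    intro f g a c d hf hg ha hd
    obtain ⟨x, y, hxy, h1⟩ := hf.exists_zero_left ha 0 0
    obtain ⟨u, v, huv, h2⟩ := hg.exists_zero_right hd x y
    exact ⟨x, y, u, v, hxy, huv, by rw [hf.eval_left_const x y u v 0 0, h1], h2⟩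
  have k2 : ∀ {f g : MvPolynomial (Fin 4) ℂ} {b c d : ℕ}, IsBihomogeneous f 0 b → IsBihomogeneous g c d → 0 < b → 0 < c →
      ∃ x y u v : ℂ, (x ≠ 0 ∨ y ≠ 0) ∧ (u ≠ 0 ∨ v ≠ 0) ∧ eval ![x, y, u, v] f = 0 ∧ eval ![x, y, u, v] g = 0 := by
    intro f g b c d hf hg hb hc
    obtain ⟨u, v, huv, h1⟩ := hf.exists_zero_right hb 0 0
    obtain ⟨x, y, hxy, h2⟩ := hg.exists_zero_left hc u v
    exact ⟨x, y, u, v, hxy, huv, by rw [hf.eval_right_const x y u v 0 0, h1], h2⟩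
  have swap : (∃ x y u v : ℂ, (x ≠ 0 ∨ y ≠ 0) ∧ (u ≠ 0 ∨ v ≠ 0) ∧ eval ![x, y, u, v] g = 0 ∧ eval ![x, y, u, v] f = 0) →
      ∃ x y u v : ℂ, (x ≠ 0 ∨ y ≠ 0) ∧ (u ≠ 0 ∨ v ≠ 0) ∧ eval ![x, y, u, v] f = 0 ∧ eval ![x, y, u, v] g = 0 := by
    rintro ⟨x, y, u, v, h1, h2, h3, h4⟩
    exact ⟨x, y, u, v, h1, h2, h4, h3⟩
  rcases Nat.eq_zero_or_pos a with rfl | ha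
  · exact k2 hf hg (by omega) (by omega)
  rcases Nat.eq_zero_or_pos b with rfl | hb
  · exact k1 hf hg (by omega) (by omega)
  rcases Nat.eq_zero_or_pos c with rfl | hc
  · exact swap (k2 hg hf (by omega) (by omega))
  rcases Nat.eq_zero_or_pos d with rfl | hd
  · exact swap (k1 hg hf (by omega) (by omega))
  obtain ⟨rfl, rfl, rfl, rfl⟩ : a = 1 ∧ b = 1 ∧ c = 1 ∧ d = 1 := by omega
  obtain ⟨a, b, c, d, hf⟩ := hf.eval_one_one
  obtain ⟨a', b', c', d', hg⟩ := hg.eval_one_one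
  -- the resultant with respect to `X, Y` is a quadratic form in `U, V`
  obtain ⟨u, v, huv, h0⟩ := exists_zero_binary (n := 2) (by norm_num)
    (fun i => if i = 0 then a * c' - c * a' else if i = 1 then a * d' + b * c' - c * b' - d * a' else b * d' - d * b')
  simp [Finset.sum_range_succ] at h0
  have hdet : (a * u + b * v) * (c' * u + d' * v) - (c * u + d * v) * (a' * u + b' * v) = 0 := by
    linear_combination h0
  have fin : ∀ x y : ℂ, (a * u + b * v) * x + (c * u + d * v) * y = 0 →
      (a' * u + b' * v) * x + (c' * u + d' * v) * y = 0 → (x ≠ 0 ∨ y ≠ 0) →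
      ∃ x y u v : ℂ, (x ≠ 0 ∨ y ≠ 0) ∧ (u ≠ 0 ∨ v ≠ 0) ∧ eval ![x, y, u, v] f = 0 ∧ eval ![x, y, u, v] g = 0 := by
    intro x y e1 e2 hxy
    exact ⟨x, y, u, v, hxy, huv, by rw [hf]; linear_combination e1, by rw [hg]; linear_combination e2⟩
  by_cases h1 : c * u + d * v ≠ 0 ∨ a * u + b * v ≠ 0
  · exact fin (c * u + d * v) (-(a * u + b * v)) (by ring) (by linear_combination -hdet) (by rwa [neg_ne_zero])
  by_cases h2 : c' * u + d' * v ≠ 0 ∨ a' * u + b' * v ≠ 0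
  · exact fin (c' * u + d' * v) (-(a' * u + b' * v)) (by linear_combination hdet) (by ring) (by rwa [neg_ne_zero])
  push Not at h1 h2
  exact fin 1 0 (by simp [h1]) (by simp [h2]) (by simp)

lemma irreducible_of_singularSet_eq_empty {q : MvPolynomial (Fin 4) ℂ} (hq : IsBihomogeneous q 2 2)
    (hs : singularSet q = ∅) : Irreducible q := by
  refine irreducible_of_factors hq ?_ (by simp) fun f g a b c d hfg hac hbd hf hg hf0 hg0 => ?_
  · rintro rfl
    obtain ⟨Q, -, -⟩ := exists_point (ne_zero_of_eps (α := ![1, 0]) (β := ![0, 1]) (by simp [eps]))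
      (ne_zero_of_eps (α := ![1, 0]) (β := ![0, 1]) (by simp [eps]))
    exact (hs ▸ (fun f σ τ => by simp [lineCoeff]) : Q ∈ (∅ : Set Pt))
  · obtain ⟨x, y, u, v, hxy, huv, h1, h2⟩ := exists_common_zero hf hg hac hbd hf0 hg0
    have nz : ∀ x y : ℂ, (x ≠ 0 ∨ y ≠ 0) → ![x, y] ≠ 0 := by
      rintro x y (h | h) h0
      · exact h (congrFun h0 0)
      · exact h (congrFun h0 1)
    obtain ⟨Q, e1, e2⟩ := exists_point (nz x y hxy) (nz u v huv)
    have m1 : Q ∈ zeros f := (SpinCoord.mem_zeros_iff hf e1 e2).mpr h1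
    have m2 : Q ∈ zeros g := (SpinCoord.mem_zeros_iff hg e1 e2).mpr h2
    have := mem_singularSet_mul m1 m2
    rw [← hfg, hs] at this
    exact this

section RicciPoly

variable {Φ : (Fin 4 → ℝ) →ₗ[ℝ] (Fin 4 → ℝ)}

lemma isBihomogeneous_ricciPolyC : IsBihomogeneous (ricciPolyC Φ) 2 2 := by
  refine isBihomogeneous_of_eval fun a b x y u v => ?_
  have e1 : dyad ![a * x, a * y] ![b * u, b * v] = (a * b) • dyad ![x, y] ![u, v] := by
    rw [← smul_smul, ← dyad_smul_right, ← dyad_smul_left]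
    simp
  rw [eval_ricciPolyC, eval_ricciPolyC, e1, map_smul, s22_smul_left, s22_smul_right]
  ring

lemma conjPoly_ricciPolyC : conjPoly (ricciPolyC Φ) = ricciPolyC Φ := by
  rw [conjPoly, ricciPolyC, map_map]
  congr 2
  ext
  simp

/-- The type `(2,2)`. -/
lemma isSpinorFactorization_of_irreducible (h : Irreducible (ricciPolyC Φ)) :
    ∃ q, IsSpinorFactorization Φ [(.real 2 2, q)] := by
  refine ⟨ricciPolyC Φ, ?_, ?_, 1, one_ne_zero, ?_⟩
  · intro x hx
    rw [List.mem_singleton.mp hx]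
    exact ⟨h, isBihomogeneous_ricciPolyC, conjPoly_ricciPolyC⟩
  · simp [components, Block.parts]
  · simp [Block.value]

end RicciPoly

end NeutralRicci

namespace NeutralRicci

open MvPolynomial

variable {Φ : (Fin 4 → ℝ) →ₗ[ℝ] (Fin 4 → ℝ)}

lemma IsWitt.trace_eq {E : Fin 4 → Fin 4 → ℝ} (hE : IsWitt E) {M : Matrix (Fin 4) (Fin 4) ℝ} (hM : HasMatrix Φ E M)
    (htr : LinearMap.trace ℝ (Fin 4 → ℝ) Φ = 0) : M 0 0 + M 1 1 + M 2 2 + M 3 3 = 0 := by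
  obtain ⟨b, hb, -⟩ := exists_basis_of_dual hE.dual
  rw [← trace_eq_of_hasMatrix b hb hM, htr]

lemma IsPsiON.trace_eq {B : Fin 4 → Fin 4 → ℝ} (hB : IsPsiON B) {M : Matrix (Fin 4) (Fin 4) ℝ} (hM : HasMatrix Φ B M)
    (htr : LinearMap.trace ℝ (Fin 4 → ℝ) Φ = 0) : M 0 0 + M 1 1 + M 2 2 + M 3 3 = 0 := by
  have := hB.toWitt.trace_eq hM.toWitt htr
  simp [psiToWitt, Fin.sum_univ_four] at this
  linarith

namespace SpinCoord

variable {C : SpinCoord} {Q : Pt} {m h : Fin 2 → ℂ}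

lemma Rep.coords_ne_zero (R : C.Rep Q m h) : ¬ (m 0 * h 0 = 0 ∧ m 1 * h 0 = 0 ∧ m 1 * h 1 = 0 ∧ m 0 * h 1 = 0) := by
  rintro ⟨h0, h1, h2, h3⟩
  rcases R.ne_fst with hm | hm <;> rcases R.ne_snd with hh | hh
  · exact mul_ne_zero hm hh h0
  · exact mul_ne_zero hm hh h3
  · exact mul_ne_zero hm hh h1
  · exact mul_ne_zero hm hh h2

lemma Rep.eps_eq (R : C.Rep Q m h) {m' h' : Fin 2 → ℂ} (R' : C.Rep Q m' h') :
    m' 0 * m 1 = m' 1 * m 0 ∧ h' 0 * h 1 = h' 1 * h 0 := by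
  have e1 : C.left m h ∈ Submodule.span ℂ {C.left m' h'} := by
    rw [← R'.2.2.1, R.2.2.1]; exact Submodule.mem_span_singleton_self _
  have e2 : C.right m h ∈ Submodule.span ℂ {C.right m' h'} := by
    rw [← R'.2.2.2, R.2.2.2]; exact Submodule.mem_span_singleton_self _
  have f1 : C.fst m ∈ Submodule.span ℂ {C.fst m'} → m' 0 * m 1 = m' 1 * m 0 := by
    intro hm
    obtain ⟨a, ha⟩ := Submodule.mem_span_singleton.mp hm
    have : eps (C.fst m') (C.fst m) = 0 := by rw [← ha, eps_smul_right, eps_self, mul_zero]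
    rw [eps_fst, mul_eq_zero, or_iff_left neC] at this
    simp only [eps] at this
    linear_combination this
  have f2 : C.snd h ∈ Submodule.span ℂ {C.snd h'} → h' 0 * h 1 = h' 1 * h 0 := by
    intro hm
    obtain ⟨a, ha⟩ := Submodule.mem_span_singleton.mp hm
    have : eps (C.snd h') (C.snd h) = 0 := by rw [← ha, eps_smul_right, eps_self, mul_zero]
    rw [eps_snd, mul_eq_zero, or_iff_left neC'] at this
    simp only [eps] at this
    linear_combination this
  simp only [left, right] at e1 e2
  split_ifs at e1 e2
  · exact ⟨f1 e2, f2 e1⟩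
  · exact ⟨f1 e1, f2 e2⟩

/-- Two pairs of coordinates describe the same point iff they are proportional. -/
lemma Rep.iff (R : C.Rep Q m h) {m' h' : Fin 2 → ℂ} (hm' : m' ≠ 0) (hh' : h' ≠ 0) :
    C.Rep Q m' h' ↔ m' 0 * m 1 = m' 1 * m 0 ∧ h' 0 * h 1 = h' 1 * h 0 :=
  ⟨fun R' => R.eps_eq R', fun e => R.of_eps hm' hh' e.1 e.2⟩

end SpinCoord

open SpinCoord

/-! ### Type I -/

/-- Near `⟨E₁⟩` the polynomial is `v (ε v + 2 y²)`: the component of bidegree `(2, 1)` touches the line `v = 0`. -/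
theorem type_I (hsa : ∀ u v, s22 (Φ u) v = s22 u (Φ v)) (htr : LinearMap.trace ℝ (Fin 4 → ℝ) Φ = 0)
    (κ : OType) (E : Fin 4 → Fin 4 → ℝ) (ε lam : ℝ) (hE : IsWitt E) (hκ : HasOType (toPsiON E) κ)
    (hε : ε = 1 ∨ ε = -1) (hM : HasMatrix Φ E !![lam, 1, 0, 0; 0, lam, 0, ε; 0, 0, lam, 0; 0, 0, 1, lam]) :
    lam = 0 ∧
      HasSpinorForm Φ κ E
        (fun o ι o' ι' A B A' B' => ε * dbl ι A B * dbl o' A' B' - dbl o A B * mix o' ι' A' B')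
        (fun X Y U V => ε • (X ^ 2 * V ^ 2) + 2 * U * V * Y ^ 2) ∧
      singularSet (ricciPolyC Φ) = pt (cvec (E 0)) ∧
      ∃ q m, IsSpinorFactorization Φ [(κ.tw (.real 2 1), q), (κ.tw (.real 0 1), m)] ∧
        crossings [(κ.tw (.real 2 1), q), (κ.tw (.real 0 1), m)] = pt (cvec (E 0)) ∧
        zeros m = linePts (cvec (E 0)) (cvec (E 1)) ∧
        ∀ Q ∈ pt (cvec (E 0)), IsRealPt Q ∧ IsTacnode (ricciPolyC Φ) Q ∧ IsTangentAt m q Q 1 := by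
  have hl0 : lam = 0 := by
    have := hE.trace_eq hM htr
    simp at this
    linarith
  subst hl0
  refine ⟨rfl, hasSpinorForm_of_matrix hE hM ?_ ?_, ?_⟩
  · intro a b a' b' A B A' B'
    simp [Fin.sum_univ_four, wittSpinor, dbl, mix]
    ring
  · intro X Y U V
    simp [Fin.sum_univ_four, wittForm, smul_eq_C_mul]
    ring
  obtain ⟨C, rfl, hs, htw⟩ := exists_of_hasOType hE hκ
  have hε0 : (ε : ℂ) ≠ 0 := by rcases hε with rfl | rfl <;> simp
  set q : MvPolynomial (Fin 4) ℂ := MvPolynomial.C (ε : ℂ) * (X 0 ^ 2 * X 3) + MvPolynomial.C 2 * (X 2 * X 1 ^ 2) with hq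
  have hqe : ∀ x y u v, eval ![x, y, u, v] q = ε * (x ^ 2 * v) + 2 * (u * y ^ 2) := fun x y u v => by simp [hq]
  have hP : ricciPolyC Φ = C.push (q * X 3) := by
    refine ricciPolyC_eq_push hM fun m h => ?_
    simp [nullCoeffs, Fin.sum_univ_four, hs, hqe]
    ring
  have hqb : IsBihomogeneous q 2 1 := isBihomogeneous_of_eval fun a b x y u v => by simp only [hqe]; ring
  have hqi : Irreducible q := by
    refine irreducible_of_bidegree_two_one hqb (fun x y hxy => ?_) fun u v huv => ?_
    · rcases hxy with hx | hy
      · exact ⟨0, 1, by simp [hqe, hε0, hx]⟩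
      · exact ⟨1, 0, by simp [hqe, hy]⟩
    · rcases huv with hu | hv
      · exact ⟨0, 1, by simp [hqe, hu]⟩
      · exact ⟨1, 0, by simp [hqe, hε0, hv]⟩
  have hl : IsBlockFactorization (q * X 3) [(.real 2 1, q), (.real 0 1, X 3)] := by
    refine ⟨?_, ?_, 1, one_ne_zero, by simp [Block.value]⟩
    · simp only [List.forall_mem_cons, Block.Admits]
      exact ⟨⟨hqi, hqb, by simp [conjPoly, hq, map_ofNat]⟩, ⟨irreducible_linear_right isBihomogeneous_fourth (X_ne_zero 3),
        isBihomogeneous_fourth, by simp [conjPoly]⟩, by simp⟩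
    · simp only [components, Block.parts, List.flatMap_cons, List.flatMap_nil, List.cons_append, List.nil_append,
        List.append_nil, List.pairwise_pair]
      exact not_associated_of_eval ![0, 1, 0, 1] (by simp [hqe]) (by simp)
  have hpt : ∀ Q, Q ∈ pt (cvec (C.E 0)) ↔ C.Rep Q ![1, 0] ![1, 0] :=
    coordBasis_E.mem_pt_iff_rep (ne_zero_left one_ne_zero) (ne_zero_left one_ne_zero) one_ne_zero
      (by simp [Fin.sum_univ_four, nullCoeffs])
  have heps : eps (![1, 0] : Fin 2 → ℂ) ![0, 1] ≠ 0 := by simp [eps]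
  have hd : DoubleAt (q * X 3) ![1, 0] ![0, 1] ![1, 0] ![0, 1] (ε * 0 ^ 2) (2 * ε * 0 * 1) (ε * 1 ^ 2) 2 0 0 := by
    intro x y u v
    simp [hqe]
    ring
  have hL : C.pushList [(.real 2 1, q), (.real 0 1, X 3)] =
      [(κ.tw (.real 2 1), C.push q), (κ.tw (.real 0 1), C.push (X 3))] := by simp [pushList, htw]
  refine ⟨?_, C.push q, C.push (X 3), hL ▸ isSpinorFactorization hP hl, ?_, zeros_fourth, ?_⟩
  · ext Q
    rw [hpt]
    constructor
    · intro hQ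
      obtain ⟨m, h, R⟩ := exists_rep C Q
      obtain ⟨χ, hχ⟩ := (coordBasis_E.mem_singularSet hsa hM R).mp hQ
      have e0 := hχ 0
      have e1 := hχ 1
      have e2 := hχ 2
      have e3 := hχ 3
      simp [Fin.sum_univ_four, nullCoeffs] at e0 e1 e2 e3
      have := R.coords_ne_zero
      have := R.ne_fst
      have := R.ne_snd
      obtain ⟨hm, hh⟩ : m 1 = 0 ∧ h 1 = 0 := by grind
      exact R.of_eps (ne_zero_left one_ne_zero) (ne_zero_left one_ne_zero) (by simp [hm]) (by simp [hh])
    · intro R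
      rw [hP]
      exact hd.mem_singularSet R heps heps
  · ext Q
    rw [hpt, ← hL]
    obtain ⟨m, h, R⟩ := exists_rep C Q
    rw [R.mem_crossings hl.1]
    simp [components, Block.parts, exists_pair_cons, hqe]
    constructor
    · rintro ⟨h1, h2⟩
      have := R.ne_snd
      exact R.of_eps (ne_zero_left one_ne_zero) (ne_zero_left one_ne_zero) (by simp; grind) (by simp [h2])
    · intro R'
      have := R.eps_eq R'
      simp at this
      simp [this]
  · intro Q hQ
    have R := (hpt Q).mp hQ
    have R' : C.Rep Q (cvec ![1, 0]) (cvec ![1, 0]) := by convert R <;> ext i <;> fin_cases i <;> simp [cvec]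
    refine ⟨isRealPt R', ?_, ?_⟩
    · rw [hP]
      exact isTacnode R heps heps hd hε0 (by simp) (by simp)
    -- in every chart the linear part of the other factor is a multiple of `τ`, so that it touches the line `τ = 0`
    · have hfold : ∀ f : AdaptedFrame Q, ∃ k : ℂ, k ≠ 0 ∧ ∀ σ τ,
          lineCoeff (C.push q) f (if C.sw then τ else σ) (if C.sw then σ else τ) 0 = 0 ∧
          lineCoeff (C.push q) f (if C.sw then τ else σ) (if C.sw then σ else τ) 1 = k * τ := by
        intro f
        obtain ⟨a, a', b, b', c, d, ha, ha', hb, hb', -, hl⟩ := exists_line R heps heps f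
        refine ⟨ε * a ^ 2 * b', by simp [hε0, ha, hb'], fun σ τ => ?_⟩
        obtain ⟨h0, h1, -⟩ := lineCoeff_of_quartic (q := C.push q) (f := f) 0 (ε * a ^ 2 * b' * τ)
          (2 * ε * a * c * σ * b' * τ + 2 * b * (a' * σ) ^ 2) (ε * (c * σ) ^ 2 * b' * τ + 2 * d * τ * (a' * σ) ^ 2) 0
          fun s => by rw [hl q σ τ s]; simp [hqe]; ring
        exact ⟨h0, h1⟩
      refine isTangentAt_fourth R (fun f => ?_) fun f σ => ?_
      · obtain ⟨k, hk, hl⟩ := hfold f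
        refine ⟨fun σ τ j hj => ?_, _, _, by rw [(hl 0 1).2]; simpa using hk⟩
        obtain rfl : j = 0 := by omega
        have := (hl (if C.sw then τ else σ) (if C.sw then σ else τ)).1
        cases hs : C.sw <;> simpa [hs] using this
      · obtain ⟨k, hk, hl⟩ := hfold f
        rw [(hl σ 0).2, mul_zero]

end NeutralRicci

namespace NeutralRicci

open MvPolynomial

open SpinCoord

variable {Φ : (Fin 4 → ℝ) →ₗ[ℝ] (Fin 4 → ℝ)}

lemma isBlockFactorization_mul_fourth {q : MvPolynomial (Fin 4) ℂ} (hqb : IsBihomogeneous q 2 1) (hqi : Irreducible q)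
    (hqc : conjPoly q = q) {x y : ℂ} (hq : eval ![x, y, 1, 0] q ≠ 0) :
    IsBlockFactorization (q * X 3) [(.real 2 1, q), (.real 0 1, X 3)] := by
  refine ⟨?_, ?_, 1, one_ne_zero, by simp [Block.value]⟩
  · simp only [List.forall_mem_cons, Block.Admits]
    exact ⟨⟨hqi, hqb, hqc⟩, ⟨irreducible_linear_right isBihomogeneous_fourth (X_ne_zero 3),
      isBihomogeneous_fourth, by simp [conjPoly]⟩, by simp⟩
  · simp only [components, Block.parts, List.flatMap_cons, List.flatMap_nil, List.cons_append, List.nil_append,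
      List.append_nil, List.pairwise_pair]
    exact fun ha => not_associated_of_eval ![x, y, 1, 0] (by simp) hq ha.symm

lemma eps_one_zero : eps (![1, 0] : Fin 2 → ℂ) ![0, 1] ≠ 0 := by simp [eps]

lemma sq_add_sq_eq_zero {x y : ℂ} (h : x ^ 2 + y ^ 2 = 0) : y = Complex.I * x ∨ y = -Complex.I * x := by
  have : (y - Complex.I * x) * (y + Complex.I * x) = 0 := by linear_combination h - x ^ 2 * Complex.I_sq
  rcases mul_eq_zero.mp this with e | e
  · exact Or.inl (by linear_combination e)
  · exact Or.inr (by linear_combination e)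

/-! ### Type II -/

/-- On the line `V = 0` the factor of bidegree `(2, 1)` is `2 b U (X² + Y²)`; its zeros there are the two nodes. -/
theorem type_II (hsa : ∀ u v, s22 (Φ u) v = s22 u (Φ v)) (htr : LinearMap.trace ℝ (Fin 4 → ℝ) Φ = 0)
    (κ : OType) (E : Fin 4 → Fin 4 → ℝ) (a b : ℝ) (hE : IsWitt E) (hκ : HasOType (toPsiON E) κ)
    (hb0 : b ≠ 0) (hM : HasMatrix Φ E !![a, b, 1, 0; -b, a, 0, -1; 0, 0, a, -b; 0, 0, b, a]) :
      a = 0 ∧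
      HasSpinorForm Φ κ E
        (fun o ι o' ι' A B A' B' => (dbl o A B - dbl ι A B) * dbl o' A' B' -
          b * (dbl o A B + dbl ι A B) * mix o' ι' A' B')
        (fun X Y U V => (X ^ 2 * ((2 * b) • U - V) + Y ^ 2 * ((2 * b) • U + V)) * V) ∧
      singularSet (ricciPolyC Φ) =
        pt (cvec (E 0) + Complex.I • cvec (E 1)) ∪ pt (cvec (E 0) - Complex.I • cvec (E 1)) ∧
      ∃ q m, IsSpinorFactorization Φ [(κ.tw (.real 2 1), q), (κ.tw (.real 0 1), m)] ∧
        crossings [(κ.tw (.real 2 1), q), (κ.tw (.real 0 1), m)] = singularSet (ricciPolyC Φ) ∧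
        zeros m = linePts (cvec (E 0)) (cvec (E 1)) ∧
        ∀ Q ∈ singularSet (ricciPolyC Φ), IsComplexNode (ricciPolyC Φ) Q ∧ IsTangentAt m (ricciPolyC Φ) Q 2 ∧
          TangentsFromComponents (ricciPolyC Φ) [(κ.tw (.real 2 1), q), (κ.tw (.real 0 1), m)] Q := by
  have ha0 : a = 0 := by
    have := hE.trace_eq hM htr
    simp at this
    linarith
  subst ha0
  refine ⟨rfl, hasSpinorForm_of_matrix hE hM ?_ ?_, ?_⟩
  · intro a b a' b' A B A' B'
    simp [Fin.sum_univ_four, wittSpinor, dbl, mix]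
    ring
  · intro X Y U V
    simp [Fin.sum_univ_four, wittForm, smul_eq_C_mul, map_ofNat]
    ring
  obtain ⟨C, rfl, hs, htw⟩ := exists_of_hasOType hE hκ
  have hb : (b : ℂ) ≠ 0 := by exact_mod_cast hb0
  set q : MvPolynomial (Fin 4) ℂ := X 0 ^ 2 * (MvPolynomial.C (2 * (b : ℂ)) * X 2 - X 3) +
    X 1 ^ 2 * (MvPolynomial.C (2 * (b : ℂ)) * X 2 + X 3) with hq
  have hqe : ∀ x y u v, eval ![x, y, u, v] q = x ^ 2 * (2 * b * u - v) + y ^ 2 * (2 * b * u + v) :=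
    fun x y u v => by simp [hq]
  have hP : ricciPolyC Φ = C.push (q * X 3) := by
    refine ricciPolyC_eq_push hM fun m h => ?_
    simp [nullCoeffs, Fin.sum_univ_four, hs, hqe]
    ring
  have hqb : IsBihomogeneous q 2 1 := isBihomogeneous_of_eval fun a b x y u v => by simp only [hqe]; ring
  have hqi : Irreducible q := by
    refine irreducible_of_bidegree_two_one hqb (fun x y hxy => ?_) fun u v huv => ?_
    · by_contra! hz
      have h1 := hz 1 0
      have h2 := hz 0 1
      rw [hqe] at h1 h2
      have h1' : (b : ℂ) * (x ^ 2 + y ^ 2) = 0 := by linear_combination h1 / 2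
      have h3 : x ^ 2 + y ^ 2 = 0 := by simpa [hb] using h1'
      have h4 : x ^ 2 = 0 := by linear_combination (h3 - h2) / 2
      have h5 : y ^ 2 = 0 := by linear_combination (h3 + h2) / 2
      simp at h4 h5
      simp [h4, h5] at hxy
    · by_contra! hz
      have h1 := hz 1 0
      have h2 := hz 0 1
      rw [hqe] at h1 h2
      have h3 : v = 0 := by linear_combination (h2 - h1) / 2
      have h4 : (b : ℂ) * u = 0 := by linear_combination (h1 + h2) / 4
      simp [hb] at h4
      simp [h3, h4] at huv
  have hl := isBlockFactorization_mul_fourth (x := 1) (y := 0) hqb hqi (by simp [conjPoly, hq, map_ofNat])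
    (by simp [hqe, hb])
  have hpt1 : ∀ Q, Q ∈ pt (cvec (C.E 0) + Complex.I • cvec (C.E 1)) ↔ C.Rep Q ![1, Complex.I] ![1, 0] :=
    coordBasis_E.mem_pt_iff_rep (ne_zero_left one_ne_zero) (ne_zero_left one_ne_zero) one_ne_zero
      (by simp [Fin.sum_univ_four, nullCoeffs])
  have hpt2 : ∀ Q, Q ∈ pt (cvec (C.E 0) - Complex.I • cvec (C.E 1)) ↔ C.Rep Q ![1, -Complex.I] ![1, 0] :=
    coordBasis_E.mem_pt_iff_rep (ne_zero_left one_ne_zero) (ne_zero_left one_ne_zero) one_ne_zero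
      (by simp [Fin.sum_univ_four, nullCoeffs, sub_eq_add_neg])
  have heps : ∀ s : ℂ, eps ![1, s] ![0, 1] ≠ 0 := fun s => by simp [eps]
  -- expansion at the points with `Y = ± i X`, `V = 0`; both signs are covered by `s`
  have hd : ∀ s : ℂ, s ^ 2 = -1 →
      DoubleAt (q * X 3) ![1, s] ![0, 1] ![1, 0] ![0, 1] 0 (4 * b * s) (-2) (2 * b) (2 * s) 1 := by
    intro s hs x y u v
    simp [hqe]
    linear_combination (x ^ 2 * (2 * b * u + v) * v) * hs
  have hL : C.pushList [(.real 2 1, q), (.real 0 1, X 3)] =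
      [(κ.tw (.real 2 1), C.push q), (κ.tw (.real 0 1), C.push (X 3))] := by simp [pushList, htw]
  have hsing : singularSet (ricciPolyC Φ) =
      pt (cvec (C.E 0) + Complex.I • cvec (C.E 1)) ∪ pt (cvec (C.E 0) - Complex.I • cvec (C.E 1)) := by
    ext Q
    rw [Set.mem_union, hpt1, hpt2]
    constructor
    · intro hQ
      obtain ⟨m, h, R⟩ := exists_rep C Q
      obtain ⟨χ, hχ⟩ := (coordBasis_E.mem_singularSet hsa hM R).mp hQ
      have e0 := hχ 0
      have e1 := hχ 1
      have e2 := hχ 2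
      have e3 := hχ 3
      rw [R.iff (ne_zero_left one_ne_zero) (ne_zero_left one_ne_zero),
        R.iff (ne_zero_left one_ne_zero) (ne_zero_left one_ne_zero)]
      simp [Fin.sum_univ_four, nullCoeffs] at e0 e1 e2 e3 ⊢
      have hm := R.ne_fst
      have hh := R.ne_snd
      clear hL hd hpt1 hpt2 hl hqi hqb hP hqe hχ hQ
      have hv : h 1 = 0 := by grind
      have hu : h 0 ≠ 0 := by simpa [hv] using hh
      have := sq_add_sq_eq_zero (x := m 0) (y := m 1) (by grind)
      simpa [hv] using this
    · rw [hP]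
      rintro (R | R)
      · exact (hd Complex.I Complex.I_sq).mem_singularSet R (heps _) eps_one_zero
      · exact (hd (-Complex.I) (by simp)).mem_singularSet R (heps _) eps_one_zero
  refine ⟨hsing, C.push q, C.push (X 3), hL ▸ isSpinorFactorization hP hl, ?_, zeros_fourth, ?_⟩
  · rw [hsing]
    ext Q
    rw [Set.mem_union, hpt1, hpt2, ← hL]
    obtain ⟨m, h, R⟩ := exists_rep C Q
    rw [R.mem_crossings hl.1, R.iff (ne_zero_left one_ne_zero) (ne_zero_left one_ne_zero),
        R.iff (ne_zero_left one_ne_zero) (ne_zero_left one_ne_zero)]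
    simp [components, Block.parts, exists_pair_cons, hqe]
    constructor
    · rintro ⟨h1, h2⟩
      have hh := R.ne_snd
      have hu : h 0 ≠ 0 := by simpa [h2] using hh
      have h3 : (2 * b * h 0) * (m 0 ^ 2 + m 1 ^ 2) = 0 := by rw [h2] at h1; linear_combination h1
      have := sq_add_sq_eq_zero (x := m 0) (y := m 1) (by simpa [hb, hu] using h3)
      simpa [h2] using this
    · rintro (⟨h1, h2⟩ | ⟨h1, h2⟩)
      · refine ⟨?_, h2⟩
        rw [h1, h2]
        linear_combination (m 0 ^ 2 * 2 * b * h 0) * Complex.I_sq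
      · refine ⟨?_, h2⟩
        rw [h1, h2]
        linear_combination (m 0 ^ 2 * 2 * b * h 0) * Complex.I_sq
  · have key : ∀ (s : ℂ) (Q : Pt), s ^ 2 = -1 → s * (starRingEnd ℂ) s = 1 → (starRingEnd ℂ) s = -s →
        C.Rep Q ![1, s] ![1, 0] →
        IsComplexNode (ricciPolyC Φ) Q ∧ IsTangentAt (C.push (X 3)) (ricciPolyC Φ) Q 2 ∧
          TangentsFromComponents (ricciPolyC Φ) (C.pushList [(.real 2 1, q), (.real 0 1, X 3)]) Q := by
      intro s Q hs hs1 hs2 R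
      have hs0 : s ≠ 0 := by rintro rfl; simp at hs
      rw [hP]
      refine ⟨⟨isNode R (heps s) eps_one_zero (hd s hs) (by simp [hb, hs0]), not_isRealPt R ?_⟩,
        isTangentAt_fourth_two R (heps s) (hd s hs) (by simp), ?_⟩
      · simp [hs2]
        intro h0
        exact hs0 (by linear_combination -h0 / 2)
      · refine R.tangentsFromComponents hl.1 (a := q) (b := X 3) (r := 1) (by simp [components, Block.parts])
          (by simp [components, Block.parts]) (by ring) (i := 0) (j := 0)
          (isBihomogeneous_of_eval fun a b x y u v => by simp) ?_ (by simp) (by simp)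
          (fun p hp _ => by simpa [components, Block.parts] using hp)
        simp [hqe]
        linear_combination (2 * b) * hs
    intro Q hQ
    rw [hsing, Set.mem_union, hpt1, hpt2] at hQ
    rw [← hL]
    rcases hQ with R | R
    · exact key _ Q Complex.I_sq (by simp) (by simp) R
    · exact key _ Q (by simp) (by simp) (by simp) R

end NeutralRicci

namespace NeutralRicci

open MvPolynomial

open SpinCoord

variable {Φ : (Fin 4 → ℝ) →ₗ[ℝ] (Fin 4 → ℝ)}

lemma IsBlockFactorization.perm {P : MvPolynomial (Fin 4) ℂ} {l l' : List (Block × MvPolynomial (Fin 4) ℂ)}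
    (h : IsBlockFactorization P l) (hp : l.Perm l') : IsBlockFactorization P l' := by
  obtain ⟨h1, h2, c, hc, h3⟩ := h
  refine ⟨fun x hx => h1 x (hp.mem_iff.mpr hx), ?_, c, hc, by rw [h3, (hp.map _).prod_eq]⟩
  exact ((hp.flatMap_right _).pairwise_iff fun {_ _} hn ha => hn ha.symm).mp h2

lemma IsPsiON.exists_spinCoord {B : Fin 4 → Fin 4 → ℝ} {κ : OType} (hB : IsPsiON B) (hκ : HasOType B κ) :
    ∃ C : SpinCoord, C.E = NeutralRicci.toWitt B ∧ C.scale = 1 ∧ ∀ b, κ.tw b = C.tw b :=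
  exists_of_hasOType hB.toWitt (by rwa [toPsiON_toWitt])

lemma isBihomogeneous_bilinear {q : MvPolynomial (Fin 4) ℂ} {a b c d : ℂ}
    (hq : ∀ x y u v, eval ![x, y, u, v] q = a * (x * u) + b * (x * v) + c * (y * u) + d * (y * v)) :
    IsBihomogeneous q 1 1 := isBihomogeneous_of_eval fun a b x y u v => by simp only [hq]; ring

namespace SpinCoord

variable {C : SpinCoord}

lemma tw_self (r : ℕ) : C.tw (.real r r) = .real r r := by simp [tw, Block.swap]

variable (C) in
/-- The coordinates with `x` and `y` interchanged. -/
def flip : SpinCoord where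
  α := C.β
  β := C.α
  α' := C.α'
  β' := C.β'
  ne := by rw [eps_swap]; exact neg_ne_zero.mpr C.ne
  ne' := C.ne'
  sw := C.sw

lemma fst_flip (x y : ℂ) : C.flip.fst ![x, y] = C.fst ![y, x] := by
  simp only [fst, flip, Matrix.cons_val]; abel

lemma left_flip (x y : ℂ) (h : Fin 2 → ℂ) : C.flip.left ![x, y] h = C.left ![y, x] h := by
  simp only [left, fst_flip]; rfl

lemma right_flip (x y : ℂ) (h : Fin 2 → ℂ) : C.flip.right ![x, y] h = C.right ![y, x] h := by
  simp only [right, fst_flip]; rfl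

lemma rep_flip {Q : Pt} {x y : ℂ} {h : Fin 2 → ℂ} : C.flip.Rep Q ![x, y] h ↔ C.Rep Q ![y, x] h := by
  rw [Rep, Rep, left_flip, right_flip]
  refine and_congr_left fun _ => not_congr ⟨fun e => ?_, fun e => ?_⟩ <;>
  · have h0 := congrFun e 0
    have h1 := congrFun e 1
    simp at h0 h1
    simp [h0, h1]

lemma push_flip {p q : MvPolynomial (Fin 4) ℂ} (H : ∀ x y u v, eval ![x, y, u, v] p = eval ![y, x, u, v] q) :
    C.flip.push p = C.push q := by
  refine (eq_push_of_eval fun m h => ?_).symm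
  have e : m = ![m 0, m 1] := by ext i; fin_cases i <;> rfl
  rw [e, left_flip, right_flip, eval_push, H]
  rfl

end SpinCoord

/-! ### Types IIIa and IIIb -/

/-- The Ricci polynomial of the types IIIa and IIIb. -/
noncomputable def cuspPoly (μ r : ℝ) : MvPolynomial (Fin 4) ℂ :=
  MvPolynomial.C (-2 * μ : ℂ) * (X 1 * X 3 + X 0 * X 2) ^ 2 -
    MvPolynomial.C (2 * r : ℂ) * (X 0 * (X 0 * X 2 - X 1 * X 3) * X 3)

lemma eval_cuspPoly (μ r : ℝ) (x y u v : ℂ) : eval ![x, y, u, v] (cuspPoly μ r) =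
    -2 * μ * (y * v + x * u) ^ 2 - 2 * r * (x * (x * u - y * v) * v) := by simp [cuspPoly]

lemma isBihomogeneous_cuspPoly (μ r : ℝ) : IsBihomogeneous (cuspPoly μ r) 2 2 :=
  isBihomogeneous_of_eval fun a b x y u v => by simp only [eval_cuspPoly]; ring

lemma irreducible_cuspPoly {μ r : ℝ} (hμ : μ ≠ 0) (hr : r ≠ 0) : Irreducible (cuspPoly μ r) := by
  have hμ' : (μ : ℂ) ≠ 0 := by exact_mod_cast hμ
  have hr' : (r : ℂ) ≠ 0 := by exact_mod_cast hr
  refine irreducible_of_discriminant (fun u v => -2 * μ * u ^ 2 - 2 * r * (u * v))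
    (fun u v => -4 * μ * (u * v) + 2 * r * v ^ 2) (fun u v => -2 * μ * v ^ 2) (isBihomogeneous_cuspPoly μ r)
    (fun x y u v => by rw [eval_cuspPoly]; ring) (fun x y hxy => ?_) (fun u v huv => ?_) fun α β γ h => ?_
  · by_cases hx : x = 0
    · exact ⟨0, 1, by simpa [eval_cuspPoly, hx, hμ] using hxy⟩
    · exact ⟨1, 0, by simp [eval_cuspPoly, hx, hμ]⟩
  · by_cases hv : v = 0
    · exact ⟨1, 0, by simpa [eval_cuspPoly, hv, hμ] using huv⟩
    · exact ⟨0, 1, by simp [eval_cuspPoly, hv, hμ]⟩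
  -- the discriminant is `4 r v³ (r v - 8 μ u)`, which has zeros of odd order
  · have h0 := h 1 0
    have h1 := h 0 1
    have h2 := h 1 1
    have h3 := h (-1) 1
    have hα : α ^ 2 = 0 := by linear_combination -h0
    have hα' : α = 0 := by simpa using hα
    subst hα'
    have hβ : β ^ 2 = 0 := by linear_combination h1 - h2 / 2 - h3 / 2
    have hβ' : β = 0 := by simpa using hβ
    subst hβ'
    have : (μ : ℂ) * r = 0 := by linear_combination (h3 - h2) / 64
    simp [hμ, hr] at this

/-- If `μ = 0`, then the polynomial is the product of three factors. -/
lemma isBlockFactorization_cuspPoly {r : ℝ} (hr : r ≠ 0) : IsBlockFactorization (cuspPoly 0 r)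
    [(.real 1 0, X 0), (.real 1 1, X 0 * X 2 - X 1 * X 3), (.real 0 1, X 3)] := by
  have hq : ∀ x y u v, eval ![x, y, u, v] (X 0 * X 2 - X 1 * X 3 : MvPolynomial (Fin 4) ℂ) =
      1 * (x * u) + 0 * (x * v) + 0 * (y * u) + (-1) * (y * v) := fun x y u v => by simp; ring
  have hX : IsBihomogeneous (X 0) 1 0 := isBihomogeneous_of_eval fun a b x y u v => by simp
  refine ⟨?_, ?_, -2 * r, by simpa using hr, ?_⟩
  · simp only [List.forall_mem_cons, Block.Admits]
    exact ⟨⟨irreducible_linear_left hX (X_ne_zero 0), hX, by simp [conjPoly]⟩,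
      ⟨irreducible_bilinear hq (by norm_num), isBihomogeneous_bilinear hq, by simp [conjPoly]⟩,
      ⟨irreducible_linear_right isBihomogeneous_fourth (X_ne_zero 3), isBihomogeneous_fourth, by simp [conjPoly]⟩,
      by simp⟩
  · simp only [components, Block.parts, List.flatMap_cons, List.flatMap_nil, List.cons_append, List.nil_append,
      List.append_nil, List.pairwise_cons, List.forall_mem_cons]
    refine ⟨⟨not_associated_of_eval ![0, 1, 0, 1] (by simp) (by simp [hq]),
      not_associated_of_eval ![0, 1, 0, 1] (by simp) (by simp), by simp⟩,
      ⟨not_associated_of_eval ![1, 1, 1, 1] (by simp) (by simp), by simp⟩, by simp⟩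
  · refine funext_eval fun x y u v => ?_
    simp [eval_cuspPoly, Block.value]
    left
    ring

/-- At the singular point the quadratic part is `-2 μ (y + v)²`. For `μ ≠ 0` the cubic term along its tangent
does not vanish; for `μ = 0` the cubic terms remain, and the polynomial splits. -/
lemma cusp_or_triple (C : SpinCoord) {μ r : ℝ} (hr : r ≠ 0) (hP : ricciPolyC Φ = C.push (cuspPoly μ r))
    {w : Fin 4 → ℂ} (hpt : ∀ Q, Q ∈ pt w ↔ C.Rep Q ![0, 1] ![1, 0])
    (hsing : ∀ Q ∈ singularSet (ricciPolyC Φ), Q ∈ pt w) :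
    singularSet (ricciPolyC Φ) = pt w ∧ (∀ Q ∈ pt w, IsRealPt Q) ∧
      (μ ≠ 0 → (∃ q, IsSpinorFactorization Φ [(.real 2 2, q)]) ∧
        ∀ Q ∈ pt w, IsCusp (ricciPolyC Φ) Q ∧ ¬ IsTacnode (ricciPolyC Φ) Q) ∧
      (μ = 0 → ∃ q₁ q₂ q₃, IsSpinorFactorization Φ [(.real 1 0, q₁), (.real 1 1, q₂), (.real 0 1, q₃)] ∧
          crossings [(.real 1 0, q₁), (.real 1 1, q₂), (.real 0 1, q₃)] = pt w ∧
          ∀ Q ∈ pt w, IsFold (ricciPolyC Φ) Q 3 ∧ Q ∈ zeros q₁ ∧ Q ∈ zeros q₂ ∧ Q ∈ zeros q₃) := by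
  have hr' : (r : ℂ) ≠ 0 := by exact_mod_cast hr
  have e1 : eps (![0, 1] : Fin 2 → ℂ) ![1, 0] ≠ 0 := by simp [eps]
  have hd : DoubleAt (cuspPoly μ r) ![0, 1] ![1, 0] ![1, 0] ![0, 1] (-2 * μ * 1 ^ 2) (2 * (-2 * μ) * 1 * 1)
      (-2 * μ * 1 ^ 2) (-2 * r) (2 * r) 0 := by
    intro x y u v
    simp [eval_cuspPoly]
    ring
  refine ⟨?_, ?_, fun hμ => ⟨?_, ?_⟩, ?_⟩
  · refine Set.Subset.antisymm hsing fun Q hQ => ?_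
    rw [hP]
    exact hd.mem_singularSet ((hpt Q).mp hQ) e1 eps_one_zero
  · intro Q hQ
    have R' : C.Rep Q (cvec ![0, 1]) (cvec ![1, 0]) := by
      convert (hpt Q).mp hQ <;> ext i <;> fin_cases i <;> simp [cvec]
    exact isRealPt R'
  · exact isSpinorFactorization_of_irreducible (by rw [hP]; exact irreducible_push (irreducible_cuspPoly hμ hr))
  · intro Q hQ
    rw [hP]
    have hk : (-2 * μ : ℂ) ≠ 0 := by simpa using hμ
    refine ⟨isCusp ((hpt Q).mp hQ) e1 eps_one_zero hd hk (by simp),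
      not_isTacnode ((hpt Q).mp hQ) e1 eps_one_zero hd hk (by simp) ?_⟩
    intro h0
    exact hr' (by linear_combination -h0 / 4)
  · rintro rfl
    have hl := isBlockFactorization_cuspPoly hr
    have main : ∀ Q m h, C.Rep Q m h → (Q ∈ pt w ↔ m 0 = 0 ∧ h 1 = 0) := by
      intro Q m h R
      rw [hpt, R.iff (ne_zero_right one_ne_zero) (ne_zero_left one_ne_zero)]
      simp [eq_comm]
    have hmem : ∀ Q ∈ pt w, IsFold (ricciPolyC Φ) Q 3 ∧ Q ∈ zeros (C.push (X 0)) ∧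
        Q ∈ zeros (C.push (X 0 * X 2 - X 1 * X 3)) ∧ Q ∈ zeros (C.push (X 3)) := by
      intro Q hQ
      have R := (hpt Q).mp hQ
      rw [hP]
      refine ⟨isFold_three (c₂₁ := -2 * r) (c₁₂ := 2 * r) (c₂₂ := 0) R e1 eps_one_zero (by simpa using hd)
        (by simp [hr]), ?_, ?_, ?_⟩
      · exact (R.mem_zeros (hl.1 (.real 1 0, X 0) (by simp)).2.1).mpr (by simp)
      · exact (R.mem_zeros (hl.1 (.real 1 1, X 0 * X 2 - X 1 * X 3) (by simp)).2.1).mpr (by simp)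
      · exact (R.mem_zeros (hl.1 (.real 0 1, X 3) (by simp)).2.1).mpr (by simp)
    -- the list of factors is reversed if the coordinates interchange the two kinds of spinors
    cases hs : C.sw
    · have hL : C.pushList [(.real 1 0, X 0), (.real 1 1, X 0 * X 2 - X 1 * X 3), (.real 0 1, X 3)] =
          [(.real 1 0, C.push (X 0)), (.real 1 1, C.push (X 0 * X 2 - X 1 * X 3)), (.real 0 1, C.push (X 3))] := by
        simp [pushList, tw, hs]
      refine ⟨_, _, _, hL ▸ isSpinorFactorization hP hl, ?_, hmem⟩
      ext Q
      obtain ⟨m, h, R⟩ := exists_rep C Q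
      have := R.ne_fst
      have := R.ne_snd
      rw [← hL, R.mem_crossings hl.1, main Q m h R]
      simp [components, Block.parts, exists_pair_cons]
      grind
    · have hp : [((.real 1 0, X 0) : Block × MvPolynomial (Fin 4) ℂ), (.real 1 1, X 0 * X 2 - X 1 * X 3),
          (.real 0 1, X 3)].Perm [(.real 0 1, X 3), (.real 1 1, X 0 * X 2 - X 1 * X 3), (.real 1 0, X 0)] :=
        (List.reverse_perm _).symm
      have hl' := hl.perm hp
      have hL : C.pushList [(.real 0 1, X 3), (.real 1 1, X 0 * X 2 - X 1 * X 3), (.real 1 0, X 0)] =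
          [(.real 1 0, C.push (X 3)), (.real 1 1, C.push (X 0 * X 2 - X 1 * X 3)), (.real 0 1, C.push (X 0))] := by
        simp [pushList, tw, hs, Block.swap]
      refine ⟨_, _, _, hL ▸ isSpinorFactorization hP hl', ?_, fun Q hQ => ?_⟩
      · ext Q
        obtain ⟨m, h, R⟩ := exists_rep C Q
        have := R.ne_fst
        have := R.ne_snd
        rw [← hL, R.mem_crossings hl'.1, main Q m h R]
        simp [components, Block.parts, exists_pair_cons]
        grind
      · obtain ⟨h1, h2, h3, h4⟩ := hmem Q hQ
        exact ⟨h1, h4, h3, h2⟩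

lemma exists_inv_sqrt_two : ∃ r : ℝ, r ≠ 0 ∧ 1 / √2 = r ∧ √2 = 2 * r := by
  refine ⟨1 / √2, by simp, rfl, ?_⟩
  rw [mul_one_div, eq_div_iff (by simp), Real.mul_self_sqrt (by norm_num)]

/-- In the coordinates of the basis the Ricci polynomial is `cuspPoly μ r` with `r = 1 / √2`. -/
theorem type_IIIa (hsa : ∀ u v, s22 (Φ u) v = s22 u (Φ v)) (htr : LinearMap.trace ℝ (Fin 4 → ℝ) Φ = 0)
    (κ : OType) (B : Fin 4 → Fin 4 → ℝ) (lam μ : ℝ) (hB : IsPsiON B) (hκ : HasOType B κ)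
    (hM : HasMatrix Φ B !![lam, 0, 0, 0; 0, μ, 1 / √2, 0; 0, -(1 / √2), μ, 1 / √2; 0, 0, 1 / √2, μ]) :
      lam + 3 * μ = 0 ∧
      HasSpinorForm Φ κ (toWitt B)
        (fun o ι o' ι' A B A' B' =>
          -μ * (2 * dbl o A B * dbl o' A' B' + 2 * dbl ι A B * dbl ι' A' B' + mix o ι A B * mix o' ι' A' B') -
          1 / √2 * (mix o ι A B * dbl o' A' B' - dbl ι A B * mix o' ι' A' B'))
        (fun X Y U V => (-2 * μ) • (Y * V + X * U) ^ 2 - √2 • (X * (X * U - Y * V) * V)) ∧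
      singularSet (ricciPolyC Φ) = pt (cvec (B 1 + B 3)) ∧
      (∀ Q ∈ pt (cvec (B 1 + B 3)), IsRealPt Q) ∧
      (lam ≠ μ → (∃ q, IsSpinorFactorization Φ [(.real 2 2, q)]) ∧
        ∀ Q ∈ pt (cvec (B 1 + B 3)), IsCusp (ricciPolyC Φ) Q ∧ ¬ IsTacnode (ricciPolyC Φ) Q) ∧
      (lam = μ → lam = 0 ∧ μ = 0 ∧
        ∃ q₁ q₂ q₃, IsSpinorFactorization Φ [(.real 1 0, q₁), (.real 1 1, q₂), (.real 0 1, q₃)] ∧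
          crossings [(.real 1 0, q₁), (.real 1 1, q₂), (.real 0 1, q₃)] = pt (cvec (B 1 + B 3)) ∧
          ∀ Q ∈ pt (cvec (B 1 + B 3)), IsFold (ricciPolyC Φ) Q 3 ∧ Q ∈ zeros q₁ ∧ Q ∈ zeros q₂ ∧ Q ∈ zeros q₃) := by
  have htr' : lam + 3 * μ = 0 := by
    have := hB.trace_eq hM htr
    simp at this
    linarith
  obtain rfl : lam = -3 * μ := by linarith
  obtain ⟨r, hr, e1, e2⟩ := exists_inv_sqrt_two
  rw [e1] at hM
  rw [e1, e2]
  refine ⟨htr', hasSpinorForm_of_matrix hB.toWitt hM.toWitt ?_ ?_, ?_⟩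
  · intro a b a' b' A B A' B'
    simp [Fin.sum_univ_four, psiToWitt, wittSpinor, dbl, mix]
    ring
  · intro X Y U V
    refine MvPolynomial.funext fun z => ?_
    simp [psiToWitt, Fin.sum_univ_four, wittForm, smul_eval]
    ring
  obtain ⟨C, hC, hs, htw⟩ := hB.exists_spinCoord hκ
  have hP : ricciPolyC Φ = C.push (cuspPoly μ r) := by
    refine ricciPolyC_eq_push (hC ▸ hM.toWitt) fun m h => ?_
    simp [nullCoeffs, psiToWitt, Fin.sum_univ_four, hs, eval_cuspPoly]
    ring
  have hpt : ∀ Q, Q ∈ pt (cvec (B 1 + B 3)) ↔ C.Rep Q ![0, 1] ![1, 0] :=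
    (coordBasis_on hC).mem_pt_iff_rep (ne_zero_right one_ne_zero) (ne_zero_left one_ne_zero) one_ne_zero
      (by simp [Fin.sum_univ_four, nullCoeffsON, cvec_add])
  obtain ⟨g1, g2, g3, g4⟩ := cusp_or_triple C hr hP hpt fun Q hQ => by
    obtain ⟨m, h, R⟩ := exists_rep C Q
    obtain ⟨χ, hχ⟩ := ((coordBasis_on hC).mem_singularSet hsa hM R).mp hQ
    have e0 := hχ 0
    have e1 := hχ 1
    have e2 := hχ 2
    have e3 := hχ 3
    rw [hpt, R.iff (ne_zero_right one_ne_zero) (ne_zero_left one_ne_zero)]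
    simp [Fin.sum_univ_four, nullCoeffsON] at e0 e1 e2 e3 ⊢
    have hm := R.ne_fst
    have hh := R.ne_snd
    have hr' : (r : ℂ) ≠ 0 := by exact_mod_cast hr
    have hk := R.coords_ne_zero
    clear hpt hP hχ hQ hM
    -- the eigenvalue is `μ`
    have hχ : χ = μ := by
      by_contra hne
      have hne' : χ - μ ≠ 0 := sub_ne_zero.mpr hne
      have h1 : (χ - μ) * (m 0 * h 1) = 0 := by linear_combination (e1 - e3) / 2
      have h1' : m 0 * h 1 = 0 := by simpa [hne'] using h1
      have h2 : (χ - μ) * (m 0 * h 0 - m 1 * h 1) = 0 := by linear_combination -e2 + 2 * r * h1'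
      have h2' : m 0 * h 0 - m 1 * h 1 = 0 := by simpa [hne'] using h2
      have h3 : (χ - μ) * (m 1 * h 0) = 0 := by linear_combination -e3 + r * h2' - (χ - μ) * h1'
      have h3' : m 1 * h 0 = 0 := by simpa [hne'] using h3
      have h4 : (m 0 * h 0) ^ 2 = 0 := by linear_combination m 0 * h 0 * h2' + m 1 * h 0 * h1'
      have h4' : m 0 * h 0 = 0 := by simpa using h4
      exact hk ⟨h4', h3', by linear_combination h4' - h2', h1'⟩
    subst hχ
    have h1 : (r : ℂ) * (m 0 * h 0 - m 1 * h 1) = 0 := by linear_combination e3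
    have h1' : m 0 * h 0 - m 1 * h 1 = 0 := by simpa [hr'] using h1
    have h2 : (r : ℂ) * (m 0 * h 1) = 0 := by linear_combination e2 / 2
    have h2' : m 0 * h 1 = 0 := by simpa [hr'] using h2
    have h3 : (m 0 * h 0) ^ 2 = 0 := by linear_combination m 0 * h 0 * h1' + m 1 * h 0 * h2'
    have h3' : m 0 * h 0 = 0 := by simpa using h3
    grind
  refine ⟨g1, g2, fun hne => g3 ?_, fun he => ?_⟩
  · rintro rfl
    simp at hne
  · have : μ = 0 := by linarith
    exact ⟨by rw [this]; simp, this, g4 this⟩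

/-- The polynomial is that of type IIIa up to an interchange of `x` and `y`, which `SpinCoord.flip` undoes. -/
theorem type_IIIb (hsa : ∀ u v, s22 (Φ u) v = s22 u (Φ v)) (htr : LinearMap.trace ℝ (Fin 4 → ℝ) Φ = 0)
    (κ : OType) (B : Fin 4 → Fin 4 → ℝ) (lam μ : ℝ) (hB : IsPsiON B) (hκ : HasOType B κ)
    (hM : HasMatrix Φ B !![lam, 1 / √2, 0, 0; 1 / √2, lam, -(1 / √2), 0; 0, 1 / √2, lam, 0; 0, 0, 0, μ]) :
      3 * lam + μ = 0 ∧
      HasSpinorForm Φ κ (toWitt B)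
        (fun o ι o' ι' A B A' B' =>
          lam * (2 * dbl ι A B * dbl o' A' B' + 2 * dbl o A B * dbl ι' A' B' + mix o ι A B * mix o' ι' A' B') +
          1 / √2 * (mix o ι A B * dbl o' A' B' - dbl o A B * mix o' ι' A' B'))
        (fun X Y U V => (2 * lam) • (X * V + U * Y) ^ 2 + √2 • (Y * (Y * U - X * V) * V)) ∧
      singularSet (ricciPolyC Φ) = pt (cvec (B 0 + B 2)) ∧
      (∀ Q ∈ pt (cvec (B 0 + B 2)), IsRealPt Q) ∧
      (lam ≠ μ → (∃ q, IsSpinorFactorization Φ [(.real 2 2, q)]) ∧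
        ∀ Q ∈ pt (cvec (B 0 + B 2)), IsCusp (ricciPolyC Φ) Q ∧ ¬ IsTacnode (ricciPolyC Φ) Q) ∧
      (lam = μ → lam = 0 ∧ μ = 0 ∧
        ∃ q₁ q₂ q₃, IsSpinorFactorization Φ [(.real 1 0, q₁), (.real 1 1, q₂), (.real 0 1, q₃)] ∧
          crossings [(.real 1 0, q₁), (.real 1 1, q₂), (.real 0 1, q₃)] = pt (cvec (B 0 + B 2)) ∧
          ∀ Q ∈ pt (cvec (B 0 + B 2)), IsFold (ricciPolyC Φ) Q 3 ∧ Q ∈ zeros q₁ ∧ Q ∈ zeros q₂ ∧ Q ∈ zeros q₃) := by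
  have htr' : 3 * lam + μ = 0 := by
    have := hB.trace_eq hM htr
    simp at this
    linarith
  obtain rfl : μ = -3 * lam := by linarith
  obtain ⟨r, hr, e1, e2⟩ := exists_inv_sqrt_two
  rw [e1] at hM
  rw [e1, e2]
  refine ⟨htr', hasSpinorForm_of_matrix hB.toWitt hM.toWitt ?_ ?_, ?_⟩
  · intro a b a' b' A B A' B'
    simp [Fin.sum_univ_four, psiToWitt, wittSpinor, dbl, mix]
    ring
  · intro X Y U V
    refine MvPolynomial.funext fun z => ?_
    simp [psiToWitt, Fin.sum_univ_four, wittForm, smul_eval]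
    ring
  obtain ⟨C, hC, hs, htw⟩ := hB.exists_spinCoord hκ
  -- interchanging `x` and `y` leads to the polynomial of type IIIa
  have hP : ricciPolyC Φ = C.flip.push (cuspPoly (-lam) (-r)) := by
    rw [push_flip (q := MvPolynomial.C (2 * lam : ℂ) * (X 0 * X 3 + X 2 * X 1) ^ 2 +
      MvPolynomial.C (2 * r : ℂ) * (X 1 * (X 1 * X 2 - X 0 * X 3) * X 3))
      (fun x y u v => by simp [eval_cuspPoly]; left; ring)]
    refine ricciPolyC_eq_push (hC ▸ hM.toWitt) fun m h => ?_
    simp [nullCoeffs, psiToWitt, Fin.sum_univ_four, hs]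
    ring
  have hpt : ∀ Q, Q ∈ pt (cvec (B 0 + B 2)) ↔ C.Rep Q ![1, 0] ![1, 0] :=
    (coordBasis_on hC).mem_pt_iff_rep (ne_zero_left one_ne_zero) (ne_zero_left one_ne_zero) one_ne_zero
      (by simp [Fin.sum_univ_four, nullCoeffsON, cvec_add])
  obtain ⟨g1, g2, g3, g4⟩ := cusp_or_triple C.flip (neg_ne_zero.mpr hr) hP
      (fun Q => (hpt Q).trans rep_flip.symm) fun Q hQ => by
    obtain ⟨m, h, R⟩ := exists_rep C Q
    obtain ⟨χ, hχ⟩ := ((coordBasis_on hC).mem_singularSet hsa hM R).mp hQ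
    have e0 := hχ 0
    have e1 := hχ 1
    have e2 := hχ 2
    have e3 := hχ 3
    rw [hpt, R.iff (ne_zero_left one_ne_zero) (ne_zero_left one_ne_zero)]
    simp [Fin.sum_univ_four, nullCoeffsON] at e0 e1 e2 e3 ⊢
    have hm := R.ne_fst
    have hh := R.ne_snd
    have hr' : (r : ℂ) ≠ 0 := by exact_mod_cast hr
    have hk := R.coords_ne_zero
    clear hpt hP hχ hQ hM
    -- the eigenvalue is `lam`
    have hχ : χ = lam := by
      by_contra hne
      have hne' : χ - lam ≠ 0 := sub_ne_zero.mpr hne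
      have h1 : (χ - lam) * (m 1 * h 1) = 0 := by linear_combination (e2 - e0) / 2
      have h1' : m 1 * h 1 = 0 := by simpa [hne'] using h1
      have h2 : (χ - lam) * (m 1 * h 0 - m 0 * h 1) = 0 := by linear_combination -e1 + 2 * r * h1'
      have h2' : m 1 * h 0 - m 0 * h 1 = 0 := by simpa [hne'] using h2
      have h3 : (χ - lam) * (m 0 * h 0) = 0 := by linear_combination -e2 + r * h2' + (χ - lam) * h1'
      have h3' : m 0 * h 0 = 0 := by simpa [hne'] using h3
      have h4 : (m 1 * h 0) ^ 2 = 0 := by linear_combination m 1 * h 0 * h2' + m 0 * h 0 * h1'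
      have h4' : m 1 * h 0 = 0 := by simpa using h4
      exact hk ⟨h3', h4', h1', by linear_combination h4' - h2'⟩
    subst hχ
    have h1 : (r : ℂ) * (m 1 * h 0 - m 0 * h 1) = 0 := by linear_combination e0
    have h1' : m 1 * h 0 - m 0 * h 1 = 0 := by simpa [hr'] using h1
    have h2 : (r : ℂ) * (m 1 * h 1) = 0 := by linear_combination e1 / 2
    have h2' : m 1 * h 1 = 0 := by simpa [hr'] using h2
    have h3 : (m 1 * h 0) ^ 2 = 0 := by linear_combination m 1 * h 0 * h1' + m 0 * h 0 * h2'
    have h3' : m 1 * h 0 = 0 := by simpa using h3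
    grind
  refine ⟨g1, g2, fun hne => g3 ?_, fun he => ?_⟩
  · intro h0
    exact hne (by linarith)
  · have : lam = 0 := by linarith
    exact ⟨this, by rw [this]; simp, g4 (by rw [this, neg_zero])⟩

end NeutralRicci

namespace NeutralRicci

open MvPolynomial

open SpinCoord

variable {Φ : (Fin 4 → ℝ) →ₗ[ℝ] (Fin 4 → ℝ)}

lemma cvec_pair (a b : ℝ) : cvec ![a, b] = ![(a : ℂ), (b : ℂ)] := by ext i; fin_cases i <;> simp [cvec]

/-! ### Type VI -/

/-- At `⟨E₁⟩` the quadratic part is `b y² + 4 λ y v - b v²`, with the discriminant `16 λ² + 4 b² > 0`. -/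
theorem type_VI (hsa : ∀ u v, s22 (Φ u) v = s22 u (Φ v)) (htr : LinearMap.trace ℝ (Fin 4 → ℝ) Φ = 0)
    (κ : OType) (E : Fin 4 → Fin 4 → ℝ) (ε lam a b : ℝ) (hE : IsWitt E) (hκ : HasOType (toPsiON E) κ)
    (hε : ε = 1 ∨ ε = -1) (hb : b ≠ 0)
    (hM : HasMatrix Φ E !![lam, 0, ε, 0; 0, a, 0, -b; 0, 0, lam, 0; 0, b, 0, a]) :
      lam + a = 0 ∧
      HasSpinorForm Φ κ E
        (fun o ι o' ι' A B A' B' => ε * dbl o A B * dbl o' A' B' -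
          b * (dbl ι A B * dbl o' A' B' - dbl o A B * dbl ι' A' B') + lam * mix o ι A B * mix o' ι' A' B')
        (fun X Y U V => ε • (Y ^ 2 * V ^ 2) - b • (X ^ 2 * V ^ 2 - Y ^ 2 * U ^ 2) + (4 * lam) • (X * Y * U * V)) ∧
      (∃ q, IsSpinorFactorization Φ [(.real 2 2, q)]) ∧
      singularSet (ricciPolyC Φ) = pt (cvec (E 0)) ∧
      ∀ Q ∈ pt (cvec (E 0)), IsRealNodeRealTangents (ricciPolyC Φ) Q := by
  have htr' : lam + a = 0 := by
    have := hE.trace_eq hM htr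
    simp at this
    linarith
  obtain rfl : a = -lam := by linarith
  refine ⟨htr', hasSpinorForm_of_matrix hE hM ?_ ?_, ?_⟩
  · intro a b a' b' A B A' B'
    simp [Fin.sum_univ_four, wittSpinor, dbl, mix]
    ring
  · intro X Y U V
    refine MvPolynomial.funext fun z => ?_
    simp [Fin.sum_univ_four, wittForm, smul_eval]
    ring
  obtain ⟨C, rfl, hs, htw⟩ := exists_of_hasOType hE hκ
  have hε0 : (ε : ℂ) ≠ 0 := by rcases hε with rfl | rfl <;> simp
  have hb' : (b : ℂ) ≠ 0 := by exact_mod_cast hb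
  set q : MvPolynomial (Fin 4) ℂ := MvPolynomial.C (ε : ℂ) * (X 1 ^ 2 * X 3 ^ 2) -
    MvPolynomial.C (b : ℂ) * (X 0 ^ 2 * X 3 ^ 2 - X 1 ^ 2 * X 2 ^ 2) +
    MvPolynomial.C (4 * lam : ℂ) * (X 0 * X 1 * X 2 * X 3) with hq
  have hqe : ∀ x y u v, eval ![x, y, u, v] q = ε * (y ^ 2 * v ^ 2) - b * (x ^ 2 * v ^ 2 - y ^ 2 * u ^ 2) +
    4 * lam * (x * y * u * v) := fun x y u v => by simp [hq]
  have hP : ricciPolyC Φ = C.push q := by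
    refine ricciPolyC_eq_push hM fun m h => ?_
    simp [nullCoeffs, Fin.sum_univ_four, hs, hqe]
    ring
  have hqi : Irreducible q := by
    refine irreducible_of_discriminant (fun u v => -b * v ^ 2) (fun u v => 4 * lam * (u * v))
      (fun u v => ε * v ^ 2 + b * u ^ 2) (isBihomogeneous_of_eval fun a b x y u v => by simp only [hqe]; ring)
      (fun x y u v => by rw [hqe]; ring) (fun x y hxy => ?_) (fun u v huv => ?_) fun α β γ h => ?_
    · by_cases hy : y = 0
      · exact ⟨0, 1, by simpa [hqe, hy, hb] using hxy⟩
      · exact ⟨1, 0, by simp [hqe, hy, hb]⟩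
    · by_cases hv : v = 0
      · exact ⟨0, 1, by simpa [hqe, hv, hb] using huv⟩
      · exact ⟨1, 0, by simp [hqe, hv, hb]⟩
    -- the discriminant is `4 v² ((4 λ² + b²) u² + b ε v²)`, whose last factor has two simple zeros
    · have h0 := h 1 0
      have h1 := h 0 1
      have h2 := h 1 1
      have h3 := h (-1) 1
      have hα : α ^ 2 = 0 := by linear_combination -h0
      have hα' : α = 0 := by simpa using hα
      subst hα'
      have hγ : γ ≠ 0 := by
        rintro rfl
        have : (b : ℂ) * ε = 0 := by linear_combination h1 / 4
        simp [hb', hε0] at this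
      have hβ : β * γ = 0 := by linear_combination (h3 - h2) / 4
      have hβ' : β = 0 := by simpa [hγ] using hβ
      subst hβ'
      have h4 : ((4 * lam ^ 2 + b ^ 2 : ℝ) : ℂ) = 0 := by
        push_cast
        linear_combination h2 / 4 - h1 / 4
      have h5 : 4 * lam ^ 2 + b ^ 2 = 0 := by exact_mod_cast h4
      have : 0 < b ^ 2 := by positivity
      nlinarith [sq_nonneg lam]
  have hpt : ∀ Q, Q ∈ pt (cvec (C.E 0)) ↔ C.Rep Q (cvec ![1, 0]) (cvec ![1, 0]) := by
    simp only [cvec_pair, Complex.ofReal_one, Complex.ofReal_zero]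
    exact coordBasis_E.mem_pt_iff_rep (ne_zero_left one_ne_zero) (ne_zero_left one_ne_zero) one_ne_zero
      (by simp [Fin.sum_univ_four, nullCoeffs])
  have hd : DoubleAt q (cvec ![1, 0]) (cvec ![0, 1]) (cvec ![1, 0]) (cvec ![0, 1]) b (4 * lam : ℝ) (-b : ℝ)
      (0 : ℝ) (0 : ℝ) ε := by
    intro x y u v
    simp [hqe, cvec_pair]
    ring
  have hnode : ∀ Q ∈ pt (cvec (C.E 0)), IsRealNodeRealTangents (ricciPolyC Φ) Q := by
    intro Q hQ
    rw [hP]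
    refine isRealNodeRealTangents ((hpt Q).mp hQ) (by simp [eps]) (by simp [eps]) hd ?_
    have : 0 < b ^ 2 := by positivity
    nlinarith [sq_nonneg lam]
  refine ⟨isSpinorFactorization_of_irreducible (by rw [hP]; exact irreducible_push hqi), ?_, hnode⟩
  refine Set.Subset.antisymm (fun Q hQ => ?_) fun Q hQ f σ τ => ?_
  · obtain ⟨m, h, R⟩ := exists_rep C Q
    obtain ⟨χ, hχ⟩ := (coordBasis_E.mem_singularSet hsa hM R).mp hQ
    have e0 := hχ 0
    have e1 := hχ 1
    have e2 := hχ 2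
    have e3 := hχ 3
    rw [hpt, cvec_pair, Complex.ofReal_one, Complex.ofReal_zero,
      R.iff (ne_zero_left one_ne_zero) (ne_zero_left one_ne_zero)]
    simp [Fin.sum_univ_four, nullCoeffs] at e0 e1 e2 e3 ⊢
    have hm := R.ne_fst
    have hh := R.ne_snd
    clear hd hpt hqi hP hqe hχ hQ hq hM hnode
    grind
  · have := (hnode Q hQ).1.1 f
    exact ⟨this.1 σ τ 0 (by norm_num), this.1 σ τ 1 (by norm_num)⟩

/-! ### Type VII -/

/-- The line `V = 0` is a component, which meets the factor of bidegree `(2, 1)` where `λ X Y = 0`. For `λ = 0` it is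
a double component, and `ε Y² + ω X²` splits into linear factors, real ones iff `ε = -ω`. -/
theorem type_VII (hsa : ∀ u v, s22 (Φ u) v = s22 u (Φ v)) (htr : LinearMap.trace ℝ (Fin 4 → ℝ) Φ = 0)
    (κ : OType) (E : Fin 4 → Fin 4 → ℝ) (ε ω lam μ : ℝ) (hE : IsWitt E) (hκ : HasOType (toPsiON E) κ)
    (hε : ε = 1 ∨ ε = -1) (hω : ω = 1 ∨ ω = -1)
    (hM : HasMatrix Φ E !![lam, 0, ε, 0; 0, μ, 0, ω; 0, 0, lam, 0; 0, 0, 0, μ]) :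
      lam + μ = 0 ∧
      HasSpinorForm Φ κ E
        (fun o ι o' ι' A B A' B' => (ε * dbl o A B + ω * dbl ι A B) * dbl o' A' B' +
          lam * mix o ι A B * mix o' ι' A' B')
        (fun X Y U V => ((ε • Y ^ 2 + ω • X ^ 2) * V + (4 * lam) • (U * X * Y)) * V) ∧
      (lam ≠ μ → lam ≠ 0 ∧ μ ≠ 0 ∧
        singularSet (ricciPolyC Φ) = pt (cvec (E 0)) ∪ pt (cvec (E 1)) ∧
        ∃ q m, IsSpinorFactorization Φ [(κ.tw (.real 2 1), q), (κ.tw (.real 0 1), m)] ∧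
          crossings [(κ.tw (.real 2 1), q), (κ.tw (.real 0 1), m)] = singularSet (ricciPolyC Φ) ∧
          zeros m = linePts (cvec (E 0)) (cvec (E 1)) ∧
          ∀ Q ∈ singularSet (ricciPolyC Φ),
            IsRealNodeRealTangents (ricciPolyC Φ) Q ∧ IsTangentAt m (ricciPolyC Φ) Q 2) ∧
      (lam = μ → lam = 0 ∧ μ = 0 ∧
        singularSet (ricciPolyC Φ) = linePts (cvec (E 0)) (cvec (E 1)) ∧
        (ε = -ω → ∃ n₁ n₂ m,
          IsSpinorFactorization Φ [(κ.tw (.real 1 0), n₁), (κ.tw (.real 1 0), n₂), (κ.tw (.sq 0 1), m)] ∧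
          zeros m = linePts (cvec (E 0)) (cvec (E 1)) ∧
          zeros n₁ = linePts (cvec (E 0 + E 1)) (cvec (E 2 - E 3)) ∧
          zeros n₂ = linePts (cvec (E 0 - E 1)) (cvec (E 2 + E 3)) ∧
          crossings [(κ.tw (.real 1 0), n₁), (κ.tw (.real 1 0), n₂), (κ.tw (.sq 0 1), m)] =
            pt (cvec (E 0 + E 1)) ∪ pt (cvec (E 0 - E 1)) ∧
          (∀ Q ∈ pt (cvec (E 0 + E 1)) ∪ pt (cvec (E 0 - E 1)), IsTangentAt m (ricciPolyC Φ) Q 3) ∧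
          ∀ Q ∈ singularSet (ricciPolyC Φ), Q ∉ pt (cvec (E 0 + E 1)) ∪ pt (cvec (E 0 - E 1)) →
            IsTacnode (ricciPolyC Φ) Q) ∧
        (ε = ω → ∃ n m,
          IsSpinorFactorization Φ [(κ.tw (.conj 1 0), n), (κ.tw (.sq 0 1), m)] ∧
          zeros m = linePts (cvec (E 0)) (cvec (E 1)) ∧
          zeros n = linePts (cvec (E 0) + Complex.I • cvec (E 1)) (cvec (E 2) + Complex.I • cvec (E 3)) ∧
          zeros (conjPoly n) = linePts (cvec (E 0) - Complex.I • cvec (E 1)) (cvec (E 2) - Complex.I • cvec (E 3)) ∧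
          crossings [(κ.tw (.conj 1 0), n), (κ.tw (.sq 0 1), m)] =
            pt (cvec (E 0) + Complex.I • cvec (E 1)) ∪ pt (cvec (E 0) - Complex.I • cvec (E 1)) ∧
          (∀ Q ∈ pt (cvec (E 0) + Complex.I • cvec (E 1)) ∪ pt (cvec (E 0) - Complex.I • cvec (E 1)),
            IsTangentAt m (ricciPolyC Φ) Q 3) ∧
          ∀ Q ∈ singularSet (ricciPolyC Φ),
            Q ∉ pt (cvec (E 0) + Complex.I • cvec (E 1)) ∪ pt (cvec (E 0) - Complex.I • cvec (E 1)) →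
            IsTacnode (ricciPolyC Φ) Q)) := by
  have htr' : lam + μ = 0 := by
    have := hE.trace_eq hM htr
    simp at this
    linarith
  obtain rfl : μ = -lam := by linarith
  refine ⟨htr', hasSpinorForm_of_matrix hE hM ?_ ?_, ?_⟩
  · intro a b a' b' A B A' B'
    simp [Fin.sum_univ_four, wittSpinor, dbl, mix]
    ring
  · intro X Y U V
    refine MvPolynomial.funext fun z => ?_
    simp [Fin.sum_univ_four, wittForm, smul_eval]
    ring
  obtain ⟨C, rfl, hs, htw⟩ := exists_of_hasOType hE hκ
  have hε0 : (ε : ℂ) ≠ 0 := by rcases hε with rfl | rfl <;> simp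
  have hω0 : (ω : ℂ) ≠ 0 := by rcases hω with rfl | rfl <;> simp
  set q : MvPolynomial (Fin 4) ℂ := (MvPolynomial.C (ε : ℂ) * X 1 ^ 2 + MvPolynomial.C (ω : ℂ) * X 0 ^ 2) * X 3 +
    MvPolynomial.C (4 * lam : ℂ) * (X 2 * X 0 * X 1) with hq
  have hqe : ∀ x y u v, eval ![x, y, u, v] q = (ε * y ^ 2 + ω * x ^ 2) * v + 4 * lam * (u * x * y) :=
    fun x y u v => by simp [hq]
  have hP : ricciPolyC Φ = C.push (q * X 3) := by
    refine ricciPolyC_eq_push hM fun m h => ?_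
    simp [nullCoeffs, Fin.sum_univ_four, hs, hqe]
    ring
  have hqb : IsBihomogeneous q 2 1 := isBihomogeneous_of_eval fun a b x y u v => by simp only [hqe]; ring
  -- the eigenvector equations
  have hsing : ∀ Q ∈ singularSet (ricciPolyC Φ), ∀ m h, C.Rep Q m h → h 1 = 0 ∧ lam * (m 0 * m 1) = 0 := by
    intro Q hQ m h R
    obtain ⟨χ, hχ⟩ := (coordBasis_E.mem_singularSet hsa hM R).mp hQ
    have e0 := hχ 0
    have e1 := hχ 1
    have e2 := hχ 2
    have e3 := hχ 3
    simp [Fin.sum_univ_four, nullCoeffs] at e0 e1 e2 e3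
    have hm := R.ne_fst
    have hh := R.ne_snd
    clear hqb hP hqe hχ hQ hq hM
    have hv : h 1 = 0 := by grind
    refine ⟨hv, ?_⟩
    have hu : h 0 ≠ 0 := by simpa [hv] using hh
    have : h 0 ^ 2 * (lam * (m 0 * m 1)) = 0 := by
      rw [hv] at e0 e1
      linear_combination (m 1 * h 0) * e0 / 2 - (m 0 * h 0) * e1 / 2
    simpa [hu] using this
  refine ⟨fun hne => ?_, fun he => ?_⟩
  · have hl0 : lam ≠ 0 := by rintro rfl; simp at hne
    have hl0' : (lam : ℂ) ≠ 0 := by exact_mod_cast hl0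
    refine ⟨hl0, neg_ne_zero.mpr hl0, ?_⟩
    have hqi : Irreducible q := by
      refine irreducible_of_bidegree_two_one hqb (fun x y hxy => ?_) fun u v huv => ?_
      · by_contra! hz
        have h1 := hz 1 0
        have h2 := hz 0 1
        rw [hqe] at h1 h2
        simp [hl0] at h1
        rcases h1 with rfl | rfl
        · simp [hε0] at h2
          simp [h2] at hxy
        · simp [hω0] at h2
          simp [h2] at hxy
      · by_cases hv : v = 0
        · exact ⟨1, 1, by simpa [hqe, hv, hl0] using huv⟩
        · exact ⟨1, 0, by simp [hqe, hv, hω0]⟩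
    have hl := isBlockFactorization_mul_fourth (x := 1) (y := 1) hqb hqi (by simp [conjPoly, hq, map_ofNat])
      (by simp [hqe, hl0])
    have hpt0 : ∀ Q, Q ∈ pt (cvec (C.E 0)) ↔ C.Rep Q ![1, 0] ![1, 0] :=
      coordBasis_E.mem_pt_iff_rep (ne_zero_left one_ne_zero) (ne_zero_left one_ne_zero) one_ne_zero
        (by simp [Fin.sum_univ_four, nullCoeffs])
    have hpt1 : ∀ Q, Q ∈ pt (cvec (C.E 1)) ↔ C.Rep Q ![0, 1] ![1, 0] :=
      coordBasis_E.mem_pt_iff_rep (ne_zero_right one_ne_zero) (ne_zero_left one_ne_zero) one_ne_zero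
        (by simp [Fin.sum_univ_four, nullCoeffs])
    have hd0 : DoubleAt (q * X 3) (cvec ![1, 0]) (cvec ![0, 1]) (cvec ![1, 0]) (cvec ![0, 1]) (0 : ℝ) (4 * lam : ℝ) ω
        (0 : ℝ) (0 : ℝ) ε := by
      intro x y u v
      simp [hqe, cvec_pair]
      ring
    have hd1 : DoubleAt (q * X 3) (cvec ![0, 1]) (cvec ![1, 0]) (cvec ![1, 0]) (cvec ![0, 1]) (0 : ℝ) (4 * lam : ℝ) ε
        (0 : ℝ) (0 : ℝ) ω := by
      intro x y u v
      simp [hqe, cvec_pair]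
      ring
    have hL : C.pushList [(.real 2 1, q), (.real 0 1, X 3)] =
        [(κ.tw (.real 2 1), C.push q), (κ.tw (.real 0 1), C.push (X 3))] := by simp [pushList, htw]
    have hnode : ∀ Q ∈ pt (cvec (C.E 0)) ∪ pt (cvec (C.E 1)),
        IsRealNodeRealTangents (ricciPolyC Φ) Q ∧ IsTangentAt (C.push (X 3)) (ricciPolyC Φ) Q 2 := by
      intro Q hQ
      have hpos : 0 < (4 * lam) ^ 2 := by positivity
      rw [hP]
      rcases hQ with hQ | hQ
      · have R := (hpt0 Q).mp hQ
        refine ⟨isRealNodeRealTangents (m := ![1, 0]) (h := ![1, 0]) (by simpa [cvec_pair] using R) (by simp [eps])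
          (by simp [eps]) hd0 (by simpa using hpos), ?_⟩
        simp only [cvec_pair, Complex.ofReal_zero, Complex.ofReal_one] at hd0
        exact isTangentAt_fourth_two R eps_one_zero hd0 (by simp [hω0])
      · have R := (hpt1 Q).mp hQ
        refine ⟨isRealNodeRealTangents (m := ![0, 1]) (h := ![1, 0]) (by simpa [cvec_pair] using R) (by simp [eps])
          (by simp [eps]) hd1 (by simpa using hpos), ?_⟩
        simp only [cvec_pair, Complex.ofReal_zero, Complex.ofReal_one] at hd1
        exact isTangentAt_fourth_two R (by simp [eps]) hd1 (by simp [hε0])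
    have hset : singularSet (ricciPolyC Φ) = pt (cvec (C.E 0)) ∪ pt (cvec (C.E 1)) := by
      refine Set.Subset.antisymm (fun Q hQ => ?_) fun Q hQ f σ τ => ?_
      · obtain ⟨m, h, R⟩ := exists_rep C Q
        obtain ⟨g1, g2⟩ := hsing Q hQ m h R
        rw [Set.mem_union, hpt0, hpt1, R.iff (ne_zero_left one_ne_zero) (ne_zero_left one_ne_zero),
          R.iff (ne_zero_right one_ne_zero) (ne_zero_left one_ne_zero)]
        simp [hl0] at g2
        simpa [g1, eq_comm, or_comm] using g2
      · have := (hnode Q hQ).1.1.1 f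
        exact ⟨this.1 σ τ 0 (by norm_num), this.1 σ τ 1 (by norm_num)⟩
    refine ⟨hset, C.push q, C.push (X 3), hL ▸ isSpinorFactorization hP hl, ?_, zeros_fourth, hset ▸ hnode⟩
    rw [hset]
    ext Q
    rw [Set.mem_union, hpt0, hpt1, ← hL]
    obtain ⟨m, h, R⟩ := exists_rep C Q
    have hh := R.ne_snd
    rw [R.mem_crossings hl.1, R.iff (ne_zero_left one_ne_zero) (ne_zero_left one_ne_zero),
        R.iff (ne_zero_right one_ne_zero) (ne_zero_left one_ne_zero)]
    simp [components, Block.parts, exists_pair_cons, hqe]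
    clear hL hnode hset hd0 hd1 hpt0 hpt1 hl hqi hsing hP hqe hqb
    grind
  · have hl0 : lam = 0 := by linarith
    subst hl0
    have hV : ∀ Q m h, C.Rep Q m h → (Q ∈ linePts (cvec (C.E 0)) (cvec (C.E 1)) ↔ h 1 = 0) := by
      intro Q m h R
      rw [← zeros_fourth, R.mem_zeros isBihomogeneous_fourth]
      simp
    have hrep : ∀ Q ∈ linePts (cvec (C.E 0)) (cvec (C.E 1)), ∃ m, C.Rep Q m ![1, 0] := by
      intro Q hQ
      obtain ⟨m, h, R⟩ := exists_rep C Q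
      exact ⟨m, R.of_eps R.1 (ne_zero_left one_ne_zero) (mul_comm _ _) (by simp [(hV Q m h R).mp hQ])⟩
    have hd : ∀ m n, DoubleAt (q * X 3) m n ![1, 0] ![0, 1] 0 0 (ε * m 1 ^ 2 + ω * m 0 ^ 2) 0
        (2 * (ε * (m 1 * n 1) + ω * (m 0 * n 0))) (ε * n 1 ^ 2 + ω * n 0 ^ 2) := by
      intro m n x y u v
      simp [hqe]
      ring
    have hset : singularSet (ricciPolyC Φ) = linePts (cvec (C.E 0)) (cvec (C.E 1)) := by
      refine Set.Subset.antisymm (fun Q hQ => ?_) fun Q hQ => ?_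
      · obtain ⟨m, h, R⟩ := exists_rep C Q
        exact (hV Q m h R).mpr (hsing Q hQ m h R).1
      · obtain ⟨m, R⟩ := hrep Q hQ
        obtain ⟨n, hn⟩ := exists_eps_eq_one R.1
        rw [hP]
        exact (hd m n).mem_singularSet R (by simp [hn]) eps_one_zero
    -- the points of the double line on the other two components
    have hthree : ∀ Q m, C.Rep Q m ![1, 0] → ε * m 1 ^ 2 + ω * m 0 ^ 2 = 0 →
        IsTangentAt (C.push (X 3)) (ricciPolyC Φ) Q 3 := by
      intro Q m R h0
      obtain ⟨n, hn⟩ := exists_eps_eq_one R.1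
      have hdn := hd m n
      rw [h0] at hdn
      rw [hP]
      refine isTangentAt_fourth_three R (by simp [hn]) hdn (Or.inr fun h1 => ?_)
      -- otherwise `m` would be isotropic and orthogonal to `n`, hence orthogonal to everything
      simp only [eps] at hn
      have h2 : (ε : ℂ) * m 1 = 0 := by linear_combination m 0 * h1 / 2 - n 0 * h0 - ε * m 1 * hn
      have h3 : m 1 = 0 := by simpa [hε0] using h2
      have h4 : m 0 = 0 := by simpa [h3, hω0] using h0
      simp [h3, h4] at hn
    -- the other points of the double line: the quadratic part is a nonzero multiple of `v²`
    have htac : ∀ Q m, C.Rep Q m ![1, 0] → ε * m 1 ^ 2 + ω * m 0 ^ 2 ≠ 0 → IsTacnode (ricciPolyC Φ) Q := by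
      intro Q m R h0
      obtain ⟨n, hn⟩ := exists_eps_eq_one R.1
      rw [hP]
      exact isTacnode (n := n) (t := ![0, 1]) (k := ε * m 1 ^ 2 + ω * m 0 ^ 2) (p := 0) (p' := 1) R (by simp [hn]) eps_one_zero
        (by simpa using hd m n) h0 (by simp) (by simp)
    refine ⟨rfl, by simp, hset, fun hεω => ?_, fun hεω => ?_⟩
    · have hl : IsBlockFactorization (q * X 3)
          [(.real 1 0, leftForm 1 1), (.real 1 0, leftForm 1 (-1)), (.sq 0 1, X 3)] := by
        refine ⟨?_, ?_, ε, by exact_mod_cast hε0, ?_⟩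
        · simp only [List.forall_mem_cons, Block.Admits]
          exact ⟨⟨irreducible_leftForm (by simp), isBihomogeneous_leftForm _ _, by simp [conjPoly_leftForm]⟩,
            ⟨irreducible_leftForm (by simp), isBihomogeneous_leftForm _ _, by simp [conjPoly_leftForm]⟩,
            ⟨irreducible_linear_right isBihomogeneous_fourth (X_ne_zero 3), isBihomogeneous_fourth,
              by simp [conjPoly]⟩, by simp⟩
        · simp only [components, Block.parts, List.flatMap_cons, List.flatMap_nil, List.cons_append, List.nil_append,
            List.append_nil, List.pairwise_cons, List.forall_mem_cons]
          exact ⟨⟨not_associated_of_eval ![1, 1, 1, 1] (by simp [eval_leftForm]) (by norm_num [eval_leftForm]),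
            not_associated_of_eval ![1, 1, 1, 1] (by simp [eval_leftForm]) (by simp), by simp⟩,
            ⟨not_associated_of_eval ![1, -1, 1, 1] (by simp [eval_leftForm]) (by simp), by simp⟩, by simp⟩
        · refine funext_eval fun x y u v => ?_
          have : (ω : ℂ) = -ε := by rw [hεω]; simp
          simp [hqe, Block.value, eval_leftForm, this]
          ring
      have hL : C.pushList [(.real 1 0, leftForm 1 1), (.real 1 0, leftForm 1 (-1)), (.sq 0 1, X 3)] =
          [(κ.tw (.real 1 0), C.push (leftForm 1 1)), (κ.tw (.real 1 0), C.push (leftForm 1 (-1))),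
            (κ.tw (.sq 0 1), C.push (X 3))] := by simp [pushList, htw]
      have hpt1 : ∀ Q, Q ∈ pt (cvec (C.E 0 + C.E 1)) ↔ C.Rep Q ![1, 1] ![1, 0] :=
        coordBasis_E.mem_pt_iff_rep (ne_zero_left one_ne_zero) (ne_zero_left one_ne_zero) one_ne_zero
          (by simp [Fin.sum_univ_four, nullCoeffs, cvec_add])
      have hpt2 : ∀ Q, Q ∈ pt (cvec (C.E 0 - C.E 1)) ↔ C.Rep Q ![1, -1] ![1, 0] :=
        coordBasis_E.mem_pt_iff_rep (ne_zero_left one_ne_zero) (ne_zero_left one_ne_zero) one_ne_zero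
          (by rw [cvec_sub]; simp [Fin.sum_univ_four, nullCoeffs, sub_eq_add_neg])
      refine ⟨_, _, _, hL ▸ isSpinorFactorization hP hl, zeros_fourth,
        zeros_left (c := 1) (by simp) one_ne_zero (by simp [cvec_add]) (by simp [cvec_sub]),
        zeros_left (c := -1) (by simp) (by simp) (by rw [cvec_sub]; simp [sub_eq_add_neg]) (by simp [cvec_add]), ?_, ?_, ?_⟩
      · ext Q
        obtain ⟨m, h, R⟩ := exists_rep C Q
        have hm := R.ne_fst
        rw [← hL, R.mem_crossings hl.1, Set.mem_union, hpt1, hpt2,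
          R.iff (ne_zero_left one_ne_zero) (ne_zero_left one_ne_zero),
          R.iff (ne_zero_left one_ne_zero) (ne_zero_left one_ne_zero)]
        simp [components, Block.parts, exists_pair_cons, eval_leftForm]
        clear hL hset hpt1 hpt2 hl hsing hP hqe hqb hthree htac hd hV hrep
        grind
      · intro Q hQ
        rw [Set.mem_union, hpt1, hpt2] at hQ
        rcases hQ with R | R
        · exact hthree Q _ R (by simp [hεω])
        · exact hthree Q _ R (by simp [hεω])
      · intro Q hQ hQ'
        obtain ⟨m, R⟩ := hrep Q (hset ▸ hQ)
        refine htac Q m R fun h0 => hQ' ?_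
        rw [Set.mem_union, hpt1, hpt2, R.iff (ne_zero_left one_ne_zero) (ne_zero_left one_ne_zero),
          R.iff (ne_zero_left one_ne_zero) (ne_zero_left one_ne_zero)]
        have : (ω : ℂ) = -ε := by rw [hεω]; simp
        have h1 : (ε : ℂ) * ((m 1 - m 0) * (m 1 + m 0)) = 0 := by rw [this] at h0; linear_combination h0
        simp [hε0] at h1
        rcases h1 with h1 | h1
        · exact Or.inl (by simp; linear_combination h1)
        · exact Or.inr (by simp; linear_combination h1)
    · have hl : IsBlockFactorization (q * X 3) [(.conj 1 0, leftForm 1 Complex.I), (.sq 0 1, X 3)] := by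
        refine ⟨?_, ?_, ε, by exact_mod_cast hε0, ?_⟩
        · simp only [List.forall_mem_cons, Block.Admits]
          exact ⟨⟨irreducible_leftForm (by simp), isBihomogeneous_leftForm _ _⟩,
            ⟨irreducible_linear_right isBihomogeneous_fourth (X_ne_zero 3), isBihomogeneous_fourth,
              by simp [conjPoly]⟩, by simp⟩
        · simp only [components, Block.parts, List.flatMap_cons, List.flatMap_nil, List.cons_append, List.nil_append,
            List.append_nil, List.pairwise_cons, List.forall_mem_cons, conjPoly_leftForm]
          refine ⟨⟨not_associated_of_eval ![1, Complex.I, 1, 1] (by simp [eval_leftForm]) ?_,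
            not_associated_of_eval ![1, Complex.I, 1, 1] (by simp [eval_leftForm]) (by simp), by simp⟩,
            ⟨not_associated_of_eval ![1, -Complex.I, 1, 1] (by simp [eval_leftForm]) (by simp), by simp⟩, by simp⟩
          simp [eval_leftForm]
          intro h0
          exact Complex.I_ne_zero (by linear_combination -h0 / 2)
        · refine funext_eval fun x y u v => ?_
          simp [hqe, Block.value, eval_leftForm, conjPoly_leftForm, ← hεω]
          linear_combination (ε * x ^ 2 * v ^ 2) * Complex.I_sq
      have hL : C.pushList [(.conj 1 0, leftForm 1 Complex.I), (.sq 0 1, X 3)] =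
          [(κ.tw (.conj 1 0), C.push (leftForm 1 Complex.I)), (κ.tw (.sq 0 1), C.push (X 3))] := by
        simp [pushList, htw]
      have hpt1 : ∀ Q, Q ∈ pt (cvec (C.E 0) + Complex.I • cvec (C.E 1)) ↔ C.Rep Q ![1, Complex.I] ![1, 0] :=
        coordBasis_E.mem_pt_iff_rep (ne_zero_left one_ne_zero) (ne_zero_left one_ne_zero) one_ne_zero
          (by simp [Fin.sum_univ_four, nullCoeffs])
      have hpt2 : ∀ Q, Q ∈ pt (cvec (C.E 0) - Complex.I • cvec (C.E 1)) ↔ C.Rep Q ![1, -Complex.I] ![1, 0] :=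
        coordBasis_E.mem_pt_iff_rep (ne_zero_left one_ne_zero) (ne_zero_left one_ne_zero) one_ne_zero
          (by simp [Fin.sum_univ_four, nullCoeffs, sub_eq_add_neg])
      refine ⟨_, _, hL ▸ isSpinorFactorization hP hl, zeros_fourth,
        zeros_left (c := -Complex.I) (by simp) (by simp) (by simp) (by simp), ?_, ?_, ?_, ?_⟩
      · rw [conjPoly_push, conjPoly_leftForm]
        exact zeros_left (c := Complex.I) (by simp) (by simp) (by simp [sub_eq_add_neg]) (by simp)
      · ext Q
        obtain ⟨m, h, R⟩ := exists_rep C Q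
        have hm := R.ne_fst
        rw [← hL, R.mem_crossings hl.1, Set.mem_union, hpt1, hpt2,
          R.iff (ne_zero_left one_ne_zero) (ne_zero_left one_ne_zero),
          R.iff (ne_zero_left one_ne_zero) (ne_zero_left one_ne_zero)]
        simp [components, Block.parts, exists_pair_cons, conjPoly_leftForm, eval_leftForm]
        have hI := Complex.I_ne_zero
        clear hL hset hpt1 hpt2 hl hsing hP hqe hqb hthree htac hd hV hrep
        grind
      · intro Q hQ
        rw [Set.mem_union, hpt1, hpt2] at hQ
        rcases hQ with R | R
        · exact hthree Q _ R (by simp [hεω])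
        · exact hthree Q _ R (by simp [hεω])
      · intro Q hQ hQ'
        obtain ⟨m, R⟩ := hrep Q (hset ▸ hQ)
        refine htac Q m R fun h0 => hQ' ?_
        rw [Set.mem_union, hpt1, hpt2, R.iff (ne_zero_left one_ne_zero) (ne_zero_left one_ne_zero),
          R.iff (ne_zero_left one_ne_zero) (ne_zero_left one_ne_zero)]
        have h1 : (ε : ℂ) * (m 0 ^ 2 + m 1 ^ 2) = 0 := by rw [← hεω] at h0; linear_combination h0
        have := sq_add_sq_eq_zero (x := m 0) (y := m 1) (by simpa [hε0] using h1)
        simpa using this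

end NeutralRicci

namespace NeutralRicci

open MvPolynomial

open SpinCoord

variable {Φ : (Fin 4 → ℝ) →ₗ[ℝ] (Fin 4 → ℝ)}

/-! ### Binary quadratic forms in two bilinear forms -/

/-- The bilinear form with the coefficients `a`, as a polynomial of bidegree `(1,1)`. -/
noncomputable def bilin (a : Fin 4 → ℂ) : MvPolynomial (Fin 4) ℂ :=
  C (a 0) * (X 0 * X 2) + C (a 1) * (X 0 * X 3) + C (a 2) * (X 1 * X 2) + C (a 3) * (X 1 * X 3)

lemma eval_bilin (a : Fin 4 → ℂ) (x y u v : ℂ) : eval ![x, y, u, v] (bilin a) =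
    a 0 * (x * u) + a 1 * (x * v) + a 2 * (y * u) + a 3 * (y * v) := by simp [bilin]

lemma conjPoly_bilin (a : Fin 4 → ℂ) : conjPoly (bilin a) = bilin fun i => (starRingEnd ℂ) (a i) := by
  simp [conjPoly, bilin]

lemma irreducible_bilin {a : Fin 4 → ℂ} (h : a 0 * a 3 - a 1 * a 2 ≠ 0) : Irreducible (bilin a) :=
  irreducible_bilinear (eval_bilin a) h

lemma isBihomogeneous_bilin (a : Fin 4 → ℂ) : IsBihomogeneous (bilin a) 1 1 :=
  isBihomogeneous_bilinear (eval_bilin a)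

/-- The linear combination `s a + t b` of two bilinear forms with real coefficients. -/
noncomputable def pencil (a b : Fin 4 → ℝ) (s t : ℂ) : MvPolynomial (Fin 4) ℂ := bilin fun i => s * a i + t * b i

lemma eval_pencil (a b : Fin 4 → ℝ) (s t x y u v : ℂ) : eval ![x, y, u, v] (pencil a b s t) =
    s * eval ![x, y, u, v] (bilin (cvec a)) + t * eval ![x, y, u, v] (bilin (cvec b)) := by
  simp only [pencil, eval_bilin, cvec]; ring

lemma conjPoly_pencil (a b : Fin 4 → ℝ) (s t : ℂ) :
    conjPoly (pencil a b s t) = pencil a b ((starRingEnd ℂ) s) ((starRingEnd ℂ) t) := by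
  simp [pencil, conjPoly_bilin]

lemma not_associated_pencil {a b : Fin 4 → ℝ} (hab : ∀ c d : ℂ, ∃ x y u v,
      eval ![x, y, u, v] (bilin (cvec a)) = c ∧ eval ![x, y, u, v] (bilin (cvec b)) = d)
    {s t s' t' : ℂ} (h : s * t' - t * s' ≠ 0) : ¬ Associated (pencil a b s t) (pencil a b s' t') := by
  obtain ⟨x, y, u, v, h1, h2⟩ := hab (-t) s
  refine not_associated_of_eval ![x, y, u, v] ?_ ?_
  · rw [eval_pencil, h1, h2]; ring
  · rw [eval_pencil, h1, h2]
    intro h0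
    exact h (by linear_combination h0)

/-- A binary quadratic form with positive discriminant is the product of two real linear forms. -/
lemma exists_real_factors {A B D : ℝ} (h : 0 < B ^ 2 - 4 * A * D) : ∃ c s t s' t' : ℝ, c ≠ 0 ∧
    s * t' - t * s' ≠ 0 ∧ A = c * (s * s') ∧ B = c * (s * t' + t * s') ∧ D = c * (t * t') := by
  by_cases hA : A = 0
  · subst hA
    have hB : B ≠ 0 := by rintro rfl; simp at h
    exact ⟨1, 0, 1, B, D, one_ne_zero, by simpa using hB, by ring, by ring, by ring⟩
  · obtain ⟨δ, hδ⟩ : ∃ δ : ℝ, δ ^ 2 = B ^ 2 - 4 * A * D := ⟨_, Real.sq_sqrt h.le⟩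
    have hδ0 : δ ≠ 0 := by rintro rfl; simp at hδ; linarith
    refine ⟨1 / (4 * A), 2 * A, B + δ, 2 * A, B - δ, by simp [hA], ?_, by field_simp; ring, by field_simp; ring, ?_⟩
    · intro h0
      have : A * δ = 0 := by linear_combination -h0 / 4
      simp [hA, hδ0] at this
    · field_simp
      linear_combination hδ

/-- A binary quadratic form with negative discriminant is, up to a real factor, the product of two complex conjugate
linear forms. -/
lemma exists_conj_factors {A B D : ℝ} (h : B ^ 2 - 4 * A * D < 0) : ∃ (c : ℝ) (s t : ℂ), c ≠ 0 ∧
    s * (starRingEnd ℂ) t - t * (starRingEnd ℂ) s ≠ 0 ∧ (A : ℂ) = c * (s * (starRingEnd ℂ) s) ∧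
    (B : ℂ) = c * (s * (starRingEnd ℂ) t + t * (starRingEnd ℂ) s) ∧ (D : ℂ) = c * (t * (starRingEnd ℂ) t) := by
  have hA : A ≠ 0 := by
    rintro rfl
    have := sq_nonneg B
    linarith
  obtain ⟨δ, hδ⟩ : ∃ δ : ℝ, δ ^ 2 = 4 * A * D - B ^ 2 := ⟨_, Real.sq_sqrt (by linarith)⟩
  have hδ0 : δ ≠ 0 := by rintro rfl; simp at hδ; linarith
  have hA' : (A : ℂ) ≠ 0 := by exact_mod_cast hA
  have hδ' : (δ : ℂ) ^ 2 = 4 * A * D - B ^ 2 := by exact_mod_cast hδ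
  have I2 := Complex.I_sq
  refine ⟨1 / (4 * A), 2 * A, B + δ * Complex.I, by simp [hA], ?_, ?_, ?_, ?_⟩
  · simp only [map_mul, map_add, Complex.conj_ofReal, Complex.conj_I, map_ofNat]
    intro h0
    have : (A : ℂ) * δ * Complex.I = 0 := by linear_combination -h0 / 4
    simp [hA, hδ0] at this
  · simp [Complex.conj_ofNat]; field_simp; ring
  · simp [Complex.conj_ofNat]; field_simp; ring
  · simp only [map_mul, map_add, Complex.conj_ofReal, Complex.conj_I]
    push_cast
    field_simp
    linear_combination -hδ' + δ ^ 2 * I2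

lemma two_linear_eq_zero {s t s' t' f g : ℂ} (h : s * t' - t * s' ≠ 0) :
    s * f + t * g = 0 ∧ s' * f + t' * g = 0 ↔ f = 0 ∧ g = 0 := by
  refine ⟨fun ⟨e, e'⟩ => ⟨?_, ?_⟩, fun ⟨e, e'⟩ => by simp [e, e']⟩
  · have : (s * t' - t * s') * f = 0 := by linear_combination t' * e - t * e'
    simpa [h] using this
  · have : (s * t' - t * s') * g = 0 := by linear_combination s * e' - s' * e
    simpa [h] using this

section Pencil

variable {C : SpinCoord} {q : MvPolynomial (Fin 4) ℂ} {a b : Fin 4 → ℝ} {A B D : ℝ} {S : Set Pt}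

/-- If the Ricci polynomial is a binary quadratic form with positive discriminant in two bilinear forms, then it has two
real factors of bidegree `(1,1)`. -/
lemma pencil_real (hP : ricciPolyC Φ = C.push q)
    (hq : ∀ x y u v, eval ![x, y, u, v] q = A * eval ![x, y, u, v] (bilin (cvec a)) ^ 2 +
      B * (eval ![x, y, u, v] (bilin (cvec a)) * eval ![x, y, u, v] (bilin (cvec b))) +
      D * eval ![x, y, u, v] (bilin (cvec b)) ^ 2)
    (hab : ∀ c d : ℂ, ∃ x y u v,
      eval ![x, y, u, v] (bilin (cvec a)) = c ∧ eval ![x, y, u, v] (bilin (cvec b)) = d)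
    (hdet : ∀ s t : ℂ, (s ≠ 0 ∨ t ≠ 0) → A * t ^ 2 - B * (s * t) + D * s ^ 2 = 0 →
      (s * a 0 + t * b 0) * (s * a 3 + t * b 3) - (s * a 1 + t * b 1) * (s * a 2 + t * b 2) ≠ 0)
    (hdisc : 0 < B ^ 2 - 4 * A * D)
    (hS : ∀ Q m h, C.Rep Q m h → (Q ∈ S ↔ eval ![m 0, m 1, h 0, h 1] (bilin (cvec a)) = 0 ∧
      eval ![m 0, m 1, h 0, h 1] (bilin (cvec b)) = 0)) :
    ∃ q₁ q₂, IsSpinorFactorization Φ [(.real 1 1, q₁), (.real 1 1, q₂)] ∧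
      crossings [(.real 1 1, q₁), (.real 1 1, q₂)] = S := by
  obtain ⟨c, s, t, s', t', hc, hd, rfl, rfl, rfl⟩ := exists_real_factors hdisc
  have hd' : (s * t' - t * s' : ℂ) ≠ 0 := by exact_mod_cast hd
  have n1 : (s : ℂ) ≠ 0 ∨ (t : ℂ) ≠ 0 := by
    by_contra! h0
    exact hd' (by rw [h0.1, h0.2]; ring)
  have n2 : (s' : ℂ) ≠ 0 ∨ (t' : ℂ) ≠ 0 := by
    by_contra! h0
    exact hd' (by rw [h0.1, h0.2]; ring)
  have hl : IsBlockFactorization q [(.real 1 1, pencil a b s t), (.real 1 1, pencil a b s' t')] := by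
    refine ⟨?_, ?_, c, hc, funext_eval fun x y u v => ?_⟩
    · simp only [List.forall_mem_cons, Block.Admits]
      exact ⟨⟨irreducible_bilin (hdet _ _ n1 (by push_cast; ring)), isBihomogeneous_bilin _, by simp [conjPoly_pencil]⟩,
        ⟨irreducible_bilin (hdet _ _ n2 (by push_cast; ring)), isBihomogeneous_bilin _, by simp [conjPoly_pencil]⟩,
        by simp⟩
    · simpa [components, Block.parts] using not_associated_pencil hab hd'
    · rw [hq]
      simp only [List.map_cons, List.map_nil, Block.value, List.prod_cons, List.prod_nil, map_mul, eval_C, eval_pencil,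
        map_one]
      push_cast
      ring
  have hL : C.pushList [(.real 1 1, pencil a b s t), (.real 1 1, pencil a b s' t')] =
      [(.real 1 1, C.push (pencil a b s t)), (.real 1 1, C.push (pencil a b s' t'))] := by
    simp [pushList, tw_self]
  refine ⟨_, _, hL ▸ isSpinorFactorization hP hl, ?_⟩
  ext Q
  obtain ⟨m, h, R⟩ := exists_rep C Q
  rw [← hL, R.mem_crossings hl.1, hS Q m h R]
  simp only [components, Block.parts, List.flatMap_cons, List.flatMap_nil, List.cons_append, List.nil_append,
    List.append_nil, exists_pair_cons, exists_pair_nil, eval_pencil, List.mem_cons, List.not_mem_nil,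
    or_false, exists_eq_left, false_and, and_false, exists_false]
  exact two_linear_eq_zero hd'

/-- If the Ricci polynomial is a binary quadratic form with negative discriminant in two bilinear forms, then it is the
product of two complex conjugate factors of bidegree `(1,1)`. -/
lemma pencil_conj (hP : ricciPolyC Φ = C.push q)
    (hq : ∀ x y u v, eval ![x, y, u, v] q = A * eval ![x, y, u, v] (bilin (cvec a)) ^ 2 +
      B * (eval ![x, y, u, v] (bilin (cvec a)) * eval ![x, y, u, v] (bilin (cvec b))) +
      D * eval ![x, y, u, v] (bilin (cvec b)) ^ 2)
    (hab : ∀ c d : ℂ, ∃ x y u v,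
      eval ![x, y, u, v] (bilin (cvec a)) = c ∧ eval ![x, y, u, v] (bilin (cvec b)) = d)
    (hdet : ∀ s t : ℂ, (s ≠ 0 ∨ t ≠ 0) → A * t ^ 2 - B * (s * t) + D * s ^ 2 = 0 →
      (s * a 0 + t * b 0) * (s * a 3 + t * b 3) - (s * a 1 + t * b 1) * (s * a 2 + t * b 2) ≠ 0)
    (hdisc : B ^ 2 - 4 * A * D < 0)
    (hS : ∀ Q m h, C.Rep Q m h → (Q ∈ S ↔ eval ![m 0, m 1, h 0, h 1] (bilin (cvec a)) = 0 ∧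
      eval ![m 0, m 1, h 0, h 1] (bilin (cvec b)) = 0)) :
    ∃ q, IsSpinorFactorization Φ [(.conj 1 1, q)] ∧ crossings [(.conj 1 1, q)] = S := by
  obtain ⟨c, s, t, hc, hd, e1, e2, e3⟩ := exists_conj_factors hdisc
  have n1 : s ≠ 0 ∨ t ≠ 0 := by
    by_contra! h0
    exact hd (by rw [h0.1, h0.2]; simp)
  have hl : IsBlockFactorization q [(.conj 1 1, pencil a b s t)] := by
    refine ⟨?_, ?_, c, hc, funext_eval fun x y u v => ?_⟩
    · simp only [List.forall_mem_cons, Block.Admits]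
      exact ⟨⟨irreducible_bilin (hdet _ _ n1 (by rw [e1, e2, e3]; ring)), isBihomogeneous_bilin _⟩, by simp⟩
    · simpa [components, Block.parts, conjPoly_pencil] using not_associated_pencil hab hd
    · rw [hq, e1, e2, e3]
      simp only [List.map_cons, List.map_nil, Block.value, List.prod_cons, List.prod_nil, map_mul, eval_C, eval_pencil,
        map_one, conjPoly_pencil]
      ring
  have hL : C.pushList [(.conj 1 1, pencil a b s t)] = [(.conj 1 1, C.push (pencil a b s t))] := by
    simp [pushList, tw, Block.swap]
  refine ⟨_, hL ▸ isSpinorFactorization hP hl, ?_⟩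
  ext Q
  obtain ⟨m, h, R⟩ := exists_rep C Q
  rw [← hL, R.mem_crossings hl.1, hS Q m h R]
  simp only [components, Block.parts, List.flatMap_cons, List.flatMap_nil, 
    List.append_nil, exists_pair_cons, exists_pair_nil, eval_pencil, List.mem_cons, List.not_mem_nil, conjPoly_pencil,
    or_false, exists_eq_left, false_and, and_false, exists_false]
  exact two_linear_eq_zero hd

end Pencil

end NeutralRicci

namespace NeutralRicci

open MvPolynomial

open SpinCoord

variable {Φ : (Fin 4 → ℝ) →ₗ[ℝ] (Fin 4 → ℝ)}

/-! ### Type IV -/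

/-- At `⟨E₂⟩` the quadratic part is `(λ - ν) / 2 (y² + v²) + 2 (λ + ν) y v`, with the discriminant
`(3 λ + ν) (λ + 3 ν)`. The latter vanishes iff `μ = ν` or `λ = μ`; the polynomial is then `k (x u ± y v)² + ε (x v)²`. -/
theorem type_IV (hsa : ∀ u v, s22 (Φ u) v = s22 u (Φ v)) (htr : LinearMap.trace ℝ (Fin 4 → ℝ) Φ = 0)
    (κ : OType) (E : Fin 4 → Fin 4 → ℝ) (ε lam μ ν : ℝ) (hE : IsWitt E) (hκ : HasOType (toPsiON E) κ)
    (hε : ε = 1 ∨ ε = -1)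
    (hM : HasMatrix Φ E !![(lam + ν) / 2, 0, (lam - ν) / 2, 0; 0, μ, 0, ε;
        (lam - ν) / 2, 0, (lam + ν) / 2, 0; 0, 0, 0, μ]) :
      lam + ν = -2 * μ ∧
      HasSpinorForm Φ κ E
        (fun o ι o' ι' A B A' B' =>
          (lam - ν) / 2 * (dbl o A B * dbl o' A' B' + dbl ι A B * dbl ι' A' B') +
          (lam + ν) / 2 * mix o ι A B * mix o' ι' A' B' + ε * dbl ι A B * dbl o' A' B')
        (fun X Y U V => ((lam - ν) / 2) • (Y ^ 2 * V ^ 2 + X ^ 2 * U ^ 2) +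
          (2 * (lam + ν)) • (X * Y * U * V) + ε • (X ^ 2 * V ^ 2)) ∧
      (lam ≠ μ → μ ≠ ν → lam ≠ ν →
        (∃ q, IsSpinorFactorization Φ [(.real 2 2, q)]) ∧
        singularSet (ricciPolyC Φ) = pt (cvec (E 1)) ∧
        (3 * lam + ν) * (lam + 3 * ν) ≠ 0 ∧
        ∀ Q ∈ pt (cvec (E 1)),
          (0 < (3 * lam + ν) * (lam + 3 * ν) → IsRealNodeRealTangents (ricciPolyC Φ) Q) ∧
          ((3 * lam + ν) * (lam + 3 * ν) < 0 → IsRealNodeComplexTangents (ricciPolyC Φ) Q)) ∧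
      (μ = ν → lam ≠ ν → lam + 3 * ν = 0 ∧
        singularSet (ricciPolyC Φ) = pt (cvec (E 1)) ∧
        (∀ Q ∈ pt (cvec (E 1)), IsRealPt Q ∧ IsTacnode (ricciPolyC Φ) Q) ∧
        (0 < ε * ν → ∃ q₁ q₂, IsSpinorFactorization Φ [(.real 1 1, q₁), (.real 1 1, q₂)] ∧
          crossings [(.real 1 1, q₁), (.real 1 1, q₂)] = pt (cvec (E 1))) ∧
        (ε * ν < 0 → ∃ q, IsSpinorFactorization Φ [(.conj 1 1, q)] ∧
          crossings [(.conj 1 1, q)] = pt (cvec (E 1)))) ∧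
      (lam = μ → lam ≠ ν → 3 * lam + ν = 0 ∧
        singularSet (ricciPolyC Φ) = pt (cvec (E 1)) ∧
        (∀ Q ∈ pt (cvec (E 1)), IsRealPt Q ∧ IsTacnode (ricciPolyC Φ) Q) ∧
        (0 < ε * lam → ∃ q, IsSpinorFactorization Φ [(.conj 1 1, q)] ∧
          crossings [(.conj 1 1, q)] = pt (cvec (E 1))) ∧
        (ε * lam < 0 → ∃ q₁ q₂, IsSpinorFactorization Φ [(.real 1 1, q₁), (.real 1 1, q₂)] ∧
          crossings [(.real 1 1, q₁), (.real 1 1, q₂)] = pt (cvec (E 1)))) ∧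
      (lam = ν → lam ≠ μ → lam + μ = 0 ∧
        singularSet (ricciPolyC Φ) = pt (cvec (E 0)) ∪ pt (cvec (E 1)) ∪ pt (cvec (E 2)) ∧
        ∃ m q n, IsSpinorFactorization Φ [(κ.tw (.real 0 1), m), (.real 1 1, q), (κ.tw (.real 1 0), n)] ∧
          zeros m = linePts (cvec (E 0)) (cvec (E 1)) ∧ zeros n = linePts (cvec (E 1)) (cvec (E 2)) ∧
          zeros m ∩ zeros n = pt (cvec (E 1)) ∧
          zeros m ∩ zeros q = pt (cvec (E 0)) ∧ zeros n ∩ zeros q = pt (cvec (E 2)) ∧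
          ∀ Q ∈ singularSet (ricciPolyC Φ), IsRealNodeRealTangents (ricciPolyC Φ) Q ∧
            TangentsFromComponents (ricciPolyC Φ)
              [(κ.tw (.real 0 1), m), (.real 1 1, q), (κ.tw (.real 1 0), n)] Q) ∧
      (lam = μ → μ = ν → lam = 0 ∧ μ = 0 ∧ ν = 0 ∧
        ∃ m n, IsSpinorFactorization Φ [(κ.tw (.sq 0 1), m), (κ.tw (.sq 1 0), n)] ∧
          zeros m = linePts (cvec (E 0)) (cvec (E 1)) ∧ zeros n = linePts (cvec (E 1)) (cvec (E 2)) ∧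
          zeros m ∩ zeros n = pt (cvec (E 1)) ∧
          zeros (ricciPolyC Φ) = zeros m ∪ zeros n ∧ singularSet (ricciPolyC Φ) = zeros m ∪ zeros n) := by
  have htr' : lam + ν = -2 * μ := by
    have := hE.trace_eq hM htr
    simp at this
    linarith
  obtain rfl : μ = -(lam + ν) / 2 := by linarith
  refine ⟨htr', hasSpinorForm_of_matrix hE hM ?_ ?_, ?_⟩
  · intro a b a' b' A B A' B'
    simp [Fin.sum_univ_four, wittSpinor, dbl, mix]
    ring
  · intro X Y U V
    refine MvPolynomial.funext fun z => ?_
    simp [Fin.sum_univ_four, wittForm, smul_eval]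
    ring
  obtain ⟨C, rfl, hs, htw⟩ := exists_of_hasOType hE hκ
  have hε0 : ε ≠ 0 := by rcases hε with rfl | rfl <;> simp
  have hε0' : (ε : ℂ) ≠ 0 := by exact_mod_cast hε0
  set q : MvPolynomial (Fin 4) ℂ := MvPolynomial.C ((lam - ν) / 2 : ℂ) * (X 1 ^ 2 * X 3 ^ 2 + X 0 ^ 2 * X 2 ^ 2) +
    MvPolynomial.C (2 * (lam + ν) : ℂ) * (X 0 * X 1 * X 2 * X 3) +
    MvPolynomial.C (ε : ℂ) * (X 0 ^ 2 * X 3 ^ 2) with hq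
  have hqe : ∀ x y u v, eval ![x, y, u, v] q = (lam - ν) / 2 * (y ^ 2 * v ^ 2 + x ^ 2 * u ^ 2) +
    2 * (lam + ν) * (x * y * u * v) + ε * (x ^ 2 * v ^ 2) := fun x y u v => by simp [hq]
  have hP : ricciPolyC Φ = C.push q := by
    refine ricciPolyC_eq_push hM fun m h => ?_
    simp [nullCoeffs, Fin.sum_univ_four, hs, hqe]
    ring
  have hqb : IsBihomogeneous q 2 2 := isBihomogeneous_of_eval fun a b x y u v => by simp only [hqe]; ring
  have hpt0 : ∀ Q, Q ∈ pt (cvec (C.E 0)) ↔ C.Rep Q ![1, 0] ![1, 0] :=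
    coordBasis_E.mem_pt_iff_rep (ne_zero_left one_ne_zero) (ne_zero_left one_ne_zero) one_ne_zero
      (by simp [Fin.sum_univ_four, nullCoeffs])
  have hpt1 : ∀ Q, Q ∈ pt (cvec (C.E 1)) ↔ C.Rep Q ![0, 1] ![1, 0] :=
    coordBasis_E.mem_pt_iff_rep (ne_zero_right one_ne_zero) (ne_zero_left one_ne_zero) one_ne_zero
      (by simp [Fin.sum_univ_four, nullCoeffs])
  have hpt2 : ∀ Q, Q ∈ pt (cvec (C.E 2)) ↔ C.Rep Q ![0, 1] ![0, 1] :=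
    coordBasis_E.mem_pt_iff_rep (ne_zero_right one_ne_zero) (ne_zero_right one_ne_zero) one_ne_zero
      (by simp [Fin.sum_univ_four, nullCoeffs])
  have hrep0 : ∀ Q m h, C.Rep Q m h → (Q ∈ pt (cvec (C.E 0)) ↔ m 1 = 0 ∧ h 1 = 0) := fun Q m h R => by
    rw [hpt0, R.iff (ne_zero_left one_ne_zero) (ne_zero_left one_ne_zero)]; simp
  have hrep1 : ∀ Q m h, C.Rep Q m h → (Q ∈ pt (cvec (C.E 1)) ↔ m 0 = 0 ∧ h 1 = 0) := fun Q m h R => by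
    rw [hpt1, R.iff (ne_zero_right one_ne_zero) (ne_zero_left one_ne_zero)]; simp [eq_comm]
  have hrep2 : ∀ Q m h, C.Rep Q m h → (Q ∈ pt (cvec (C.E 2)) ↔ m 0 = 0 ∧ h 0 = 0) := fun Q m h R => by
    rw [hpt2, R.iff (ne_zero_right one_ne_zero) (ne_zero_right one_ne_zero)]; simp [eq_comm]
  have hptR : ∀ Q, Q ∈ pt (cvec (C.E 1)) ↔ C.Rep Q (cvec ![0, 1]) (cvec ![1, 0]) := by
    simpa only [cvec_pair, Complex.ofReal_one, Complex.ofReal_zero] using hpt1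
  have e1 : eps (![0, 1] : Fin 2 → ℂ) ![1, 0] ≠ 0 := by simp [eps]
  have hd : DoubleAt q ![0, 1] ![1, 0] ![1, 0] ![0, 1] ((lam - ν) / 2) (2 * (lam + ν)) ((lam - ν) / 2) 0 0 ε := by
    intro x y u v
    simp [hqe]
    ring
  have hsing : lam ≠ ν → singularSet (ricciPolyC Φ) = pt (cvec (C.E 1)) := by
    intro hne
    refine Set.Subset.antisymm (fun Q hQ => ?_) fun Q hQ => ?_
    · obtain ⟨m, h, R⟩ := exists_rep C Q
      obtain ⟨χ, hχ⟩ := (coordBasis_E.mem_singularSet hsa hM R).mp hQ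
      have e0 := hχ 0
      have e1 := hχ 1
      have e2 := hχ 2
      have e3 := hχ 3
      rw [hrep1 Q m h R]
      simp [Fin.sum_univ_four, nullCoeffs] at e0 e1 e2 e3 ⊢
      have hm := R.ne_fst
      have hh := R.ne_snd
      have hδ : (lam : ℂ) - ν ≠ 0 := sub_ne_zero.mpr (by exact_mod_cast hne)
      have h3 : m 0 * h 1 = 0 := by
        by_contra h3
        have hχ : χ = -(lam + ν) / 2 := by
          rcases e3 with h4 | h4 | h4
          · linear_combination -h4
          · exact absurd (by rw [h4, zero_mul]) h3
          · exact absurd (by rw [h4, mul_zero]) h3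
        subst hχ
        exact h3 (by simpa [hε0] using (by linear_combination -e1 : (ε : ℂ) * (m 0 * h 1) = 0))
      have h4 : m 0 * h 0 = 0 ∧ m 1 * h 1 = 0 := by
        have h5 : m 0 * h 0 = 0 ∨ m 1 * h 1 = 0 := by
          rcases mul_eq_zero.mp h3 with h | h <;> simp [h]
        rcases h5 with h5 | h5
        · have : (lam - ν : ℂ) * (m 1 * h 1) = 0 := by
            linear_combination 2 * e0 + (2 * χ - (lam + ν)) * h5
          exact ⟨h5, by simpa [hδ] using this⟩
        · have : (lam - ν : ℂ) * (m 0 * h 0) = 0 := by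
            linear_combination 2 * e2 + (2 * χ - (lam + ν)) * h5
          exact ⟨by simpa [hδ] using this, h5⟩
      clear hd hpt0 hpt1 hpt2 hptR hqb hP hqe hχ hQ hq hM hrep0 hrep1 hrep2
      grind
    · rw [hP]
      exact hd.mem_singularSet ((hpt1 Q).mp hQ) e1 eps_one_zero
  have hreal : ∀ Q ∈ pt (cvec (C.E 1)), IsRealPt Q := fun Q hQ => isRealPt ((hptR Q).mp hQ)
  have hδ : lam ≠ ν → (lam : ℂ) - ν ≠ 0 := fun h => sub_ne_zero.mpr (by exact_mod_cast h)
  refine ⟨fun h1 h2 h3 => ?_, fun h1 h2 => ?_, fun h1 h2 => ?_, fun h1 h2 => ?_, fun h1 h2 => ?_⟩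
  · have hD : (3 * lam + ν) * (lam + 3 * ν) ≠ 0 := by
      refine mul_ne_zero (fun h => h1 (by linarith)) fun h => h2 (by linarith)
    have hδ' := hδ h3
    have hqi : Irreducible q := by
      refine irreducible_of_discriminant (fun u v => (lam - ν) / 2 * u ^ 2 + ε * v ^ 2)
        (fun u v => 2 * (lam + ν) * (u * v)) (fun u v => (lam - ν) / 2 * v ^ 2) hqb
        (fun x y u v => by rw [hqe]; ring) (fun x y hxy => ?_) (fun u v huv => ?_) fun α β γ h => ?_
      · by_cases hx : x = 0
        · exact ⟨0, 1, by simpa [hqe, hx, hδ'] using hxy⟩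
        · exact ⟨1, 0, by simp [hqe, hx, hδ']⟩
      · by_cases hv : v = 0
        · exact ⟨1, 0, by simpa [hqe, hv, hδ'] using huv⟩
        · exact ⟨0, 1, by simp [hqe, hv, hδ']⟩
      -- the discriminant is `v² (D u² - 2 (λ - ν) ε v²)`, whose last factor has two simple zeros
      · have k0 := h 1 0
        have k1 := h 0 1
        have k2 := h 1 1
        have k3 := h (-1) 1
        have hα : α ^ 2 = 0 := by linear_combination -k0
        have hα' : α = 0 := by simpa using hα
        subst hα'
        have hγ : γ ≠ 0 := by
          rintro rfl
          have : (lam - ν : ℂ) * ε = 0 := by linear_combination -k1 / 2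
          simp [hδ', hε0] at this
        have hβ : β * γ = 0 := by linear_combination (k3 - k2) / 4
        have hβ' : β = 0 := by simpa [hγ] using hβ
        subst hβ'
        have : (((3 * lam + ν) * (lam + 3 * ν) : ℝ) : ℂ) = 0 := by
          push_cast
          linear_combination k2 - k1
        exact hD (by exact_mod_cast this)
    refine ⟨isSpinorFactorization_of_irreducible (by rw [hP]; exact irreducible_push hqi), hsing h3, hD,
      fun Q hQ => ⟨fun hD => ?_, fun hD => ?_⟩⟩
    · rw [hP]
      refine isRealNodeRealTangents (n := ![1, 0]) (t := ![0, 1]) (c₂₀ := (lam - ν) / 2) (c₁₁ := 2 * (lam + ν))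
        (c₀₂ := (lam - ν) / 2) (c₂₁ := 0) (c₁₂ := 0) (c₂₂ := ε) ((hptR Q).mp hQ) (by simp [eps]) (by simp [eps])
        (by simpa [cvec_pair] using hd) (by nlinarith)
    · rw [hP]
      refine isRealNodeComplexTangents (n := ![1, 0]) (t := ![0, 1]) (c₂₀ := (lam - ν) / 2) (c₁₁ := 2 * (lam + ν))
        (c₀₂ := (lam - ν) / 2) (c₂₂ := ε) ((hptR Q).mp hQ) (by simp [eps]) (by simp [eps])
        (by simpa [cvec_pair] using hd) (by nlinarith)
  · -- `μ = ν`: a quadratic form in `x u + y v` and `x v`, without mixed term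
    obtain rfl : lam = -3 * ν := by linarith
    have hν : ν ≠ 0 := by rintro rfl; simp at h2
    have hqe' : ∀ x y u v, eval ![x, y, u, v] q =
        (-2 * ν : ℝ) * eval ![x, y, u, v] (bilin (cvec ![1, 0, 0, 1])) ^ 2 +
        (0 : ℝ) * (eval ![x, y, u, v] (bilin (cvec ![1, 0, 0, 1])) * eval ![x, y, u, v] (bilin (cvec ![0, 1, 0, 0]))) +
        ε * eval ![x, y, u, v] (bilin (cvec ![0, 1, 0, 0])) ^ 2 := by
      intro x y u v
      simp [hqe, eval_bilin, cvec]
      ring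
    have hab : ∀ c d : ℂ, ∃ x y u v, eval ![x, y, u, v] (bilin (cvec ![1, 0, 0, 1])) = c ∧
        eval ![x, y, u, v] (bilin (cvec ![0, 1, 0, 0])) = d :=
      fun c d => ⟨1, 0, c, d, by simp [eval_bilin, cvec], by simp [eval_bilin, cvec]⟩
    have hdet : ∀ s t : ℂ, (s ≠ 0 ∨ t ≠ 0) → (-2 * ν : ℝ) * t ^ 2 - (0 : ℝ) * (s * t) + ε * s ^ 2 = 0 →
        (s * (![1, 0, 0, 1] : Fin 4 → ℝ) 0 + t * (![0, 1, 0, 0] : Fin 4 → ℝ) 0) *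
          (s * (![1, 0, 0, 1] : Fin 4 → ℝ) 3 + t * (![0, 1, 0, 0] : Fin 4 → ℝ) 3) -
        (s * (![1, 0, 0, 1] : Fin 4 → ℝ) 1 + t * (![0, 1, 0, 0] : Fin 4 → ℝ) 1) *
          (s * (![1, 0, 0, 1] : Fin 4 → ℝ) 2 + t * (![0, 1, 0, 0] : Fin 4 → ℝ) 2) ≠ 0 := by
      intro s t hst h0 h1
      have hs0 : s = 0 := by simpa using h1
      subst hs0
      have ht0 : t = 0 := by simpa [hν] using h0
      simp [ht0] at hst
    have hS : ∀ Q m h, C.Rep Q m h → (Q ∈ pt (cvec (C.E 1)) ↔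
        eval ![m 0, m 1, h 0, h 1] (bilin (cvec ![1, 0, 0, 1])) = 0 ∧
        eval ![m 0, m 1, h 0, h 1] (bilin (cvec ![0, 1, 0, 0])) = 0) := by
      intro Q m h R
      have := R.ne_fst
      have := R.ne_snd
      rw [hrep1 Q m h R]
      simp [eval_bilin, cvec]
      clear hd hpt0 hpt1 hpt2 hptR hqb hP hqe hq hM hrep0 hrep1 hrep2 hqe' hab hdet
      grind
    refine ⟨by ring, hsing h2, fun Q hQ => ⟨hreal Q hQ, ?_⟩, fun h0 => ?_, fun h0 => ?_⟩
    · rw [hP]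
      refine isTacnode (m := ![0, 1]) (n := ![1, 0]) (h := ![1, 0]) (t := ![0, 1]) (k := -2 * ν) (p := 1) (p' := 1)
        (c₂₁ := 0) (c₁₂ := 0) (c₂₂ := ε) ((hpt1 Q).mp hQ) e1 eps_one_zero ?_ (by simp [hν]) (by simp) (by simp)
      convert hd using 1 <;> push_cast <;> ring
    · exact pencil_real hP hqe' hab hdet (by linarith) hS
    · exact pencil_conj hP hqe' hab hdet (by linarith) hS
  · -- `λ = μ`: a quadratic form in `x u - y v` and `x v`, without mixed term
    obtain rfl : ν = -3 * lam := by linarith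
    have hν : lam ≠ 0 := by rintro rfl; simp at h2
    have hqe' : ∀ x y u v, eval ![x, y, u, v] q =
        (2 * lam : ℝ) * eval ![x, y, u, v] (bilin (cvec ![1, 0, 0, -1])) ^ 2 +
        (0 : ℝ) * (eval ![x, y, u, v] (bilin (cvec ![1, 0, 0, -1])) * eval ![x, y, u, v] (bilin (cvec ![0, 1, 0, 0]))) +
        ε * eval ![x, y, u, v] (bilin (cvec ![0, 1, 0, 0])) ^ 2 := by
      intro x y u v
      simp [hqe, eval_bilin, cvec]
      ring
    have hab : ∀ c d : ℂ, ∃ x y u v, eval ![x, y, u, v] (bilin (cvec ![1, 0, 0, -1])) = c ∧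
        eval ![x, y, u, v] (bilin (cvec ![0, 1, 0, 0])) = d :=
      fun c d => ⟨1, 0, c, d, by simp [eval_bilin, cvec], by simp [eval_bilin, cvec]⟩
    have hdet : ∀ s t : ℂ, (s ≠ 0 ∨ t ≠ 0) → (2 * lam : ℝ) * t ^ 2 - (0 : ℝ) * (s * t) + ε * s ^ 2 = 0 →
        (s * (![1, 0, 0, -1] : Fin 4 → ℝ) 0 + t * (![0, 1, 0, 0] : Fin 4 → ℝ) 0) *
          (s * (![1, 0, 0, -1] : Fin 4 → ℝ) 3 + t * (![0, 1, 0, 0] : Fin 4 → ℝ) 3) -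
        (s * (![1, 0, 0, -1] : Fin 4 → ℝ) 1 + t * (![0, 1, 0, 0] : Fin 4 → ℝ) 1) *
          (s * (![1, 0, 0, -1] : Fin 4 → ℝ) 2 + t * (![0, 1, 0, 0] : Fin 4 → ℝ) 2) ≠ 0 := by
      intro s t hst h0 h1
      have hs0 : s = 0 := by simpa using h1
      subst hs0
      have ht0 : t = 0 := by simpa [hν] using h0
      simp [ht0] at hst
    have hS : ∀ Q m h, C.Rep Q m h → (Q ∈ pt (cvec (C.E 1)) ↔
        eval ![m 0, m 1, h 0, h 1] (bilin (cvec ![1, 0, 0, -1])) = 0 ∧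
        eval ![m 0, m 1, h 0, h 1] (bilin (cvec ![0, 1, 0, 0])) = 0) := by
      intro Q m h R
      have := R.ne_fst
      have := R.ne_snd
      rw [hrep1 Q m h R]
      simp [eval_bilin, cvec]
      clear hd hpt0 hpt1 hpt2 hptR hqb hP hqe hq hM hrep0 hrep1 hrep2 hqe' hab hdet
      grind
    refine ⟨by ring, hsing h2, fun Q hQ => ⟨hreal Q hQ, ?_⟩, fun h0 => ?_, fun h0 => ?_⟩
    · rw [hP]
      refine isTacnode (m := ![0, 1]) (n := ![1, 0]) (h := ![1, 0]) (t := ![0, 1]) (k := 2 * lam) (p := 1) (p' := -1)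
        (c₂₁ := 0) (c₁₂ := 0) (c₂₂ := ε) ((hpt1 Q).mp hQ) e1 eps_one_zero ?_ (by simp [hν]) (by simp) (by simp)
      convert hd using 1 <;> push_cast <;> ring
    · exact pencil_conj hP hqe' hab hdet (by linarith) hS
    · exact pencil_real hP hqe' hab hdet (by linarith) hS
  · -- `λ = ν`: the polynomial is `x v (ε x v + 4 λ y u)`
    subst h1
    have hlam : lam ≠ 0 := by rintro rfl; simp at h2
    have hlam' : (lam : ℂ) ≠ 0 := by exact_mod_cast hlam
    set p : MvPolynomial (Fin 4) ℂ := bilin (cvec ![0, ε, 4 * lam, 0]) with hp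
    have hpe : ∀ x y u v, eval ![x, y, u, v] p = ε * (x * v) + 4 * lam * (y * u) := by
      intro x y u v
      simp [hp, eval_bilin, cvec]
    have hl : IsBlockFactorization q [(.real 0 1, X 3), (.real 1 1, p), (.real 1 0, leftForm 0 1)] := by
      refine ⟨?_, ?_, 1, one_ne_zero, ?_⟩
      · simp only [List.forall_mem_cons, Block.Admits]
        exact ⟨⟨irreducible_linear_right isBihomogeneous_fourth (X_ne_zero 3), isBihomogeneous_fourth, by simp [conjPoly]⟩,
          ⟨irreducible_bilin (by simp [cvec, hε0, hlam]), isBihomogeneous_bilin _,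
            by simp [hp, conjPoly_bilin, cvec]; rfl⟩,
          ⟨irreducible_leftForm (by simp), isBihomogeneous_leftForm _ _, by simp [conjPoly_leftForm]⟩, by simp⟩
      · simp only [components, Block.parts, List.flatMap_cons, List.flatMap_nil, List.cons_append, List.nil_append,
          List.append_nil, List.pairwise_cons, List.forall_mem_cons]
        exact ⟨⟨not_associated_of_eval ![1, 1, 1, 0] (by simp) (by simp [hpe, hlam]),
          not_associated_of_eval ![1, 1, 1, 0] (by simp) (by simp [eval_leftForm]), by simp⟩,
          ⟨not_associated_of_eval ![1, 0, 1, 0] (by simp [hpe]) (by simp [eval_leftForm]), by simp⟩, by simp⟩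
      · refine funext_eval fun x y u v => ?_
        simp [hqe, Block.value, eval_leftForm, hpe]
        ring
    have hL : C.pushList [(.real 0 1, X 3), (.real 1 1, p), (.real 1 0, leftForm 0 1)] =
        [(κ.tw (.real 0 1), C.push (X 3)), (.real 1 1, C.push p), (κ.tw (.real 1 0), C.push (leftForm 0 1))] := by
      simp [pushList, htw, tw_self]
    have hset : singularSet (ricciPolyC Φ) = pt (cvec (C.E 0)) ∪ pt (cvec (C.E 1)) ∪ pt (cvec (C.E 2)) := by
      ext Q
      obtain ⟨m, h, R⟩ := exists_rep C Q
      rw [coordBasis_E.mem_singularSet hsa hM R, Set.mem_union, Set.mem_union, hrep0 Q m h R, hrep1 Q m h R,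
        hrep2 Q m h R]
      have hm := R.ne_fst
      have hh := R.ne_snd
      constructor
      · rintro ⟨χ, hχ⟩
        have e0 := hχ 0
        have e1 := hχ 1
        have e2 := hχ 2
        have e3 := hχ 3
        simp [Fin.sum_univ_four, nullCoeffs] at e0 e1 e2 e3
        clear hd hpt0 hpt1 hpt2 hptR hqb hP hqe hχ hq hM hrep0 hrep1 hrep2 hl hL hpe hp hsing hreal
        grind
      · rintro ((⟨h1, h2⟩ | ⟨h1, h2⟩) | ⟨h1, h2⟩)
        · exact ⟨lam, fun i => by fin_cases i <;> simp [Fin.sum_univ_four, nullCoeffs, h1, h2]⟩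
        · exact ⟨-lam, fun i => by fin_cases i <;> simp [Fin.sum_univ_four, nullCoeffs, h1, h2]⟩
        · exact ⟨lam, fun i => by fin_cases i <;> simp [Fin.sum_univ_four, nullCoeffs, h1, h2]⟩
    have hz3 : ∀ Q m h, C.Rep Q m h → (Q ∈ zeros (C.push (X 3)) ↔ h 1 = 0) := fun Q m h R => by
      rw [R.mem_zeros isBihomogeneous_fourth]; simp
    have hz0 : ∀ Q m h, C.Rep Q m h → (Q ∈ zeros (C.push (leftForm 0 1)) ↔ m 0 = 0) := fun Q m h R => by
      rw [R.mem_zeros (isBihomogeneous_leftForm 0 1)]; simp [eval_leftForm]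
    have hzp : ∀ Q m h, C.Rep Q m h → (Q ∈ zeros (C.push p) ↔ ε * (m 0 * h 1) + 4 * lam * (m 1 * h 0) = 0) :=
      fun Q m h R => by rw [R.mem_zeros (isBihomogeneous_bilin _), hpe]
    have hfac : q = X 3 * p * leftForm 0 1 := funext_eval fun x y u v => by
      simp [hqe, hpe, eval_leftForm]; ring
    refine ⟨by ring, hset, _, _, _, hL ▸ isSpinorFactorization hP hl, zeros_fourth,
      zeros_left (c := 1) (by simp) one_ne_zero (by simp) (by simp), ?_, ?_, ?_, ?_⟩
    · ext Q
      obtain ⟨m, h, R⟩ := exists_rep C Q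
      rw [Set.mem_inter_iff, hz3 Q m h R, hz0 Q m h R, hrep1 Q m h R, and_comm]
    · ext Q
      obtain ⟨m, h, R⟩ := exists_rep C Q
      have := R.ne_snd
      rw [Set.mem_inter_iff, hz3 Q m h R, hzp Q m h R, hrep0 Q m h R]
      grind
    · ext Q
      obtain ⟨m, h, R⟩ := exists_rep C Q
      have := R.ne_fst
      rw [Set.mem_inter_iff, hz0 Q m h R, hzp Q m h R, hrep2 Q m h R]
      grind
    · rw [hset]
      rintro Q ((hQ | hQ) | hQ)
      · have R := (hpt0 Q).mp hQ
        have R' : C.Rep Q (cvec ![1, 0]) (cvec ![1, 0]) := by simpa [cvec_pair] using R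
        rw [← hL, hP]
        refine ⟨isRealNodeRealTangents (n := ![0, 1]) (t := ![0, 1]) (c₂₀ := 0) (c₁₁ := 4 * lam)
          (c₀₂ := ε) (c₂₁ := 0) (c₁₂ := 0) (c₂₂ := 0) R' (by simp [eps]) (by simp [eps])
          (fun x y u v => by simp [cvec_pair, hqe]; left; ring) (by simp; positivity),
          R.tangentsFromComponents hl.1 (a := X 3) (b := p) (r := leftForm 0 1) (by simp [components, Block.parts])
            (by simp [components, Block.parts]) hfac (isBihomogeneous_leftForm 0 1) (by simp) (by simp [hpe])
            (by simp [eval_leftForm]) ?_⟩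
        simp [components, Block.parts, eval_leftForm]
      · have R := (hpt1 Q).mp hQ
        rw [← hL, hP]
        refine ⟨isRealNodeRealTangents (n := ![1, 0]) (t := ![0, 1]) (c₂₀ := 0) (c₁₁ := 4 * lam)
          (c₀₂ := 0) (c₂₁ := 0) (c₁₂ := 0) (c₂₂ := ε) ((hptR Q).mp hQ) (by simp [eps]) (by simp [eps])
          (fun x y u v => by simp [cvec_pair, hqe]; ring) (by simp; positivity),
          R.tangentsFromComponents hl.1 (a := X 3) (b := leftForm 0 1) (r := p) (by simp [components, Block.parts])
            (by simp [components, Block.parts]) (by rw [hfac]; ring) (isBihomogeneous_bilin _) (by simp)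
            (by simp [eval_leftForm]) (by simp [hpe, hlam]) ?_⟩
        simp [components, Block.parts, hpe, hlam]
      · have R := (hpt2 Q).mp hQ
        have R' : C.Rep Q (cvec ![0, 1]) (cvec ![0, 1]) := by simpa [cvec_pair] using R
        rw [← hL, hP]
        refine ⟨isRealNodeRealTangents (n := ![1, 0]) (t := ![1, 0]) (c₂₀ := ε) (c₁₁ := 4 * lam)
          (c₀₂ := 0) (c₂₁ := 0) (c₁₂ := 0) (c₂₂ := 0) R' (by simp [eps]) (by simp [eps])
          (fun x y u v => by simp [cvec_pair, hqe]; ring) (by simp; positivity),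
          R.tangentsFromComponents hl.1 (a := p) (b := leftForm 0 1) (r := X 3) (by simp [components, Block.parts])
            (by simp [components, Block.parts]) (by rw [hfac]; ring) isBihomogeneous_fourth (by simp [hpe])
            (by simp [eval_leftForm]) (by simp) ?_⟩
        simp [components, Block.parts]
  · -- all eigenvalues zero: the polynomial is `ε x² v²`
    obtain rfl : ν = 0 := by linarith
    obtain rfl : lam = 0 := by linarith
    have hl : IsBlockFactorization q [(.sq 0 1, X 3), (.sq 1 0, leftForm 0 1)] := by
      refine ⟨?_, ?_, ε, hε0, ?_⟩
      · simp only [List.forall_mem_cons, Block.Admits]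
        exact ⟨⟨irreducible_linear_right isBihomogeneous_fourth (X_ne_zero 3), isBihomogeneous_fourth, by simp [conjPoly]⟩,
          ⟨irreducible_leftForm (by simp), isBihomogeneous_leftForm _ _, by simp [conjPoly_leftForm]⟩, by simp⟩
      · simp only [components, Block.parts, List.flatMap_cons, List.flatMap_nil, List.cons_append, List.nil_append,
          List.append_nil, List.pairwise_cons, List.forall_mem_cons]
        exact ⟨⟨not_associated_of_eval ![1, 1, 1, 0] (by simp) (by simp [eval_leftForm]), by simp⟩, by simp⟩
      · refine funext_eval fun x y u v => ?_
        simp [hqe, Block.value, eval_leftForm]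
        left
        ring
    have hL : C.pushList [(.sq 0 1, X 3), (.sq 1 0, leftForm 0 1)] =
        [(κ.tw (.sq 0 1), C.push (X 3)), (κ.tw (.sq 1 0), C.push (leftForm 0 1))] := by
      simp [pushList, htw]
    have hz3 : ∀ Q m h, C.Rep Q m h → (Q ∈ zeros (C.push (X 3)) ↔ h 1 = 0) := fun Q m h R => by
      rw [R.mem_zeros isBihomogeneous_fourth]; simp
    have hz0 : ∀ Q m h, C.Rep Q m h → (Q ∈ zeros (C.push (leftForm 0 1)) ↔ m 0 = 0) := fun Q m h R => by
      rw [R.mem_zeros (isBihomogeneous_leftForm 0 1)]; simp [eval_leftForm]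
    refine ⟨rfl, by simp, rfl, _, _, hL ▸ isSpinorFactorization hP hl, zeros_fourth,
      zeros_left (c := 1) (by simp) one_ne_zero (by simp) (by simp), ?_, ?_, ?_⟩
    · ext Q
      obtain ⟨m, h, R⟩ := exists_rep C Q
      rw [Set.mem_inter_iff, hz3 Q m h R, hz0 Q m h R, hrep1 Q m h R, and_comm]
    · ext Q
      obtain ⟨m, h, R⟩ := exists_rep C Q
      rw [Set.mem_union, hz3 Q m h R, hz0 Q m h R, hP, R.mem_zeros hqb, hqe]
      simp [hε0, or_comm]
    · ext Q
      obtain ⟨m, h, R⟩ := exists_rep C Q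
      rw [Set.mem_union, hz3 Q m h R, hz0 Q m h R, coordBasis_E.mem_singularSet hsa hM R]
      constructor
      · rintro ⟨χ, hχ⟩
        have e0 := hχ 0
        have e1 := hχ 1
        have e2 := hχ 2
        have e3 := hχ 3
        simp [Fin.sum_univ_four, nullCoeffs] at e0 e1 e2 e3
        clear hd hpt0 hpt1 hpt2 hptR hqb hP hqe hχ hq hM hrep0 hrep1 hrep2 hl hL hsing hreal
        grind
      · rintro (h1 | h1)
        · exact ⟨0, fun i => by fin_cases i <;> simp [Fin.sum_univ_four, nullCoeffs, h1]⟩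
        · exact ⟨0, fun i => by fin_cases i <;> simp [Fin.sum_univ_four, nullCoeffs, h1]⟩

end NeutralRicci

namespace NeutralRicci

open MvPolynomial

open SpinCoord

variable {Φ : (Fin 4 → ℝ) →ₗ[ℝ] (Fin 4 → ℝ)}

/-! ### Configurations of two lines in each of the two rulings -/

section FourLines

variable {C : SpinCoord} {Q : Pt} {q : MvPolynomial (Fin 4) ℂ} {c s t s' t' p r p' r' : ℂ}

/-- The quadratic part at the intersection of a line of each ruling is a multiple of `y v`. -/
lemma node_of_lines {l : List (Block × MvPolynomial (Fin 4) ℂ)} (hl : ∀ x ∈ l, x.1.Admits x.2)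
    (hq : q = MvPolynomial.C c * (leftForm s t * leftForm s' t' * (rightForm p r * rightForm p' r'))) (hc : c ≠ 0)
    (hst : s * t' - t * s' ≠ 0) (hpr : p * r' - r * p' ≠ 0)
    (hcomp : ∀ x, x ∈ components l ↔
      x = leftForm s t ∨ x = leftForm s' t' ∨ x = rightForm p r ∨ x = rightForm p' r')
    (R : C.Rep Q ![s, t] ![p, r]) :
    IsNode (C.push q) Q ∧ TangentsFromComponents (C.push q) (C.pushList l) Q := by
  have k1 : t' * s - s' * t ≠ 0 := fun h0 => hst (by linear_combination h0)
  have k2 : r' * p - p' * r ≠ 0 := fun h0 => hpr (by linear_combination h0)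
  constructor
  · refine isNode (n := ![s', t']) (t := ![p', r']) (c₂₀ := 0) (c₁₁ := c * (s * t' - t * s') ^ 2 * (p * r' - r * p') ^ 2)
      (c₀₂ := 0) (c₂₁ := 0) (c₁₂ := 0) (c₂₂ := 0) R (by simpa [eps] using hst) (by simpa [eps] using hpr) ?_ ?_
    · intro x y u v
      simp only [hq, map_mul, eval_leftForm, eval_rightForm, eval_C, Matrix.cons_val]
      ring
    · simp [hc, hst, hpr]
  · refine R.tangentsFromComponents hl (a := leftForm s t) (b := rightForm p r)
      (r := MvPolynomial.C c * (leftForm s' t' * rightForm p' r')) ((hcomp _).mpr (by simp)) ((hcomp _).mpr (by simp))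
      (by rw [hq]; ring) (i := 1) (j := 1) ?_ ?_ ?_ ?_ fun x hx h0 => ?_
    · refine isBihomogeneous_of_eval fun a b x y u v => ?_
      simp only [map_mul, eval_leftForm, eval_rightForm, eval_C]
      ring
    · simp [eval_leftForm]; ring
    · simp [eval_rightForm]; ring
    · simp [eval_rightForm, eval_leftForm, hc, k1, k2]
    · rcases (hcomp x).mp hx with rfl | rfl | rfl | rfl
      · simp
      · simp [eval_leftForm, k1] at h0
      · simp
      · simp [eval_rightForm, k2] at h0

/-- A curve that consists of two lines of each ruling has four nodes, at which two of the lines cross. -/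
lemma four_lines {l : List (Block × MvPolynomial (Fin 4) ℂ)} (hl : ∀ x ∈ l, x.1.Admits x.2)
    (hq : q = MvPolynomial.C c * (leftForm s t * leftForm s' t' * (rightForm p r * rightForm p' r'))) (hc : c ≠ 0)
    (hst : s * t' - t * s' ≠ 0) (hpr : p * r' - r * p' ≠ 0)
    (hcomp : components l = [leftForm s t, leftForm s' t', rightForm p r, rightForm p' r'] ∨
      components l = [rightForm p r, rightForm p' r', leftForm s t, leftForm s' t']) :
    (∀ Q, Q ∈ crossings (C.pushList l) ↔ C.Rep Q ![s, t] ![p, r] ∨ C.Rep Q ![s, t] ![p', r'] ∨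
      C.Rep Q ![s', t'] ![p, r] ∨ C.Rep Q ![s', t'] ![p', r']) ∧
    ∀ Q ∈ crossings (C.pushList l), IsNode (C.push q) Q ∧ TangentsFromComponents (C.push q) (C.pushList l) Q := by
  have nz : ∀ {s t s' t' : ℂ}, s * t' - t * s' ≠ 0 → (![s, t] : Fin 2 → ℂ) ≠ 0 :=
    fun {s t s' t'} h => ne_zero_of_eps (β := ![s', t']) (by simpa [eps] using h)
  have hst' : s' * t - t' * s ≠ 0 := fun h0 => hst (by linear_combination -h0)
  have hpr' : p' * r - r' * p ≠ 0 := fun h0 => hpr (by linear_combination -h0)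
  have main : ∀ Q, Q ∈ crossings (C.pushList l) ↔ C.Rep Q ![s, t] ![p, r] ∨ C.Rep Q ![s, t] ![p', r'] ∨
      C.Rep Q ![s', t'] ![p, r] ∨ C.Rep Q ![s', t'] ![p', r'] := by
    intro Q
    obtain ⟨m, h, R⟩ := exists_rep C Q
    have n1 : ¬ (t * m 0 - s * m 1 = 0 ∧ t' * m 0 - s' * m 1 = 0) := by
      rintro ⟨h1, h2⟩
      have h3 : (s * t' - t * s') * m 0 = 0 := by linear_combination s * h2 - s' * h1
      have h4 : (s * t' - t * s') * m 1 = 0 := by linear_combination t * h2 - t' * h1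
      rcases R.ne_fst with h5 | h5
      · simp [hst, h5] at h3
      · simp [hst, h5] at h4
    have n2 : ¬ (r * h 0 - p * h 1 = 0 ∧ r' * h 0 - p' * h 1 = 0) := by
      rintro ⟨h1, h2⟩
      have h3 : (p * r' - r * p') * h 0 = 0 := by linear_combination p * h2 - p' * h1
      have h4 : (p * r' - r * p') * h 1 = 0 := by linear_combination r * h2 - r' * h1
      rcases R.ne_snd with h5 | h5
      · simp [hpr, h5] at h3
      · simp [hpr, h5] at h4
    have e : ∀ a b x y : ℂ, a * y = b * x ↔ b * x - a * y = 0 := fun a b x y =>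
      ⟨fun h0 => by rw [h0, sub_self], fun h0 => (sub_eq_zero.mp h0).symm⟩
    rw [R.mem_crossings hl, R.iff (nz hst) (nz hpr), R.iff (nz hst) (nz hpr'), R.iff (nz hst') (nz hpr),
      R.iff (nz hst') (nz hpr')]
    simp only [Matrix.cons_val_zero, Matrix.cons_val_one, e]
    rcases hcomp with hcomp | hcomp <;>
    · rw [hcomp]
      clear hq hcomp hl hst hpr hst' hpr' hc e nz R
      simp only [exists_pair_cons, exists_pair_nil, List.mem_cons, List.not_mem_nil, or_false, exists_eq_or_imp,
        exists_eq_left, eval_leftForm, eval_rightForm, false_and, exists_false, and_false]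
      tauto
  refine ⟨main, fun Q hQ => ?_⟩
  have hmem : ∀ x, x ∈ components l ↔
      x = leftForm s t ∨ x = leftForm s' t' ∨ x = rightForm p r ∨ x = rightForm p' r' := by
    intro x
    rcases hcomp with hcomp | hcomp <;> rw [hcomp] <;> simp only [List.mem_cons, List.not_mem_nil, or_false]
    constructor <;> rintro (h | h | h | h) <;> simp [h]
  rcases (main Q).mp hQ with R | R | R | R
  · exact node_of_lines hl hq hc hst hpr hmem R
  · exact node_of_lines hl (by rw [hq]; ring) hc hst hpr' (fun x => by rw [hmem, or_comm (a := x = rightForm p r)]) R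
  · exact node_of_lines hl (by rw [hq]; ring) hc hst' hpr (fun x => by rw [hmem, or_left_comm]) R
  · exact node_of_lines hl (by rw [hq]; ring) hc hst' hpr' (fun x => by rw [hmem, or_left_comm, or_comm (a := x = rightForm p r)]) R

end FourLines

/-! ### Types V and VIII -/

/-- A rotation block has no real eigenvalues, and its eigenvectors are isotropic for the sum of squares. -/
lemma rotation_block {a b : ℝ} (hb : b ≠ 0) {χ k l : ℂ} (e : a * k + b * l = χ * k) (e' : -b * k + a * l = χ * l) :
    (k = 0 ∧ l = 0) ∨ ((χ - a) ^ 2 = -b ^ 2 ∧ (∀ x : ℝ, χ ≠ x) ∧ k ^ 2 + l ^ 2 = 0) := by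
  have hb' : (b : ℂ) ≠ 0 := by exact_mod_cast hb
  by_cases h : (χ - a) ^ 2 = -b ^ 2
  · refine Or.inr ⟨h, ?_, ?_⟩
    · rintro x rfl
      have h1 : (x - a) ^ 2 = -b ^ 2 := by exact_mod_cast h
      have : 0 < b ^ 2 := by positivity
      nlinarith [sq_nonneg (x - a)]
    · have : (b : ℂ) ^ 2 * (k ^ 2 + l ^ 2) = 0 := by
        linear_combination (b * l + (χ - a) * k) * e + k ^ 2 * h
      simpa [hb'] using this
  · have h' : (χ - a) ^ 2 + b ^ 2 ≠ 0 := fun h0 => h (by linear_combination h0)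
    have h1 : ((χ - a) ^ 2 + b ^ 2) * k = 0 := by linear_combination -(χ - a) * e - b * e'
    have h2 : ((χ - a) ^ 2 + b ^ 2) * l = 0 := by linear_combination b * e - (χ - a) * e'
    exact Or.inl ⟨by simpa [h'] using h1, by simpa [h'] using h2⟩

lemma nullCoeffsON_sq (m h : Fin 2 → ℂ) : nullCoeffsON m h 0 ^ 2 + nullCoeffsON m h 1 ^ 2 =
    nullCoeffsON m h 2 ^ 2 + nullCoeffsON m h 3 ^ 2 := by
  simp [nullCoeffsON]; ring

lemma SpinCoord.Rep.exists_nullCoeffsON_ne_zero {C : SpinCoord} {Q : Pt} {m h : Fin 2 → ℂ} (R : C.Rep Q m h) :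
    ¬ (nullCoeffsON m h 0 = 0 ∧ nullCoeffsON m h 1 = 0 ∧ nullCoeffsON m h 2 = 0 ∧ nullCoeffsON m h 3 = 0) := by
  rintro ⟨h0, h1, h2, h3⟩
  simp [nullCoeffsON] at h0 h1 h2 h3
  exact R.coords_ne_zero ⟨by linear_combination (h0 + h2) / 2, by linear_combination (h1 + h3) / 2,
    by linear_combination (h0 - h2) / 2, by linear_combination (h3 - h1) / 2⟩

/-- For `λ = ν` the polynomial is a quadratic form in `x u - y v` and `y u - x v` with the coefficients `λ, b, -λ`, hence
with positive discriminant. -/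
theorem type_V (hsa : ∀ u v, s22 (Φ u) v = s22 u (Φ v)) (htr : LinearMap.trace ℝ (Fin 4 → ℝ) Φ = 0)
    (κ : OType) (B : Fin 4 → Fin 4 → ℝ) (lam a b ν : ℝ) (hB : IsPsiON B) (hκ : HasOType B κ) (hb : b ≠ 0)
    (hM : HasMatrix Φ B !![lam, 0, 0, 0; 0, a, b, 0; 0, -b, a, 0; 0, 0, 0, ν]) :
      lam + ν = -2 * a ∧
      HasSpinorForm Φ κ (toWitt B)
        (fun o ι o' ι' A B A' B' =>
          (3 * lam + ν) / 4 * (dbl o A B * dbl o' A' B' + dbl ι A B * dbl ι' A' B') -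
          (lam + 3 * ν) / 4 * (dbl ι A B * dbl o' A' B' + dbl o A B * dbl ι' A' B') +
          (lam - ν) / 4 * mix o ι A B * mix o' ι' A' B' -
          b / 2 * (mix o ι A B * (dbl o' A' B' + dbl ι' A' B') - (dbl o A B + dbl ι A B) * mix o' ι' A' B'))
        (fun X Y U V => ((3 * lam + ν) / 4) • (Y * V + X * U) ^ 2 - ((lam + 3 * ν) / 4) • (X * V + Y * U) ^ 2 +
          b • (X * Y * (V ^ 2 + U ^ 2) - (X ^ 2 + Y ^ 2) * U * V)) ∧
      (lam ≠ ν → (∃ q, IsSpinorFactorization Φ [(.real 2 2, q)]) ∧ singularSet (ricciPolyC Φ) = ∅) ∧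
      (lam = ν → lam = -a ∧
        singularSet (ricciPolyC Φ) = pt (cvec (B 0 + B 3)) ∪ pt (cvec (B 0 - B 3)) ∧
        (∀ Q ∈ singularSet (ricciPolyC Φ), IsRealNodeRealTangents (ricciPolyC Φ) Q) ∧
        ∃ q₁ q₂, IsSpinorFactorization Φ [(.real 1 1, q₁), (.real 1 1, q₂)] ∧
          crossings [(.real 1 1, q₁), (.real 1 1, q₂)] = singularSet (ricciPolyC Φ)) := by
  have htr' : lam + ν = -2 * a := by
    have := hB.trace_eq hM htr
    simp at this
    linarith
  obtain rfl : a = -(lam + ν) / 2 := by linarith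
  refine ⟨htr', hasSpinorForm_of_matrix hB.toWitt hM.toWitt ?_ ?_, ?_⟩
  · intro a b a' b' A B A' B'
    simp [Fin.sum_univ_four, psiToWitt, wittSpinor, dbl, mix]
    ring
  · intro X Y U V
    refine MvPolynomial.funext fun z => ?_
    simp [psiToWitt, Fin.sum_univ_four, wittForm, smul_eval]
    ring
  obtain ⟨C, hC, hs, htw⟩ := hB.exists_spinCoord hκ
  -- only the two real eigenvalues have null eigenvectors
  have key : ∀ Q ∈ singularSet (ricciPolyC Φ), ∀ m h, C.Rep Q m h → nullCoeffsON m h 1 = 0 ∧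
      nullCoeffsON m h 2 = 0 ∧ lam = ν := by
    intro Q hQ m h R
    obtain ⟨χ, hχ⟩ := ((coordBasis_on hC).mem_singularSet hsa hM R).mp hQ
    have e0 := hχ 0
    have e1 := hχ 1
    have e2 := hχ 2
    have e3 := hχ 3
    simp [Fin.sum_univ_four, -mul_eq_mul_left_iff, -mul_eq_mul_right_iff] at e0 e1 e2 e3
    have hnull := nullCoeffsON_sq m h
    have hnz := R.exists_nullCoeffsON_ne_zero
    generalize nullCoeffsON m h = k at *
    have h12 : k 1 = 0 ∧ k 2 = 0 := by
      rcases rotation_block (a := -(lam + ν) / 2) hb (χ := χ) (k := k 1) (l := k 2)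
        (by push_cast; linear_combination e1) (by push_cast; linear_combination e2) with h0 | ⟨-, h0, h1⟩
      · exact h0
      · have k0 : k 0 = 0 := by
          by_contra h2
          exact h0 lam (mul_right_cancel₀ h2 e0).symm
        have k3 : k 3 = 0 := by
          by_contra h2
          exact h0 ν (mul_right_cancel₀ h2 e3).symm
        have h2 : k 1 ^ 2 = 0 := by
          rw [k0, k3] at hnull
          linear_combination (hnull + h1) / 2
        have h3 : k 2 ^ 2 = 0 := by linear_combination h1 - h2
        exact ⟨by simpa using h2, by simpa using h3⟩
    refine ⟨h12.1, h12.2, ?_⟩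
    by_contra hne
    have hne' : (lam : ℂ) ≠ ν := by exact_mod_cast hne
    rw [h12.1, h12.2] at hnull
    have h4 : k 0 = 0 ∨ k 3 = 0 := by
      by_contra! h5
      exact hne' ((mul_right_cancel₀ h5.1 e0).trans (mul_right_cancel₀ h5.2 e3).symm)
    rcases h4 with h4 | h4
    · rw [h4] at hnull
      exact hnz ⟨h4, h12.1, h12.2, by simpa using hnull.symm⟩
    · rw [h4] at hnull
      exact hnz ⟨by simpa using hnull, h12.1, h12.2, h4⟩
  refine ⟨fun hne => ?_, fun he => ?_⟩
  · have hs : singularSet (ricciPolyC Φ) = ∅ := by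
      refine Set.eq_empty_of_forall_notMem fun Q hQ => ?_
      obtain ⟨m, h, R⟩ := exists_rep C Q
      exact hne (key Q hQ m h R).2.2
    exact ⟨isSpinorFactorization_of_irreducible (irreducible_of_singularSet_eq_empty isBihomogeneous_ricciPolyC hs), hs⟩
  · subst he
    set q : MvPolynomial (Fin 4) ℂ := MvPolynomial.C (lam : ℂ) * bilin (cvec ![1, 0, 0, -1]) ^ 2 +
      MvPolynomial.C (b : ℂ) * (bilin (cvec ![1, 0, 0, -1]) * bilin (cvec ![0, -1, 1, 0])) +
      MvPolynomial.C ((-lam : ℝ) : ℂ) * bilin (cvec ![0, -1, 1, 0]) ^ 2 with hq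
    have e1 : ∀ x y u v, eval ![x, y, u, v] (bilin (cvec ![1, 0, 0, -1])) = x * u - y * v := fun x y u v => by
      simp [eval_bilin, cvec]; ring
    have e2 : ∀ x y u v, eval ![x, y, u, v] (bilin (cvec ![0, -1, 1, 0])) = y * u - x * v := fun x y u v => by
      simp [eval_bilin, cvec]; ring
    have hqe : ∀ x y u v, eval ![x, y, u, v] q = lam * (x * u - y * v) ^ 2 +
        b * ((x * u - y * v) * (y * u - x * v)) - lam * (y * u - x * v) ^ 2 := fun x y u v => by
      simp [hq, e1, e2]; ring
    have hP : ricciPolyC Φ = C.push q := by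
      refine ricciPolyC_eq_push (hC ▸ hM.toWitt) fun m h => ?_
      simp [nullCoeffs, psiToWitt, Fin.sum_univ_four, hs, hqe]
      ring
    have hpt1 : ∀ Q, Q ∈ pt (cvec (B 0 + B 3)) ↔ C.Rep Q ![1, 1] ![1, 1] :=
      (coordBasis_on hC).mem_pt_iff_rep (ne_zero_left one_ne_zero) (ne_zero_left one_ne_zero) (c := 2) two_ne_zero
        (by simp [Fin.sum_univ_four, nullCoeffsON, cvec_add, one_add_one_eq_two])
    have hpt2 : ∀ Q, Q ∈ pt (cvec (B 0 - B 3)) ↔ C.Rep Q ![1, -1] ![1, -1] :=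
      (coordBasis_on hC).mem_pt_iff_rep (ne_zero_left one_ne_zero) (ne_zero_left one_ne_zero) (c := 2) two_ne_zero
        (by rw [cvec_sub]; simp [Fin.sum_univ_four, nullCoeffsON, one_add_one_eq_two]; module)
    have hrep : ∀ Q m h, C.Rep Q m h → (Q ∈ pt (cvec (B 0 + B 3)) ∪ pt (cvec (B 0 - B 3)) ↔
        m 0 * h 0 - m 1 * h 1 = 0 ∧ m 1 * h 0 - m 0 * h 1 = 0) := by
      intro Q m h R
      have hm := R.ne_fst
      have hh := R.ne_snd
      rw [Set.mem_union, hpt1, hpt2, R.iff (ne_zero_left one_ne_zero) (ne_zero_left one_ne_zero),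
        R.iff (ne_zero_left one_ne_zero) (ne_zero_left one_ne_zero)]
      simp
      clear hP hqe hq hM hpt1 hpt2 e1 e2 key
      grind
    have hnode : ∀ Q ∈ pt (cvec (B 0 + B 3)) ∪ pt (cvec (B 0 - B 3)), IsRealNodeRealTangents (ricciPolyC Φ) Q := by
      have hdisc : 0 < (4 * lam) ^ 2 + 4 * b ^ 2 := by positivity
      rw [hP]
      rintro Q (hQ | hQ)
      · have R : C.Rep Q (cvec ![1, 1]) (cvec ![1, 1]) := by simpa [cvec_pair] using (hpt1 Q).mp hQ
        refine isRealNodeRealTangents (n := ![0, 1]) (t := ![0, 1]) (c₂₀ := -b) (c₁₁ := 4 * lam) (c₀₂ := b)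
          (c₂₁ := 2 * lam - b) (c₁₂ := 2 * lam + b) (c₂₂ := lam) R (by simp [eps]) (by simp [eps]) ?_ (by linarith)
        intro x y u v
        simp [hqe, cvec_pair]
        ring
      · have R : C.Rep Q (cvec ![1, -1]) (cvec ![1, -1]) := by simpa [cvec_pair] using (hpt2 Q).mp hQ
        refine isRealNodeRealTangents (n := ![0, 1]) (t := ![0, 1]) (c₂₀ := b) (c₁₁ := 4 * lam) (c₀₂ := -b)
          (c₂₁ := -2 * lam - b) (c₁₂ := b - 2 * lam) (c₂₂ := lam) R (by simp [eps]) (by simp [eps]) ?_ (by linarith)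
        intro x y u v
        simp [hqe, cvec_pair]
        ring
    have hset : singularSet (ricciPolyC Φ) = pt (cvec (B 0 + B 3)) ∪ pt (cvec (B 0 - B 3)) := by
      refine Set.Subset.antisymm (fun Q hQ => ?_) fun Q hQ f σ τ => ?_
      · obtain ⟨m, h, R⟩ := exists_rep C Q
        obtain ⟨h1, h2, -⟩ := key Q hQ m h R
        exact (hrep Q m h R).mpr ⟨by simpa [nullCoeffsON] using h2, by simpa [nullCoeffsON] using h1⟩
      · have := (hnode Q hQ).1.1 f
        exact ⟨this.1 σ τ 0 (by norm_num), this.1 σ τ 1 (by norm_num)⟩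
    rw [hset]
    refine ⟨by ring, rfl, hnode, pencil_real (A := lam) (B := b) (D := -lam) (a := ![1, 0, 0, -1]) (b := ![0, -1, 1, 0])
      hP (fun x y u v => by simp [hq]) (fun c d => ⟨1, 0, c, -d, by simp [e1], by simp [e2]⟩) ?_ ?_ ?_⟩
    · intro s t hst h0 h1
      simp at h0 h1
      have h2 : (b : ℂ) * (s * t) = 0 := by linear_combination lam * h1 - h0
      have h3 : s * t = 0 := by
        have hb' : (b : ℂ) ≠ 0 := by exact_mod_cast hb
        simpa [hb'] using h2
      rcases mul_eq_zero.mp h3 with h4 | h4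
      · have : t = 0 := by simpa [h4] using h1
        simp [h4, this] at hst
      · have : s = 0 := by simpa [h4] using h1
        simp [h4, this] at hst
    · have : 0 < b ^ 2 := by positivity
      nlinarith [sq_nonneg lam]
    · intro Q m h R
      rw [hrep Q m h R, e1, e2]

/-- The vanishing of `s` on a null eigenvector forces both rotation blocks to have its eigenvalue, hence `a = c` and
`b = ± d`. For `b = d` the polynomial is `b (x² + y²) (u² - v²)`. -/
theorem type_VIII (hsa : ∀ u v, s22 (Φ u) v = s22 u (Φ v)) (htr : LinearMap.trace ℝ (Fin 4 → ℝ) Φ = 0)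
    (κ : OType) (B : Fin 4 → Fin 4 → ℝ) (a b c d : ℝ) (hB : IsPsiON B) (hκ : HasOType B κ) (hb : b ≠ 0) (hd : d ≠ 0)
    (hM : HasMatrix Φ B !![a, 0, b, 0; 0, c, 0, d; -b, 0, a, 0; 0, -d, 0, c]) :
      a + c = 0 ∧
      HasSpinorForm Φ κ (toWitt B)
        (fun o ι o' ι' A B A' B' => a * mix o ι A B * mix o' ι' A' B' -
          b * (dbl o A B * dbl o' A' B' - dbl ι A B * dbl ι' A' B') -
          d * (dbl ι A B * dbl o' A' B' - dbl o A B * dbl ι' A' B'))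
        (fun X Y U V => (4 * a) • (U * V * X * Y) + b • (X ^ 2 * U ^ 2 - Y ^ 2 * V ^ 2) +
          d • (Y ^ 2 * U ^ 2 - X ^ 2 * V ^ 2)) ∧
      (¬ (a = c ∧ (b = d ∨ b = -d)) →
        (∃ q, IsSpinorFactorization Φ [(.real 2 2, q)]) ∧ singularSet (ricciPolyC Φ) = ∅) ∧
      (a = c → b = d → a = 0 ∧ c = 0 ∧
        singularSet (ricciPolyC Φ) =
          pt (cvec (B 0 - B 3) + Complex.I • cvec (B 1 + B 2)) ∪
          pt (cvec (B 0 + B 3) + Complex.I • cvec (B 2 - B 1)) ∪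
          pt (cvec (B 0 - B 3) - Complex.I • cvec (B 1 + B 2)) ∪
          pt (cvec (B 0 + B 3) - Complex.I • cvec (B 2 - B 1)) ∧
        ∃ n m₁ m₂,
          IsSpinorFactorization Φ [(κ.tw (.conj 1 0), n), (κ.tw (.real 0 1), m₁), (κ.tw (.real 0 1), m₂)] ∧
          crossings [(κ.tw (.conj 1 0), n), (κ.tw (.real 0 1), m₁), (κ.tw (.real 0 1), m₂)] =
            singularSet (ricciPolyC Φ) ∧
          ∀ Q ∈ singularSet (ricciPolyC Φ), IsComplexNode (ricciPolyC Φ) Q ∧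
            TangentsFromComponents (ricciPolyC Φ)
              [(κ.tw (.conj 1 0), n), (κ.tw (.real 0 1), m₁), (κ.tw (.real 0 1), m₂)] Q) := by
  have htr' : a + c = 0 := by
    have := hB.trace_eq hM htr
    simp at this
    linarith
  obtain rfl : c = -a := by linarith
  refine ⟨htr', hasSpinorForm_of_matrix hB.toWitt hM.toWitt ?_ ?_, ?_⟩
  · intro a b a' b' A B A' B'
    simp [Fin.sum_univ_four, psiToWitt, wittSpinor, dbl, mix]
    ring
  · intro X Y U V
    refine MvPolynomial.funext fun z => ?_
    simp [psiToWitt, Fin.sum_univ_four, wittForm, smul_eval]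
    ring
  obtain ⟨C, hC, hs, htw⟩ := hB.exists_spinCoord hκ
  have hb' : (b : ℂ) ≠ 0 := by exact_mod_cast hb
  refine ⟨fun hne => ?_, fun h1 h2 => ?_⟩
  · have hs : singularSet (ricciPolyC Φ) = ∅ := by
      refine Set.eq_empty_of_forall_notMem fun Q hQ => ?_
      obtain ⟨m, h, R⟩ := exists_rep C Q
      obtain ⟨χ, hχ⟩ := ((coordBasis_on hC).mem_singularSet hsa hM R).mp hQ
      have e0 := hχ 0
      have e1 := hχ 1
      have e2 := hχ 2
      have e3 := hχ 3
      simp [Fin.sum_univ_four, -mul_eq_mul_left_iff, -mul_eq_mul_right_iff] at e0 e1 e2 e3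
      have hnull := nullCoeffsON_sq m h
      have hnz := R.exists_nullCoeffsON_ne_zero
      generalize nullCoeffsON m h = k at *
      rcases rotation_block hb (χ := χ) (k := k 0) (l := k 2) e0 (by linear_combination e2) with
        ⟨k0, k2⟩ | ⟨h1, h2, h3⟩ <;>
      rcases rotation_block (a := -a) hd (χ := χ) (k := k 1) (l := k 3) (by push_cast; linear_combination e1)
        (by push_cast; linear_combination e3) with ⟨k1, k3⟩ | ⟨h1', h2', h3'⟩
      · exact hnz ⟨k0, k1, k2, k3⟩
      · rw [k0, k2] at hnull
        have k1 : k 1 ^ 2 = 0 := by linear_combination (hnull + h3') / 2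
        have k3 : k 3 ^ 2 = 0 := by linear_combination h3' - k1
        exact hnz ⟨k0, by simpa using k1, k2, by simpa using k3⟩
      · rw [k1, k3] at hnull
        have k0 : k 0 ^ 2 = 0 := by linear_combination (hnull + h3) / 2
        have k2 : k 2 ^ 2 = 0 := by linear_combination h3 - k0
        exact hnz ⟨by simpa using k0, k1, by simpa using k2, k3⟩
      · -- the two blocks have a common eigenvalue, which is not real
        have h4 : 4 * a * χ = b ^ 2 - d ^ 2 := by
          push_cast at h1'
          linear_combination h1' - h1
        have ha : a = 0 := by
          by_contra ha
          have ha' : (a : ℂ) ≠ 0 := by exact_mod_cast ha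
          refine h2 ((b ^ 2 - d ^ 2) / (4 * a)) ?_
          push_cast
          field_simp
          linear_combination h4
        refine hne ⟨by rw [ha]; simp, ?_⟩
        have h5 : ((b ^ 2 : ℝ) : ℂ) = ((d ^ 2 : ℝ) : ℂ) := by
          push_cast
          rw [ha, Complex.ofReal_zero] at h4
          linear_combination -h4
        exact sq_eq_sq_iff_eq_or_eq_neg.mp (by exact_mod_cast h5)
    exact ⟨isSpinorFactorization_of_irreducible (irreducible_of_singularSet_eq_empty isBihomogeneous_ricciPolyC hs), hs⟩
  · obtain rfl : a = 0 := by linarith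
    subst h2
    have I2 := Complex.I_sq
    have hI : Complex.I + Complex.I ≠ 0 := by simp [← two_mul]
    set q : MvPolynomial (Fin 4) ℂ := MvPolynomial.C (-b : ℂ) *
      (leftForm 1 Complex.I * leftForm 1 (-Complex.I) * (rightForm 1 1 * rightForm 1 (-1))) with hq
    have hqe : ∀ x y u v, eval ![x, y, u, v] q = b * ((x ^ 2 + y ^ 2) * (u ^ 2 - v ^ 2)) := fun x y u v => by
      simp [hq, eval_leftForm, eval_rightForm]
      linear_combination -b * x ^ 2 * (u ^ 2 - v ^ 2) * I2
    have hP : ricciPolyC Φ = C.push q := by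
      refine ricciPolyC_eq_push (hC ▸ hM.toWitt) fun m h => ?_
      simp [nullCoeffs, psiToWitt, Fin.sum_univ_four, hs, hqe]
      ring
    have hl : IsBlockFactorization q
        [(.conj 1 0, leftForm 1 Complex.I), (.real 0 1, rightForm 1 1), (.real 0 1, rightForm 1 (-1))] := by
      refine ⟨?_, ?_, -b, by simpa using hb, ?_⟩
      · simp only [List.forall_mem_cons, Block.Admits]
        exact ⟨⟨irreducible_leftForm (by simp), isBihomogeneous_leftForm _ _⟩,
          ⟨irreducible_rightForm (by simp), isBihomogeneous_rightForm _ _, by simp [conjPoly_rightForm]⟩,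
          ⟨irreducible_rightForm (by simp), isBihomogeneous_rightForm _ _, by simp [conjPoly_rightForm]⟩, by simp⟩
      · simp only [components, Block.parts, List.flatMap_cons, List.flatMap_nil, List.cons_append, List.nil_append,
          List.append_nil, List.pairwise_cons, List.forall_mem_cons, conjPoly_leftForm, map_one, Complex.conj_I]
        exact ⟨⟨not_associated_of_eval ![1, Complex.I, 1, 1] (by simp [eval_leftForm]) (by
            rw [eval_leftForm]; exact fun h0 => hI (by linear_combination -h0)),
          not_associated_of_eval ![1, Complex.I, 1, 0] (by simp [eval_leftForm]) (by simp [eval_rightForm]),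
          not_associated_of_eval ![1, Complex.I, 1, 0] (by simp [eval_leftForm]) (by simp [eval_rightForm]), by simp⟩,
          ⟨not_associated_of_eval ![1, -Complex.I, 1, 0] (by simp [eval_leftForm]) (by simp [eval_rightForm]),
          not_associated_of_eval ![1, -Complex.I, 1, 0] (by simp [eval_leftForm]) (by simp [eval_rightForm]), by simp⟩,
          ⟨not_associated_of_eval ![1, 1, 1, 1] (by simp [eval_rightForm]) (by norm_num [eval_rightForm]), by simp⟩,
          by simp⟩
      · simp [hq, Block.value, conjPoly_leftForm]
    have hL : C.pushList [(.conj 1 0, leftForm 1 Complex.I), (.real 0 1, rightForm 1 1), (.real 0 1, rightForm 1 (-1))] =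
        [(κ.tw (.conj 1 0), C.push (leftForm 1 Complex.I)), (κ.tw (.real 0 1), C.push (rightForm 1 1)),
          (κ.tw (.real 0 1), C.push (rightForm 1 (-1)))] := by simp [pushList, htw]
    obtain ⟨hcr, hnode⟩ := four_lines (C := C) hl.1 hq (neg_ne_zero.mpr hb') (fun h0 => hI (by linear_combination -h0))
      (by norm_num) (Or.inl (by simp [components, Block.parts, conjPoly_leftForm]))
    have nz : ∀ z : ℂ, (![1, z] : Fin 2 → ℂ) ≠ 0 := fun z => ne_zero_left one_ne_zero
    have hc1 : (1 - Complex.I : ℂ) ≠ 0 := fun h0 => by simpa using congrArg Complex.re h0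
    have hc2 : (1 + Complex.I : ℂ) ≠ 0 := fun h0 => by simpa using congrArg Complex.re h0
    have hpts : pt (cvec (B 0 - B 3) + Complex.I • cvec (B 1 + B 2)) ∪
          pt (cvec (B 0 + B 3) + Complex.I • cvec (B 2 - B 1)) ∪
          pt (cvec (B 0 - B 3) - Complex.I • cvec (B 1 + B 2)) ∪
          pt (cvec (B 0 + B 3) - Complex.I • cvec (B 2 - B 1)) =
        crossings (C.pushList
          [(.conj 1 0, leftForm 1 Complex.I), (.real 0 1, rightForm 1 1), (.real 0 1, rightForm 1 (-1))]) := by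
      ext Q
      rw [hcr, Set.mem_union, Set.mem_union, Set.mem_union,
        (coordBasis_on hC).mem_pt_iff_rep (nz Complex.I) (nz (-1)) hc1 ?_,
        (coordBasis_on hC).mem_pt_iff_rep (nz (-Complex.I)) (nz 1) hc1 ?_,
        (coordBasis_on hC).mem_pt_iff_rep (nz (-Complex.I)) (nz (-1)) hc2 ?_,
        (coordBasis_on hC).mem_pt_iff_rep (nz Complex.I) (nz 1) hc2 ?_]
      · tauto
      all_goals
        ext i
        simp [Fin.sum_univ_four, nullCoeffsON, cvec]
        ring_nf
        try rw [I2]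
        try ring
    have hset : singularSet (ricciPolyC Φ) = crossings (C.pushList
          [(.conj 1 0, leftForm 1 Complex.I), (.real 0 1, rightForm 1 1), (.real 0 1, rightForm 1 (-1))]) := by
      refine Set.Subset.antisymm (fun Q hQ => (hcr Q).mpr ?_) fun Q hQ f σ τ => ?_
      · obtain ⟨m, h, R⟩ := exists_rep C Q
        obtain ⟨χ, hχ⟩ := ((coordBasis_on hC).mem_singularSet hsa hM R).mp hQ
        have e0 := hχ 0
        have e1 := hχ 1
        have e2 := hχ 2
        have e3 := hχ 3
        rw [R.iff (nz _) (nz _), R.iff (nz _) (nz _), R.iff (nz _) (nz _), R.iff (nz _) (nz _)]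
        simp [Fin.sum_univ_four, nullCoeffsON, -mul_eq_mul_left_iff, -mul_eq_mul_right_iff] at e0 e1 e2 e3 ⊢
        have h1 : (b : ℂ) * ((m 0 ^ 2 + m 1 ^ 2) * (h 0 * h 1)) = 0 := by
          linear_combination (m 0 * h 0 + m 1 * h 1) * e1 / 2 - (m 1 * h 0 - m 0 * h 1) * e0 / 2
        have h1' : (m 0 ^ 2 + m 1 ^ 2) * (h 0 * h 1) = 0 := by simpa [hb'] using h1
        have h2 : (b : ℂ) * (m 0 ^ 2 * h 0 ^ 2 + m 1 ^ 2 * h 1 ^ 2) = 0 := by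
          linear_combination (m 0 * h 0 - m 1 * h 1) * e0 / 2 - (m 0 * h 0 + m 1 * h 1) * e2 / 2
        have h2' : m 0 ^ 2 * h 0 ^ 2 + m 1 ^ 2 * h 1 ^ 2 = 0 := by simpa [hb'] using h2
        have h3 : (b : ℂ) * (m 1 ^ 2 * h 0 ^ 2 + m 0 ^ 2 * h 1 ^ 2) = 0 := by
          linear_combination (m 1 * h 0 + m 0 * h 1) * e1 / 2 - (m 1 * h 0 - m 0 * h 1) * e3 / 2
        have h3' : m 1 ^ 2 * h 0 ^ 2 + m 0 ^ 2 * h 1 ^ 2 = 0 := by simpa [hb'] using h3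
        have hm := R.ne_fst
        have hh := R.ne_snd
        have h4 : m 0 ^ 2 + m 1 ^ 2 = 0 := by
          clear e0 e1 e2 e3 hχ
          grind
        have h5 : h 0 ^ 2 = h 1 ^ 2 := by
          clear e0 e1 e2 e3 hχ
          grind
        have h6 : m 1 = Complex.I * m 0 ∨ m 1 = -Complex.I * m 0 := by
          have : (m 1 - Complex.I * m 0) * (m 1 + Complex.I * m 0) = 0 := by
            linear_combination h4 - m 0 ^ 2 * I2
          rcases mul_eq_zero.mp this with h | h
          · exact Or.inl (by linear_combination h)
          · exact Or.inr (by linear_combination h)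
        rcases h6 with h6 | h6 <;> rcases sq_eq_sq_iff_eq_or_eq_neg.mp h5 with h7 | h7 <;> simp [h6, h7]
      · rw [hP]
        have := (hnode Q hQ).1.1 f
        exact ⟨this.1 σ τ 0 (by norm_num), this.1 σ τ 1 (by norm_num)⟩
    refine ⟨rfl, by simp, by rw [hset, hpts], _, _, _, hL ▸ isSpinorFactorization hP hl, ?_, ?_⟩
    · rw [hset, hL]
    · intro Q hQ
      rw [hset] at hQ
      obtain ⟨g1, g2⟩ := hnode Q hQ
      rw [← hL, hP]
      refine ⟨⟨g1, ?_⟩, g2⟩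
      rcases (hcr Q).mp hQ with R | R | R | R <;>
      · refine not_isRealPt R ?_
        intro h0
        have := congrArg Complex.im h0
        norm_num at this

end NeutralRicci

namespace NeutralRicci

open MvPolynomial

open SpinCoord

variable {Φ : (Fin 4 → ℝ) →ₗ[ℝ] (Fin 4 → ℝ)}

/-! ### Diagonalizable endomorphisms -/

lemma pt_neg (w : Fin 4 → ℂ) : pt (-w) = pt w := by
  rw [pt, pt, ← Set.neg_singleton, Submodule.span_neg]

/-- Orthonormal bases with the opposite signature also come from spinor coordinates, those with a negative scale. -/
lemma exists_spinCoord_of_sign {D : Fin 4 → Fin 4 → ℝ} {c : ℝ} (hc : c = 1 ∨ c = -1)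
    (hD : ∀ i j, s22 (D i) (D j) = if i = j then c * ![1, 1, -1, -1] i else 0) :
    ∃ C : SpinCoord, C.E = NeutralRicci.toWitt D ∧ C.scale = c := by
  rcases hc with rfl | rfl
  · have hD' : IsPsiON D := fun i j => by simpa using hD i j
    obtain ⟨κ, hκ, -⟩ := hD'.toWitt.existsUnique_oType
    obtain ⟨C, hC, hs, -⟩ := exists_of_hasOType hD'.toWitt hκ
    exact ⟨C, hC, hs⟩
  · -- interchange the definite planes, and change the sign of the second primed spinor
    have hD' : IsPsiON ![D 2, D 3, D 0, D 1] := fun i j => by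
      fin_cases i <;> fin_cases j <;> simp [hD]
    obtain ⟨κ, hκ, -⟩ := hD'.toWitt.existsUnique_oType
    obtain ⟨C, hC, hs, -⟩ := exists_of_hasOType hD'.toWitt hκ
    refine ⟨{ C with β' := -C.β', ne' := by rw [eps_neg_right]; exact neg_ne_zero.mpr C.ne' }, ?_, ?_⟩
    · have h : ∀ i, C.E i = NeutralRicci.toWitt ![D 2, D 3, D 0, D 1] i := fun i => by rw [hC]
      have h0 := h 0
      have h1 := h 1
      have h2 := h 2
      have h3 := h 3
      funext i
      cases hsw : C.sw <;> fin_cases i <;>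
        simp [E, hsw, NeutralRicci.toWitt, dyad_neg_left, dyad_neg_right] at h0 h1 h2 h3 ⊢
      · rw [h0, add_comm]
      · rw [h1, add_comm]
      · rw [h2, ← smul_neg, neg_sub]
      · rw [← neg_eq_iff_eq_neg.mpr h3.symm, ← smul_neg, neg_sub]
      · rw [h0, add_comm]
      · rw [h1, add_comm]
      · rw [h2, ← smul_neg, neg_sub]
      · rw [← neg_eq_iff_eq_neg.mpr h3.symm, ← smul_neg, neg_sub]
    · rw [scale] at hs ⊢
      simp only [eps_neg_right, mul_neg]
      rw [hs]

/-- An orthonormal eigenbasis may be numbered such that the first two vectors are those of one definite plane. -/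
lemma IsPsiON.exists_rearranged {B : Fin 4 → Fin 4 → ℝ} {d : Fin 4 → ℝ} (hB : IsPsiON B)
    (hM : HasMatrix Φ B (Matrix.diagonal d)) (hd : d 0 + d 1 + d 2 + d 3 = 0) {i j k l : Fin 4}
    (hn : [i, j, k, l].Nodup) (hij : s22 (B i) (B i) = s22 (B j) (B j)) :
    ∃ C : SpinCoord, C.E = NeutralRicci.toWitt ![B i, B j, B k, B l] ∧ C.scale ^ 2 = 1 ∧
      HasMatrix Φ ![B i, B j, B k, B l] (Matrix.diagonal ![d i, d j, d k, d l]) ∧ d i + d j + d k + d l = 0 := by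
  have hM' : ∀ n, Φ (B n) = d n • B n := fun n => by
    rw [hM n, Finset.sum_eq_single n (fun m _ h => by simp [h]) (by simp)]
    simp
  have hs : ∀ n, s22 (B n) (B n) = ![1, 1, -1, -1] n := fun n => by simp [hB n n]
  have ho : ∀ m n, m ≠ n → s22 (B m) (B n) = 0 := fun m n h => by simp [hB m n, h]
  have hsum : d i + d j + d k + d l = 0 := by
    rw [← hd]
    have h1 : ∀ i j k l : Fin 4, [i, j, k, l].Nodup → ({i, j, k, l} : Finset (Fin 4)) = Finset.univ := by decide
    have h2 := congrArg (fun s : Finset (Fin 4) => ∑ n ∈ s, d n) (h1 i j k l hn)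
    simp only [List.nodup_cons, List.mem_cons, List.not_mem_nil, or_false, not_or] at hn
    rw [← Fin.sum_univ_four, ← h2, Finset.sum_insert, Finset.sum_insert, Finset.sum_insert, Finset.sum_singleton]
    · ring
    all_goals simp [hn]
  have hsign : ∃ c : ℝ, (c = 1 ∨ c = -1) ∧ s22 (B i) (B i) = c ∧ s22 (B j) (B j) = c ∧ s22 (B k) (B k) = -c ∧
      s22 (B l) (B l) = -c := by
    have h1 : ∀ i j k l : Fin 4, [i, j, k, l].Nodup → (![1, 1, -1, -1] : Fin 4 → ℤ) i = ![1, 1, -1, -1] j →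
        ∃ c : Bool, ![1, 1, -1, -1] i = (if c then 1 else -1 : ℤ) ∧ ![1, 1, -1, -1] j = (if c then 1 else -1 : ℤ) ∧
          ![1, 1, -1, -1] k = -(if c then 1 else -1 : ℤ) ∧ ![1, 1, -1, -1] l = -(if c then 1 else -1 : ℤ) := by
      decide
    have hcast : ∀ n, s22 (B n) (B n) = ((![1, 1, -1, -1] n : ℤ) : ℝ) := fun n => by
      rw [hs]; fin_cases n <;> simp
    obtain ⟨c, g0, g1, g2, g3⟩ := h1 i j k l hn (by rw [hcast, hcast] at hij; exact_mod_cast hij)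
    rw [hcast, hcast, hcast, hcast, g0, g1, g2, g3]
    refine ⟨((if c then 1 else -1 : ℤ) : ℝ), ?_, rfl, rfl, by push_cast; rfl, by push_cast; rfl⟩
    cases c <;> simp
  obtain ⟨c, hc, hi, hj, hk, hl⟩ := hsign
  simp only [List.nodup_cons, List.mem_cons, List.not_mem_nil, or_false, not_or] at hn
  obtain ⟨C, hC, hCs⟩ := exists_spinCoord_of_sign (D := ![B i, B j, B k, B l]) hc fun m n => by
    fin_cases m <;> fin_cases n <;> simp [hi, hj, hk, hl] <;> apply ho <;> simp [hn, eq_comm]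
  refine ⟨C, hC, by rcases hc with rfl | rfl <;> simp [hCs], fun n => ?_, hsum⟩
  fin_cases n <;> simp [Fin.sum_univ_four, hM']

section Diagonal

variable {C : SpinCoord} {D : Fin 4 → Fin 4 → ℝ} {e : Fin 4 → ℝ}

lemma ricciPolyC_diagonal (hC : C.E = NeutralRicci.toWitt D) (hM : HasMatrix Φ D (Matrix.diagonal e))
    (he : e 0 + e 1 + e 2 + e 3 = 0) {q : MvPolynomial (Fin 4) ℂ}
    (hq : ∀ x y u v, eval ![x, y, u, v] q = C.scale * ((e 0 - e 2) / 2 * (y ^ 2 * v ^ 2 + x ^ 2 * u ^ 2) +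
      (e 1 - e 3) / 2 * (x ^ 2 * v ^ 2 + y ^ 2 * u ^ 2) + 2 * (e 0 + e 2) * (u * v * x * y))) :
    ricciPolyC Φ = C.push q := by
  refine ricciPolyC_eq_push (hC ▸ hM.toWitt) fun m h => ?_
  have h3 : ((e 3 : ℝ) : ℂ) = -e 0 - e 1 - e 2 := by
    rw [show e 3 = -e 0 - e 1 - e 2 by linarith]
    push_cast
    rfl
  simp [nullCoeffs, psiToWitt, Fin.sum_univ_four, hq, h3, -mul_eq_mul_left_iff]
  ring

lemma mem_singularSet_diagonal (hsa : ∀ u v, s22 (Φ u) v = s22 u (Φ v)) (hC : C.E = NeutralRicci.toWitt D)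
    (hM : HasMatrix Φ D (Matrix.diagonal e)) {Q : Pt} {m h : Fin 2 → ℂ} (R : C.Rep Q m h) :
    Q ∈ singularSet (ricciPolyC Φ) ↔ ∃ χ : ℂ, ∀ i, nullCoeffsON m h i ≠ 0 → χ = e i := by
  rw [(coordBasis_on hC).mem_singularSet hsa hM R]
  refine exists_congr fun χ => forall_congr' fun i => ?_
  rw [Finset.sum_eq_single i (fun j _ hj => by simp [Matrix.diagonal_apply_ne _ hj.symm]) (by simp),
    Matrix.diagonal_apply_eq, mul_eq_mul_right_iff, or_iff_not_imp_right, eq_comm (a := χ)]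

/-- Null eigenvectors belong to multiple eigenvalues. -/
lemma singularSet_diagonal_eq_empty (hsa : ∀ u v, s22 (Φ u) v = s22 u (Φ v)) (hC : C.E = NeutralRicci.toWitt D)
    (hM : HasMatrix Φ D (Matrix.diagonal e)) (he : Function.Injective e) : singularSet (ricciPolyC Φ) = ∅ := by
  refine Set.eq_empty_of_forall_notMem fun Q hQ => ?_
  obtain ⟨m, h, R⟩ := exists_rep C Q
  obtain ⟨χ, hχ⟩ := (mem_singularSet_diagonal hsa hC hM R).mp hQ
  have key : ∀ i j, i ≠ j → nullCoeffsON m h i ≠ 0 → nullCoeffsON m h j = 0 := fun i j hij hi => by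
    by_contra hj
    exact hij (he (by exact_mod_cast (hχ i hi).symm.trans (hχ j hj)))
  have hnull := nullCoeffsON_sq m h
  refine R.exists_nullCoeffsON_ne_zero ⟨?_, ?_, ?_, ?_⟩ <;> by_contra hk
  · simp [key 0 1 (by decide) hk, key 0 2 (by decide) hk, key 0 3 (by decide) hk, hk] at hnull
  · simp [key 1 0 (by decide) hk, key 1 2 (by decide) hk, key 1 3 (by decide) hk, hk] at hnull
  · simp [key 2 0 (by decide) hk, key 2 1 (by decide) hk, key 2 3 (by decide) hk] at hnull
    exact hk (by simpa using hnull.symm)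
  · simp [key 3 0 (by decide) hk, key 3 1 (by decide) hk, key 3 2 (by decide) hk] at hnull
    exact hk (by simpa using hnull.symm)

end Diagonal

end NeutralRicci

namespace NeutralRicci

open MvPolynomial

open SpinCoord

variable {Φ : (Fin 4 → ℝ) →ₗ[ℝ] (Fin 4 → ℝ)}

lemma eq_zero_of_eigenvalues {k k' l l' χ : ℂ} {p r s : ℝ} (hpr : p ≠ r) (hps : p ≠ s) (hrs : r ≠ s)
    (h : k = 0 → k' = 0 → (l = 0 ↔ l' = 0)) (hk : k ≠ 0 → χ = p) (hk' : k' ≠ 0 → χ = p) (hl : l ≠ 0 → χ = r)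
    (hl' : l' ≠ 0 → χ = s) : l = 0 ∧ l' = 0 := by
  have h1 : (p : ℂ) ≠ r := by exact_mod_cast hpr
  have h2 : (p : ℂ) ≠ s := by exact_mod_cast hps
  have h3 : (r : ℂ) ≠ s := by exact_mod_cast hrs
  grind

section DoubleEigenvalue

variable {C : SpinCoord} {D : Fin 4 → Fin 4 → ℝ} {p r s : ℝ}

/-- A double eigenvalue with a definite eigenspace. After subtraction of the double eigenvalue from `Φ`, the Ricci
polynomial is a combination of the squares of the two other coefficients of the null vector, which are bilinear. -/
lemma singular_of_definite_pair (hsa : ∀ u v, s22 (Φ u) v = s22 u (Φ v)) (hC : C.E = NeutralRicci.toWitt D)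
    (hs : C.scale ^ 2 = 1) (hM : HasMatrix Φ D (Matrix.diagonal ![p, p, r, s])) (hsum : p + p + r + s = 0)
    (hpr : p ≠ r) (hps : p ≠ s) (hrs : r ≠ s) :
    singularSet (ricciPolyC Φ) =
      pt (cvec (D 0) + Complex.I • cvec (D 1)) ∪ pt (cvec (D 0) - Complex.I • cvec (D 1)) ∧
    (∀ Q ∈ singularSet (ricciPolyC Φ), IsComplexNode (ricciPolyC Φ) Q) ∧
    (3 * r + s) * (r + 3 * s) ≠ 0 ∧
    (0 < (3 * r + s) * (r + 3 * s) → ∃ q, IsSpinorFactorization Φ [(.conj 1 1, q)] ∧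
      crossings [(.conj 1 1, q)] = singularSet (ricciPolyC Φ)) ∧
    ((3 * r + s) * (r + 3 * s) < 0 →
      ∃ q₁ q₂, IsSpinorFactorization Φ [(.real 1 1, q₁), (.real 1 1, q₂)] ∧
      crossings [(.real 1 1, q₁), (.real 1 1, q₂)] = singularSet (ricciPolyC Φ)) := by
  have I2 := Complex.I_sq
  have hc : C.scale ≠ 0 := C.scale_ne_zero
  have hdisc : (3 * r + s) * (r + 3 * s) = 4 * ((p - r) * (p - s)) := by
    obtain rfl : s = -2 * p - r := by linarith
    ring
  have hne : (p - r) * (p - s) ≠ 0 := mul_ne_zero (sub_ne_zero.mpr hpr) (sub_ne_zero.mpr hps)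
  obtain ⟨A, hA⟩ : ∃ A : ℝ, A = C.scale * (p - r) / 2 := ⟨_, rfl⟩
  obtain ⟨F, hF⟩ : ∃ F : ℝ, F = C.scale * (p - s) / 2 := ⟨_, rfl⟩
  have hAF : 4 * (A * F) = (p - r) * (p - s) := by
    rw [hA, hF]
    linear_combination (p - r) * (p - s) * hs
  have hA0 : A * F ≠ 0 := fun h0 => hne (by rw [← hAF, h0, mul_zero])
  have hFA : F - A ≠ 0 := by
    rw [hA, hF, show C.scale * (p - s) / 2 - C.scale * (p - r) / 2 = C.scale * (r - s) / 2 by ring]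
    exact div_ne_zero (mul_ne_zero hc (sub_ne_zero.mpr hrs)) two_ne_zero
  set q : MvPolynomial (Fin 4) ℂ := MvPolynomial.C (A : ℂ) * bilin (cvec ![1, 0, 0, -1]) ^ 2 +
    MvPolynomial.C (F : ℂ) * bilin (cvec ![0, 1, 1, 0]) ^ 2 with hq
  have e1 : ∀ x y u v, eval ![x, y, u, v] (bilin (cvec ![1, 0, 0, -1])) = x * u - y * v := fun x y u v => by
    simp [eval_bilin, cvec]; ring
  have e2 : ∀ x y u v, eval ![x, y, u, v] (bilin (cvec ![0, 1, 1, 0])) = y * u + x * v := fun x y u v => by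
    simp [eval_bilin, cvec]; ring
  have hqe : ∀ x y u v, eval ![x, y, u, v] q = A * (x * u - y * v) ^ 2 + F * (y * u + x * v) ^ 2 := fun x y u v => by
    simp [hq, e1, e2]
  have hP : ricciPolyC Φ = C.push q := by
    refine ricciPolyC_diagonal hC hM (by simpa using hsum) fun x y u v => ?_
    have h0 : (s : ℂ) = -2 * p - r := by
      rw [show s = -2 * p - r by linarith]
      push_cast
      rfl
    rw [hqe, hA, hF]
    simp [h0, -mul_eq_mul_left_iff]
    ring
  have nz : ∀ z : ℂ, (![1, z] : Fin 2 → ℂ) ≠ 0 := fun z => ne_zero_left one_ne_zero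
  have hpt1 : ∀ Q, Q ∈ pt (cvec (D 0) + Complex.I • cvec (D 1)) ↔ C.Rep Q ![1, Complex.I] ![1, -Complex.I] :=
    (coordBasis_on hC).mem_pt_iff_rep (nz _) (nz _) (c := 2) two_ne_zero (by
      simp [Fin.sum_univ_four, nullCoeffsON]; module)
  have hpt2 : ∀ Q, Q ∈ pt (cvec (D 0) - Complex.I • cvec (D 1)) ↔ C.Rep Q ![1, -Complex.I] ![1, - -Complex.I] :=
    (coordBasis_on hC).mem_pt_iff_rep (nz _) (nz _) (c := 2) two_ne_zero (by
      simp [Fin.sum_univ_four, nullCoeffsON]; module)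
  have hrep : ∀ Q m h, C.Rep Q m h →
      (Q ∈ pt (cvec (D 0) + Complex.I • cvec (D 1)) ∪ pt (cvec (D 0) - Complex.I • cvec (D 1)) ↔
        m 0 * h 0 - m 1 * h 1 = 0 ∧ m 1 * h 0 + m 0 * h 1 = 0) := by
    intro Q m h R
    have hm := R.ne_fst
    have hh := R.ne_snd
    rw [Set.mem_union, hpt1, hpt2, R.iff (nz _) (nz _), R.iff (nz _) (nz _)]
    simp only [Matrix.cons_val_zero, Matrix.cons_val_one, one_mul]
    constructor
    · rintro (⟨h1, h2⟩ | ⟨h1, h2⟩) <;> rw [h1, h2] <;> constructor <;> first | ring1 | linear_combination m 0 * h 0 * I2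
    · rintro ⟨h1, h2⟩
      have h3 : m 0 ^ 2 + m 1 ^ 2 = 0 := by
        rcases hh with hh | hh
        · exact (mul_eq_zero.mp (by linear_combination m 0 * h1 + m 1 * h2 : (m 0 ^ 2 + m 1 ^ 2) * h 0 = 0)).resolve_right hh
        · exact (mul_eq_zero.mp (by linear_combination m 0 * h2 - m 1 * h1 : (m 0 ^ 2 + m 1 ^ 2) * h 1 = 0)).resolve_right hh
      have hm0 : m 0 ≠ 0 := by
        intro h0
        simp [h0] at h3 hm
        exact hm h3
      rcases sq_add_sq_eq_zero h3 with h4 | h4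
      · refine Or.inl ⟨h4, mul_left_cancel₀ hm0 ?_⟩
        rw [h4] at h2
        linear_combination h2
      · refine Or.inr ⟨h4, mul_left_cancel₀ hm0 ?_⟩
        rw [h4] at h2
        linear_combination h2
  have hset : singularSet (ricciPolyC Φ) =
      pt (cvec (D 0) + Complex.I • cvec (D 1)) ∪ pt (cvec (D 0) - Complex.I • cvec (D 1)) := by
    ext Q
    obtain ⟨m, h, R⟩ := exists_rep C Q
    rw [mem_singularSet_diagonal hsa hC hM R, hrep Q m h R]
    have hnull := nullCoeffsON_sq m h
    change _ ↔ nullCoeffsON m h 2 = 0 ∧ nullCoeffsON m h 3 = 0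
    generalize nullCoeffsON m h = k at *
    constructor
    · rintro ⟨χ, hχ⟩
      refine eq_zero_of_eigenvalues hpr hps hrs (fun h0 h1 => ?_) (by simpa using hχ 0) (by simpa using hχ 1)
        (by simpa using hχ 2) (by simpa using hχ 3)
      simp only [h0, h1] at hnull
      constructor <;> intro h2 <;> refine pow_eq_zero_iff two_ne_zero |>.mp ?_ <;> rw [h2] at hnull <;>
        linear_combination -hnull
    · rintro ⟨h2, h3⟩
      refine ⟨p, fun i => ?_⟩
      fin_cases i <;> simp [h2, h3]
  have hnode : ∀ i₀ : ℂ, i₀ ^ 2 = -1 → ∀ Q, C.Rep Q ![1, i₀] ![1, -i₀] → IsNode (C.push q) Q := by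
    intro i₀ hi Q R
    refine isNode (n := ![0, 1]) (t := ![0, 1]) (c₂₀ := F - A) (c₁₁ := 2 * (A + F)) (c₀₂ := F - A)
      (c₂₁ := -2 * A * i₀) (c₁₂ := 2 * A * i₀) (c₂₂ := A) R (by simp [eps]) (by simp [eps]) ?_ ?_
    · intro x y u v
      simp [hqe]
      linear_combination A * ((y * u - x * v) ^ 2 +
        x * u * (2 * (i₀ * (y * u - x * v) - y * v) + x * u * (i₀ ^ 2 + 1))) * hi
    · rw [show (2 * (A + F : ℂ)) ^ 2 - 4 * (F - A) * (F - A) = 16 * ((A * F : ℝ) : ℂ) by push_cast; ring]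
      exact mul_ne_zero (by norm_num) (by exact_mod_cast hA0)
  have hab : ∀ c d : ℂ, ∃ x y u v, eval ![x, y, u, v] (bilin (cvec ![1, 0, 0, -1])) = c ∧
      eval ![x, y, u, v] (bilin (cvec ![0, 1, 1, 0])) = d := fun c d => ⟨1, 0, c, d, by simp [e1], by simp [e2]⟩
  have hdet : ∀ x y : ℂ, (x ≠ 0 ∨ y ≠ 0) → A * y ^ 2 - ((0 : ℝ) : ℂ) * (x * y) + F * x ^ 2 = 0 →
      (x * (![1, 0, 0, -1] : Fin 4 → ℝ) 0 + y * (![0, 1, 1, 0] : Fin 4 → ℝ) 0) *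
        (x * (![1, 0, 0, -1] : Fin 4 → ℝ) 3 + y * (![0, 1, 1, 0] : Fin 4 → ℝ) 3) -
      (x * (![1, 0, 0, -1] : Fin 4 → ℝ) 1 + y * (![0, 1, 1, 0] : Fin 4 → ℝ) 1) *
        (x * (![1, 0, 0, -1] : Fin 4 → ℝ) 2 + y * (![0, 1, 1, 0] : Fin 4 → ℝ) 2) ≠ 0 := by
    intro x y hxy h0 h1
    simp at h0 h1
    have hFA' : (F : ℂ) - A ≠ 0 := by exact_mod_cast hFA
    have h2 : (F - A : ℂ) * x ^ 2 = 0 := by linear_combination h0 + A * h1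
    have h3 : x = 0 := by simpa [hFA'] using h2
    have h4 : y = 0 := by simpa [h3] using h1
    simp [h3, h4] at hxy
  rw [hset]
  refine ⟨rfl, ?_, by rw [hdisc]; exact mul_ne_zero four_ne_zero hne, fun h0 => ?_, fun h0 => ?_⟩
  · rw [hP]
    rintro Q (hQ | hQ)
    · refine ⟨hnode _ I2 Q ((hpt1 Q).mp hQ), not_isRealPt ((hpt1 Q).mp hQ) fun h0 => ?_⟩
      have := congrArg Complex.im h0
      norm_num at this
    · refine ⟨hnode _ (by simp) Q ((hpt2 Q).mp hQ), not_isRealPt ((hpt2 Q).mp hQ) fun h0 => ?_⟩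
      have := congrArg Complex.im h0
      norm_num at this
  · exact pencil_conj (A := A) (B := 0) (D := F) (a := ![1, 0, 0, -1]) (b := ![0, 1, 1, 0])
      hP (fun x y u v => by simp [hq]) hab hdet (by rw [hdisc, ← hAF] at h0; linarith)
      fun Q m h R => by rw [hrep Q m h R, e1, e2]
  · exact pencil_real (A := A) (B := 0) (D := F) (a := ![1, 0, 0, -1]) (b := ![0, 1, 1, 0])
      hP (fun x y u v => by simp [hq]) hab hdet (by rw [hdisc, ← hAF] at h0; linarith)
      fun Q m h R => by rw [hrep Q m h R, e1, e2]

/-- A double eigenvalue with an indefinite eigenspace; the Ricci polynomial is again a combination of two squares. -/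
lemma singular_of_indefinite_pair (hsa : ∀ u v, s22 (Φ u) v = s22 u (Φ v)) (hC : C.E = NeutralRicci.toWitt D)
    (hs : C.scale ^ 2 = 1) (hM : HasMatrix Φ D (Matrix.diagonal ![p, r, p, s])) (hsum : p + r + p + s = 0)
    (hpr : p ≠ r) (hps : p ≠ s) (hrs : r ≠ s) :
    singularSet (ricciPolyC Φ) = pt (cvec (D 0 + D 2)) ∪ pt (cvec (D 0 - D 2)) ∧
    (3 * r + s) * (r + 3 * s) ≠ 0 ∧
    (0 < (3 * r + s) * (r + 3 * s) →
      (∀ Q ∈ singularSet (ricciPolyC Φ), IsRealNodeRealTangents (ricciPolyC Φ) Q) ∧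
      ∃ q₁ q₂, IsSpinorFactorization Φ [(.real 1 1, q₁), (.real 1 1, q₂)] ∧
      crossings [(.real 1 1, q₁), (.real 1 1, q₂)] = singularSet (ricciPolyC Φ)) ∧
    ((3 * r + s) * (r + 3 * s) < 0 →
      (∀ Q ∈ singularSet (ricciPolyC Φ), IsRealNodeComplexTangents (ricciPolyC Φ) Q) ∧
      ∃ q, IsSpinorFactorization Φ [(.conj 1 1, q)] ∧ crossings [(.conj 1 1, q)] = singularSet (ricciPolyC Φ)) := by
  have hc : C.scale ≠ 0 := C.scale_ne_zero
  have hdisc : (3 * r + s) * (r + 3 * s) = 4 * ((p - r) * (p - s)) := by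
    obtain rfl : s = -2 * p - r := by linarith
    ring
  have hne : (p - r) * (p - s) ≠ 0 := mul_ne_zero (sub_ne_zero.mpr hpr) (sub_ne_zero.mpr hps)
  obtain ⟨A, hA⟩ : ∃ A : ℝ, A = C.scale * (r - p) / 2 := ⟨_, rfl⟩
  obtain ⟨F, hF⟩ : ∃ F : ℝ, F = C.scale * (p - s) / 2 := ⟨_, rfl⟩
  have hAF : 4 * (A * F) = -((p - r) * (p - s)) := by
    rw [hA, hF]
    linear_combination -(p - r) * (p - s) * hs
  have hFA : F + A ≠ 0 := by
    rw [hA, hF, show C.scale * (p - s) / 2 + C.scale * (r - p) / 2 = C.scale * (r - s) / 2 by ring]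
    exact div_ne_zero (mul_ne_zero hc (sub_ne_zero.mpr hrs)) two_ne_zero
  set q : MvPolynomial (Fin 4) ℂ := MvPolynomial.C (A : ℂ) * bilin (cvec ![0, -1, 1, 0]) ^ 2 +
    MvPolynomial.C (F : ℂ) * bilin (cvec ![0, 1, 1, 0]) ^ 2 with hq
  have e1 : ∀ x y u v, eval ![x, y, u, v] (bilin (cvec ![0, -1, 1, 0])) = y * u - x * v := fun x y u v => by
    simp [eval_bilin, cvec]; ring
  have e2 : ∀ x y u v, eval ![x, y, u, v] (bilin (cvec ![0, 1, 1, 0])) = y * u + x * v := fun x y u v => by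
    simp [eval_bilin, cvec]; ring
  have hqe : ∀ x y u v, eval ![x, y, u, v] q = A * (y * u - x * v) ^ 2 + F * (y * u + x * v) ^ 2 := fun x y u v => by
    simp [hq, e1, e2]
  have hP : ricciPolyC Φ = C.push q := by
    refine ricciPolyC_diagonal hC hM (by simpa using hsum) fun x y u v => ?_
    have h0 : (s : ℂ) = -2 * p - r := by
      rw [show s = -2 * p - r by linarith]
      push_cast
      rfl
    rw [hqe, hA, hF]
    simp [h0, -mul_eq_mul_left_iff]
    ring
  have hpt1 : ∀ Q, Q ∈ pt (cvec (D 0 + D 2)) ↔ C.Rep Q ![1, 0] ![1, 0] :=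
    (coordBasis_on hC).mem_pt_iff_rep (ne_zero_left one_ne_zero) (ne_zero_left one_ne_zero) one_ne_zero
      (by simp [Fin.sum_univ_four, nullCoeffsON, cvec_add])
  have hpt2 : ∀ Q, Q ∈ pt (cvec (D 0 - D 2)) ↔ C.Rep Q ![0, 1] ![0, 1] :=
    (coordBasis_on hC).mem_pt_iff_rep (ne_zero_right one_ne_zero) (ne_zero_right one_ne_zero) one_ne_zero
      (by rw [cvec_sub]; simp [Fin.sum_univ_four, nullCoeffsON, sub_eq_add_neg])
  have hrep : ∀ Q m h, C.Rep Q m h → (Q ∈ pt (cvec (D 0 + D 2)) ∪ pt (cvec (D 0 - D 2)) ↔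
        m 1 * h 0 - m 0 * h 1 = 0 ∧ m 1 * h 0 + m 0 * h 1 = 0) := by
    intro Q m h R
    have hm := R.ne_fst
    have hh := R.ne_snd
    rw [Set.mem_union, hpt1, hpt2, R.iff (ne_zero_left one_ne_zero) (ne_zero_left one_ne_zero),
      R.iff (ne_zero_right one_ne_zero) (ne_zero_right one_ne_zero)]
    simp only [Matrix.cons_val_zero, Matrix.cons_val_one, one_mul, zero_mul]
    clear hP hqe hq hM hpt1 hpt2 e1 e2 hAF hA hF hFA hdisc
    grind
  have hset : singularSet (ricciPolyC Φ) = pt (cvec (D 0 + D 2)) ∪ pt (cvec (D 0 - D 2)) := by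
    ext Q
    obtain ⟨m, h, R⟩ := exists_rep C Q
    rw [mem_singularSet_diagonal hsa hC hM R, hrep Q m h R]
    have hnull := nullCoeffsON_sq m h
    change _ ↔ nullCoeffsON m h 1 = 0 ∧ nullCoeffsON m h 3 = 0
    generalize nullCoeffsON m h = k at *
    constructor
    · rintro ⟨χ, hχ⟩
      refine eq_zero_of_eigenvalues hpr hps hrs (fun h0 h1 => ?_) (by simpa using hχ 0) (by simpa using hχ 2)
        (by simpa using hχ 1) (by simpa using hχ 3)
      simp only [h0, h1] at hnull
      constructor <;> intro h2 <;> refine pow_eq_zero_iff two_ne_zero |>.mp ?_ <;> rw [h2] at hnull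
      · linear_combination -hnull
      · linear_combination hnull
    · rintro ⟨h2, h3⟩
      refine ⟨p, fun i => ?_⟩
      fin_cases i <;> simp [h2, h3]
  have hab : ∀ c d : ℂ, ∃ x y u v, eval ![x, y, u, v] (bilin (cvec ![0, -1, 1, 0])) = c ∧
      eval ![x, y, u, v] (bilin (cvec ![0, 1, 1, 0])) = d := fun c d =>
    ⟨1, 1, (c + d) / 2, (d - c) / 2, by rw [e1]; ring, by rw [e2]; ring⟩
  have hdet : ∀ x y : ℂ, (x ≠ 0 ∨ y ≠ 0) → A * y ^ 2 - ((0 : ℝ) : ℂ) * (x * y) + F * x ^ 2 = 0 →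
      (x * (![0, -1, 1, 0] : Fin 4 → ℝ) 0 + y * (![0, 1, 1, 0] : Fin 4 → ℝ) 0) *
        (x * (![0, -1, 1, 0] : Fin 4 → ℝ) 3 + y * (![0, 1, 1, 0] : Fin 4 → ℝ) 3) -
      (x * (![0, -1, 1, 0] : Fin 4 → ℝ) 1 + y * (![0, 1, 1, 0] : Fin 4 → ℝ) 1) *
        (x * (![0, -1, 1, 0] : Fin 4 → ℝ) 2 + y * (![0, 1, 1, 0] : Fin 4 → ℝ) 2) ≠ 0 := by
    intro x y hxy h0 h1
    have h1' : y ^ 2 = x ^ 2 := by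
      simp only [Matrix.cons_val, Complex.ofReal_zero, Complex.ofReal_one, Complex.ofReal_neg] at h1
      linear_combination -h1
    have hFA' : (F : ℂ) + A ≠ 0 := by exact_mod_cast hFA
    have h2 : (F + A : ℂ) * x ^ 2 = 0 := by
      rw [Complex.ofReal_zero] at h0
      linear_combination h0 - A * h1'
    have h3 : x = 0 := by simpa [hFA'] using h2
    have h4 : y = 0 := by simpa [h3] using h1'
    simp [h3, h4] at hxy
  rw [hset]
  refine ⟨rfl, by rw [hdisc]; exact mul_ne_zero four_ne_zero hne, fun h0 => ⟨?_, ?_⟩, fun h0 => ⟨?_, ?_⟩⟩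
  · have hd : 0 < (2 * (F - A)) ^ 2 - 4 * (A + F) * (A + F) := by
      rw [hdisc] at h0
      nlinarith
    rw [hP]
    rintro Q (hQ | hQ)
    · have R : C.Rep Q (cvec ![1, 0]) (cvec ![1, 0]) := by simpa [cvec_pair] using (hpt1 Q).mp hQ
      refine isRealNodeRealTangents (n := ![0, 1]) (t := ![0, 1]) (c₂₁ := 0) (c₁₂ := 0) (c₂₂ := 0) R (by simp [eps])
        (by simp [eps]) ?_ hd
      intro x y u v
      simp [hqe, cvec_pair]
      ring
    · have R : C.Rep Q (cvec ![0, 1]) (cvec ![0, 1]) := by simpa [cvec_pair] using (hpt2 Q).mp hQ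
      refine isRealNodeRealTangents (n := ![1, 0]) (t := ![1, 0]) (c₂₁ := 0) (c₁₂ := 0) (c₂₂ := 0) R (by simp [eps])
        (by simp [eps]) ?_ hd
      intro x y u v
      simp [hqe, cvec_pair]
      ring
  · exact pencil_real (A := A) (B := 0) (D := F) (a := ![0, -1, 1, 0]) (b := ![0, 1, 1, 0])
      hP (fun x y u v => by simp [hq]) hab hdet (by rw [hdisc] at h0; linarith)
      fun Q m h R => by rw [hrep Q m h R, e1, e2]
  · have hd : 0 < 4 * (A + F) * (A + F) - (2 * (F - A)) ^ 2 := by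
      rw [hdisc] at h0
      nlinarith
    rw [hP]
    rintro Q (hQ | hQ)
    · have R : C.Rep Q (cvec ![1, 0]) (cvec ![1, 0]) := by simpa [cvec_pair] using (hpt1 Q).mp hQ
      refine isRealNodeComplexTangents (n := ![0, 1]) (t := ![0, 1]) (c₂₂ := 0) R (by simp [eps]) (by simp [eps]) ?_ hd
      intro x y u v
      simp [hqe, cvec_pair]
      ring
    · have R : C.Rep Q (cvec ![0, 1]) (cvec ![0, 1]) := by simpa [cvec_pair] using (hpt2 Q).mp hQ
      refine isRealNodeComplexTangents (n := ![1, 0]) (t := ![1, 0]) (c₂₂ := 0) R (by simp [eps]) (by simp [eps]) ?_ hd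
      intro x y u v
      simp [hqe, cvec_pair]
      ring
  · exact pencil_conj (A := A) (B := 0) (D := F) (a := ![0, -1, 1, 0]) (b := ![0, 1, 1, 0])
      hP (fun x y u v => by simp [hq]) hab hdet (by rw [hdisc] at h0; linarith)
      fun Q m h R => by rw [hrep Q m h R, e1, e2]

end DoubleEigenvalue

end NeutralRicci

namespace NeutralRicci

open MvPolynomial

open SpinCoord

variable {Φ : (Fin 4 → ℝ) →ₗ[ℝ] (Fin 4 → ℝ)}

lemma eq_zero_of_two_eigenvalues {k k' l l' χ p r : ℂ} (hpr : p ≠ r) (hk : k ≠ 0 → χ = p) (hk' : k' ≠ 0 → χ = p)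
    (hl : l ≠ 0 → χ = r) (hl' : l' ≠ 0 → χ = r) : (l = 0 ∧ l' = 0) ∨ (k = 0 ∧ k' = 0) := by
  by_cases h : χ = p
  · exact Or.inl ⟨by_contra fun h0 => hpr (h.symm.trans (hl h0)), by_contra fun h0 => hpr (h.symm.trans (hl' h0))⟩
  · exact Or.inr ⟨by_contra fun h0 => h (hk h0), by_contra fun h0 => h (hk' h0)⟩

section MultipleEigenvalues

variable {C : SpinCoord} {D : Fin 4 → Fin 4 → ℝ} {p r s : ℝ}

/-- Two double eigenvalues with definite eigenspaces: the polynomial is a multiple of `(x² + y²) (u² + v²)`. -/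
lemma singular_of_definite_pairs (hsa : ∀ u v, s22 (Φ u) v = s22 u (Φ v)) (hC : C.E = NeutralRicci.toWitt D)
    (hM : HasMatrix Φ D (Matrix.diagonal ![p, p, r, r])) (hsum : p + p + r + r = 0) (hpr : p ≠ r) :
    singularSet (ricciPolyC Φ) =
      pt (cvec (D 0) + Complex.I • cvec (D 1)) ∪ pt (cvec (D 0) - Complex.I • cvec (D 1)) ∪
      pt (cvec (D 2) + Complex.I • cvec (D 3)) ∪ pt (cvec (D 2) - Complex.I • cvec (D 3)) ∧
    ∃ n m, IsSpinorFactorization Φ [(.conj 1 0, n), (.conj 0 1, m)] ∧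
      crossings [(.conj 1 0, n), (.conj 0 1, m)] = singularSet (ricciPolyC Φ) ∧
      ∀ Q ∈ singularSet (ricciPolyC Φ), IsComplexNode (ricciPolyC Φ) Q ∧
        TangentsFromComponents (ricciPolyC Φ) [(.conj 1 0, n), (.conj 0 1, m)] Q := by
  obtain rfl : r = -p := by linarith
  have hp : p ≠ 0 := fun h0 => hpr (by rw [h0, neg_zero])
  have hc : C.scale * p ≠ 0 := mul_ne_zero C.scale_ne_zero hp
  have I2 := Complex.I_sq
  have hI : Complex.I + Complex.I ≠ 0 := by simp [← two_mul]
  set q : MvPolynomial (Fin 4) ℂ := MvPolynomial.C ((C.scale * p : ℝ) : ℂ) *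
    (leftForm 1 Complex.I * leftForm 1 (-Complex.I) * (rightForm 1 Complex.I * rightForm 1 (-Complex.I))) with hq
  have hP : ricciPolyC Φ = C.push q := by
    refine ricciPolyC_diagonal hC hM (by simp) fun x y u v => ?_
    simp [hq, eval_leftForm, eval_rightForm, -mul_eq_mul_left_iff]
    linear_combination C.scale * p * (-x ^ 2 * (v ^ 2 - u ^ 2 * Complex.I ^ 2) - u ^ 2 * (x ^ 2 + y ^ 2)) * I2
  have hl : IsBlockFactorization q [(.conj 1 0, leftForm 1 Complex.I), (.conj 0 1, rightForm 1 Complex.I)] := by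
    refine ⟨?_, ?_, C.scale * p, hc, ?_⟩
    · simp only [List.forall_mem_cons, Block.Admits]
      exact ⟨⟨irreducible_leftForm (by simp), isBihomogeneous_leftForm _ _⟩,
        ⟨irreducible_rightForm (by simp), isBihomogeneous_rightForm _ _⟩, by simp⟩
    · simp only [components, Block.parts, List.flatMap_cons, List.flatMap_nil, List.cons_append, List.nil_append,
        List.append_nil, List.pairwise_cons, List.forall_mem_cons, conjPoly_leftForm, conjPoly_rightForm, map_one,
        Complex.conj_I]
      exact ⟨⟨not_associated_of_eval ![1, Complex.I, 1, 1] (by simp [eval_leftForm]) (by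
          rw [eval_leftForm]; exact fun h0 => hI (by linear_combination -h0)),
        not_associated_of_eval ![1, Complex.I, 1, 0] (by simp [eval_leftForm]) (by simp [eval_rightForm]),
        not_associated_of_eval ![1, Complex.I, 1, 0] (by simp [eval_leftForm]) (by simp [eval_rightForm]), by simp⟩,
        ⟨not_associated_of_eval ![1, -Complex.I, 1, 0] (by simp [eval_leftForm]) (by simp [eval_rightForm]),
        not_associated_of_eval ![1, -Complex.I, 1, 0] (by simp [eval_leftForm]) (by simp [eval_rightForm]), by simp⟩,
        ⟨not_associated_of_eval ![1, 1, 1, Complex.I] (by simp [eval_rightForm]) (by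
          rw [eval_rightForm]; exact fun h0 => hI (by linear_combination -h0)), by simp⟩,
        by simp⟩
    · simp [hq, Block.value, conjPoly_leftForm, conjPoly_rightForm]
  -- the primed factor comes first when the coordinates interchange the two kinds of spinors
  obtain ⟨l, n, m, hlf, hcomp, hL⟩ : ∃ l n m, IsBlockFactorization q l ∧
      (components l = [leftForm 1 Complex.I, leftForm 1 (-Complex.I), rightForm 1 Complex.I, rightForm 1 (-Complex.I)] ∨
      components l = [rightForm 1 Complex.I, rightForm 1 (-Complex.I), leftForm 1 Complex.I, leftForm 1 (-Complex.I)]) ∧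
      C.pushList l = [(.conj 1 0, n), (.conj 0 1, m)] := by
    cases hsw : C.sw
    · exact ⟨_, _, _, hl, Or.inl (by simp [components, Block.parts, conjPoly_leftForm, conjPoly_rightForm]),
        by simp only [pushList, tw, hsw, List.map_cons, List.map_nil]; rfl⟩
    · exact ⟨_, _, _, hl.perm (List.Perm.swap _ _ _),
        Or.inr (by simp [components, Block.parts, conjPoly_leftForm, conjPoly_rightForm]),
        by simp only [pushList, tw, hsw, List.map_cons, List.map_nil]; rfl⟩
  obtain ⟨hcr, hnode⟩ := four_lines (C := C) hlf.1 hq (by exact_mod_cast hc) (fun h0 => hI (by linear_combination -h0))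
    (fun h0 => hI (by linear_combination -h0)) hcomp
  have nz : ∀ z : ℂ, (![1, z] : Fin 2 → ℂ) ≠ 0 := fun z => ne_zero_left one_ne_zero
  have hpts : pt (cvec (D 0) + Complex.I • cvec (D 1)) ∪ pt (cvec (D 0) - Complex.I • cvec (D 1)) ∪
      pt (cvec (D 2) + Complex.I • cvec (D 3)) ∪ pt (cvec (D 2) - Complex.I • cvec (D 3)) =
        crossings (C.pushList l) := by
    ext Q
    rw [hcr, Set.mem_union, Set.mem_union, Set.mem_union,
      (coordBasis_on hC).mem_pt_iff_rep (nz Complex.I) (nz (-Complex.I)) (c := 2) two_ne_zero ?_,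
      (coordBasis_on hC).mem_pt_iff_rep (nz (-Complex.I)) (nz Complex.I) (c := 2) two_ne_zero ?_,
      (coordBasis_on hC).mem_pt_iff_rep (nz Complex.I) (nz Complex.I) (c := 2) two_ne_zero ?_,
      (coordBasis_on hC).mem_pt_iff_rep (nz (-Complex.I)) (nz (-Complex.I)) (c := 2) two_ne_zero ?_]
    · tauto
    all_goals
      ext i
      simp [Fin.sum_univ_four, nullCoeffsON, cvec]
      ring
  have hset : singularSet (ricciPolyC Φ) = crossings (C.pushList l) := by
    refine Set.Subset.antisymm (fun Q hQ => (hcr Q).mpr ?_) fun Q hQ f σ τ => ?_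
    · obtain ⟨m, h, R⟩ := exists_rep C Q
      obtain ⟨χ, hχ⟩ := (mem_singularSet_diagonal hsa hC hM R).mp hQ
      have k0 := hχ 0
      have k1 := hχ 1
      have k2 := hχ 2
      have k3 := hχ 3
      rw [R.iff (nz _) (nz _), R.iff (nz _) (nz _), R.iff (nz _) (nz _), R.iff (nz _) (nz _)]
      simp only [nullCoeffsON, Matrix.cons_val, one_mul] at k0 k1 k2 k3 ⊢
      have hpr' : (p : ℂ) ≠ ((-p : ℝ) : ℂ) := by exact_mod_cast hpr
      have hm := R.ne_fst
      have hh := R.ne_snd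
      obtain ⟨f1, f2, f3, f4⟩ : (m 0 ^ 2 + m 1 ^ 2) * h 0 = 0 ∧ (m 0 ^ 2 + m 1 ^ 2) * h 1 = 0 ∧
          (h 0 ^ 2 + h 1 ^ 2) * m 0 = 0 ∧ (h 0 ^ 2 + h 1 ^ 2) * m 1 = 0 := by
        rcases eq_zero_of_two_eigenvalues hpr' k0 k1 k2 k3 with ⟨a, b⟩ | ⟨a, b⟩
        · exact ⟨by linear_combination m 0 * a + m 1 * b, by linear_combination m 0 * b - m 1 * a,
            by linear_combination h 0 * a + h 1 * b, by linear_combination h 0 * b - h 1 * a⟩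
        · exact ⟨by linear_combination m 0 * a + m 1 * b, by linear_combination m 1 * a - m 0 * b,
            by linear_combination h 0 * a - h 1 * b, by linear_combination h 1 * a + h 0 * b⟩
      have h4 : m 0 ^ 2 + m 1 ^ 2 = 0 :=
        hh.elim (mul_eq_zero.mp f1).resolve_right (mul_eq_zero.mp f2).resolve_right
      have h5 : h 0 ^ 2 + h 1 ^ 2 = 0 :=
        hm.elim (mul_eq_zero.mp f3).resolve_right (mul_eq_zero.mp f4).resolve_right
      rcases sq_add_sq_eq_zero h4 with h6 | h6 <;> rcases sq_add_sq_eq_zero h5 with h7 | h7 <;> simp [h6, h7]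
    · rw [hP]
      have := (hnode Q hQ).1.1 f
      exact ⟨this.1 σ τ 0 (by norm_num), this.1 σ τ 1 (by norm_num)⟩
  refine ⟨by rw [hset, hpts], n, m, hL ▸ isSpinorFactorization hP hlf, by rw [hset, hL], fun Q hQ => ?_⟩
  rw [hset] at hQ
  obtain ⟨g1, g2⟩ := hnode Q hQ
  rw [← hL, hP]
  refine ⟨⟨g1, ?_⟩, g2⟩
  rcases (hcr Q).mp hQ with R | R | R | R <;>
  · refine not_isRealPt R fun h0 => ?_
    have := congrArg Complex.im h0
    norm_num at this

/-- Two double eigenvalues with indefinite eigenspaces: the polynomial is a multiple of `x y u v`. -/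
lemma singular_of_indefinite_pairs (hsa : ∀ u v, s22 (Φ u) v = s22 u (Φ v)) (hC : C.E = NeutralRicci.toWitt D)
    (hM : HasMatrix Φ D (Matrix.diagonal ![p, r, p, r])) (hsum : p + r + p + r = 0) (hpr : p ≠ r) :
    singularSet (ricciPolyC Φ) = pt (cvec (D 0 + D 2)) ∪ pt (cvec (D 0 - D 2)) ∪
      pt (cvec (D 1 + D 3)) ∪ pt (cvec (D 1 - D 3)) ∧
    ∃ n₁ n₂ m₁ m₂,
      IsSpinorFactorization Φ [(.real 1 0, n₁), (.real 1 0, n₂), (.real 0 1, m₁), (.real 0 1, m₂)] ∧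
      crossings [(.real 1 0, n₁), (.real 1 0, n₂), (.real 0 1, m₁), (.real 0 1, m₂)] =
        singularSet (ricciPolyC Φ) ∧
      ∀ Q ∈ singularSet (ricciPolyC Φ), IsRealNodeRealTangents (ricciPolyC Φ) Q ∧
        TangentsFromComponents (ricciPolyC Φ)
          [(.real 1 0, n₁), (.real 1 0, n₂), (.real 0 1, m₁), (.real 0 1, m₂)] Q := by
  obtain rfl : r = -p := by linarith
  have hp : p ≠ 0 := fun h0 => hpr (by rw [h0, neg_zero])
  have hc : 4 * (C.scale * p) ≠ 0 := mul_ne_zero four_ne_zero (mul_ne_zero C.scale_ne_zero hp)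
  set q : MvPolynomial (Fin 4) ℂ := MvPolynomial.C ((4 * (C.scale * p) : ℝ) : ℂ) *
    (leftForm 1 0 * leftForm 0 1 * (rightForm 1 0 * rightForm 0 1)) with hq
  have hqe : ∀ x y u v, eval ![x, y, u, v] q = (4 * (C.scale * p) : ℝ) * (x * y * u * v) := fun x y u v => by
    simp [hq, eval_leftForm, eval_rightForm, -mul_eq_mul_left_iff]
    ring
  have hP : ricciPolyC Φ = C.push q := by
    refine ricciPolyC_diagonal hC hM (by simp) fun x y u v => ?_
    rw [hqe]
    simp [-mul_eq_mul_left_iff]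
    ring
  have hl : IsBlockFactorization q [(.real 1 0, leftForm 1 0), (.real 1 0, leftForm 0 1), (.real 0 1, rightForm 1 0),
      (.real 0 1, rightForm 0 1)] := by
    refine ⟨?_, ?_, 4 * (C.scale * p), hc, ?_⟩
    · simp only [List.forall_mem_cons, Block.Admits]
      exact ⟨⟨irreducible_leftForm (by simp), isBihomogeneous_leftForm _ _, by simp [conjPoly_leftForm]⟩,
        ⟨irreducible_leftForm (by simp), isBihomogeneous_leftForm _ _, by simp [conjPoly_leftForm]⟩,
        ⟨irreducible_rightForm (by simp), isBihomogeneous_rightForm _ _, by simp [conjPoly_rightForm]⟩,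
        ⟨irreducible_rightForm (by simp), isBihomogeneous_rightForm _ _, by simp [conjPoly_rightForm]⟩, by simp⟩
    · simp only [components, Block.parts, List.flatMap_cons, List.flatMap_nil, List.cons_append, List.nil_append,
        List.pairwise_cons, List.forall_mem_cons]
      exact ⟨⟨not_associated_of_eval ![1, 0, 1, 1] (by simp [eval_leftForm]) (by simp [eval_leftForm]),
        not_associated_of_eval ![1, 0, 1, 1] (by simp [eval_leftForm]) (by simp [eval_rightForm]),
        not_associated_of_eval ![1, 0, 1, 1] (by simp [eval_leftForm]) (by simp [eval_rightForm]), by simp⟩,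
        ⟨not_associated_of_eval ![0, 1, 1, 1] (by simp [eval_leftForm]) (by simp [eval_rightForm]),
        not_associated_of_eval ![0, 1, 1, 1] (by simp [eval_leftForm]) (by simp [eval_rightForm]), by simp⟩,
        ⟨not_associated_of_eval ![1, 1, 1, 0] (by simp [eval_rightForm]) (by simp [eval_rightForm]), by simp⟩,
        by simp⟩
    · simp [hq, Block.value, mul_assoc]
  obtain ⟨l, n₁, n₂, m₁, m₂, hlf, hcomp, hL⟩ : ∃ l n₁ n₂ m₁ m₂, IsBlockFactorization q l ∧
      (components l = [leftForm 1 0, leftForm 0 1, rightForm 1 0, rightForm 0 1] ∨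
      components l = [rightForm 1 0, rightForm 0 1, leftForm 1 0, leftForm 0 1]) ∧
      C.pushList l = [(.real 1 0, n₁), (.real 1 0, n₂), (.real 0 1, m₁), (.real 0 1, m₂)] := by
    cases hsw : C.sw
    · exact ⟨_, _, _, _, _, hl, Or.inl (by simp [components, Block.parts]),
        by simp only [pushList, tw, hsw, List.map_cons, List.map_nil]; rfl⟩
    · exact ⟨_, _, _, _, _, hl.perm (List.perm_append_comm (l₁ := [_, _]) (l₂ := [_, _])),
        Or.inr (by simp [components, Block.parts]),
        by simp only [pushList, tw, hsw, List.map_append, List.map_cons, List.map_nil]; rfl⟩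
  obtain ⟨hcr, hnode⟩ := four_lines (C := C) hlf.1 hq (by exact_mod_cast hc) (by norm_num) (by norm_num) hcomp
  have nz : (![1, 0] : Fin 2 → ℂ) ≠ 0 := ne_zero_left one_ne_zero
  have nz' : (![0, 1] : Fin 2 → ℂ) ≠ 0 := ne_zero_right one_ne_zero
  have hpts : pt (cvec (D 0 + D 2)) ∪ pt (cvec (D 0 - D 2)) ∪ pt (cvec (D 1 + D 3)) ∪ pt (cvec (D 1 - D 3)) =
        crossings (C.pushList l) := by
    ext Q
    rw [hcr, Set.mem_union, Set.mem_union, Set.mem_union,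
      (coordBasis_on hC).mem_pt_iff_rep nz nz (c := 1) one_ne_zero ?_,
      (coordBasis_on hC).mem_pt_iff_rep nz' nz' (c := 1) one_ne_zero ?_,
      (coordBasis_on hC).mem_pt_iff_rep nz' nz (c := 1) one_ne_zero ?_,
      (coordBasis_on hC).mem_pt_iff_rep nz nz' (c := -1) (by norm_num) ?_]
    · tauto
    all_goals
      ext i
      simp [Fin.sum_univ_four, nullCoeffsON, cvec]
      try ring
  have hset : singularSet (ricciPolyC Φ) = crossings (C.pushList l) := by
    refine Set.Subset.antisymm (fun Q hQ => (hcr Q).mpr ?_) fun Q hQ f σ τ => ?_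
    · obtain ⟨m, h, R⟩ := exists_rep C Q
      obtain ⟨χ, hχ⟩ := (mem_singularSet_diagonal hsa hC hM R).mp hQ
      have k0 := hχ 0
      have k1 := hχ 1
      have k2 := hχ 2
      have k3 := hχ 3
      rw [R.iff nz nz, R.iff nz nz', R.iff nz' nz, R.iff nz' nz']
      simp only [nullCoeffsON, Matrix.cons_val, one_mul, zero_mul] at k0 k1 k2 k3 ⊢
      have hpr' : (p : ℂ) ≠ ((-p : ℝ) : ℂ) := by exact_mod_cast hpr
      have hm := R.ne_fst
      have hh := R.ne_snd
      obtain ⟨f1, f2, f3, f4⟩ : m 0 * m 1 * h 0 = 0 ∧ m 0 * m 1 * h 1 = 0 ∧ h 0 * h 1 * m 0 = 0 ∧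
          h 0 * h 1 * m 1 = 0 := by
        rcases eq_zero_of_two_eigenvalues hpr' k0 k2 k1 k3 with ⟨a, b⟩ | ⟨a, b⟩
        · exact ⟨by linear_combination m 0 * (a + b) / 2, by linear_combination m 1 * (b - a) / 2,
            by linear_combination h 0 * (b - a) / 2, by linear_combination h 1 * (a + b) / 2⟩
        · exact ⟨by linear_combination m 1 * (a + b) / 2, by linear_combination m 0 * (a - b) / 2,
            by linear_combination h 1 * (a + b) / 2, by linear_combination h 0 * (a - b) / 2⟩
      have h4 : m 0 = 0 ∨ m 1 = 0 := mul_eq_zero.mp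
        (hh.elim (mul_eq_zero.mp f1).resolve_right (mul_eq_zero.mp f2).resolve_right)
      have h5 : h 0 = 0 ∨ h 1 = 0 := mul_eq_zero.mp
        (hm.elim (mul_eq_zero.mp f3).resolve_right (mul_eq_zero.mp f4).resolve_right)
      rcases h4 with h6 | h6 <;> rcases h5 with h7 | h7 <;> simp [h6, h7]
    · rw [hP]
      have := (hnode Q hQ).1.1 f
      exact ⟨this.1 σ τ 0 (by norm_num), this.1 σ τ 1 (by norm_num)⟩
  refine ⟨by rw [hset, hpts], n₁, n₂, m₁, m₂, hL ▸ isSpinorFactorization hP hlf, by rw [hset, hL], fun Q hQ => ?_⟩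
  rw [hset] at hQ
  rw [← hL, hP]
  refine ⟨?_, (hnode Q hQ).2⟩
  have hd : 0 < (4 * (C.scale * p)) ^ 2 - 4 * 0 * 0 := by
    have := pow_pos (abs_pos.mpr hc) 2
    rw [sq_abs] at this
    linarith
  have c1 : cvec ![1, 0] = ![(1 : ℂ), 0] := by simp [cvec_pair]
  have c2 : cvec ![0, 1] = ![(0 : ℂ), 1] := by simp [cvec_pair]
  rcases (hcr Q).mp hQ with R | R | R | R
  · rw [← c1] at R
    refine isRealNodeRealTangents (n := ![0, 1]) (t := ![0, 1]) (c₂₁ := 0) (c₁₂ := 0) (c₂₂ := 0) R (by simp [eps])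
      (by simp [eps]) ?_ hd
    intro x y u v
    simp only [hqe, cvec_pair, Complex.ofReal_zero, Complex.ofReal_one, Matrix.cons_val]
    push_cast
    ring
  · rw [← c1, ← c2] at R
    refine isRealNodeRealTangents (n := ![0, 1]) (t := ![1, 0]) (c₂₁ := 0) (c₁₂ := 0) (c₂₂ := 0) R (by simp [eps])
      (by simp [eps]) ?_ hd
    intro x y u v
    simp only [hqe, cvec_pair, Complex.ofReal_zero, Complex.ofReal_one, Matrix.cons_val]
    push_cast
    ring
  · rw [← c1, ← c2] at R
    refine isRealNodeRealTangents (n := ![1, 0]) (t := ![0, 1]) (c₂₁ := 0) (c₁₂ := 0) (c₂₂ := 0) R (by simp [eps])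
      (by simp [eps]) ?_ hd
    intro x y u v
    simp only [hqe, cvec_pair, Complex.ofReal_zero, Complex.ofReal_one, Matrix.cons_val]
    push_cast
    ring
  · rw [← c2] at R
    refine isRealNodeRealTangents (n := ![1, 0]) (t := ![1, 0]) (c₂₁ := 0) (c₁₂ := 0) (c₂₂ := 0) R (by simp [eps])
      (by simp [eps]) ?_ hd
    intro x y u v
    simp only [hqe, cvec_pair, Complex.ofReal_zero, Complex.ofReal_one, Matrix.cons_val]
    push_cast
    ring

lemma SpinCoord.CoordBasis.mem_pts_triple {k : (Fin 2 → ℂ) → (Fin 2 → ℂ) → Fin 4 → ℂ} (H : CoordBasis C D k) {Q : Pt}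
    {m h : Fin 2 → ℂ} (R : C.Rep Q m h) :
    Q ∈ pts (Submodule.span ℂ {cvec (D 0), cvec (D 1), cvec (D 2)}) ↔ k m h 3 = 0 := by
  obtain ⟨r, hr, he⟩ := H.eq
  rw [mem_pts_iff R.2.2.1 R.2.2.2, he, Submodule.smul_mem_iff _ hr, Submodule.mem_span_triple]
  constructor
  · rintro ⟨x, y, z, e⟩
    have := Fintype.linearIndependent_iff.mp H.li (fun i => ![x, y, z, 0] i - k m h i)
      (by simp only [sub_smul, Finset.sum_sub_distrib, ← e, Fin.sum_univ_four]; simp) 3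
    simpa using this
  · intro e
    exact ⟨k m h 0, k m h 1, k m h 2, by simp [Fin.sum_univ_four, e]⟩

/-- A triple eigenvalue: the polynomial is a multiple of the square of the coefficient of the fourth eigenvector. -/
lemma singular_of_triple (hsa : ∀ u v, s22 (Φ u) v = s22 u (Φ v)) (hC : C.E = NeutralRicci.toWitt D)
    (hM : HasMatrix Φ D (Matrix.diagonal ![p, p, p, s])) (hsum : p + p + p + s = 0) (hps : p ≠ s) :
    ∃ q, IsSpinorFactorization Φ [(.sq 1 1, q)] ∧
      zeros q = pts (Submodule.span ℂ {cvec (D 0), cvec (D 1), cvec (D 2)}) ∧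
      zeros (ricciPolyC Φ) = zeros q ∧ singularSet (ricciPolyC Φ) = zeros q := by
  obtain rfl : s = -3 * p := by linarith
  have hp : p ≠ 0 := fun h0 => hps (by rw [h0, mul_zero])
  have hc : 2 * (C.scale * p) ≠ 0 := mul_ne_zero two_ne_zero (mul_ne_zero C.scale_ne_zero hp)
  have hc' : ((2 * (C.scale * p) : ℝ) : ℂ) ≠ 0 := by exact_mod_cast hc
  have e2 : ∀ x y u v, eval ![x, y, u, v] (bilin (cvec ![0, 1, 1, 0])) = y * u + x * v := fun x y u v => by
    simp [eval_bilin, cvec]; ring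
  set q : MvPolynomial (Fin 4) ℂ := MvPolynomial.C ((2 * (C.scale * p) : ℝ) : ℂ) * bilin (cvec ![0, 1, 1, 0]) ^ 2 with hq
  have hqe : ∀ x y u v, eval ![x, y, u, v] q = (2 * (C.scale * p) : ℝ) * (y * u + x * v) ^ 2 := fun x y u v => by
    simp [hq, e2]
  have hP : ricciPolyC Φ = C.push q := by
    refine ricciPolyC_diagonal hC hM (by simp; linarith) fun x y u v => ?_
    rw [hqe]
    simp [-mul_eq_mul_left_iff]
    ring
  have hl : IsBlockFactorization q [(.sq 1 1, bilin (cvec ![0, 1, 1, 0]))] := by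
    refine ⟨?_, ?_, 2 * (C.scale * p), hc, ?_⟩
    · simp only [List.forall_mem_cons, Block.Admits]
      exact ⟨⟨irreducible_bilin (by simp [cvec]), isBihomogeneous_bilin _, by simp [conjPoly_bilin, cvec]; rfl⟩, by simp⟩
    · simp [components, Block.parts]
    · simp [hq, Block.value]
  have hL : C.pushList [(.sq 1 1, bilin (cvec ![0, 1, 1, 0]))] =
      [(.sq 1 1, C.push (bilin (cvec ![0, 1, 1, 0])))] := by simp [pushList, tw, Block.swap]
  have hz : zeros (C.push (bilin (cvec ![0, 1, 1, 0]))) =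
      pts (Submodule.span ℂ {cvec (D 0), cvec (D 1), cvec (D 2)}) :=
    zeros_push (isBihomogeneous_bilin _) fun Q m h R => by
      rw [(coordBasis_on hC).mem_pts_triple R, e2]
      rfl
  refine ⟨_, hL ▸ isSpinorFactorization hP hl, hz, ?_, ?_⟩
  · rw [hz, hP]
    refine zeros_push (r := 2) (s := 2) (isBihomogeneous_of_eval fun a b x y u v => ?_) fun Q m h R => ?_
    · rw [hqe, hqe]
      ring
    · rw [(coordBasis_on hC).mem_pts_triple R, hqe, mul_eq_zero, or_iff_right hc', pow_eq_zero_iff two_ne_zero]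
      rfl
  · ext Q
    obtain ⟨m, h, R⟩ := exists_rep C Q
    rw [hz, (coordBasis_on hC).mem_pts_triple R, mem_singularSet_diagonal hsa hC hM R]
    have hnull := nullCoeffsON_sq m h
    have hnz := R.exists_nullCoeffsON_ne_zero
    generalize nullCoeffsON m h = k at *
    constructor
    · rintro ⟨χ, hχ⟩
      by_contra h3
      have k3 := hχ 3 h3
      have key : ∀ i, i ≠ 3 → k i = 0 := fun i hi => by
        by_contra h0
        have := (hχ i h0).symm.trans k3
        refine hps ?_
        fin_cases i <;> simp at this hi <;>
          exact Complex.ofReal_injective (by push_cast; linear_combination this)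
      simp [key 0, key 1, key 2] at hnull
      exact h3 (by simpa using hnull.symm)
    · intro h3
      refine ⟨p, fun i => ?_⟩
      fin_cases i <;> simp [h3]

end MultipleEigenvalues

end NeutralRicci

namespace NeutralRicci

open MvPolynomial

open SpinCoord

variable {Φ : (Fin 4 → ℝ) →ₗ[ℝ] (Fin 4 → ℝ)}

/-- By a renumbering of the basis, each coincidence of eigenvalues is reduced to a standard position. -/
theorem type_IX (hsa : ∀ u v, s22 (Φ u) v = s22 u (Φ v)) (htr : LinearMap.trace ℝ (Fin 4 → ℝ) Φ = 0)
    (κ : OType) (B : Fin 4 → Fin 4 → ℝ) (d : Fin 4 → ℝ) (hB : IsPsiON B)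
    (hM : HasMatrix Φ B (Matrix.diagonal d)) :
      d 0 + d 1 + d 2 + d 3 = 0 ∧
      HasSpinorForm Φ κ (toWitt B)
        (fun o ι o' ι' A B A' B' =>
          (d 0 - d 2) / 2 * (dbl o A B * dbl o' A' B' + dbl ι A B * dbl ι' A' B') +
          (d 1 - d 3) / 2 * (dbl ι A B * dbl o' A' B' + dbl o A B * dbl ι' A' B') +
          (d 0 + d 2) / 2 * mix o ι A B * mix o' ι' A' B')
        (fun X Y U V => ((d 0 - d 2) / 2) • (Y ^ 2 * V ^ 2 + X ^ 2 * U ^ 2) +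
          ((d 1 - d 3) / 2) • (X ^ 2 * V ^ 2 + Y ^ 2 * U ^ 2) + (2 * (d 0 + d 2)) • (U * V * X * Y)) ∧
      -- no two eigenvalues equal
      (Function.Injective d →
        (∃ q, IsSpinorFactorization Φ [(.real 2 2, q)]) ∧ singularSet (ricciPolyC Φ) = ∅) ∧
      (∀ i j k l : Fin 4, [i, j, k, l].Nodup →
        -- exactly two eigenvalues equal, their eigenvectors of the same character
        (d i = d j → d i ≠ d k → d i ≠ d l → d k ≠ d l → s22 (B i) (B i) = s22 (B j) (B j) →
          singularSet (ricciPolyC Φ) =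
            pt (cvec (B i) + Complex.I • cvec (B j)) ∪ pt (cvec (B i) - Complex.I • cvec (B j)) ∧
          (∀ Q ∈ singularSet (ricciPolyC Φ), IsComplexNode (ricciPolyC Φ) Q) ∧
          (3 * d k + d l) * (d k + 3 * d l) ≠ 0 ∧
          (0 < (3 * d k + d l) * (d k + 3 * d l) → ∃ q, IsSpinorFactorization Φ [(.conj 1 1, q)] ∧
            crossings [(.conj 1 1, q)] = singularSet (ricciPolyC Φ)) ∧
          ((3 * d k + d l) * (d k + 3 * d l) < 0 →
            ∃ q₁ q₂, IsSpinorFactorization Φ [(.real 1 1, q₁), (.real 1 1, q₂)] ∧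
            crossings [(.real 1 1, q₁), (.real 1 1, q₂)] = singularSet (ricciPolyC Φ))) ∧
        -- exactly two eigenvalues equal, their eigenvectors of opposite character
        (d i = d j → d i ≠ d k → d i ≠ d l → d k ≠ d l → s22 (B i) (B i) = -s22 (B j) (B j) →
          singularSet (ricciPolyC Φ) = pt (cvec (B i + B j)) ∪ pt (cvec (B i - B j)) ∧
          (3 * d k + d l) * (d k + 3 * d l) ≠ 0 ∧
          (0 < (3 * d k + d l) * (d k + 3 * d l) →
            (∀ Q ∈ singularSet (ricciPolyC Φ), IsRealNodeRealTangents (ricciPolyC Φ) Q) ∧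
            ∃ q₁ q₂, IsSpinorFactorization Φ [(.real 1 1, q₁), (.real 1 1, q₂)] ∧
            crossings [(.real 1 1, q₁), (.real 1 1, q₂)] = singularSet (ricciPolyC Φ)) ∧
          ((3 * d k + d l) * (d k + 3 * d l) < 0 →
            (∀ Q ∈ singularSet (ricciPolyC Φ), IsRealNodeComplexTangents (ricciPolyC Φ) Q) ∧
            ∃ q, IsSpinorFactorization Φ [(.conj 1 1, q)] ∧
            crossings [(.conj 1 1, q)] = singularSet (ricciPolyC Φ))) ∧
        -- two pairs of equal eigenvalues, of the same character within each pair
        (d i = d j → d k = d l → d i ≠ d k → s22 (B i) (B i) = s22 (B j) (B j) →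
          singularSet (ricciPolyC Φ) =
            pt (cvec (B i) + Complex.I • cvec (B j)) ∪ pt (cvec (B i) - Complex.I • cvec (B j)) ∪
            pt (cvec (B k) + Complex.I • cvec (B l)) ∪ pt (cvec (B k) - Complex.I • cvec (B l)) ∧
          ∃ n m, IsSpinorFactorization Φ [(.conj 1 0, n), (.conj 0 1, m)] ∧
            crossings [(.conj 1 0, n), (.conj 0 1, m)] = singularSet (ricciPolyC Φ) ∧
            ∀ Q ∈ singularSet (ricciPolyC Φ), IsComplexNode (ricciPolyC Φ) Q ∧
              TangentsFromComponents (ricciPolyC Φ) [(.conj 1 0, n), (.conj 0 1, m)] Q) ∧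
        -- two pairs of equal eigenvalues, of opposite character within each pair
        (d i = d j → d k = d l → d i ≠ d k → s22 (B i) (B i) = -s22 (B j) (B j) →
          singularSet (ricciPolyC Φ) = pt (cvec (B i + B j)) ∪ pt (cvec (B i - B j)) ∪
            pt (cvec (B k + B l)) ∪ pt (cvec (B k - B l)) ∧
          ∃ n₁ n₂ m₁ m₂,
            IsSpinorFactorization Φ [(.real 1 0, n₁), (.real 1 0, n₂), (.real 0 1, m₁), (.real 0 1, m₂)] ∧
            crossings [(.real 1 0, n₁), (.real 1 0, n₂), (.real 0 1, m₁), (.real 0 1, m₂)] =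
              singularSet (ricciPolyC Φ) ∧
            ∀ Q ∈ singularSet (ricciPolyC Φ), IsRealNodeRealTangents (ricciPolyC Φ) Q ∧
              TangentsFromComponents (ricciPolyC Φ)
                [(.real 1 0, n₁), (.real 1 0, n₂), (.real 0 1, m₁), (.real 0 1, m₂)] Q) ∧
        -- exactly three equal eigenvalues
        (d i = d j → d j = d k → d k ≠ d l →
          ∃ q, IsSpinorFactorization Φ [(.sq 1 1, q)] ∧
            zeros q = pts (Submodule.span ℂ {cvec (B i), cvec (B j), cvec (B k)}) ∧
            zeros (ricciPolyC Φ) = zeros q ∧ singularSet (ricciPolyC Φ) = zeros q)) ∧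
      -- all eigenvalues equal
      ((∀ i j, d i = d j) → d = 0 ∧ Φ = 0 ∧ (∀ A B A' B', ricciSpinor Φ A B A' B' = 0) ∧ ricciPoly Φ = 0 ∧
        zeros (ricciPolyC Φ) = Set.univ) := by
  have htr' : d 0 + d 1 + d 2 + d 3 = 0 := by simpa using hB.trace_eq hM htr
  have h3 : d 3 = -d 0 - d 1 - d 2 := by linarith
  refine ⟨htr', hasSpinorForm_of_matrix hB.toWitt hM.toWitt ?_ ?_, ?_⟩
  · intro a b a' b' A B A' B'
    simp [Fin.sum_univ_four, psiToWitt, wittSpinor, dbl, mix, h3]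
    ring
  · intro X Y U V
    refine MvPolynomial.funext fun z => ?_
    simp [psiToWitt, Fin.sum_univ_four, wittForm, smul_eval, h3]
    ring
  have hs : ∀ n, s22 (B n) (B n) = ((![1, 1, -1, -1] n : ℤ) : ℝ) := fun n => by
    rw [hB n n]; fin_cases n <;> simp
  -- a vector of a pair of opposite character has the character of one of the remaining two
  have hsame : ∀ i j k l : Fin 4, [i, j, k, l].Nodup → s22 (B i) (B i) = -s22 (B j) (B j) →
      s22 (B i) (B i) = s22 (B k) (B k) ∨ s22 (B i) (B i) = s22 (B l) (B l) := by
    have : ∀ i j k l : Fin 4, [i, j, k, l].Nodup → (![1, 1, -1, -1] : Fin 4 → ℤ) i = -![1, 1, -1, -1] j →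
        (![1, 1, -1, -1] : Fin 4 → ℤ) i = ![1, 1, -1, -1] k ∨ (![1, 1, -1, -1] : Fin 4 → ℤ) i = ![1, 1, -1, -1] l := by
      decide
    intro i j k l hn h
    rw [hs, hs] at h
    rw [hs, hs, hs]
    exact_mod_cast this i j k l hn (by exact_mod_cast h)
  refine ⟨fun hinj => ?_, fun i j k l hn => ⟨fun hij hik hil hkl hsij => ?_, fun hij hik hil hkl hsij => ?_,
    fun hij hkl hik hsij => ?_, fun hij hkl hik hsij => ?_, fun hij hjk hkl => ?_⟩, fun heq => ?_⟩
  · obtain ⟨κ, hκ, -⟩ := hB.toWitt.existsUnique_oType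
    obtain ⟨C, hC, -, -⟩ := exists_of_hasOType hB.toWitt hκ
    have hs := singularSet_diagonal_eq_empty hsa hC hM hinj
    exact ⟨isSpinorFactorization_of_irreducible (irreducible_of_singularSet_eq_empty isBihomogeneous_ricciPolyC hs), hs⟩
  · obtain ⟨C, hC, hc, hM', hsum⟩ := hB.exists_rearranged hM htr' hn hsij
    rw [← hij] at hM' hsum
    have h := singular_of_definite_pair hsa hC hc hM' hsum hik hil hkl
    simp only [Matrix.cons_val] at h
    exact h
  · rcases hsame i j k l hn hsij with hk | hk
    · obtain ⟨C, hC, hc, hM', hsum⟩ := hB.exists_rearranged (i := i) (j := k) (k := j) (l := l) hM htr'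
        ((List.Perm.swap _ _ _).cons _ |>.nodup_iff.mp hn) hk
      rw [← hij] at hM' hsum
      have h := singular_of_indefinite_pair hsa hC hc hM' hsum hik hil hkl
      simp only [Matrix.cons_val] at h
      exact h
    · obtain ⟨C, hC, hc, hM', hsum⟩ := hB.exists_rearranged (i := i) (j := l) (k := j) (l := k) hM htr'
        ((List.perm_append_comm (l₁ := [j, k]) (l₂ := [l])).cons _ |>.nodup_iff.mp hn) hk
      rw [← hij] at hM' hsum
      rw [show (3 * d k + d l) * (d k + 3 * d l) = (3 * d l + d k) * (d l + 3 * d k) by ring]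
      have h := singular_of_indefinite_pair hsa hC hc hM' hsum hil hik hkl.symm
      simp only [Matrix.cons_val] at h
      exact h
  · obtain ⟨C, hC, hc, hM', hsum⟩ := hB.exists_rearranged hM htr' hn hsij
    rw [← hij, ← hkl] at hM' hsum
    have h := singular_of_definite_pairs hsa hC hM' hsum hik
    simp only [Matrix.cons_val] at h
    exact h
  · rcases hsame i j k l hn hsij with hk | hk
    · obtain ⟨C, hC, hc, hM', hsum⟩ := hB.exists_rearranged (i := i) (j := k) (k := j) (l := l) hM htr'
        ((List.Perm.swap _ _ _).cons _ |>.nodup_iff.mp hn) hk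
      rw [← hij, ← hkl] at hM' hsum
      have h := singular_of_indefinite_pairs hsa hC hM' hsum hik
      simp only [Matrix.cons_val] at h
      exact h
    · obtain ⟨C, hC, hc, hM', hsum⟩ := hB.exists_rearranged (i := i) (j := l) (k := j) (l := k) hM htr'
        ((List.perm_append_comm (l₁ := [j, k]) (l₂ := [l])).cons _ |>.nodup_iff.mp hn) hk
      rw [← hij, ← hkl] at hM' hsum
      have h := singular_of_indefinite_pairs hsa hC hM' hsum hik
      simp only [Matrix.cons_val] at h
      rw [add_comm (B l), ← neg_sub (B k), cvec_neg, pt_neg] at h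
      exact h
  · -- two of the three eigenvectors have the same character
    have hpair : s22 (B j) (B j) = s22 (B k) (B k) ∨ s22 (B i) (B i) = s22 (B k) (B k) ∨
        s22 (B i) (B i) = s22 (B j) (B j) := by
      have : ∀ i j k : Fin 4, (![1, 1, -1, -1] : Fin 4 → ℤ) j = ![1, 1, -1, -1] k ∨
          (![1, 1, -1, -1] : Fin 4 → ℤ) i = ![1, 1, -1, -1] k ∨ (![1, 1, -1, -1] : Fin 4 → ℤ) i = ![1, 1, -1, -1] j := by
        decide
      rw [hs, hs, hs]
      exact_mod_cast this i j k
    rcases hpair with hp | hp | hp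
    · obtain ⟨C, hC, hc, hM', hsum⟩ := hB.exists_rearranged (i := j) (j := k) (k := i) (l := l) hM htr'
        (by simp only [List.nodup_cons, List.mem_cons, List.not_mem_nil, or_false, not_or] at hn ⊢; tauto) hp
      rw [hij, ← hjk] at hM' hsum
      have h := singular_of_triple hsa hC hM' hsum (hjk ▸ hkl)
      simp only [Matrix.cons_val] at h
      rwa [show ({cvec (B j), cvec (B k), cvec (B i)} : Set (Fin 4 → ℂ)) = {cvec (B i), cvec (B j), cvec (B k)} by
        ext; simp only [Set.mem_insert_iff, Set.mem_singleton_iff]; tauto] at h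
    · obtain ⟨C, hC, hc, hM', hsum⟩ := hB.exists_rearranged (i := i) (j := k) (k := j) (l := l) hM htr'
        ((List.Perm.swap _ _ _).cons _ |>.nodup_iff.mp hn) hp
      rw [hij, ← hjk] at hM' hsum
      have h := singular_of_triple hsa hC hM' hsum (hjk ▸ hkl)
      simp only [Matrix.cons_val] at h
      rwa [Set.pair_comm (cvec (B k))] at h
    · obtain ⟨C, hC, hc, hM', hsum⟩ := hB.exists_rearranged hM htr' hn hp
      rw [hij, ← hjk] at hM' hsum
      have h := singular_of_triple hsa hC hM' hsum (hjk ▸ hkl)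
      simp only [Matrix.cons_val] at h
      exact h
  · have hd : d = 0 := funext fun n => by
      rw [heq 1 0, heq 2 0, heq 3 0] at htr'
      rw [heq n 0, Pi.zero_apply]
      linarith
    have hΦ : Φ = 0 := by
      obtain ⟨b, hb, -⟩ := exists_basis_of_dual hB.toWitt.dual
      refine b.ext fun n => ?_
      rw [hb, hM.toWitt n]
      simp [hd, psiToWitt]
    have hsp : ∀ A B A' B', ricciSpinor Φ A B A' B' = 0 := fun A B A' B' => by
      rw [ricciSpinor, hΦ, LinearMap.zero_apply, s22_zero_right]
    have hP : ricciPoly Φ = 0 := by simp [ricciPoly, ricciPolyIn, hsp]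
    exact ⟨hd, hΦ, hsp, hP, by simp [zeros, ricciPolyC, hP]⟩

end NeutralRicci

theorem mainTheorem2 (Φ : (Fin 4 → ℝ) →ₗ[ℝ] (Fin 4 → ℝ)) (hsa : ∀ u v, s22 (Φ u) v = s22 u (Φ v))
    (htr : LinearMap.trace ℝ (Fin 4 → ℝ) Φ = 0) :
    -- symmetry of the Ricci spinor
    (∀ A B A' B', ricciSpinor Φ A B A' B' = ricciSpinor Φ B A A' B' ∧
      ricciSpinor Φ A B A' B' = ricciSpinor Φ A B B' A') ∧
    -- O-types of Witt bases, and the spin frames that represent them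
    (∀ E, IsWitt E → (∃! κ, HasOType (toPsiON E) κ) ∧
      ∀ κ, HasOType (toPsiON E) κ ↔ ∃ o ι o' ι', eps o ι = 1 ∧ eps o' ι' = 1 ∧ E = wittOf κ o ι o' ι') ∧
    -- the points of `CP¹ × CP¹` are the null directions, the singular points of the Ricci locus the null eigenvectors
    (∀ w : Fin 4 → ℂ, w ≠ 0 → s22 w w = 0 →
      ∃ Q, pt w = {Q} ∧ (Q ∈ singularSet (ricciPolyC Φ) ↔ ∃ χ : ℂ, complexify Φ w = χ • w)) ∧
    (∀ Q : Pt, ∃ w : Fin 4 → ℂ, w ≠ 0 ∧ s22 w w = 0 ∧ pt w = {Q}) ∧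
    -- Type I
    (∀ κ E (ε lam : ℝ), IsWitt E → HasOType (toPsiON E) κ → (ε = 1 ∨ ε = -1) →
      HasMatrix Φ E !![lam, 1, 0, 0; 0, lam, 0, ε; 0, 0, lam, 0; 0, 0, 1, lam] →
      lam = 0 ∧
      HasSpinorForm Φ κ E
        (fun o ι o' ι' A B A' B' => ε * dbl ι A B * dbl o' A' B' - dbl o A B * mix o' ι' A' B')
        (fun X Y U V => ε • (X ^ 2 * V ^ 2) + 2 * U * V * Y ^ 2) ∧
      singularSet (ricciPolyC Φ) = pt (cvec (E 0)) ∧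
      ∃ q m, IsSpinorFactorization Φ [(κ.tw (.real 2 1), q), (κ.tw (.real 0 1), m)] ∧
        crossings [(κ.tw (.real 2 1), q), (κ.tw (.real 0 1), m)] = pt (cvec (E 0)) ∧
        zeros m = linePts (cvec (E 0)) (cvec (E 1)) ∧
        ∀ Q ∈ pt (cvec (E 0)), IsRealPt Q ∧ IsTacnode (ricciPolyC Φ) Q ∧ IsTangentAt m q Q 1) ∧
    -- Type II
    (∀ κ E (a b : ℝ), IsWitt E → HasOType (toPsiON E) κ → b ≠ 0 →
      HasMatrix Φ E !![a, b, 1, 0; -b, a, 0, -1; 0, 0, a, -b; 0, 0, b, a] →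
      a = 0 ∧
      HasSpinorForm Φ κ E
        (fun o ι o' ι' A B A' B' => (dbl o A B - dbl ι A B) * dbl o' A' B' -
          b * (dbl o A B + dbl ι A B) * mix o' ι' A' B')
        (fun X Y U V => (X ^ 2 * ((2 * b) • U - V) + Y ^ 2 * ((2 * b) • U + V)) * V) ∧
      singularSet (ricciPolyC Φ) =
        pt (cvec (E 0) + Complex.I • cvec (E 1)) ∪ pt (cvec (E 0) - Complex.I • cvec (E 1)) ∧
      ∃ q m, IsSpinorFactorization Φ [(κ.tw (.real 2 1), q), (κ.tw (.real 0 1), m)] ∧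
        crossings [(κ.tw (.real 2 1), q), (κ.tw (.real 0 1), m)] = singularSet (ricciPolyC Φ) ∧
        zeros m = linePts (cvec (E 0)) (cvec (E 1)) ∧
        ∀ Q ∈ singularSet (ricciPolyC Φ), IsComplexNode (ricciPolyC Φ) Q ∧ IsTangentAt m (ricciPolyC Φ) Q 2 ∧
          TangentsFromComponents (ricciPolyC Φ) [(κ.tw (.real 2 1), q), (κ.tw (.real 0 1), m)] Q) ∧
    -- Type IIIa
    (∀ κ B (lam μ : ℝ), IsPsiON B → HasOType B κ →
      HasMatrix Φ B !![lam, 0, 0, 0; 0, μ, 1 / √2, 0; 0, -(1 / √2), μ, 1 / √2; 0, 0, 1 / √2, μ] →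
      lam + 3 * μ = 0 ∧
      HasSpinorForm Φ κ (toWitt B)
        (fun o ι o' ι' A B A' B' =>
          -μ * (2 * dbl o A B * dbl o' A' B' + 2 * dbl ι A B * dbl ι' A' B' + mix o ι A B * mix o' ι' A' B') -
          1 / √2 * (mix o ι A B * dbl o' A' B' - dbl ι A B * mix o' ι' A' B'))
        (fun X Y U V => (-2 * μ) • (Y * V + X * U) ^ 2 - √2 • (X * (X * U - Y * V) * V)) ∧
      singularSet (ricciPolyC Φ) = pt (cvec (B 1 + B 3)) ∧
      (∀ Q ∈ pt (cvec (B 1 + B 3)), IsRealPt Q) ∧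
      (lam ≠ μ → (∃ q, IsSpinorFactorization Φ [(.real 2 2, q)]) ∧
        ∀ Q ∈ pt (cvec (B 1 + B 3)), IsCusp (ricciPolyC Φ) Q ∧ ¬ IsTacnode (ricciPolyC Φ) Q) ∧
      (lam = μ → lam = 0 ∧ μ = 0 ∧
        ∃ q₁ q₂ q₃, IsSpinorFactorization Φ [(.real 1 0, q₁), (.real 1 1, q₂), (.real 0 1, q₃)] ∧
          crossings [(.real 1 0, q₁), (.real 1 1, q₂), (.real 0 1, q₃)] = pt (cvec (B 1 + B 3)) ∧
          ∀ Q ∈ pt (cvec (B 1 + B 3)), IsFold (ricciPolyC Φ) Q 3 ∧ Q ∈ zeros q₁ ∧ Q ∈ zeros q₂ ∧ Q ∈ zeros q₃)) ∧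
    -- Type IIIb
    (∀ κ B (lam μ : ℝ), IsPsiON B → HasOType B κ →
      HasMatrix Φ B !![lam, 1 / √2, 0, 0; 1 / √2, lam, -(1 / √2), 0; 0, 1 / √2, lam, 0; 0, 0, 0, μ] →
      3 * lam + μ = 0 ∧
      HasSpinorForm Φ κ (toWitt B)
        (fun o ι o' ι' A B A' B' =>
          lam * (2 * dbl ι A B * dbl o' A' B' + 2 * dbl o A B * dbl ι' A' B' + mix o ι A B * mix o' ι' A' B') +
          1 / √2 * (mix o ι A B * dbl o' A' B' - dbl o A B * mix o' ι' A' B'))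
        (fun X Y U V => (2 * lam) • (X * V + U * Y) ^ 2 + √2 • (Y * (Y * U - X * V) * V)) ∧
      singularSet (ricciPolyC Φ) = pt (cvec (B 0 + B 2)) ∧
      (∀ Q ∈ pt (cvec (B 0 + B 2)), IsRealPt Q) ∧
      (lam ≠ μ → (∃ q, IsSpinorFactorization Φ [(.real 2 2, q)]) ∧
        ∀ Q ∈ pt (cvec (B 0 + B 2)), IsCusp (ricciPolyC Φ) Q ∧ ¬ IsTacnode (ricciPolyC Φ) Q) ∧
      (lam = μ → lam = 0 ∧ μ = 0 ∧
        ∃ q₁ q₂ q₃, IsSpinorFactorization Φ [(.real 1 0, q₁), (.real 1 1, q₂), (.real 0 1, q₃)] ∧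
          crossings [(.real 1 0, q₁), (.real 1 1, q₂), (.real 0 1, q₃)] = pt (cvec (B 0 + B 2)) ∧
          ∀ Q ∈ pt (cvec (B 0 + B 2)), IsFold (ricciPolyC Φ) Q 3 ∧ Q ∈ zeros q₁ ∧ Q ∈ zeros q₂ ∧ Q ∈ zeros q₃)) ∧
    -- Type IV
    (∀ κ E (ε lam μ ν : ℝ), IsWitt E → HasOType (toPsiON E) κ → (ε = 1 ∨ ε = -1) →
      HasMatrix Φ E !![(lam + ν) / 2, 0, (lam - ν) / 2, 0; 0, μ, 0, ε;
        (lam - ν) / 2, 0, (lam + ν) / 2, 0; 0, 0, 0, μ] →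
      lam + ν = -2 * μ ∧
      HasSpinorForm Φ κ E
        (fun o ι o' ι' A B A' B' =>
          (lam - ν) / 2 * (dbl o A B * dbl o' A' B' + dbl ι A B * dbl ι' A' B') +
          (lam + ν) / 2 * mix o ι A B * mix o' ι' A' B' + ε * dbl ι A B * dbl o' A' B')
        (fun X Y U V => ((lam - ν) / 2) • (Y ^ 2 * V ^ 2 + X ^ 2 * U ^ 2) +
          (2 * (lam + ν)) • (X * Y * U * V) + ε • (X ^ 2 * V ^ 2)) ∧
      (lam ≠ μ → μ ≠ ν → lam ≠ ν →
        (∃ q, IsSpinorFactorization Φ [(.real 2 2, q)]) ∧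
        singularSet (ricciPolyC Φ) = pt (cvec (E 1)) ∧
        (3 * lam + ν) * (lam + 3 * ν) ≠ 0 ∧
        ∀ Q ∈ pt (cvec (E 1)),
          (0 < (3 * lam + ν) * (lam + 3 * ν) → IsRealNodeRealTangents (ricciPolyC Φ) Q) ∧
          ((3 * lam + ν) * (lam + 3 * ν) < 0 → IsRealNodeComplexTangents (ricciPolyC Φ) Q)) ∧
      (μ = ν → lam ≠ ν → lam + 3 * ν = 0 ∧
        singularSet (ricciPolyC Φ) = pt (cvec (E 1)) ∧
        (∀ Q ∈ pt (cvec (E 1)), IsRealPt Q ∧ IsTacnode (ricciPolyC Φ) Q) ∧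
        (0 < ε * ν → ∃ q₁ q₂, IsSpinorFactorization Φ [(.real 1 1, q₁), (.real 1 1, q₂)] ∧
          crossings [(.real 1 1, q₁), (.real 1 1, q₂)] = pt (cvec (E 1))) ∧
        (ε * ν < 0 → ∃ q, IsSpinorFactorization Φ [(.conj 1 1, q)] ∧
          crossings [(.conj 1 1, q)] = pt (cvec (E 1)))) ∧
      (lam = μ → lam ≠ ν → 3 * lam + ν = 0 ∧
        singularSet (ricciPolyC Φ) = pt (cvec (E 1)) ∧
        (∀ Q ∈ pt (cvec (E 1)), IsRealPt Q ∧ IsTacnode (ricciPolyC Φ) Q) ∧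
        (0 < ε * lam → ∃ q, IsSpinorFactorization Φ [(.conj 1 1, q)] ∧
          crossings [(.conj 1 1, q)] = pt (cvec (E 1))) ∧
        (ε * lam < 0 → ∃ q₁ q₂, IsSpinorFactorization Φ [(.real 1 1, q₁), (.real 1 1, q₂)] ∧
          crossings [(.real 1 1, q₁), (.real 1 1, q₂)] = pt (cvec (E 1)))) ∧
      (lam = ν → lam ≠ μ → lam + μ = 0 ∧
        singularSet (ricciPolyC Φ) = pt (cvec (E 0)) ∪ pt (cvec (E 1)) ∪ pt (cvec (E 2)) ∧
        ∃ m q n, IsSpinorFactorization Φ [(κ.tw (.real 0 1), m), (.real 1 1, q), (κ.tw (.real 1 0), n)] ∧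
          zeros m = linePts (cvec (E 0)) (cvec (E 1)) ∧ zeros n = linePts (cvec (E 1)) (cvec (E 2)) ∧
          zeros m ∩ zeros n = pt (cvec (E 1)) ∧
          zeros m ∩ zeros q = pt (cvec (E 0)) ∧ zeros n ∩ zeros q = pt (cvec (E 2)) ∧
          ∀ Q ∈ singularSet (ricciPolyC Φ), IsRealNodeRealTangents (ricciPolyC Φ) Q ∧
            TangentsFromComponents (ricciPolyC Φ)
              [(κ.tw (.real 0 1), m), (.real 1 1, q), (κ.tw (.real 1 0), n)] Q) ∧
      (lam = μ → μ = ν → lam = 0 ∧ μ = 0 ∧ ν = 0 ∧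
        ∃ m n, IsSpinorFactorization Φ [(κ.tw (.sq 0 1), m), (κ.tw (.sq 1 0), n)] ∧
          zeros m = linePts (cvec (E 0)) (cvec (E 1)) ∧ zeros n = linePts (cvec (E 1)) (cvec (E 2)) ∧
          zeros m ∩ zeros n = pt (cvec (E 1)) ∧
          zeros (ricciPolyC Φ) = zeros m ∪ zeros n ∧ singularSet (ricciPolyC Φ) = zeros m ∪ zeros n)) ∧
    -- Type V
    (∀ κ B (lam a b ν : ℝ), IsPsiON B → HasOType B κ → b ≠ 0 →
      HasMatrix Φ B !![lam, 0, 0, 0; 0, a, b, 0; 0, -b, a, 0; 0, 0, 0, ν] →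
      lam + ν = -2 * a ∧
      HasSpinorForm Φ κ (toWitt B)
        (fun o ι o' ι' A B A' B' =>
          (3 * lam + ν) / 4 * (dbl o A B * dbl o' A' B' + dbl ι A B * dbl ι' A' B') -
          (lam + 3 * ν) / 4 * (dbl ι A B * dbl o' A' B' + dbl o A B * dbl ι' A' B') +
          (lam - ν) / 4 * mix o ι A B * mix o' ι' A' B' -
          b / 2 * (mix o ι A B * (dbl o' A' B' + dbl ι' A' B') - (dbl o A B + dbl ι A B) * mix o' ι' A' B'))
        (fun X Y U V => ((3 * lam + ν) / 4) • (Y * V + X * U) ^ 2 - ((lam + 3 * ν) / 4) • (X * V + Y * U) ^ 2 +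
          b • (X * Y * (V ^ 2 + U ^ 2) - (X ^ 2 + Y ^ 2) * U * V)) ∧
      (lam ≠ ν → (∃ q, IsSpinorFactorization Φ [(.real 2 2, q)]) ∧ singularSet (ricciPolyC Φ) = ∅) ∧
      (lam = ν → lam = -a ∧
        singularSet (ricciPolyC Φ) = pt (cvec (B 0 + B 3)) ∪ pt (cvec (B 0 - B 3)) ∧
        (∀ Q ∈ singularSet (ricciPolyC Φ), IsRealNodeRealTangents (ricciPolyC Φ) Q) ∧
        ∃ q₁ q₂, IsSpinorFactorization Φ [(.real 1 1, q₁), (.real 1 1, q₂)] ∧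
          crossings [(.real 1 1, q₁), (.real 1 1, q₂)] = singularSet (ricciPolyC Φ))) ∧
    -- Type VI
    (∀ κ E (ε lam a b : ℝ), IsWitt E → HasOType (toPsiON E) κ → (ε = 1 ∨ ε = -1) → b ≠ 0 →
      HasMatrix Φ E !![lam, 0, ε, 0; 0, a, 0, -b; 0, 0, lam, 0; 0, b, 0, a] →
      lam + a = 0 ∧
      HasSpinorForm Φ κ E
        (fun o ι o' ι' A B A' B' => ε * dbl o A B * dbl o' A' B' -
          b * (dbl ι A B * dbl o' A' B' - dbl o A B * dbl ι' A' B') + lam * mix o ι A B * mix o' ι' A' B')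
        (fun X Y U V => ε • (Y ^ 2 * V ^ 2) - b • (X ^ 2 * V ^ 2 - Y ^ 2 * U ^ 2) + (4 * lam) • (X * Y * U * V)) ∧
      (∃ q, IsSpinorFactorization Φ [(.real 2 2, q)]) ∧
      singularSet (ricciPolyC Φ) = pt (cvec (E 0)) ∧
      ∀ Q ∈ pt (cvec (E 0)), IsRealNodeRealTangents (ricciPolyC Φ) Q) ∧
    -- Type VII
    (∀ κ E (ε ω lam μ : ℝ), IsWitt E → HasOType (toPsiON E) κ → (ε = 1 ∨ ε = -1) → (ω = 1 ∨ ω = -1) →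
      HasMatrix Φ E !![lam, 0, ε, 0; 0, μ, 0, ω; 0, 0, lam, 0; 0, 0, 0, μ] →
      lam + μ = 0 ∧
      HasSpinorForm Φ κ E
        (fun o ι o' ι' A B A' B' => (ε * dbl o A B + ω * dbl ι A B) * dbl o' A' B' +
          lam * mix o ι A B * mix o' ι' A' B')
        (fun X Y U V => ((ε • Y ^ 2 + ω • X ^ 2) * V + (4 * lam) • (U * X * Y)) * V) ∧
      (lam ≠ μ → lam ≠ 0 ∧ μ ≠ 0 ∧
        singularSet (ricciPolyC Φ) = pt (cvec (E 0)) ∪ pt (cvec (E 1)) ∧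
        ∃ q m, IsSpinorFactorization Φ [(κ.tw (.real 2 1), q), (κ.tw (.real 0 1), m)] ∧
          crossings [(κ.tw (.real 2 1), q), (κ.tw (.real 0 1), m)] = singularSet (ricciPolyC Φ) ∧
          zeros m = linePts (cvec (E 0)) (cvec (E 1)) ∧
          ∀ Q ∈ singularSet (ricciPolyC Φ),
            IsRealNodeRealTangents (ricciPolyC Φ) Q ∧ IsTangentAt m (ricciPolyC Φ) Q 2) ∧
      (lam = μ → lam = 0 ∧ μ = 0 ∧
        singularSet (ricciPolyC Φ) = linePts (cvec (E 0)) (cvec (E 1)) ∧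
        (ε = -ω → ∃ n₁ n₂ m,
          IsSpinorFactorization Φ [(κ.tw (.real 1 0), n₁), (κ.tw (.real 1 0), n₂), (κ.tw (.sq 0 1), m)] ∧
          zeros m = linePts (cvec (E 0)) (cvec (E 1)) ∧
          zeros n₁ = linePts (cvec (E 0 + E 1)) (cvec (E 2 - E 3)) ∧
          zeros n₂ = linePts (cvec (E 0 - E 1)) (cvec (E 2 + E 3)) ∧
          crossings [(κ.tw (.real 1 0), n₁), (κ.tw (.real 1 0), n₂), (κ.tw (.sq 0 1), m)] =
            pt (cvec (E 0 + E 1)) ∪ pt (cvec (E 0 - E 1)) ∧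
          (∀ Q ∈ pt (cvec (E 0 + E 1)) ∪ pt (cvec (E 0 - E 1)), IsTangentAt m (ricciPolyC Φ) Q 3) ∧
          ∀ Q ∈ singularSet (ricciPolyC Φ), Q ∉ pt (cvec (E 0 + E 1)) ∪ pt (cvec (E 0 - E 1)) →
            IsTacnode (ricciPolyC Φ) Q) ∧
        (ε = ω → ∃ n m,
          IsSpinorFactorization Φ [(κ.tw (.conj 1 0), n), (κ.tw (.sq 0 1), m)] ∧
          zeros m = linePts (cvec (E 0)) (cvec (E 1)) ∧
          zeros n = linePts (cvec (E 0) + Complex.I • cvec (E 1)) (cvec (E 2) + Complex.I • cvec (E 3)) ∧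
          zeros (conjPoly n) = linePts (cvec (E 0) - Complex.I • cvec (E 1)) (cvec (E 2) - Complex.I • cvec (E 3)) ∧
          crossings [(κ.tw (.conj 1 0), n), (κ.tw (.sq 0 1), m)] =
            pt (cvec (E 0) + Complex.I • cvec (E 1)) ∪ pt (cvec (E 0) - Complex.I • cvec (E 1)) ∧
          (∀ Q ∈ pt (cvec (E 0) + Complex.I • cvec (E 1)) ∪ pt (cvec (E 0) - Complex.I • cvec (E 1)),
            IsTangentAt m (ricciPolyC Φ) Q 3) ∧
          ∀ Q ∈ singularSet (ricciPolyC Φ),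
            Q ∉ pt (cvec (E 0) + Complex.I • cvec (E 1)) ∪ pt (cvec (E 0) - Complex.I • cvec (E 1)) →
            IsTacnode (ricciPolyC Φ) Q))) ∧
    -- Type VIII
    (∀ κ B (a b c d : ℝ), IsPsiON B → HasOType B κ → b ≠ 0 → d ≠ 0 →
      HasMatrix Φ B !![a, 0, b, 0; 0, c, 0, d; -b, 0, a, 0; 0, -d, 0, c] →
      a + c = 0 ∧
      HasSpinorForm Φ κ (toWitt B)
        (fun o ι o' ι' A B A' B' => a * mix o ι A B * mix o' ι' A' B' -
          b * (dbl o A B * dbl o' A' B' - dbl ι A B * dbl ι' A' B') -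
          d * (dbl ι A B * dbl o' A' B' - dbl o A B * dbl ι' A' B'))
        (fun X Y U V => (4 * a) • (U * V * X * Y) + b • (X ^ 2 * U ^ 2 - Y ^ 2 * V ^ 2) +
          d • (Y ^ 2 * U ^ 2 - X ^ 2 * V ^ 2)) ∧
      (¬ (a = c ∧ (b = d ∨ b = -d)) →
        (∃ q, IsSpinorFactorization Φ [(.real 2 2, q)]) ∧ singularSet (ricciPolyC Φ) = ∅) ∧
      (a = c → b = d → a = 0 ∧ c = 0 ∧
        singularSet (ricciPolyC Φ) =
          pt (cvec (B 0 - B 3) + Complex.I • cvec (B 1 + B 2)) ∪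
          pt (cvec (B 0 + B 3) + Complex.I • cvec (B 2 - B 1)) ∪
          pt (cvec (B 0 - B 3) - Complex.I • cvec (B 1 + B 2)) ∪
          pt (cvec (B 0 + B 3) - Complex.I • cvec (B 2 - B 1)) ∧
        ∃ n m₁ m₂,
          IsSpinorFactorization Φ [(κ.tw (.conj 1 0), n), (κ.tw (.real 0 1), m₁), (κ.tw (.real 0 1), m₂)] ∧
          crossings [(κ.tw (.conj 1 0), n), (κ.tw (.real 0 1), m₁), (κ.tw (.real 0 1), m₂)] =
            singularSet (ricciPolyC Φ) ∧
          ∀ Q ∈ singularSet (ricciPolyC Φ), IsComplexNode (ricciPolyC Φ) Q ∧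
            TangentsFromComponents (ricciPolyC Φ)
              [(κ.tw (.conj 1 0), n), (κ.tw (.real 0 1), m₁), (κ.tw (.real 0 1), m₂)] Q)) ∧
    -- Type IX
    (∀ κ B (d : Fin 4 → ℝ), IsPsiON B → HasOType B κ → HasMatrix Φ B (Matrix.diagonal d) →
      d 0 + d 1 + d 2 + d 3 = 0 ∧
      HasSpinorForm Φ κ (toWitt B)
        (fun o ι o' ι' A B A' B' =>
          (d 0 - d 2) / 2 * (dbl o A B * dbl o' A' B' + dbl ι A B * dbl ι' A' B') +
          (d 1 - d 3) / 2 * (dbl ι A B * dbl o' A' B' + dbl o A B * dbl ι' A' B') +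
          (d 0 + d 2) / 2 * mix o ι A B * mix o' ι' A' B')
        (fun X Y U V => ((d 0 - d 2) / 2) • (Y ^ 2 * V ^ 2 + X ^ 2 * U ^ 2) +
          ((d 1 - d 3) / 2) • (X ^ 2 * V ^ 2 + Y ^ 2 * U ^ 2) + (2 * (d 0 + d 2)) • (U * V * X * Y)) ∧
      -- no two eigenvalues equal
      (Function.Injective d →
        (∃ q, IsSpinorFactorization Φ [(.real 2 2, q)]) ∧ singularSet (ricciPolyC Φ) = ∅) ∧
      (∀ i j k l : Fin 4, [i, j, k, l].Nodup →
        -- exactly two eigenvalues equal, their eigenvectors of the same character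
        (d i = d j → d i ≠ d k → d i ≠ d l → d k ≠ d l → s22 (B i) (B i) = s22 (B j) (B j) →
          singularSet (ricciPolyC Φ) =
            pt (cvec (B i) + Complex.I • cvec (B j)) ∪ pt (cvec (B i) - Complex.I • cvec (B j)) ∧
          (∀ Q ∈ singularSet (ricciPolyC Φ), IsComplexNode (ricciPolyC Φ) Q) ∧
          (3 * d k + d l) * (d k + 3 * d l) ≠ 0 ∧
          (0 < (3 * d k + d l) * (d k + 3 * d l) → ∃ q, IsSpinorFactorization Φ [(.conj 1 1, q)] ∧
            crossings [(.conj 1 1, q)] = singularSet (ricciPolyC Φ)) ∧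
          ((3 * d k + d l) * (d k + 3 * d l) < 0 →
            ∃ q₁ q₂, IsSpinorFactorization Φ [(.real 1 1, q₁), (.real 1 1, q₂)] ∧
            crossings [(.real 1 1, q₁), (.real 1 1, q₂)] = singularSet (ricciPolyC Φ))) ∧
        -- exactly two eigenvalues equal, their eigenvectors of opposite character
        (d i = d j → d i ≠ d k → d i ≠ d l → d k ≠ d l → s22 (B i) (B i) = -s22 (B j) (B j) →
          singularSet (ricciPolyC Φ) = pt (cvec (B i + B j)) ∪ pt (cvec (B i - B j)) ∧
          (3 * d k + d l) * (d k + 3 * d l) ≠ 0 ∧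
          (0 < (3 * d k + d l) * (d k + 3 * d l) →
            (∀ Q ∈ singularSet (ricciPolyC Φ), IsRealNodeRealTangents (ricciPolyC Φ) Q) ∧
            ∃ q₁ q₂, IsSpinorFactorization Φ [(.real 1 1, q₁), (.real 1 1, q₂)] ∧
            crossings [(.real 1 1, q₁), (.real 1 1, q₂)] = singularSet (ricciPolyC Φ)) ∧
          ((3 * d k + d l) * (d k + 3 * d l) < 0 →
            (∀ Q ∈ singularSet (ricciPolyC Φ), IsRealNodeComplexTangents (ricciPolyC Φ) Q) ∧
            ∃ q, IsSpinorFactorization Φ [(.conj 1 1, q)] ∧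
            crossings [(.conj 1 1, q)] = singularSet (ricciPolyC Φ))) ∧
        -- two pairs of equal eigenvalues, of the same character within each pair
        (d i = d j → d k = d l → d i ≠ d k → s22 (B i) (B i) = s22 (B j) (B j) →
          singularSet (ricciPolyC Φ) =
            pt (cvec (B i) + Complex.I • cvec (B j)) ∪ pt (cvec (B i) - Complex.I • cvec (B j)) ∪
            pt (cvec (B k) + Complex.I • cvec (B l)) ∪ pt (cvec (B k) - Complex.I • cvec (B l)) ∧
          ∃ n m, IsSpinorFactorization Φ [(.conj 1 0, n), (.conj 0 1, m)] ∧
            crossings [(.conj 1 0, n), (.conj 0 1, m)] = singularSet (ricciPolyC Φ) ∧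
            ∀ Q ∈ singularSet (ricciPolyC Φ), IsComplexNode (ricciPolyC Φ) Q ∧
              TangentsFromComponents (ricciPolyC Φ) [(.conj 1 0, n), (.conj 0 1, m)] Q) ∧
        -- two pairs of equal eigenvalues, of opposite character within each pair
        (d i = d j → d k = d l → d i ≠ d k → s22 (B i) (B i) = -s22 (B j) (B j) →
          singularSet (ricciPolyC Φ) = pt (cvec (B i + B j)) ∪ pt (cvec (B i - B j)) ∪
            pt (cvec (B k + B l)) ∪ pt (cvec (B k - B l)) ∧
          ∃ n₁ n₂ m₁ m₂,
            IsSpinorFactorization Φ [(.real 1 0, n₁), (.real 1 0, n₂), (.real 0 1, m₁), (.real 0 1, m₂)] ∧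
            crossings [(.real 1 0, n₁), (.real 1 0, n₂), (.real 0 1, m₁), (.real 0 1, m₂)] =
              singularSet (ricciPolyC Φ) ∧
            ∀ Q ∈ singularSet (ricciPolyC Φ), IsRealNodeRealTangents (ricciPolyC Φ) Q ∧
              TangentsFromComponents (ricciPolyC Φ)
                [(.real 1 0, n₁), (.real 1 0, n₂), (.real 0 1, m₁), (.real 0 1, m₂)] Q) ∧
        -- exactly three equal eigenvalues
        (d i = d j → d j = d k → d k ≠ d l →
          ∃ q, IsSpinorFactorization Φ [(.sq 1 1, q)] ∧
            zeros q = pts (Submodule.span ℂ {cvec (B i), cvec (B j), cvec (B k)}) ∧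
            zeros (ricciPolyC Φ) = zeros q ∧ singularSet (ricciPolyC Φ) = zeros q)) ∧
      -- all eigenvalues equal
      ((∀ i j, d i = d j) → d = 0 ∧ Φ = 0 ∧ (∀ A B A' B', ricciSpinor Φ A B A' B' = 0) ∧ ricciPoly Φ = 0 ∧
        zeros (ricciPolyC Φ) = Set.univ)) := by
  exact ⟨ricciSpinor_symm hsa htr,
    fun E hE => ⟨hE.existsUnique_oType, hE.hasOType_iff⟩,
    fun w hw hn => null_direction_point hsa hw hn,
    point_null_direction,
    fun κ E ε lam => type_I hsa htr κ E ε lam,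
    fun κ E a b => type_II hsa htr κ E a b,
    fun κ B lam μ => type_IIIa hsa htr κ B lam μ,
    fun κ B lam μ => type_IIIb hsa htr κ B lam μ,
    fun κ E ε lam μ ν => type_IV hsa htr κ E ε lam μ ν,
    fun κ B lam a b ν => type_V hsa htr κ B lam a b ν,
    fun κ E ε lam a b => type_VI hsa htr κ E ε lam a b,
    fun κ E ε ω lam μ => type_VII hsa htr κ E ε ω lam μ,
    fun κ B a b c d => type_VIII hsa htr κ B a b c d,
    fun κ B d hB _ => type_IX hsa htr κ B d hB⟩
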